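/- **Setting.** Let $A\in\mathbb R^{n\times n}$, $B\in\mathbb R^{n\times m}$, let $Q\in\mathbb R^{n\times n}$ be symmetric (possibly indefinite), and let $\mathcal L\subset\mathbb R^n$ be a subspace. For $x_0\in\mathbb R^n$ and $u\in L^m_{2,loc}(\mathbb R^+)$ let $x(\cdot;x_0,u)$ be the trajectory of $\dot x=Ax+Bu$, $x(0)=x_0$, and $$J_T(x_0,u)=\int_0^T \big(x(t;x_0,u)^\top Q\,x(t;x_0,u)+u(t)^\top u(t)\big)\,dt .$$ Let $\mathcal U_{\mathcal L}(x_0)$ be the set of $u\in L^m_{2,loc}(\mathbb R^+)$ for which $J(x_0,u):=\lim_{T\to\infty}J_T(x_0,u)$ exists in $\mathbb R\cup\{\pm\infty\}$ and the Euclidean distance from $x(t;x_0,u)$ to $\mathcal L$ tends to $0$ as $t\to\infty$. Put $V_{\mathcal L}(x_0)=\inf\{J(x_0,u): u\in\mathcal U_{\mathcal L}(x_0)\}$. The problem is *well-posed* if $V_{\mathcal L}(x_0)\in\mathbb R$ for all $x_0$. An input $u^\star\in\mathcal U_{\mathcal L}(x_0)$ with $J(x_0,u^\star)=V_{\mathcal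 L}(x_0)$ is *optimal* for $x_0$, and the problem is *attainable* if every $x_0$ has an optimal input. Let $\phi(K)=A^\top K+KA+Q-KBB^\top K$. Assume that $(A,B)$ is stabilizable and that there is a symmetric $K\le 0$ with $\phi(K)\ge 0$. **Decomposition.** Let $\mathcal C=\operatorname{Im}B+A\operatorname{Im}B+\dots+A^{n-1}\operatorname{Im}B$, let $\mathcal X_2$ be any complement of $\mathcal C$ in $\mathbb R^n$, and take a basis of $\mathbb R^n$ composed of a basis of $\mathcal C$ ($n_1$ vectors) and one of $\mathcal X_2$ ($n_2$ vectors). In these coordinates ($A$ and $B$ transforming as maps, $Q$ and $K$ as quadratic forms) $$A=\begin{bmatrix}A_1&A_{12}\\0&A_2\end{bmatrix},\quad B=\begin{bmatrix}B_1\\0\end{bmatrix},\quad Q=\begin{bmatrix}Q_1&Q_{12}\\Q_{12}^\top&Q_2\end{bmatrix}.$$ Let $\phi_1(K_1)=A_1^\top K_1+K_1A_1+Q_1-K_1B_1B_1^\top K_1$, $A_1(K_1)=A_1-B_1B_1^\top K_1$, and let $\mathcal L_1=\mathcal L\cap\mathcal C$, viewed in $\mathbb R^{n_1}$. For a real square matrix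 $M$ with characteristic polynomial $p=p_-p_0p_+$, where the real monic factors have all their roots in the open left half plane, on the imaginary axis and in the open right half plane respectively, let $\mathcal X^{-}(M),\mathcal X^0(M),\mathcal X^+(M)$ be the kernels of $p_-(M),p_0(M),p_+(M)$. **Definition of $K^\star$.** The set of symmetric solutions of $\phi_1(K_1)=0$ has a least element $K_1^-$ and a greatest element $K_1^+$ (for the order in which $M\le N$ means that $N-M$ is positive semidefinite). Put $\Delta_1=K_1^+-K_1^-$ and $$\mathcal N_1=\{x: A_1(K_1^-)^kx\in\mathcal L_1\cap\operatorname{Ker}K_1^-,\ 0\le k\le n_1-1\}\cap\mathcal X^+(A_1(K_1^-)).$$ Then $\mathbb R^{n_1}=\mathcal N_1\oplus\Delta_1^{-1}(\mathcal N_1^\perp)$, where $\Delta_1^{-1}(\mathcal N_1^\perp)=\{x:\Delta_1x\in\mathcal N_1^\perp\}$. With $P$ the projection onto $\mathcal N_1$ along $\Delta_1^{-1}(\mathcal N_1^\perp)$, put $\overline K_1=K_1^-P+K_1^+(I-P)$. Then $$\mathcal X^+(A_1(\overline K_1))=\mathcal N_1,\quad \mathcal X^0(A_1(\overline K_1))=\operatorname{Ker}\Delta_1,\quad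 \mathcal X^-(A_1(\overline K_1))=\mathcal X^-(A_1(K_1^+))\cap\Delta_1^{-1}(\mathcal N_1^\perp).$$ There is exactly one $K_{12}^\star\in\mathbb R^{n_1\times n_2}$ such that $x^\top K_{12}^\star=0$ for $x\in\mathcal N_1$ and $$x^\top\big(A_1(\overline K_1)^\top K_{12}^\star+K_{12}^\star A_2\big)=-x^\top\big(Q_{12}+\overline K_1A_{12}\big)\quad\text{for } x\in\mathcal X^0(A_1(\overline K_1))\text{ and for } x\in\mathcal X^-(A_1(\overline K_1)),$$ and exactly one $K_2^\star\in\mathbb R^{n_2\times n_2}$ such that $$A_2^\top K_2^\star+K_2^\star A_2=K_{12}^{\star\top}B_1B_1^\top K_{12}^\star-K_{12}^{\star\top}A_{12}-A_{12}^\top K_{12}^\star-Q_2 .$$ Let $K^\star\in\mathbb R^{n\times n}$ be the matrix whose quadratic form has in the chosen coordinates the matrix $\begin{bmatrix}\overline K_1&K_{12}^\star\\K_{12}^{\star\top}&K_2^\star\end{bmatrix}$. It is symmetric and $\phi(K^\star)=0$. **Theorem.** Under these assumptions (and with the existence and uniqueness claims just made): 1. The problem is well-posed. 2. $V_{\mathcal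 L}(x_0)=x_0^\top K^\star x_0$ for all $x_0\in\mathbb R^n$. 3. The problem is attainable if and only if $\operatorname{Ker}(\Delta_1)\subset\mathcal L_1\cap\operatorname{Ker}(K_1^-)$. 4. If the problem is attainable, then for each $x_0\in\mathbb R^n$ there is exactly one optimal input $u^\star$ (up to equality almost everywhere on $[0,\infty)$), and it is given by the feedback $u^\star=-B^\top K^\star x$. -/

import Mathlib

open Matrix Filter Topology MeasureTheory Polynomial
open scoped MatrixOrder

noncomputable section

namespace IndefLQ

/-! Linear algebra. The matrix order `≤` is the Loewner order: `M ≤ N` iff `N - M` is positive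
semidefinite. -/

section LinearAlgebra

variable {ι κ : Type*} [Fintype ι] [DecidableEq ι] [Fintype κ]

/-- The Riccati map `φ(K) = Aᵀ K + K A + Q - K B Bᵀ K`. -/
def riccati (A : Matrix ι ι ℝ) (B : Matrix ι κ ℝ) (Q K : Matrix ι ι ℝ) : Matrix ι ι ℝ :=
  Aᵀ * K + K * A + Q - K * B * Bᵀ * K

/-- `∂Γ`: the real symmetric solutions of the algebraic Riccati equation `φ(K) = 0`. -/
def areSolutions (A : Matrix ι ι ℝ) (B : Matrix ι κ ℝ) (Q : Matrix ι ι ℝ) :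
    Set (Matrix ι ι ℝ) :=
  {K | K.IsSymm ∧ riccati A B Q K = 0}

/-- `Γ₋`: the real symmetric `K ≤ 0` with `φ(K) ≥ 0`. -/
def negAriSolutions (A : Matrix ι ι ℝ) (B : Matrix ι κ ℝ) (Q : Matrix ι ι ℝ) :
    Set (Matrix ι ι ℝ) :=
  {K | K.IsSymm ∧ 0 ≤ riccati A B Q K ∧ K ≤ 0}

/-- The closed-loop matrix `A(K) = A - B Bᵀ K`. -/
def closedLoop (A : Matrix ι ι ℝ) (B : Matrix ι κ ℝ) (K : Matrix ι ι ℝ) : Matrix ι ι ℝ :=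
  A - B * Bᵀ * K

/-- `(A, B)` is stabilizable: some feedback `u = F x` places all (complex) eigenvalues of
`A + B F` in the open left half plane. -/
def Stabilizable (A : Matrix ι ι ℝ) (B : Matrix ι κ ℝ) : Prop :=
  ∃ F : Matrix κ ι ℝ, ∀ z ∈ spectrum ℂ ((A + B * F).map (algebraMap ℝ ℂ)), z.re < 0

/-- The kernel of a matrix. -/
abbrev kerM (M : Matrix ι ι ℝ) : Submodule ℝ (ι → ℝ) := LinearMap.ker M.mulVecLin

/-- The controllable subspace `⟨A | Im B⟩ = Im B + A Im B + ⋯ + A^(n-1) Im B`. -/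
def controllableSubspace (A : Matrix ι ι ℝ) (B : Matrix ι κ ℝ) : Submodule ℝ (ι → ℝ) :=
  ⨆ k : Fin (Fintype.card ι),
    (LinearMap.range B.mulVecLin).map (A ^ (k : ℕ)).mulVecLin

/-- `⟨V | A⟩ = {x | x, A x, …, A^(n-1) x ∈ V}`. -/
def unobservableSubspace (V : Submodule ℝ (ι → ℝ)) (A : Matrix ι ι ℝ) : Submodule ℝ (ι → ℝ) :=
  ⨅ k : Fin (Fintype.card ι), V.comap (A ^ (k : ℕ)).mulVecLin

/-- The orthogonal complement for the standard Euclidean inner product. -/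
def perp (V : Submodule ℝ (ι → ℝ)) : Submodule ℝ (ι → ℝ) where
  carrier := {y | ∀ x ∈ V, x ⬝ᵥ y = 0}
  add_mem' := fun hy hz x hx => by rw [dotProduct_add, hy x hx, hz x hx, add_zero]
  zero_mem' := fun x _ => dotProduct_zero x
  smul_mem' := fun c y hy x hx => by rw [dotProduct_smul, hy x hx, smul_zero]

open Classical in
/-- For a set `S` of complex numbers closed under conjugation, the real monic factor of `p` made of
the real irreducible factors (with multiplicity) all of whose complex roots lie in `S`. -/
def rootFactor (S : Set ℂ) (p : ℝ[X]) : ℝ[X] :=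
  ((UniqueFactorizationMonoid.normalizedFactors p).filter
    (fun q => ∀ z : ℂ, aeval z q = 0 → z ∈ S)).prod

/-- The spectral subspace `Ker p_S(A)`, where `p_S` is the factor of the characteristic polynomial
of `A` with roots in `S`. -/
def spectralSubspace (S : Set ℂ) (A : Matrix ι ι ℝ) : Submodule ℝ (ι → ℝ) :=
  kerM (aeval A (rootFactor S A.charpoly))

/-- `𝒳⁻(A)`. -/
def specNeg (A : Matrix ι ι ℝ) : Submodule ℝ (ι → ℝ) := spectralSubspace {z | z.re < 0} A

/-- `𝒳⁰(A)`. -/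
def specZero (A : Matrix ι ι ℝ) : Submodule ℝ (ι → ℝ) := spectralSubspace {z | z.re = 0} A

/-- `𝒳⁺(A)`. -/
def specPos (A : Matrix ι ι ℝ) : Submodule ℝ (ι → ℝ) := spectralSubspace {z | 0 < z.re} A

/-- `P` is the projection onto `V` along `W`; in particular the space is `V ⊕ W`. -/
def IsProjectionAlong (P : Matrix ι ι ℝ) (V W : Submodule ℝ (ι → ℝ)) : Prop :=
  IsCompl V W ∧ (∀ x ∈ V, P *ᵥ x = x) ∧ ∀ x ∈ W, P *ᵥ x = 0

/-- `⟨L₁ ∩ Ker K⁻ | A(K⁻)⟩ ∩ 𝒳⁺(A(K⁻))`. -/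
def nSubspace (A : Matrix ι ι ℝ) (B : Matrix ι κ ℝ) (L₁ : Submodule ℝ (ι → ℝ))
    (Km : Matrix ι ι ℝ) : Submodule ℝ (ι → ℝ) :=
  unobservableSubspace (L₁ ⊓ kerM Km) (closedLoop A B Km) ⊓ specPos (closedLoop A B Km)

/-- `Δ⁻¹(N^⊥) = {x | Δ x ∈ N^⊥}`. -/
def gapComplement (Δ : Matrix ι ι ℝ) (N : Submodule ℝ (ι → ℝ)) : Submodule ℝ (ι → ℝ) :=
  (perp N).comap Δ.mulVecLin

end LinearAlgebra

/-! The control problem `ẋ = A x + B u`, `x(0) = x₀`, with running cost `xᵀ Q x + uᵀ u`. Inputs are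
functions on `ℝ` of which only the restriction to `[0, ∞)` is used. -/

section Control

variable {n m : ℕ}

/-- `u ∈ L²_loc([0, ∞); ℝᵐ)`. -/
def L2loc (u : ℝ → Fin m → ℝ) : Prop :=
  AEStronglyMeasurable u (volume.restrict (Set.Ici 0)) ∧
    ∀ T : ℝ, 0 ≤ T → IntegrableOn (fun t => u t ⬝ᵥ u t) (Set.Icc 0 T)

/-- The state trajectory `x(t; x₀, u)` of `ẋ = A x + B u`, `x(0) = x₀`, for `t ≥ 0`, given by the
variation of constants formula. -/
def traj (A : Matrix (Fin n) (Fin n) ℝ) (B : Matrix (Fin n) (Fin m) ℝ) (x₀ : Fin n → ℝ)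
    (u : ℝ → Fin m → ℝ) (t : ℝ) : Fin n → ℝ :=
  NormedSpace.exp (t • A) *ᵥ x₀ +
    ∫ s in (0 : ℝ)..t, NormedSpace.exp ((t - s) • A) *ᵥ (B *ᵥ u s)

/-- The finite-horizon cost `J_T(x₀, u)`. -/
def costT (A : Matrix (Fin n) (Fin n) ℝ) (B : Matrix (Fin n) (Fin m) ℝ)
    (Q : Matrix (Fin n) (Fin n) ℝ) (x₀ : Fin n → ℝ) (u : ℝ → Fin m → ℝ) (T : ℝ) : ℝ :=
  ∫ t in (0 : ℝ)..T, (traj A B x₀ u t ⬝ᵥ Q *ᵥ traj A B x₀ u t + u t ⬝ᵥ u t)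

/-- The Euclidean distance from `x` to the subspace `L`. -/
def eucDist (L : Submodule ℝ (Fin n → ℝ)) (x : Fin n → ℝ) : ℝ :=
  Metric.infDist (WithLp.toLp 2 x : EuclideanSpace ℝ (Fin n)) (WithLp.toLp 2 '' (L : Set (Fin n → ℝ)))

/-- `𝒰_L(x₀)`: the inputs in `L²_loc` for which `lim J_T(x₀, u)` exists in `ℝ ∪ {±∞}` and the
distance from the state to `L` tends to zero. -/
def admissible (A : Matrix (Fin n) (Fin n) ℝ) (B : Matrix (Fin n) (Fin m) ℝ)
    (Q : Matrix (Fin n) (Fin n) ℝ) (L : Submodule ℝ (Fin n → ℝ)) (x₀ : Fin n → ℝ) :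
    Set (ℝ → Fin m → ℝ) :=
  {u | L2loc u ∧
    (∃ J : EReal, Tendsto (fun T : ℝ => (costT A B Q x₀ u T : EReal)) atTop (𝓝 J)) ∧
    Tendsto (fun t : ℝ => eucDist L (traj A B x₀ u t)) atTop (𝓝 0)}

/-- `J(x₀, u) = lim J_T(x₀, u)` in `ℝ ∪ {±∞}`; used only for inputs for which the limit exists. -/
def cost (A : Matrix (Fin n) (Fin n) ℝ) (B : Matrix (Fin n) (Fin m) ℝ)
    (Q : Matrix (Fin n) (Fin n) ℝ) (x₀ : Fin n → ℝ) (u : ℝ → Fin m → ℝ) : EReal :=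
  limUnder atTop (fun T : ℝ => (costT A B Q x₀ u T : EReal))

/-- The optimal cost `V_L(x₀)`, an infimum in `ℝ ∪ {±∞}`. -/
def value (A : Matrix (Fin n) (Fin n) ℝ) (B : Matrix (Fin n) (Fin m) ℝ)
    (Q : Matrix (Fin n) (Fin n) ℝ) (L : Submodule ℝ (Fin n → ℝ)) (x₀ : Fin n → ℝ) : EReal :=
  sInf (cost A B Q x₀ '' admissible A B Q L x₀)

/-- The problem is well-posed: the optimal cost is a real number for every initial state. -/
def WellPosed (A : Matrix (Fin n) (Fin n) ℝ) (B : Matrix (Fin n) (Fin m) ℝ)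
    (Q : Matrix (Fin n) (Fin n) ℝ) (L : Submodule ℝ (Fin n → ℝ)) : Prop :=
  ∀ x₀, ∃ r : ℝ, value A B Q L x₀ = r

/-- `u` is an optimal input for the initial state `x₀`. -/
def IsOptimal (A : Matrix (Fin n) (Fin n) ℝ) (B : Matrix (Fin n) (Fin m) ℝ)
    (Q : Matrix (Fin n) (Fin n) ℝ) (L : Submodule ℝ (Fin n → ℝ)) (x₀ : Fin n → ℝ)
    (u : ℝ → Fin m → ℝ) : Prop :=
  u ∈ admissible A B Q L x₀ ∧ value A B Q L x₀ = cost A B Q x₀ u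

/-- The problem is attainable: every initial state has an optimal input. -/
def Attainable (A : Matrix (Fin n) (Fin n) ℝ) (B : Matrix (Fin n) (Fin m) ℝ)
    (Q : Matrix (Fin n) (Fin n) ℝ) (L : Submodule ℝ (Fin n → ℝ)) : Prop :=
  ∀ x₀, ∃ u, IsOptimal A B Q L x₀ u

end Control

/-! The Kalman controllability decomposition, in the coordinates of a basis `b` of `ℝⁿ` indexed by
`Fin n₁ ⊕ Fin n₂` whose first `n₁` vectors span the controllable subspace. The remaining vectors
span the chosen complement. -/

section Kalman

variable {n m n₁ n₂ : ℕ}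

/-- The matrix whose columns are the basis vectors. -/
def colMatrix (b : Module.Basis (Fin n₁ ⊕ Fin n₂) ℝ (Fin n → ℝ)) :
    Matrix (Fin n) (Fin n₁ ⊕ Fin n₂) ℝ :=
  Matrix.of fun i j => b j i

/-- `A` in the coordinates of `b`. -/
def coordA (A : Matrix (Fin n) (Fin n) ℝ) (b : Module.Basis (Fin n₁ ⊕ Fin n₂) ℝ (Fin n → ℝ)) :
    Matrix (Fin n₁ ⊕ Fin n₂) (Fin n₁ ⊕ Fin n₂) ℝ :=
  LinearMap.toMatrix b b A.mulVecLin

/-- `B` in the coordinates of `b` (on the state space). -/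
def coordB (B : Matrix (Fin n) (Fin m) ℝ) (b : Module.Basis (Fin n₁ ⊕ Fin n₂) ℝ (Fin n → ℝ)) :
    Matrix (Fin n₁ ⊕ Fin n₂) (Fin m) ℝ :=
  LinearMap.toMatrix (Pi.basisFun ℝ (Fin m)) b B.mulVecLin

/-- The matrix of the quadratic form `xᵀ M x` in the coordinates of `b`. -/
def coordForm (M : Matrix (Fin n) (Fin n) ℝ)
    (b : Module.Basis (Fin n₁ ⊕ Fin n₂) ℝ (Fin n → ℝ)) :
    Matrix (Fin n₁ ⊕ Fin n₂) (Fin n₁ ⊕ Fin n₂) ℝ :=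
  (colMatrix b)ᵀ * M * colMatrix b

/-- The block `B₁`. -/
def coordB₁ (B : Matrix (Fin n) (Fin m) ℝ) (b : Module.Basis (Fin n₁ ⊕ Fin n₂) ℝ (Fin n → ℝ)) :
    Matrix (Fin n₁) (Fin m) ℝ :=
  (coordB B b).submatrix Sum.inl id

/-- `L₁ = L ∩ 𝒞`, viewed as a subspace of `ℝ^n₁` through the first `n₁` vectors of `b`. -/
def coordL₁ (L : Submodule ℝ (Fin n → ℝ))
    (b : Module.Basis (Fin n₁ ⊕ Fin n₂) ℝ (Fin n → ℝ)) : Submodule ℝ (Fin n₁ → ℝ) :=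
  L.comap ((colMatrix b).submatrix id Sum.inl).mulVecLin

/-- The conditions on the off-diagonal block `K₁₂`, for a given upper left block `K₁`: it vanishes
on `𝒳⁺(A₁(K₁))`, and the Sylvester equation
`A₁(K₁)ᵀ K₁₂ + K₁₂ A₂ = -(Q₁₂ + K₁ A₁₂)` holds in the rows belonging to `𝒳⁰(A₁(K₁))` and to
`𝒳⁻(A₁(K₁))`. -/
def OffDiagonalBlock (A₁ : Matrix (Fin n₁) (Fin n₁) ℝ) (A₁₂ : Matrix (Fin n₁) (Fin n₂) ℝ)
    (A₂ : Matrix (Fin n₂) (Fin n₂) ℝ) (B₁ : Matrix (Fin n₁) (Fin m) ℝ)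
    (Q₁₂ : Matrix (Fin n₁) (Fin n₂) ℝ) (K₁ : Matrix (Fin n₁) (Fin n₁) ℝ)
    (K₁₂ : Matrix (Fin n₁) (Fin n₂) ℝ) : Prop :=
  (∀ x ∈ specPos (closedLoop A₁ B₁ K₁), x ᵥ* K₁₂ = 0) ∧
  (∀ x ∈ specZero (closedLoop A₁ B₁ K₁),
    x ᵥ* ((closedLoop A₁ B₁ K₁)ᵀ * K₁₂ + K₁₂ * A₂) = x ᵥ* (-(Q₁₂ + K₁ * A₁₂))) ∧
  (∀ x ∈ specNeg (closedLoop A₁ B₁ K₁),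
    x ᵥ* ((closedLoop A₁ B₁ K₁)ᵀ * K₁₂ + K₁₂ * A₂) = x ᵥ* (-(Q₁₂ + K₁ * A₁₂)))

/-- The Lyapunov equation for the lower right block `K₂`, for a given `K₁₂`. -/
def LowerBlock (A₁₂ : Matrix (Fin n₁) (Fin n₂) ℝ) (A₂ : Matrix (Fin n₂) (Fin n₂) ℝ)
    (B₁ : Matrix (Fin n₁) (Fin m) ℝ) (Q₂ : Matrix (Fin n₂) (Fin n₂) ℝ)
    (K₁₂ : Matrix (Fin n₁) (Fin n₂) ℝ) (K₂ : Matrix (Fin n₂) (Fin n₂) ℝ) : Prop :=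
  A₂ᵀ * K₂ + K₂ * A₂ = K₁₂ᵀ * B₁ * B₁ᵀ * K₁₂ - K₁₂ᵀ * A₁₂ - A₁₂ᵀ * K₁₂ - Q₂

end Kalman

end IndefLQ

end

set_option linter.unusedSectionVars false

/-! For a symmetric K with φ(K) = 0, completing the square gives J_T = x₀ᵀKx₀ - x(T)ᵀKx(T) + ∫₀ᵀ |u
+ BᵀKx|². The theorem therefore asks for the solution K whose terminal form is asymptotically
nonpositive along every admissible trajectory of bounded cost, and whose value x₀ᵀKx₀ is approached
by admissible feedbacks.

On the controllable subspace the Newton-Kleinman iteration, run forwards and in reversed time,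
yields the extremal solutions K₁⁺ and K₁⁻. Their closed loops have spectrum in the closed left and
the closed right half plane respectively, and the imaginary part of both is Ker Δ₁
(`specZero_eq_ker_gap_pos`, `specZero_eq_ker_gap_neg`). The unstable motions in 𝒩₁ cost nothing and
stay in the constraint space, so they need no control; everything else should be stabilized as far
as possible. Hence K₁⁻ is used on 𝒩₁ and K₁⁺ on its Δ₁-orthogonal complement, and the remaining
blocks of K⋆ are forced by linear equations.

Upper bound: modulo 𝒩₁ the solution K⋆ is the greatest one, hence a limit of costs of feedbacks that
are stabilizing modulo 𝒩₁ (`maximal_modulo`). Since 𝒩₁ lies in ℒ, these feedbacks are admissible.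

Lower bound: let Γ ≤ 0 satisfy φ(Γ) ≥ 0. Bounded cost bounds -xᵀΓx, ∫ xᵀφ(Γ)x and ∫ |u + BᵀΓx|², and
the constraint controls the distance to ℒ. The motions that escape all these bounds form an
A-invariant subspace of ℒ, with spectrum in the closed right half plane, on which Γ and φ(Γ) vanish.
There K⋆ vanishes as well (`KalmanForm.unobservable_vanish`), so K⋆x stays bounded
(`OptimalForm.bddHalfLine_mulVec`). Then u + BᵀK⋆x is square integrable, the part of the state that
is stable under the closed loop tends to zero, and on the remaining part, 𝒩₁ together with Ker Δ₁,
the form of K⋆ is nonpositive (`OptimalForm.asymptotics`).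

Attainability: equality in these estimates forces u = -BᵀK⋆x. On Ker Δ₁ the resulting motion is a
pure oscillation, so its distance to ℒ and its terminal form can tend to zero only if they vanish
identically, that is, if Ker Δ₁ lies in ℒ₁ ∩ Ker K₁⁻. In that case the feedback is optimal.

Spectral arguments are carried out over ℝ: spectra are located by real polynomials with prescribed
complex roots, spectral projections are replaced by Bézout identities, and a complex eigenvector is
a pair of real vectors. -/

namespace IndefLQ

/-! ### Real polynomials with prescribed complex roots -/

/-- The polynomial `p` is nonzero and all of its complex roots lie in `S`. -/
def RootsIn (S : Set ℂ) (p : ℝ[X]) : Prop := p ≠ 0 ∧ ∀ z : ℂ, aeval z p = 0 → z ∈ S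

theorem RootsIn.mono {S T : Set ℂ} (h : S ⊆ T) {p : ℝ[X]} (hp : RootsIn S p) : RootsIn T p :=
  ⟨hp.1, fun z hz => h (hp.2 z hz)⟩

theorem RootsIn.one (S : Set ℂ) : RootsIn S 1 :=
  ⟨one_ne_zero, fun z hz => by simp at hz⟩

theorem RootsIn.mul {S : Set ℂ} {p q : ℝ[X]} (hp : RootsIn S p) (hq : RootsIn S q) :
    RootsIn S (p * q) := by
  refine ⟨mul_ne_zero hp.1 hq.1, fun z hz => ?_⟩
  rw [map_mul, mul_eq_zero] at hz
  exact hz.elim (hp.2 z) (hq.2 z)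

theorem RootsIn.of_dvd {S : Set ℂ} {p q : ℝ[X]} (hp : RootsIn S p) (h : q ∣ p) :
    RootsIn S q := by
  obtain ⟨r, rfl⟩ := h
  refine ⟨left_ne_zero_of_mul hp.1, fun z hz => hp.2 z ?_⟩
  rw [map_mul, hz, zero_mul]

/-- A common factor would have a common complex root. The resulting Bézout identity plays the role
of a spectral projection throughout. -/
theorem RootsIn.isCoprime {S T : Set ℂ} (hST : Disjoint S T) {p q : ℝ[X]}
    (hp : RootsIn S p) (hq : RootsIn T q) : IsCoprime p q := by
  refine (Polynomial.isCoprime_iff_aeval_ne_zero_of_isAlgClosed (k := ℝ) ℂ p q).2 fun z => ?_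
  by_contra! h
  exact Set.disjoint_left.1 hST (hp.2 z h.1) (hq.2 z h.2)

/-- Two polynomials have a common divisor, in the ideal they generate, with roots in the
intersection. -/
theorem RootsIn.exists_gcd {S T : Set ℂ} {p q : ℝ[X]} (hp : RootsIn S p) (hq : RootsIn T q) :
    ∃ a b g : ℝ[X], RootsIn (S ∩ T) g ∧ g = a * p + b * q := by
  classical
  refine ⟨EuclideanDomain.gcdA p q, EuclideanDomain.gcdB p q, EuclideanDomain.gcd p q,
    ⟨?_, fun z hz => ⟨?_, ?_⟩⟩, ?_⟩
  · intro h
    exact hp.1 (EuclideanDomain.gcd_eq_zero_iff.1 h).1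
  · exact (hp.of_dvd (EuclideanDomain.gcd_dvd_left p q)).2 z hz
  · exact (hq.of_dvd (EuclideanDomain.gcd_dvd_right p q)).2 z hz
  · rw [EuclideanDomain.gcd_eq_gcd_ab]; ring

/-- A real irreducible polynomial has at most one root up to conjugation. -/
theorem eq_or_eq_conj_of_irreducible {q : ℝ[X]} (hq : Irreducible q) {z w : ℂ}
    (hz : aeval z q = 0) (hw : aeval w q = 0) : w = z ∨ w = (starRingEnd ℂ) z := by
  -- A real root gives the divisor X - z, a nonreal one the quadratic (X - z)(X - z̄).
  -- Irreducibility makes this divisor equal to q up to a constant.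
  by_cases him : z.im = 0
  · have hzr : ((z.re : ℝ) : ℂ) = z := by apply Complex.ext <;> simp [him]
    have hr : q.IsRoot z.re := by
      have : aeval ((z.re : ℝ) : ℂ) q = 0 := by rw [hzr]; exact hz
      rw [← Complex.coe_algebraMap, aeval_algebraMap_apply] at this
      simpa using this
    obtain ⟨r, hr'⟩ := dvd_iff_isRoot.2 hr
    have hu : IsUnit r := by
      rcases hq.isUnit_or_isUnit hr' with h | h
      · exact absurd h (not_isUnit_X_sub_C _)
      · exact h
    obtain ⟨c, hc, rfl⟩ := Polynomial.isUnit_iff.1 hu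
    rw [hr'] at hw
    simp only [map_mul, map_sub, aeval_X, aeval_C, mul_eq_zero] at hw
    rcases hw with h | h
    · left; rw [← hzr]; simpa [sub_eq_zero] using h
    · simp only [Complex.coe_algebraMap, Complex.ofReal_eq_zero] at h
      exact absurd (h ▸ hc) not_isUnit_zero
  · have hd := q.quadratic_dvd_of_aeval_eq_zero_im_ne_zero hz him
    obtain ⟨r, hr'⟩ := hd
    have hu : IsUnit r := by
      rcases hq.isUnit_or_isUnit hr' with h | h
      · exfalso
        have h2 : (X ^ 2 - C (2 * z.re) * X + C (‖z‖ ^ 2) : ℝ[X]).natDegree = 2 := by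
          compute_degree!
        rw [natDegree_eq_zero_of_isUnit h] at h2
        exact absurd h2 (by norm_num)
      · exact h
    obtain ⟨c, hc, rfl⟩ := Polynomial.isUnit_iff.1 hu
    rw [hr'] at hw
    have hmap : aeval w (X ^ 2 - C (2 * z.re) * X + C (‖z‖ ^ 2) : ℝ[X])
        = (w - z) * (w - (starRingEnd ℂ) z) := by
      have h1 : z + (starRingEnd ℂ) z = ((2 * z.re : ℝ) : ℂ) := by
        rw [Complex.add_conj]
      have h2 : z * (starRingEnd ℂ) z = ((‖z‖ ^ 2 : ℝ) : ℂ) := by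
        rw [Complex.mul_conj']; push_cast; rfl
      simp only [map_add, map_sub, map_mul, map_pow, aeval_X, aeval_C, Complex.coe_algebraMap]
      rw [← Complex.ofReal_pow, ← h2]
      push_cast at h1 ⊢
      linear_combination w * h1
    rw [map_mul, hmap, mul_eq_zero, mul_eq_zero, sub_eq_zero, sub_eq_zero] at hw
    rcases hw with h | h
    · exact h
    · simp only [aeval_C, Complex.coe_algebraMap, Complex.ofReal_eq_zero] at h
      exact absurd (h ▸ hc) not_isUnit_zero

open Classical in
theorem rootsIn_rootFactor (S : Set ℂ) (p : ℝ[X]) : RootsIn S (rootFactor S p) := by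
  unfold rootFactor
  have : ∀ s : Multiset ℝ[X], (∀ q ∈ s, RootsIn S q) → RootsIn S s.prod := by
    intro s
    induction s using Multiset.induction_on with
    | empty => intro _; simpa using RootsIn.one S
    | cons a s ih =>
      intro h
      rw [Multiset.prod_cons]
      exact (h a (by simp)).mul (ih fun q hq => h q (by simp [hq]))
  refine this _ fun q hq => ?_
  rw [Multiset.mem_filter] at hq
  exact ⟨(UniqueFactorizationMonoid.irreducible_of_normalized_factor q hq.1).ne_zero, hq.2⟩

-- The roots of a real irreducible factor form one conjugation class, so for a conjugation-stable S
-- they lie all inside or all outside S. Without this stability a discarded factor could still have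
-- a root in S.
open Classical in
theorem exists_rootFactor_mul {S : Set ℂ} (hS : ∀ z ∈ S, (starRingEnd ℂ) z ∈ S) {p : ℝ[X]}
    (hp : p ≠ 0) : ∃ r, RootsIn Sᶜ r ∧ p = rootFactor S p * r := by
  have hassoc := UniqueFactorizationMonoid.prod_normalizedFactors hp
  set s := UniqueFactorizationMonoid.normalizedFactors p with hs
  have hsplit : s.prod = rootFactor S p *
      (s.filter (fun q => ¬ ∀ z : ℂ, aeval z q = 0 → z ∈ S)).prod := by
    unfold rootFactor
    rw [← Multiset.prod_add, Multiset.filter_add_not]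
  obtain ⟨u, hu⟩ := hassoc
  have hrest : ∀ t : Multiset ℝ[X], (∀ q ∈ t, RootsIn Sᶜ q) → RootsIn Sᶜ t.prod := by
    intro t
    induction t using Multiset.induction_on with
    | empty => intro _; simpa using RootsIn.one Sᶜ
    | cons a t ih =>
      intro h
      rw [Multiset.prod_cons]
      exact (h a (by simp)).mul (ih fun q hq => h q (by simp [hq]))
  have h1 : RootsIn Sᶜ (s.filter (fun q => ¬ ∀ z : ℂ, aeval z q = 0 → z ∈ S)).prod := by
    refine hrest _ fun q hq => ?_
    rw [Multiset.mem_filter] at hq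
    have hirr := UniqueFactorizationMonoid.irreducible_of_normalized_factor q hq.1
    refine ⟨hirr.ne_zero, fun w hw hwS => ?_⟩
    apply hq.2
    intro z hz
    rcases eq_or_eq_conj_of_irreducible hirr hw hz with rfl | rfl
    · exact hwS
    · exact hS _ hwS
  refine ⟨(s.filter (fun q => ¬ ∀ z : ℂ, aeval z q = 0 → z ∈ S)).prod * u, ?_, ?_⟩
  · refine h1.mul ⟨u.ne_zero, fun z hz => ?_⟩
    exfalso
    have h2 : IsUnit (aeval z (u : ℝ[X])) := u.isUnit.map (aeval z)
    rw [hz] at h2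
    exact not_isUnit_zero h2
  · rw [← mul_assoc, ← hsplit, hu]

/-! ### Polynomials in a matrix -/

section Aeval

variable {ι κ : Type*} [Fintype ι] [DecidableEq ι] [Fintype κ] [DecidableEq κ]

theorem aeval_mul_mulVec (M : Matrix ι ι ℝ) (p q : ℝ[X]) (x : ι → ℝ) :
    aeval M (p * q) *ᵥ x = aeval M p *ᵥ (aeval M q *ᵥ x) := by
  rw [map_mul, ← Matrix.mulVec_mulVec]

theorem aeval_mulVec_comm (M : Matrix ι ι ℝ) (p q : ℝ[X]) (x : ι → ℝ) :
    aeval M p *ᵥ (aeval M q *ᵥ x) = aeval M q *ᵥ (aeval M p *ᵥ x) := by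
  rw [← aeval_mul_mulVec, mul_comm, aeval_mul_mulVec]

theorem aeval_mulVec_mem {M : Matrix ι ι ℝ} {V : Submodule ℝ (ι → ℝ)}
    (hV : ∀ x ∈ V, M *ᵥ x ∈ V) (p : ℝ[X]) {x : ι → ℝ} (hx : x ∈ V) : aeval M p *ᵥ x ∈ V := by
  induction p using Polynomial.induction_on' with
  | add p q hp hq => rw [map_add, Matrix.add_mulVec]; exact V.add_mem hp hq
  | monomial n a =>
    have hpow : ∀ n : ℕ, (M ^ n) *ᵥ x ∈ V := by
      intro n
      induction n with
      | zero => simpa using hx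
      | succ n ih => rw [pow_succ', ← Matrix.mulVec_mulVec]; exact hV _ ih
    rw [aeval_monomial, ← Algebra.smul_def, Matrix.smul_mulVec]
    exact V.smul_mem _ (hpow n)

/-- Transports annihilating polynomials, and with them the location of the spectrum, between a
system and its quotients and restrictions. -/
theorem mul_aeval_of_intertwine {Y : Matrix κ ι ℝ} {M : Matrix ι ι ℝ} {M' : Matrix κ κ ℝ}
    (h : Y * M = M' * Y) (p : ℝ[X]) : Y * aeval M p = aeval M' p * Y := by
  induction p using Polynomial.induction_on' with
  | add p q hp hq => rw [map_add, map_add, Matrix.mul_add, Matrix.add_mul, hp, hq]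
  | monomial n a =>
    have hpow : ∀ n : ℕ, Y * M ^ n = M' ^ n * Y := by
      intro n
      induction n with
      | zero => simp
      | succ n ih => rw [pow_succ, ← Matrix.mul_assoc, ih, Matrix.mul_assoc, h, ← Matrix.mul_assoc,
          pow_succ]
    rw [aeval_monomial, aeval_monomial, ← Algebra.smul_def, ← Algebra.smul_def, Matrix.mul_smul,
      Matrix.smul_mul, hpow]

theorem transpose_aeval (M : Matrix ι ι ℝ) (p : ℝ[X]) : (aeval M p)ᵀ = aeval Mᵀ p := by
  induction p using Polynomial.induction_on' with
  | add p q hp hq => rw [map_add, map_add, Matrix.transpose_add, hp, hq]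
  | monomial n a =>
    rw [aeval_monomial, aeval_monomial, ← Algebra.smul_def, ← Algebra.smul_def,
      Matrix.transpose_smul, Matrix.transpose_pow]

/-- Serves to compare closed loops of different Riccati solutions on an invariant subspace where
these solutions agree. -/
theorem aeval_mulVec_congr {M M' : Matrix ι ι ℝ} {V : Submodule ℝ (ι → ℝ)}
    (hV : ∀ x ∈ V, M *ᵥ x ∈ V) (h : ∀ x ∈ V, M' *ᵥ x = M *ᵥ x) (p : ℝ[X]) {x : ι → ℝ}
    (hx : x ∈ V) : aeval M' p *ᵥ x = aeval M p *ᵥ x := by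
  induction p using Polynomial.induction_on' with
  | add p q hp hq => rw [map_add, map_add, Matrix.add_mulVec, Matrix.add_mulVec, hp, hq]
  | monomial n a =>
    have hpow : ∀ n : ℕ, (M ^ n) *ᵥ x ∈ V ∧ (M' ^ n) *ᵥ x = (M ^ n) *ᵥ x := by
      intro n
      induction n with
      | zero => simpa using hx
      | succ n ih =>
        rw [pow_succ', ← Matrix.mulVec_mulVec, pow_succ', ← Matrix.mulVec_mulVec, ih.2]
        exact ⟨hV _ ih.1, h _ ih.1⟩
    rw [aeval_monomial, aeval_monomial, ← Algebra.smul_def, ← Algebra.smul_def,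
      Matrix.smul_mulVec, Matrix.smul_mulVec, (hpow n).2]

theorem aeval_charpoly_mulVec (M : Matrix ι ι ℝ) (x : ι → ℝ) : aeval M M.charpoly *ᵥ x = 0 := by
  rw [Matrix.aeval_self_charpoly, Matrix.zero_mulVec]

/-- A vector killed by two polynomials in `M` is killed by their greatest common divisor. -/
theorem exists_rootsIn_inter {S T : Set ℂ} {M : Matrix ι ι ℝ} {p q : ℝ[X]} {x : ι → ℝ}
    (hp : RootsIn S p) (hq : RootsIn T q)
    (hpx : aeval M p *ᵥ x = 0) (hqx : aeval M q *ᵥ x = 0) :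
    ∃ g, RootsIn (S ∩ T) g ∧ aeval M g *ᵥ x = 0 := by
  obtain ⟨a, b, g, hg, he⟩ := hp.exists_gcd hq
  refine ⟨g, hg, ?_⟩
  rw [he, map_add, Matrix.add_mulVec, aeval_mul_mulVec, aeval_mul_mulVec, hpx, hqx]
  simp

/-- If `p(M) x` and `q(M) x` lie in an invariant subspace and `p, q` are coprime, then so does
`x`. -/
theorem mem_of_isCoprime {M : Matrix ι ι ℝ} {V : Submodule ℝ (ι → ℝ)}
    (hV : ∀ x ∈ V, M *ᵥ x ∈ V) {p q : ℝ[X]} (h : IsCoprime p q) {x : ι → ℝ}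
    (hp : aeval M p *ᵥ x ∈ V) (hq : aeval M q *ᵥ x ∈ V) : x ∈ V := by
  obtain ⟨a, b, hab⟩ := h
  have : x = aeval M (a * p + b * q) *ᵥ x := by rw [hab]; simp
  rw [this, map_add, Matrix.add_mulVec, aeval_mul_mulVec, aeval_mul_mulVec]
  exact V.add_mem (aeval_mulVec_mem hV _ hp) (aeval_mulVec_mem hV _ hq)

theorem eq_zero_of_isCoprime {M : Matrix ι ι ℝ} {p q : ℝ[X]} (h : IsCoprime p q) {x : ι → ℝ}
    (hp : aeval M p *ᵥ x = 0) (hq : aeval M q *ᵥ x = 0) : x = 0 := by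
  have := mem_of_isCoprime (M := M) (V := ⊥) (by simp) h (x := x) (by simpa using hp)
    (by simpa using hq)
  simpa using this

/-- Write the characteristic polynomial as s r with s its S-part. If p(M)x = 0, then s(M)x is killed
both by p and by r, which are coprime. This frees later arguments from the particular polynomial in
the definition. -/
theorem mem_spectralSubspace {S : Set ℂ} (hS : ∀ z ∈ S, (starRingEnd ℂ) z ∈ S)
    {M : Matrix ι ι ℝ} {x : ι → ℝ} :
    x ∈ spectralSubspace S M ↔ ∃ p, RootsIn S p ∧ aeval M p *ᵥ x = 0 := by
  unfold spectralSubspace kerM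
  rw [LinearMap.mem_ker, Matrix.mulVecLin_apply]
  constructor
  · intro h
    exact ⟨_, rootsIn_rootFactor S _, h⟩
  · rintro ⟨p, hp, hpx⟩
    obtain ⟨r, hr, hc⟩ := exists_rootFactor_mul hS (p := M.charpoly) M.charpoly_monic.ne_zero
    refine eq_zero_of_isCoprime (hp.isCoprime disjoint_compl_right hr) (M := M) ?_ ?_
    · rw [aeval_mulVec_comm, hpx, Matrix.mulVec_zero]
    · rw [← aeval_mul_mulVec, mul_comm, ← hc, aeval_charpoly_mulVec]

theorem mem_specNeg {M : Matrix ι ι ℝ} {x : ι → ℝ} :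
    x ∈ specNeg M ↔ ∃ p, RootsIn {z | z.re < 0} p ∧ aeval M p *ᵥ x = 0 :=
  mem_spectralSubspace (by simp)

theorem mem_specZero {M : Matrix ι ι ℝ} {x : ι → ℝ} :
    x ∈ specZero M ↔ ∃ p, RootsIn {z | z.re = 0} p ∧ aeval M p *ᵥ x = 0 :=
  mem_spectralSubspace (by simp)

theorem mem_specPos {M : Matrix ι ι ℝ} {x : ι → ℝ} :
    x ∈ specPos M ↔ ∃ p, RootsIn {z | 0 < z.re} p ∧ aeval M p *ᵥ x = 0 :=
  mem_spectralSubspace (by simp)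

/-- Every nonzero polynomial splits as a factor with roots in `S` and one with roots outside. -/
theorem exists_split {S : Set ℂ} (hS : ∀ z ∈ S, (starRingEnd ℂ) z ∈ S) {p : ℝ[X]} (hp : p ≠ 0) :
    ∃ q r, RootsIn S q ∧ RootsIn Sᶜ r ∧ p = q * r := by
  obtain ⟨r, hr, h⟩ := exists_rootFactor_mul hS hp
  exact ⟨_, r, rootsIn_rootFactor S p, hr, h⟩

/-- Real form of the existence of eigenvectors: if `p(M) x₀ ∈ Y` with `x₀ ∉ Y`, then there is
`x + i y ∉ Y_ℂ` with `(M - z) (x + i y) ∈ Y_ℂ` for some root `z` of `p`. -/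
theorem exists_eigenpair {M : Matrix ι ι ℝ} {V Y : Submodule ℝ (ι → ℝ)}
    (hV : ∀ x ∈ V, M *ᵥ x ∈ V) {p : ℝ[X]} (hp : p ≠ 0) {x₀ : ι → ℝ} (hx₀ : x₀ ∈ V)
    (hY : x₀ ∉ Y) (hpx : aeval M p *ᵥ x₀ ∈ Y) :
    ∃ z : ℂ, aeval z p = 0 ∧ ∃ x ∈ V, ∃ y ∈ V, ¬ (x ∈ Y ∧ y ∈ Y) ∧
      M *ᵥ x - z.re • x + z.im • y ∈ Y ∧ M *ᵥ y - z.im • x - z.re • y ∈ Y := by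
  induction hd : p.natDegree using Nat.strong_induction_on generalizing p with
  | _ d ih =>
  by_cases hd0 : p.natDegree = 0
  · exfalso
    rw [natDegree_eq_zero] at hd0
    obtain ⟨c, rfl⟩ := hd0
    have hc : c ≠ 0 := by rintro rfl; simp at hp
    apply hY
    rw [aeval_C, Algebra.algebraMap_eq_smul_one, Matrix.smul_mulVec, Matrix.one_mulVec] at hpx
    have := Y.smul_mem c⁻¹ hpx
    rwa [smul_smul, inv_mul_cancel₀ hc, one_smul] at this
  obtain ⟨z, hz⟩ : ∃ z : ℂ, aeval z p = 0 := IsAlgClosed.exists_aeval_eq_zero _ p (by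
    intro h; exact hd0 (natDegree_eq_zero_iff_degree_le_zero.2 h.le))
  by_cases him : z.im = 0
  · have hzr : ((z.re : ℝ) : ℂ) = z := by apply Complex.ext <;> simp [him]
    have hr : p.IsRoot z.re := by
      have : aeval ((z.re : ℝ) : ℂ) p = 0 := by rw [hzr]; exact hz
      rw [← Complex.coe_algebraMap, aeval_algebraMap_apply] at this
      simpa using this
    obtain ⟨r, hr'⟩ := dvd_iff_isRoot.2 hr
    have hr0 : r ≠ 0 := by rintro rfl; simp at hr'; exact hp hr'
    -- If r(M)x₀ is still in Y, the factor r of smaller degree serves as well; otherwise r(M)x₀ is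
    -- itself the eigenvector modulo Y.
    by_cases hrY : aeval M r *ᵥ x₀ ∈ Y
    · have hlt : r.natDegree < d := by
        rw [← hd, hr', natDegree_mul (X_sub_C_ne_zero _) hr0, natDegree_X_sub_C]; omega
      obtain ⟨w, hw, h⟩ := ih _ hlt hr0 hrY rfl
      exact ⟨w, by rw [hr', map_mul, hw, mul_zero], h⟩
    · refine ⟨z, hz, aeval M r *ᵥ x₀, aeval_mulVec_mem hV r hx₀, 0, V.zero_mem,
        fun h => hrY h.1, ?_, ?_⟩
      · rw [hr', aeval_mul_mulVec] at hpx
        simpa [-Matrix.mulVec_mulVec, Matrix.sub_mulVec, Algebra.algebraMap_eq_smul_one,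
          Matrix.smul_mulVec] using hpx
      · simp [him]
  · obtain ⟨r, hr'⟩ := p.quadratic_dvd_of_aeval_eq_zero_im_ne_zero hz him
    have hq : (X ^ 2 - C (2 * z.re) * X + C (‖z‖ ^ 2) : ℝ[X]).natDegree = 2 := by
      compute_degree!
    have hr0 : r ≠ 0 := by rintro rfl; simp at hr'; exact hp hr'
    by_cases hrY : aeval M r *ᵥ x₀ ∈ Y
    · have hlt : r.natDegree < d := by
        rw [← hd, hr', natDegree_mul _ hr0, hq]
        · omega
        · intro h; rw [h] at hq; simp at hq
      obtain ⟨w, hw, h⟩ := ih _ hlt hr0 hrY rfl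
      exact ⟨w, by rw [hr', map_mul, hw, mul_zero], h⟩
    · set x₁ := aeval M r *ᵥ x₀ with hx₁
      have hx₁V : x₁ ∈ V := aeval_mulVec_mem hV r hx₀
      -- These are the real and imaginary parts of (M - z̄)x₁. Applying M - z gives the quadratic
      -- factor evaluated at M, whose value at x₁ lies in Y.
      refine ⟨z, hz, M *ᵥ x₁ - z.re • x₁, V.sub_mem (hV _ hx₁V) (V.smul_mem _ hx₁V),
        z.im • x₁, V.smul_mem _ hx₁V, fun h => ?_, ?_, ?_⟩
      · apply hrY
        have := Y.smul_mem (z.im)⁻¹ h.2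
        rwa [smul_smul, inv_mul_cancel₀ him, one_smul] at this
      · rw [hr', aeval_mul_mulVec, ← hx₁] at hpx
        convert! hpx using 1
        simp only [map_add, map_sub, map_mul, aeval_X, aeval_C, Matrix.add_mulVec,
          Matrix.sub_mulVec, Algebra.algebraMap_eq_smul_one, Matrix.smul_mulVec,
          Matrix.one_mulVec, smul_mul_assoc, one_mul, pow_two, ← Matrix.mulVec_mulVec,
          Matrix.mulVec_sub, Matrix.mulVec_smul, smul_sub, smul_smul]
        rw [← pow_two ‖z‖, ← Complex.normSq_eq_norm_sq, Complex.normSq_apply]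
        module
      · convert! Y.zero_mem using 1
        rw [Matrix.mulVec_smul]
        module

/-- If all eigenvectors of `M` in `V` modulo `Y` belong to eigenvalues in `S`, then some polynomial
with roots in `S` maps `V` into `Y`. -/
theorem exists_rootsIn_of_eigenpairs {S : Set ℂ} (hS : ∀ z ∈ S, (starRingEnd ℂ) z ∈ S)
    {M : Matrix ι ι ℝ} {V Y : Submodule ℝ (ι → ℝ)} (hV : ∀ x ∈ V, M *ᵥ x ∈ V)
    (h : ∀ z : ℂ, z ∉ S → ∀ x ∈ V, ∀ y ∈ V, M *ᵥ x - z.re • x + z.im • y ∈ Y →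
      M *ᵥ y - z.im • x - z.re • y ∈ Y → x ∈ Y ∧ y ∈ Y) :
    ∃ p, RootsIn S p ∧ ∀ x ∈ V, aeval M p *ᵥ x ∈ Y := by
  obtain ⟨q, r, hq, hr, hc⟩ := exists_split hS (p := M.charpoly) M.charpoly_monic.ne_zero
  refine ⟨q, hq, fun x hx => ?_⟩
  by_contra hxY
  obtain ⟨z, hz, a, ha, b, hb, hab, h1, h2⟩ := exists_eigenpair hV hr.1
    (aeval_mulVec_mem hV q hx) hxY (by
      rw [← aeval_mul_mulVec, mul_comm, ← hc, aeval_charpoly_mulVec]; exact Y.zero_mem)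
  exact hab (h z (hr.2 z hz) a ha b hb h1 h2)

/-- If `(x, y) ≠ 0` is an eigenpair of `M` for `z` and `p(M) = 0` on it, then `z` is a root. -/
theorem aeval_eigenpair {M : Matrix ι ι ℝ} {z : ℂ} {x y : ι → ℝ}
    (h1 : M *ᵥ x = z.re • x - z.im • y) (h2 : M *ᵥ y = z.im • x + z.re • y) (p : ℝ[X]) :
    aeval M p *ᵥ x = (aeval z p).re • x - (aeval z p).im • y ∧
    aeval M p *ᵥ y = (aeval z p).im • x + (aeval z p).re • y := by
  induction p using Polynomial.induction_on' with
  | add p q hp hq =>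
    simp only [map_add, Matrix.add_mulVec, hp.1, hq.1, hp.2, hq.2, Complex.add_re, Complex.add_im]
    constructor <;> module
  | monomial n a =>
    have hpow : ∀ n : ℕ, (M ^ n) *ᵥ x = (z ^ n).re • x - (z ^ n).im • y ∧
        (M ^ n) *ᵥ y = (z ^ n).im • x + (z ^ n).re • y := by
      intro n
      induction n with
      | zero => simp
      | succ n ih =>
        rw [pow_succ', ← Matrix.mulVec_mulVec, ← Matrix.mulVec_mulVec, ih.1, ih.2]
        simp only [Matrix.mulVec_sub, Matrix.mulVec_add, Matrix.mulVec_smul, h1, h2, pow_succ,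
          Complex.mul_re, Complex.mul_im]
        constructor <;> module
    rw [aeval_monomial, aeval_monomial, ← Algebra.smul_def, ← Algebra.smul_def,
      Matrix.smul_mulVec, Matrix.smul_mulVec, (hpow n).1, (hpow n).2]
    simp only [Complex.smul_re, Complex.smul_im]
    constructor <;> module

theorem root_of_eigenpair {M : Matrix ι ι ℝ} {z : ℂ} {x y : ι → ℝ}
    (h1 : M *ᵥ x = z.re • x - z.im • y) (h2 : M *ᵥ y = z.im • x + z.re • y) {p : ℝ[X]}
    (hx : aeval M p *ᵥ x = 0) (hy : aeval M p *ᵥ y = 0) (hxy : ¬ (x = 0 ∧ y = 0)) :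
    aeval z p = 0 := by
  obtain ⟨e1, e2⟩ := aeval_eigenpair h1 h2 p
  rw [hx] at e1
  rw [hy] at e2
  set w := aeval z p
  have key : ∀ u v : ℝ, ¬ (u = 0 ∧ v = 0) → 0 = w.re • u - w.im • v → 0 = w.im • u + w.re • v →
      w = 0 := by
    intro u v huv h1 h2
    simp only [smul_eq_mul] at h1 h2
    have h3 : w.re * (u ^ 2 + v ^ 2) = 0 := by linear_combination -u * h1 - v * h2
    have h4 : w.im * (u ^ 2 + v ^ 2) = 0 := by linear_combination v * h1 - u * h2
    have h5 : u ^ 2 + v ^ 2 ≠ 0 := by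
      intro h
      apply huv
      constructor <;> nlinarith [sq_nonneg u, sq_nonneg v]
    apply Complex.ext
    · simpa [h5] using h3
    · simpa [h5] using h4
  by_contra hw
  apply hxy
  have : ∀ i, x i = 0 ∧ y i = 0 := by
    intro i
    by_contra hi
    exact hw (key _ _ hi (congrFun e1 i) (congrFun e2 i))
  exact ⟨funext fun i => (this i).1, funext fun i => (this i).2⟩

end Aeval

/-! ### Matrices with prescribed kernels -/

section Kernels

variable {ι κ μ : Type*} [Fintype ι] [DecidableEq ι] [Fintype κ] [DecidableEq κ] [Fintype μ]
  [DecidableEq μ]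

theorem mulVec_ext {Y Z : Matrix κ ι ℝ} (h : ∀ x, Y *ᵥ x = Z *ᵥ x) : Y = Z := by
  classical
  exact Matrix.toLin'.injective (LinearMap.ext fun x => by simpa using h x)

/-- A subspace is the kernel of a matrix with a right inverse. -/
theorem exists_quotient_matrix (V : Submodule ℝ (ι → ℝ)) :
    ∃ (k : ℕ) (π : Matrix (Fin k) ι ℝ) (σ : Matrix ι (Fin k) ℝ), π * σ = 1 ∧
      ∀ x, π *ᵥ x = 0 ↔ x ∈ V := by
  let k := Module.finrank ℝ ((ι → ℝ) ⧸ V)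
  let e : ((ι → ℝ) ⧸ V) ≃ₗ[ℝ] (Fin k → ℝ) := (Module.finBasis ℝ _).equivFun
  let f : (ι → ℝ) →ₗ[ℝ] (Fin k → ℝ) := e.toLinearMap ∘ₗ V.mkQ
  have hf : LinearMap.range f = ⊤ := by
    rw [LinearMap.range_eq_top]
    exact e.surjective.comp V.mkQ_surjective
  obtain ⟨g, hg⟩ := LinearMap.exists_rightInverse_of_surjective f hf
  refine ⟨k, LinearMap.toMatrix' f, LinearMap.toMatrix' g, ?_, fun x => ?_⟩
  · rw [← LinearMap.toMatrix'_comp, hg, LinearMap.toMatrix'_id]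
  · rw [LinearMap.toMatrix'_mulVec]
    simp [f]

/-- Factorization through a matrix with smaller kernel. -/
theorem exists_factor {π : Matrix κ ι ℝ} {Y : Matrix μ ι ℝ} (h : ∀ x, π *ᵥ x = 0 → Y *ᵥ x = 0) :
    ∃ Z : Matrix μ κ ℝ, Y = Z * π := by
  obtain ⟨g, hg⟩ := LinearMap.exists_extend
    (((LinearMap.ker π.mulVecLin).liftQ Y.mulVecLin (by
      intro x hx
      simp only [LinearMap.mem_ker, Matrix.mulVecLin_apply] at hx ⊢
      exact h x hx)) ∘ₗ (π.mulVecLin.quotKerEquivRange.symm).toLinearMap)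
  refine ⟨LinearMap.toMatrix' g, mulVec_ext fun x => ?_⟩
  have := LinearMap.congr_fun hg ⟨π *ᵥ x, by exact ⟨_, rfl⟩⟩
  simp only [LinearMap.comp_apply, Submodule.subtype_apply] at this
  rw [← Matrix.mulVec_mulVec, LinearMap.toMatrix'_mulVec, this]
  have h2 : π.mulVecLin.quotKerEquivRange.symm ⟨π *ᵥ x, by exact ⟨_, rfl⟩⟩ =
      Submodule.Quotient.mk x := by
    rw [LinearEquiv.symm_apply_eq]
    rfl
  rw [LinearEquiv.coe_coe, h2]
  rfl

/-- The matrix induced on a quotient by an invariant subspace. -/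
theorem quotient_intertwine {V : Submodule ℝ (ι → ℝ)} {π : Matrix κ ι ℝ} {σ : Matrix ι κ ℝ}
    (hπσ : π * σ = 1) (hker : ∀ x, π *ᵥ x = 0 ↔ x ∈ V) {M : Matrix ι ι ℝ}
    (hV : ∀ x ∈ V, M *ᵥ x ∈ V) : π * M = (π * M * σ) * π := by
  refine mulVec_ext fun x => ?_
  have h1 : x - σ *ᵥ (π *ᵥ x) ∈ V := by
    rw [← hker, Matrix.mulVec_sub, Matrix.mulVec_mulVec, hπσ, Matrix.one_mulVec, sub_self]
  have h2 := (hker _).2 (hV _ h1)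
  rw [Matrix.mulVec_sub, Matrix.mulVec_sub, sub_eq_zero] at h2
  simpa [Matrix.mulVec_mulVec, Matrix.mul_assoc] using h2

theorem factor_through_quotient {V : Submodule ℝ (ι → ℝ)} {π : Matrix κ ι ℝ} {σ : Matrix ι κ ℝ}
    (hπσ : π * σ = 1) (hker : ∀ x, π *ᵥ x = 0 ↔ x ∈ V) {Y : Matrix μ ι ℝ}
    (hV : ∀ x ∈ V, Y *ᵥ x = 0) : Y = Y * σ * π := by
  obtain ⟨Z, hZ⟩ := exists_factor (π := π) (Y := Y) (fun x hx => hV x ((hker x).1 hx))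
  calc Y = Z * π := hZ
    _ = Z * (π * σ) * π := by rw [hπσ, Matrix.mul_one]
    _ = Y * σ * π := by rw [hZ]; simp only [Matrix.mul_assoc]

end Kernels

end IndefLQ

namespace IndefLQ

section Flow

variable {ι κ : Type*} [Fintype ι] [DecidableEq ι] [Fintype κ] [DecidableEq κ]

/-! ### The flow of a linear differential equation -/

/-- The matrix exponential `exp (t M)`. -/
noncomputable def flow (M : Matrix ι ι ℝ) (t : ℝ) : Matrix ι ι ℝ := NormedSpace.exp (t • M)

theorem flow_zero (M : Matrix ι ι ℝ) : flow M 0 = 1 := by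
  simp [flow]

theorem flow_add (M : Matrix ι ι ℝ) (s t : ℝ) : flow M (s + t) = flow M s * flow M t := by
  unfold flow
  rw [add_smul]
  exact Matrix.exp_add_of_commute _ _ (((Commute.refl M).smul_left s).smul_right t)

theorem flow_mul_neg (M : Matrix ι ι ℝ) (t : ℝ) : flow M t * flow M (-t) = 1 := by
  rw [← flow_add, add_neg_cancel, flow_zero]

section
open scoped Matrix.Norms.Operator

theorem hasDerivAt_flow (M : Matrix ι ι ℝ) (t : ℝ) : HasDerivAt (flow M) (M * flow M t) t :=
  hasDerivAt_exp_smul_const' (𝕂 := ℝ) M t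

theorem commute_flow (M : Matrix ι ι ℝ) (t : ℝ) : M * flow M t = flow M t * M :=
  (hasDerivAt_flow M t).unique (hasDerivAt_exp_smul_const (𝕂 := ℝ) M t)

theorem hasDerivAt_flow_apply (M : Matrix ι ι ℝ) (t : ℝ) (i j : ι) :
    HasDerivAt (fun t => flow M t i j) ((M * flow M t) i j) t := by
  have h := hasDerivAt_flow M t
  have h1 := (hasDerivAt_pi.1 h) i
  exact (hasDerivAt_pi.1 h1) j

end

theorem hasDerivAt_flow_mulVec (M : Matrix ι ι ℝ) (v : ι → ℝ) (t : ℝ) :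
    HasDerivAt (fun t => flow M t *ᵥ v) (M *ᵥ (flow M t *ᵥ v)) t := by
  rw [hasDerivAt_pi]
  intro i
  rw [Matrix.mulVec_mulVec]
  simp only [Matrix.mulVec, dotProduct]
  exact HasDerivAt.fun_sum fun j _ => (hasDerivAt_flow_apply M t i j).mul_const _

/-- A linear combination of the coordinates of `x` has the corresponding derivative. -/
theorem hasDerivAt_dot {x : ℝ → ι → ℝ} {x' : ι → ℝ} {t : ℝ} (h : HasDerivAt x x' t)
    (Y : Matrix κ ι ℝ) : HasDerivAt (fun t => Y *ᵥ x t) (Y *ᵥ x') t := by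
  rw [hasDerivAt_pi]
  intro i
  simp only [Matrix.mulVec, dotProduct]
  exact HasDerivAt.fun_sum fun j _ => ((hasDerivAt_pi.1 h) j).const_mul _

theorem hasDerivAt_dotProduct {x y : ℝ → ι → ℝ} {x' y' : ι → ℝ} {t : ℝ}
    (hx : HasDerivAt x x' t) (hy : HasDerivAt y y' t) :
    HasDerivAt (fun t => x t ⬝ᵥ y t) (x' ⬝ᵥ y t + x t ⬝ᵥ y') t := by
  simp only [dotProduct, ← Finset.sum_add_distrib]
  exact HasDerivAt.fun_sum fun j _ => ((hasDerivAt_pi.1 hx) j).mul ((hasDerivAt_pi.1 hy) j)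

/-- Uniqueness for linear differential equations. -/
theorem eq_flow_of_hasDerivAt {M : Matrix ι ι ℝ} {x : ℝ → ι → ℝ}
    (hc : ContinuousOn x (Set.Ici 0)) (hx : ∀ t, 0 < t → HasDerivAt x (M *ᵥ x t) t) {t : ℝ}
    (ht : 0 ≤ t) : x t = flow M t *ᵥ x 0 := by
  have hd : ∀ s, 0 < s → HasDerivAt (fun s => flow M (-s) *ᵥ x s) 0 s := by
    intro s hs
    rw [hasDerivAt_pi]
    intro i
    have h1 : ∀ j, HasDerivAt (fun s => flow M (-s) i j) (-(M * flow M (-s)) i j) s := by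
      intro j
      have h2 := (hasDerivAt_flow_apply M (-s) i j).comp s (hasDerivAt_neg s)
      simpa [Function.comp_def] using h2
    have h3 : HasDerivAt (fun s => (flow M (-s) *ᵥ x s) i)
        (∑ j, (-(M * flow M (-s)) i j * x s j + flow M (-s) i j * (M *ᵥ x s) j)) s := by
      simp only [Matrix.mulVec, dotProduct]
      exact HasDerivAt.fun_sum fun j _ => (h1 j).mul ((hasDerivAt_pi.1 (hx s hs)) j)
    have h4 : ∑ j, (-(M * flow M (-s)) i j * x s j + flow M (-s) i j * (M *ᵥ x s) j) = 0 := by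
      have : (-(M * flow M (-s)) *ᵥ x s + flow M (-s) *ᵥ (M *ᵥ x s)) i = 0 := by
        rw [Matrix.mulVec_mulVec, ← commute_flow, Matrix.neg_mulVec]
        simp
      rw [Finset.sum_add_distrib]
      exact this
    rw [h4] at h3
    exact h3
  have hcont : ContinuousOn (fun s => flow M (-s) *ᵥ x s) (Set.Icc 0 t) := by
    have hf : Continuous fun s => flow M (-s) := by
      refine continuous_matrix fun i j => ?_
      have : Continuous fun s => flow M s i j :=
        continuous_iff_continuousAt.2 fun s => (hasDerivAt_flow_apply M s i j).continuousAt
      exact this.comp continuous_neg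
    rw [continuousOn_pi]
    intro i
    simp only [Matrix.mulVec, dotProduct]
    refine continuousOn_finsetSum _ fun j _ => ContinuousOn.mul ?_ ?_
    · exact (hf.matrix_elem i j).continuousOn
    · exact ((continuousOn_pi.1 hc) j).mono fun s hs => hs.1
  have hconst : flow M (-t) *ᵥ x t = flow M (-0) *ᵥ x 0 := by
    have hI : t ∈ Set.Icc 0 t := ⟨ht, le_refl t⟩
    refine constant_of_has_deriv_right_zero hcont ?_ t hI |>.trans rfl
    intro s hs
    -- At the initial time only continuity is assumed; the right derivative there is the limit of
    -- the derivatives at positive times.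
    rcases hs.1.eq_or_lt with h0 | h0
    · subst h0
      refine hasDerivWithinAt_Ici_of_tendsto_deriv (s := Set.Ioo 0 t) ?_ ?_ ?_ ?_
      · intro s hs
        exact (hd s hs.1).differentiableAt.differentiableWithinAt
      · refine (hcont 0 ⟨le_refl _, ht⟩).mono fun s hs => ⟨hs.1.le, hs.2.le⟩
      · exact Ioo_mem_nhdsGT hs.2
      · refine tendsto_const_nhds.congr' ?_
        filter_upwards [self_mem_nhdsWithin] with s hs
        exact (hd s hs).deriv.symm
    · exact (hd s h0).hasDerivWithinAt
  rw [neg_zero, flow_zero, Matrix.one_mulVec] at hconst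
  rw [← hconst, Matrix.mulVec_mulVec, flow_mul_neg, Matrix.one_mulVec]

theorem flow_intertwine {Y : Matrix κ ι ℝ} {M : Matrix ι ι ℝ} {M' : Matrix κ κ ℝ}
    (h : Y * M = M' * Y) {t : ℝ} (ht : 0 ≤ t) (v : ι → ℝ) :
    Y *ᵥ (flow M t *ᵥ v) = flow M' t *ᵥ (Y *ᵥ v) := by
  have hd : ∀ t, HasDerivAt (fun t => Y *ᵥ (flow M t *ᵥ v))
      (M' *ᵥ (Y *ᵥ (flow M t *ᵥ v))) t := by
    intro t
    have := hasDerivAt_dot (hasDerivAt_flow_mulVec M v t) Y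
    rwa [Matrix.mulVec_mulVec _ Y M, h, ← Matrix.mulVec_mulVec] at this
  have := eq_flow_of_hasDerivAt (M := M') (x := fun t => Y *ᵥ (flow M t *ᵥ v))
    (fun t _ => (hd t).continuousAt.continuousWithinAt) (fun t _ => hd t) ht
  simpa [flow_zero, Matrix.one_mulVec] using this

theorem flow_mulVec_mem {M : Matrix ι ι ℝ} {V : Submodule ℝ (ι → ℝ)}
    (hV : ∀ x ∈ V, M *ᵥ x ∈ V) {t : ℝ} (ht : 0 ≤ t) {x : ι → ℝ} (hx : x ∈ V) :
    flow M t *ᵥ x ∈ V := by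
  obtain ⟨k, π, σ, hπσ, hker⟩ := exists_quotient_matrix V
  rw [← hker, flow_intertwine (quotient_intertwine hπσ hker hV) ht, (hker x).2 hx,
    Matrix.mulVec_zero]

/-- Variation of constants: the integrating factor exp(-zt) leaves exp(-zt) f with derivative
exp(-zt) g, whose norm is bounded by an increasing exponential. -/
theorem decay_of_deriv {f g : ℝ → ℂ} {z : ℂ} {a C : ℝ} (hza : z.re < -a)
    (hf : ∀ t, HasDerivAt f (z * f t + g t) t)
    (hg : ∀ t, 0 ≤ t → ‖g t‖ ≤ C * Real.exp (-a * t)) :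
    ∃ C', ∀ t, 0 ≤ t → ‖f t‖ ≤ C' * Real.exp (-a * t) := by
  -- The growth rate of the bound for exp(-zt) g; it is positive because the forcing decays more
  -- slowly than the homogeneous solution.
  set β : ℝ := -z.re - a with hβ
  have hβ0 : 0 < β := by rw [hβ]; linarith
  have hC : 0 ≤ C := by
    have := (norm_nonneg _).trans (hg 0 le_rfl)
    simpa using this
  set h : ℝ → ℂ := fun t => Complex.exp (-z * t) * f t with hh
  have hder : ∀ t : ℝ, HasDerivAt h (Complex.exp (-z * t) * g t) t := by
    intro t
    have h1 : HasDerivAt (fun t : ℝ => Complex.exp (-z * t)) (Complex.exp (-z * t) * (-z)) t := by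
      have h2 : HasDerivAt (fun t : ℝ => -z * (t : ℂ)) (-z) t := by
        simpa using (Complex.ofRealCLM.hasDerivAt (x := t)).const_mul (-z)
      exact h2.cexp
    have h3 := h1.mul (hf t)
    convert! h3 using 1
    ring
  have hexp : ∀ t : ℝ, ‖Complex.exp (-z * t)‖ = Real.exp (-z.re * t) := by
    intro t
    rw [Complex.norm_exp]
    simp
  refine ⟨‖f 0‖ + C / β, fun t ht => ?_⟩
  have hB : ∀ x : ℝ, HasDerivAt (fun x => ‖f 0‖ + C / β * Real.exp (β * x))
      (C * Real.exp (β * x)) x := by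
    intro x
    have h1 : HasDerivAt (fun x : ℝ => Real.exp (β * x)) (Real.exp (β * x) * β) x := by
      have h2 : HasDerivAt (fun x : ℝ => β * x) β x := by simpa using (hasDerivAt_id x).const_mul β
      exact h2.exp
    have h2 := (h1.const_mul (C / β)).const_add ‖f 0‖
    convert! h2 using 1
    field_simp
  have hb := image_norm_le_of_norm_deriv_right_le_deriv_boundary (a := 0) (b := t)
    (f := h) (f' := fun t => Complex.exp (-z * t) * g t)
    (fun s _ => (hder s).continuousAt.continuousWithinAt)
    (fun s _ => (hder s).hasDerivWithinAt) (by simp [hh]; positivity) hB (by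
      intro s hs
      rw [norm_mul, hexp]
      calc Real.exp (-z.re * s) * ‖g s‖
          ≤ Real.exp (-z.re * s) * (C * Real.exp (-a * s)) :=
            mul_le_mul_of_nonneg_left (hg s hs.1) (Real.exp_pos _).le
        _ = C * Real.exp (β * s) := by
            rw [mul_left_comm, ← Real.exp_add]
            congr 2
            rw [hβ]; ring) (x := t) ⟨ht, le_refl t⟩
  simp only [hh, norm_mul, hexp] at hb
  have h5 : ‖f t‖ = Real.exp (z.re * t) * (Real.exp (-z.re * t) * ‖f t‖) := by
    rw [← mul_assoc, ← Real.exp_add]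
    simp
  rw [h5]
  calc Real.exp (z.re * t) * (Real.exp (-z.re * t) * ‖f t‖)
      ≤ Real.exp (z.re * t) * (‖f 0‖ + C / β * Real.exp (β * t)) :=
        mul_le_mul_of_nonneg_left hb (Real.exp_pos _).le
    _ = Real.exp (z.re * t) * ‖f 0‖ + C / β * Real.exp (-a * t) := by
        have : Real.exp (-a * t) = Real.exp (z.re * t) * Real.exp (β * t) := by
          rw [← Real.exp_add]; congr 1; rw [hβ]; ring
        rw [this]; ring
    _ ≤ Real.exp (-a * t) * ‖f 0‖ + C / β * Real.exp (-a * t) := by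
        gcongr
    _ = _ := by ring

/-- Induction on the degree of q: for a root z, the row y(M - z) is killed by the remaining factor,
and it is the forcing term in the scalar equation with coefficient z for the observation through y.
-/
theorem exists_exp_decay_of_poly (M : Matrix ι ι ℝ) (v : ι → ℝ) {q : ℂ[X]} (hq : q ≠ 0)
    (hroots : ∀ z, q.IsRoot z → z.re < 0) {y : ι → ℂ}
    (hy : y ᵥ* aeval (M.map (algebraMap ℝ ℂ)) q = 0) :
    ∃ a C : ℝ, 0 < a ∧ ∀ t, 0 ≤ t →
      ‖∑ i, y i * ((flow M t *ᵥ v) i : ℂ)‖ ≤ C * Real.exp (-a * t) := by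
  induction hd : q.natDegree using Nat.strong_induction_on generalizing q y with
  | _ d ih =>
  by_cases hd0 : q.natDegree = 0
  · rw [natDegree_eq_zero] at hd0
    obtain ⟨c, rfl⟩ := hd0
    have hc : c ≠ 0 := by rintro rfl; simp at hq
    rw [aeval_C, Algebra.algebraMap_eq_smul_one, Matrix.vecMul_smul, Matrix.vecMul_one,
      smul_eq_zero] at hy
    have hy0 := hy.resolve_left hc
    exact ⟨1, 0, one_pos, fun t _ => by simp [hy0]⟩
  obtain ⟨z, hz⟩ := IsAlgClosed.exists_root q (by
    intro h; exact hd0 (natDegree_eq_zero_iff_degree_le_zero.2 h.le))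
  obtain ⟨r, hr⟩ := dvd_iff_isRoot.2 hz
  have hr0 : r ≠ 0 := by rintro rfl; simp at hr; exact hq hr
  set Mc := M.map (algebraMap ℝ ℂ) with hMc
  set y' := y ᵥ* (Mc - z • (1 : Matrix ι ι ℂ)) with hy'
  have hlt : r.natDegree < d := by
    rw [← hd, hr, natDegree_mul (X_sub_C_ne_zero _) hr0, natDegree_X_sub_C]; omega
  obtain ⟨a, C, ha, hC⟩ := ih _ hlt hr0 (fun w hw => hroots w (by
    rw [hr, IsRoot.def, eval_mul, hw, mul_zero])) (y := y') (by
    rw [hy', Matrix.vecMul_vecMul]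
    rw [hr, map_mul, map_sub, aeval_X, aeval_C, Algebra.algebraMap_eq_smul_one] at hy
    exact hy) rfl
  have hz0 := hroots z hz
  -- `decay_of_deriv` needs a rate strictly below -Re z, so half of it is taken.
  set a' := min a (-z.re / 2) with ha'
  have ha'0 : 0 < a' := lt_min ha (by linarith)
  have hC0 : 0 ≤ C := by
    have := (norm_nonneg _).trans (hC 0 le_rfl)
    simpa using this
  obtain ⟨C', hC'⟩ := decay_of_deriv (z := z) (a := a') (C := C)
    (f := fun t => ∑ i, y i * ((flow M t *ᵥ v) i : ℂ))
    (g := fun t => ∑ i, y' i * ((flow M t *ᵥ v) i : ℂ))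
    (by have := min_le_right a (-z.re / 2); linarith) (by
      intro t
      have h1 : HasDerivAt (fun t => ∑ i, y i * ((flow M t *ᵥ v) i : ℂ))
          (∑ i, y i * ((M *ᵥ (flow M t *ᵥ v)) i : ℂ)) t :=
        HasDerivAt.fun_sum fun i _ =>
          (((hasDerivAt_pi.1 (hasDerivAt_flow_mulVec M v t)) i).ofReal_comp).const_mul _
      convert! h1 using 1
      set w : ι → ℂ := fun i => ((flow M t *ᵥ v) i : ℂ) with hw
      have h2 : ∀ i, ((M *ᵥ (flow M t *ᵥ v)) i : ℂ) = (Mc *ᵥ w) i := by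
        intro i
        conv_lhs => rw [Matrix.mulVec]
        conv_rhs => rw [Matrix.mulVec]
        simp only [dotProduct]
        push_cast
        rfl
      change z * (y ⬝ᵥ w) + y' ⬝ᵥ w = ∑ i, y i * ((M *ᵥ (flow M t *ᵥ v)) i : ℂ)
      simp only [h2]
      change z * (y ⬝ᵥ w) + y' ⬝ᵥ w = y ⬝ᵥ (Mc *ᵥ w)
      rw [hy', ← Matrix.dotProduct_mulVec, Matrix.sub_mulVec, Matrix.smul_mulVec,
        Matrix.one_mulVec, dotProduct_sub, dotProduct_smul, smul_eq_mul]
      ring) (by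
      intro t ht
      refine (hC t ht).trans ?_
      gcongr
      nlinarith [min_le_left a (-z.re / 2)])
  exact ⟨a', C', ha'0, hC'⟩

/-- If `Y q(M) = 0` with all roots of `q` in the open left half plane, then `Y exp(tM) v → 0`. -/
theorem tendsto_flow_zero {M : Matrix ι ι ℝ} {q : ℝ[X]} (hq : RootsIn {z | z.re < 0} q)
    {Y : Matrix κ ι ℝ} (hY : Y * aeval M q = 0) (v : ι → ℝ) :
    Tendsto (fun t => Y *ᵥ (flow M t *ᵥ v)) atTop (𝓝 0) := by
  rw [tendsto_pi_nhds]
  intro j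
  set y : ι → ℂ := fun i => (Y j i : ℂ)
  have hmap : aeval (M.map (algebraMap ℝ ℂ)) (q.map (algebraMap ℝ ℂ)) =
      (aeval M q).map (algebraMap ℝ ℂ) := by
    rw [aeval_map_algebraMap]
    have := (aeval_algHom_apply (Algebra.ofId ℝ ℂ).mapMatrix M q)
    exact this
  obtain ⟨a, C, ha, hC⟩ := exists_exp_decay_of_poly M v (q := q.map (algebraMap ℝ ℂ))
    (by rw [Ne, Polynomial.map_eq_zero]; exact hq.1)
    (fun z hz => hq.2 z (by rw [IsRoot.def, eval_map_algebraMap] at hz; exact hz)) (y := y) (by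
      rw [hmap]
      ext i
      have : (Y * aeval M q) j i = 0 := by rw [hY]; rfl
      rw [Matrix.mul_apply] at this
      simp only [Matrix.vecMul, dotProduct, Matrix.map_apply, y, Pi.zero_apply]
      have h2 := congrArg (fun r : ℝ => (r : ℂ)) this
      push_cast at h2
      exact h2)
  have hlim : Tendsto (fun t : ℝ => C * Real.exp (-a * t)) atTop (𝓝 0) := by
    have h1 : Tendsto (fun t : ℝ => -a * t) atTop atBot :=
      tendsto_id.const_mul_atTop_of_neg (by linarith)
    simpa using (Real.tendsto_exp_atBot.comp h1).const_mul C
  refine squeeze_zero_norm' ?_ hlim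
  filter_upwards [eventually_ge_atTop 0] with t ht
  refine le_trans (le_of_eq ?_) (hC t ht)
  have : (∑ i, y i * ((flow M t *ᵥ v) i : ℂ)) = (((Y *ᵥ (flow M t *ᵥ v)) j : ℝ) : ℂ) := by
    conv_rhs => rw [Matrix.mulVec]
    simp only [dotProduct]
    push_cast
    rfl
  rw [this, Complex.norm_real]

end Flow

/-! ### Symmetric matrices and the Loewner order -/

section Loewner

variable {ι κ : Type*} [Fintype ι] [DecidableEq ι] [Fintype κ] [DecidableEq κ]

theorem nonneg_iff {M : Matrix ι ι ℝ} :
    0 ≤ M ↔ M.IsSymm ∧ ∀ x : ι → ℝ, 0 ≤ x ⬝ᵥ M *ᵥ x := by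
  rw [Matrix.nonneg_iff_posSemidef, Matrix.posSemidef_iff_dotProduct_mulVec]
  simp [Matrix.IsHermitian, Matrix.IsSymm, Matrix.conjTranspose_eq_transpose_of_trivial]

theorem loewner_le_iff {M N : Matrix ι ι ℝ} (hM : M.IsSymm) (hN : N.IsSymm) :
    M ≤ N ↔ ∀ x : ι → ℝ, x ⬝ᵥ M *ᵥ x ≤ x ⬝ᵥ N *ᵥ x := by
  rw [← sub_nonneg, nonneg_iff]
  simp only [Matrix.sub_mulVec, dotProduct_sub, sub_nonneg]
  exact ⟨fun h => h.2, fun h => ⟨hN.sub hM, h⟩⟩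

theorem dot_mulVec (Y : Matrix κ ι ℝ) (x : κ → ℝ) (y : ι → ℝ) :
    x ⬝ᵥ Y *ᵥ y = (Yᵀ *ᵥ x) ⬝ᵥ y := by
  rw [Matrix.dotProduct_mulVec, Matrix.mulVec_transpose]

theorem symm_dot {D : Matrix ι ι ℝ} (hD : D.IsSymm) (x y : ι → ℝ) :
    x ⬝ᵥ D *ᵥ y = y ⬝ᵥ D *ᵥ x := by
  rw [dot_mulVec, hD.eq, dotProduct_comm]

theorem dot_self_nonneg (x : ι → ℝ) : 0 ≤ x ⬝ᵥ x :=
  Finset.sum_nonneg fun i _ => mul_self_nonneg (x i)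

theorem dot_self_eq_zero {x : ι → ℝ} : x ⬝ᵥ x = 0 ↔ x = 0 := dotProduct_self_eq_zero

/-- Cauchy-Schwarz for a nonnegative form. -/
theorem dot_sq_le {D : Matrix ι ι ℝ} (hD : 0 ≤ D) (x y : ι → ℝ) :
    (x ⬝ᵥ D *ᵥ y) ^ 2 ≤ (x ⬝ᵥ D *ᵥ x) * (y ⬝ᵥ D *ᵥ y) := by
  obtain ⟨hs, hp⟩ := nonneg_iff.1 hD
  have h : ∀ t : ℝ, 0 ≤ (y ⬝ᵥ D *ᵥ y) * (t * t) + (2 * (x ⬝ᵥ D *ᵥ y)) * t + x ⬝ᵥ D *ᵥ x := by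
    intro t
    have := hp (x + t • y)
    simp only [Matrix.mulVec_add, Matrix.mulVec_smul, dotProduct_add, add_dotProduct,
      dotProduct_smul, smul_dotProduct, smul_eq_mul] at this
    rw [symm_dot hs y x] at this
    linarith
  have := discrim_le_zero h
  unfold discrim at this
  nlinarith

theorem mulVec_eq_zero_of_form {D : Matrix ι ι ℝ} (hD : 0 ≤ D) {x : ι → ℝ}
    (h : x ⬝ᵥ D *ᵥ x = 0) : D *ᵥ x = 0 := by
  have := dot_sq_le hD (D *ᵥ x) x
  rw [h, mul_zero] at this
  have h2 : (D *ᵥ x) ⬝ᵥ D *ᵥ x = 0 := by nlinarith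
  exact dot_self_eq_zero.1 h2

/-- `|D x|² ≤ c xᵀ D x` for nonnegative `D`. -/
theorem exists_mulVec_sq_le {D : Matrix ι ι ℝ} (hD : 0 ≤ D) :
    ∃ c : ℝ, 0 ≤ c ∧ ∀ x, (D *ᵥ x) ⬝ᵥ (D *ᵥ x) ≤ c * (x ⬝ᵥ D *ᵥ x) := by
  -- The constant is the trace of D; Cauchy-Schwarz for D is applied to each coordinate of D x.
  refine ⟨∑ i, (Pi.single i (1 : ℝ) : ι → ℝ) ⬝ᵥ D *ᵥ (Pi.single i 1),
    Finset.sum_nonneg fun i _ => (nonneg_iff.1 hD).2 _, fun x => ?_⟩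
  rw [Finset.sum_mul, dotProduct]
  refine Finset.sum_le_sum fun i _ => ?_
  have := dot_sq_le hD (Pi.single i 1) x
  rw [single_dotProduct, one_mul] at this
  nlinarith

theorem conj_nonneg {D : Matrix ι ι ℝ} (hD : 0 ≤ D) (Y : Matrix ι κ ℝ) : 0 ≤ Yᵀ * D * Y := by
  rw [nonneg_iff] at hD ⊢
  refine ⟨?_, fun x => ?_⟩
  · rw [Matrix.IsSymm, Matrix.transpose_mul, Matrix.transpose_mul, Matrix.transpose_transpose,
      hD.1.eq, Matrix.mul_assoc]
  · rw [← Matrix.mulVec_mulVec, ← Matrix.mulVec_mulVec, dot_mulVec, Matrix.transpose_transpose]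
    exact hD.2 _

theorem transpose_mul_self_nonneg (Y : Matrix κ ι ℝ) : 0 ≤ Yᵀ * Y := by
  rw [nonneg_iff]
  refine ⟨by rw [Matrix.IsSymm, Matrix.transpose_mul, Matrix.transpose_transpose], fun x => ?_⟩
  rw [← Matrix.mulVec_mulVec, dot_mulVec, Matrix.transpose_transpose]
  exact dot_self_nonneg _

end Loewner

/-! ### Lyapunov and Sylvester equations -/

section Lyapunov

variable {ι κ : Type*} [Fintype ι] [DecidableEq ι] [Fintype κ] [DecidableEq κ]

/-- `M` is annihilated by a polynomial with all roots in the open left half plane. -/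
def Hurwitz (M : Matrix ι ι ℝ) : Prop := ∃ p, RootsIn {z | z.re < 0} p ∧ aeval M p = 0

theorem Hurwitz.transpose {M : Matrix ι ι ℝ} (h : Hurwitz M) : Hurwitz Mᵀ := by
  obtain ⟨p, hp, hM⟩ := h
  exact ⟨p, hp, by rw [← transpose_aeval, hM, Matrix.transpose_zero]⟩

theorem Hurwitz.tendsto {M : Matrix ι ι ℝ} (h : Hurwitz M) (v : ι → ℝ) :
    Tendsto (fun t => flow M t *ᵥ v) atTop (𝓝 0) := by
  obtain ⟨p, hp, hM⟩ := h
  have h1 : (1 : Matrix ι ι ℝ) * aeval M p = 0 := by rw [hM, Matrix.mul_zero]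
  have h2 := tendsto_flow_zero hp h1 v
  simp only [Matrix.one_mulVec] at h2
  exact h2

/-- Affine substitution `M ↦ c M + d`. -/
theorem rootsIn_comp {S T : Set ℂ} {p : ℝ[X]} (hp : RootsIn S p) {c d : ℝ} (hc : c ≠ 0)
    (hST : ∀ w : ℂ, c * w + d ∈ S → w ∈ T) : RootsIn T (p.comp (C c * X + C d)) := by
  refine ⟨fun h => hp.1 ?_, fun w hw => hST w (hp.2 _ ?_)⟩
  · rw [comp_eq_zero_iff] at h
    rcases h with h | ⟨_, h⟩
    · exact h
    · have := congrArg (fun q : ℝ[X] => q.coeff 1) h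
      simp at this
      exact absurd this hc
  · rw [aeval_comp] at hw
    simpa using hw

theorem aeval_comp_affine (M : Matrix ι ι ℝ) (p : ℝ[X]) (c d : ℝ) :
    aeval M (p.comp (C c * X + C d)) = aeval (c • M + d • 1) p := by
  rw [aeval_comp]
  simp [Algebra.algebraMap_eq_smul_one]

/-- There are finitely many roots, so they keep a positive distance from the imaginary axis; the
shift turns this margin into an exponential rate. -/
theorem Hurwitz.exists_shift {M : Matrix ι ι ℝ} (h : Hurwitz M) :
    ∃ a : ℝ, 0 < a ∧ Hurwitz (M + a • 1) := by
  obtain ⟨p, hp, hM⟩ := h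
  have hfin := p.rootSet_finite ℂ
  obtain ⟨a, ha, hlt⟩ : ∃ a : ℝ, 0 < a ∧ ∀ z ∈ p.rootSet ℂ, z.re < -a := by
    have : ∀ z ∈ p.rootSet ℂ, z.re < 0 := fun z hz =>
      hp.2 z ((mem_rootSet.1 hz).2)
    revert this
    refine hfin.induction_on _ ?_ ?_
    · intro _; exact ⟨1, one_pos, by simp⟩
    · intro z s _ _ ih h
      obtain ⟨a, ha, h'⟩ := ih fun w hw => h w (Set.mem_insert_of_mem _ hw)
      have hz := h z (Set.mem_insert _ _)
      refine ⟨min a (-z.re / 2), lt_min ha (by linarith), ?_⟩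
      intro w hw
      rcases Set.mem_insert_iff.1 hw with rfl | hw
      · have := min_le_right a (-w.re / 2); linarith
      · have := min_le_left a (-z.re / 2); linarith [h' w hw]
  have hp' : RootsIn {z | z.re < -a} p :=
    ⟨hp.1, fun z hz => hlt z (mem_rootSet.2 ⟨hp.1, hz⟩)⟩
  refine ⟨a, ha, p.comp (C 1 * X + C (-a)), rootsIn_comp hp' one_ne_zero ?_, ?_⟩
  · intro w hw
    simp at hw
    simpa using hw
  · rw [aeval_comp_affine]
    simpa using hM

/-- A shift beyond the whole spectrum makes an arbitrary M antistable, so Lyapunov equations become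
solvable without any assumption on M. -/
theorem exists_neg_shift (M : Matrix ι ι ℝ) : ∃ β : ℝ, 0 < β ∧ Hurwitz (-(M + β • 1)) := by
  have h0 := M.charpoly_monic.ne_zero
  obtain ⟨β, hβ, hlt⟩ : ∃ β : ℝ, 0 < β ∧ ∀ z ∈ M.charpoly.rootSet ℂ, -β < z.re := by
    refine (M.charpoly.rootSet_finite ℂ).induction_on _ ⟨1, one_pos, by simp⟩ ?_
    intro z s _ _ ih
    obtain ⟨a, ha, h'⟩ := ih
    refine ⟨max a (-z.re + 1), lt_max_of_lt_left ha, ?_⟩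
    intro w hw
    rcases Set.mem_insert_iff.1 hw with rfl | hw
    · have := le_max_right a (-w.re + 1); linarith
    · have := le_max_left a (-z.re + 1); linarith [h' w hw]
  have hp : RootsIn {z | -β < z.re} M.charpoly :=
    ⟨h0, fun z hz => hlt z (mem_rootSet.2 ⟨h0, hz⟩)⟩
  refine ⟨β, hβ, M.charpoly.comp (C (-1) * X + C (-β)), rootsIn_comp hp (by norm_num) ?_, ?_⟩
  · intro w hw
    simp at hw
    simpa using hw
  · rw [aeval_comp_affine]
    have : (-1 : ℝ) • (-(M + β • (1 : Matrix ι ι ℝ))) + (-β) • 1 = M := by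
      simp [neg_smul]
    rw [this, Matrix.aeval_self_charpoly]

/-- The homogeneous Sylvester equation `X N = N' X`. -/
theorem sylvester_zero {N : Matrix ι ι ℝ} {N' : Matrix κ κ ℝ} {X : Matrix κ ι ℝ}
    (h : X * N = N' * X) {p r : ℝ[X]} (hpr : IsCoprime p r) (hp : aeval N p = 0)
    (hr : aeval N' r = 0) : X = 0 := by
  obtain ⟨a, b, hab⟩ := hpr
  have h1 := mul_aeval_of_intertwine h (a * p + b * r)
  conv_lhs at h1 => rw [hab, map_one, Matrix.mul_one]
  rw [h1, map_add, map_mul, map_mul, hr, mul_zero, add_zero,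
    ← map_mul, ← mul_aeval_of_intertwine h, map_mul, hp, mul_zero, Matrix.mul_zero]

theorem Hurwitz.neg_roots {M : Matrix ι ι ℝ} (h : Hurwitz M) :
    ∃ p, RootsIn {z | 0 < z.re} p ∧ aeval (-M) p = 0 := by
  obtain ⟨p, hp, hM⟩ := h
  refine ⟨p.comp (C (-1) * X + C 0), rootsIn_comp hp (by norm_num) ?_, ?_⟩
  · intro w hw
    simpa using hw
  · rw [aeval_comp_affine]
    simpa using hM

theorem disjoint_neg_pos : Disjoint {z : ℂ | z.re < 0} {z : ℂ | 0 < z.re} := by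
  rw [Set.disjoint_left]
  intro z h1 h2
  exact lt_asymm (a := z.re) (b := 0) h1 h2

/-- The Lyapunov equation has exactly one solution. -/
theorem lyapunov_existsUnique {M : Matrix ι ι ℝ} (h : Hurwitz M) (R : Matrix ι ι ℝ) :
    ∃! X : Matrix ι ι ℝ, Mᵀ * X + X * M = R := by
  let S : Matrix ι ι ℝ →ₗ[ℝ] Matrix ι ι ℝ :=
    { toFun := fun X => Mᵀ * X + X * M
      map_add' := fun X Y => by rw [Matrix.mul_add, Matrix.add_mul]; abel
      map_smul' := fun c X => by simp }
  -- A homogeneous solution intertwines M with -Mᵀ, whose spectra lie in opposite half planes.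
  -- Injectivity suffices in finite dimension.
  have hinj : Function.Injective S := by
    rw [injective_iff_map_eq_zero]
    intro X hX
    obtain ⟨p, hp, hM⟩ := h
    obtain ⟨r, hr, hM'⟩ := Hurwitz.neg_roots (Hurwitz.transpose ⟨p, hp, hM⟩)
    refine sylvester_zero (N := M) (N' := -Mᵀ) ?_ (hp.isCoprime disjoint_neg_pos hr) hM hM'
    have h1 : Mᵀ * X + X * M = 0 := hX
    rw [Matrix.neg_mul]
    exact eq_neg_of_add_eq_zero_right h1
  have hsurj : Function.Surjective S := LinearMap.injective_iff_surjective.1 hinj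
  obtain ⟨X, hX⟩ := hsurj R
  exact ⟨X, hX, fun Y hY => hinj (hY.trans hX.symm)⟩

/-- The transpose solves the same equation, so uniqueness applies. -/
theorem lyapunov_symm {M : Matrix ι ι ℝ} (h : Hurwitz M) {R X : Matrix ι ι ℝ} (hR : R.IsSymm)
    (hX : Mᵀ * X + X * M = R) : X.IsSymm := by
  refine (lyapunov_existsUnique h R).unique ?_ hX
  rw [← hR.eq, ← hX]
  simp only [Matrix.transpose_add, Matrix.transpose_mul, Matrix.transpose_transpose]
  rw [add_comm]

/-- A symmetric `X` whose form decreases along the trajectories of a Hurwitz matrix is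
nonnegative. -/
theorem lyapunov_nonneg {M : Matrix ι ι ℝ} (h : Hurwitz M) {X : Matrix ι ι ℝ} (hX : X.IsSymm)
    (hd : ∀ x : ι → ℝ, x ⬝ᵥ X *ᵥ (M *ᵥ x) ≤ 0) : 0 ≤ X := by
  rw [nonneg_iff]
  refine ⟨hX, fun x => ?_⟩
  -- The form along the flow is nonincreasing and tends to zero, hence its initial value is
  -- nonnegative.
  set f : ℝ → ℝ := fun t => (flow M t *ᵥ x) ⬝ᵥ X *ᵥ (flow M t *ᵥ x) with hf
  have hder : ∀ t, HasDerivAt f (2 * ((flow M t *ᵥ x) ⬝ᵥ X *ᵥ (M *ᵥ (flow M t *ᵥ x)))) t := by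
    intro t
    have h1 := hasDerivAt_flow_mulVec M x t
    have h2 := hasDerivAt_dotProduct h1 (hasDerivAt_dot h1 X)
    convert! h2 using 1
    rw [symm_dot hX (M *ᵥ _)]
    ring
  have hanti : Antitone f := by
    refine antitone_of_deriv_nonpos (fun t => (hder t).differentiableAt) fun t => ?_
    rw [(hder t).deriv]
    linarith [hd (flow M t *ᵥ x)]
  have hlim : Tendsto f atTop (𝓝 0) := by
    have hc : Continuous fun y : ι → ℝ => y ⬝ᵥ X *ᵥ y := by
      simp only [dotProduct, Matrix.mulVec]
      fun_prop
    have := (hc.tendsto 0).comp (h.tendsto x)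
    simpa [hf, Function.comp_def] using this
  have := hanti.le_of_tendsto hlim 0
  simpa [hf, flow_zero] using this

/-- Existence of nonnegative solutions of the Lyapunov equation. -/
theorem exists_lyapunov {M : Matrix ι ι ℝ} (h : Hurwitz M) {R : Matrix ι ι ℝ} (hR : 0 ≤ R) :
    ∃ X : Matrix ι ι ℝ, 0 ≤ X ∧ Mᵀ * X + X * M = -R := by
  obtain ⟨X, hX, -⟩ := lyapunov_existsUnique h (-R)
  obtain ⟨hRs, hRp⟩ := nonneg_iff.1 hR
  have hXs : X.IsSymm := lyapunov_symm h hRs.neg hX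
  refine ⟨X, lyapunov_nonneg h hXs fun x => ?_, hX⟩
  have h1 : x ⬝ᵥ (Mᵀ * X + X * M) *ᵥ x = -(x ⬝ᵥ R *ᵥ x) := by
    rw [hX, Matrix.neg_mulVec, dotProduct_neg]
  rw [Matrix.add_mulVec, dotProduct_add, ← Matrix.mulVec_mulVec, ← Matrix.mulVec_mulVec,
    dot_mulVec, Matrix.transpose_transpose, symm_dot hXs] at h1
  linarith [hRp x]

end Lyapunov

end IndefLQ

namespace IndefLQ

section Controllability

variable {ι κ : Type*} [Fintype ι] [DecidableEq ι] [Fintype κ] [DecidableEq κ]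

/-! ### Controllable and unobservable subspaces -/

/-- Cayley-Hamilton: only the remainder of p modulo the characteristic polynomial matters. -/
theorem aeval_mem_of_pow_mem {V : Submodule ℝ (ι → ℝ)} {A : Matrix ι ι ℝ} {x : ι → ℝ}
    (h : ∀ k < Fintype.card ι, (A ^ k) *ᵥ x ∈ V) (p : ℝ[X]) : aeval A p *ᵥ x ∈ V := by
  -- In dimension zero the characteristic polynomial is 1, and the strict degree bound on the
  -- remainder used below fails.
  rcases isEmpty_or_nonempty ι with hι | hι
  · have : aeval A p *ᵥ x = 0 := Subsingleton.elim _ _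
    rw [this]; exact V.zero_mem
  rw [Matrix.aeval_eq_aeval_mod_charpoly, aeval_eq_sum_range, Matrix.sum_mulVec]
  refine V.sum_mem fun k hk => ?_
  rw [Matrix.smul_mulVec]
  refine V.smul_mem _ (h k ?_)
  have hlt : (p %ₘ A.charpoly).natDegree < Fintype.card ι := by
    have h1 := natDegree_modByMonic_lt p A.charpoly_monic (by
      intro h
      have := A.charpoly_natDegree_eq_dim
      rw [h, natDegree_one] at this
      exact Fintype.card_ne_zero this.symm)
    rwa [A.charpoly_natDegree_eq_dim] at h1
  have := Finset.mem_range.1 hk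
  omega

theorem mem_unobservable {V : Submodule ℝ (ι → ℝ)} {A : Matrix ι ι ℝ} {x : ι → ℝ} :
    x ∈ unobservableSubspace V A ↔ ∀ p : ℝ[X], aeval A p *ᵥ x ∈ V := by
  unfold unobservableSubspace
  simp only [Submodule.mem_iInf, Submodule.mem_comap, Matrix.mulVecLin_apply]
  constructor
  · intro h p
    exact aeval_mem_of_pow_mem (fun k hk => h ⟨k, hk⟩) p
  · intro h k
    simpa using h (X ^ (k : ℕ))

theorem unobservable_le {V : Submodule ℝ (ι → ℝ)} {A : Matrix ι ι ℝ} :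
    unobservableSubspace V A ≤ V := fun x hx => by
  simpa using mem_unobservable.1 hx 1

theorem unobservable_invariant {V : Submodule ℝ (ι → ℝ)} {A : Matrix ι ι ℝ} {x : ι → ℝ}
    (hx : x ∈ unobservableSubspace V A) : A *ᵥ x ∈ unobservableSubspace V A := by
  rw [mem_unobservable] at hx ⊢
  intro p
  have := hx (p * X)
  rwa [aeval_mul_mulVec, aeval_X] at this

theorem le_unobservable {U V : Submodule ℝ (ι → ℝ)} {A : Matrix ι ι ℝ} (hUV : U ≤ V)
    (hU : ∀ x ∈ U, A *ᵥ x ∈ U) : U ≤ unobservableSubspace V A := fun _ hx =>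
  mem_unobservable.2 fun p => hUV (aeval_mulVec_mem hU p hx)

theorem range_le_controllable (A : Matrix ι ι ℝ) (B : Matrix ι κ ℝ) (p : ℝ[X]) (u : κ → ℝ) :
    aeval A p *ᵥ (B *ᵥ u) ∈ controllableSubspace A B := by
  refine aeval_mem_of_pow_mem (fun k hk => ?_) p
  unfold controllableSubspace
  refine Submodule.mem_iSup_of_mem ⟨k, hk⟩ ?_
  exact ⟨B *ᵥ u, ⟨u, rfl⟩, rfl⟩

theorem mulVec_mem_controllable (A : Matrix ι ι ℝ) (B : Matrix ι κ ℝ) (u : κ → ℝ) :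
    B *ᵥ u ∈ controllableSubspace A B := by
  simpa using range_le_controllable A B 1 u

theorem controllable_le {A : Matrix ι ι ℝ} {B : Matrix ι κ ℝ} {V : Submodule ℝ (ι → ℝ)}
    (hB : ∀ u, B *ᵥ u ∈ V) (hV : ∀ x ∈ V, A *ᵥ x ∈ V) : controllableSubspace A B ≤ V := by
  unfold controllableSubspace
  refine iSup_le fun k => ?_
  rintro _ ⟨_, ⟨u, rfl⟩, rfl⟩
  have := aeval_mulVec_mem hV (X ^ (k : ℕ)) (hB u)
  simpa using this

theorem controllable_invariant {A : Matrix ι ι ℝ} {B : Matrix ι κ ℝ} {x : ι → ℝ}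
    (hx : x ∈ controllableSubspace A B) : A *ᵥ x ∈ controllableSubspace A B := by
  have h : controllableSubspace A B ≤ (controllableSubspace A B).comap A.mulVecLin := by
    conv_lhs => unfold controllableSubspace
    refine iSup_le fun k => ?_
    rintro _ ⟨_, ⟨u, rfl⟩, rfl⟩
    have := range_le_controllable A B (X ^ ((k : ℕ) + 1)) u
    simpa [pow_succ', Matrix.mul_assoc] using this
  exact h hx

/-- The uncontrollable part of `A` is annihilated by a polynomial with roots in the open left half
plane. -/
def StabPair (A : Matrix ι ι ℝ) (B : Matrix ι κ ℝ) : Prop :=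
  ∃ q, RootsIn {z | z.re < 0} q ∧ ∀ x, aeval A q *ᵥ x ∈ controllableSubspace A B

theorem StabPair.of_top {A : Matrix ι ι ℝ} {B : Matrix ι κ ℝ}
    (h : controllableSubspace A B = ⊤) : StabPair A B :=
  ⟨1, RootsIn.one _, fun x => by rw [h]; trivial⟩

/-- Feedback does not change the dynamics modulo the controllable subspace. -/
theorem aeval_feedback_mem (A : Matrix ι ι ℝ) (B : Matrix ι κ ℝ) (F : Matrix κ ι ℝ) (q : ℝ[X])
    (x : ι → ℝ) :
    aeval (A + B * F) q *ᵥ x ∈ controllableSubspace A B ↔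
      aeval A q *ᵥ x ∈ controllableSubspace A B := by
  obtain ⟨k, π, σ, hπσ, hker⟩ := exists_quotient_matrix (controllableSubspace A B)
  have hA := quotient_intertwine hπσ hker (M := A) fun x hx => controllable_invariant hx
  have hB : π * B = 0 := by
    refine mulVec_ext fun u => ?_
    rw [← Matrix.mulVec_mulVec, Matrix.zero_mulVec]
    exact (hker _).2 (mulVec_mem_controllable A B u)
  have hF : π * (A + B * F) = (π * A * σ) * π := by
    rw [Matrix.mul_add, ← Matrix.mul_assoc, hB, Matrix.zero_mul, add_zero, ← hA]
  rw [← hker, ← hker, Matrix.mulVec_mulVec, Matrix.mulVec_mulVec, mul_aeval_of_intertwine hA,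
    mul_aeval_of_intertwine hF]

/-- The characteristic polynomial of A + BF kills everything, and modulo the controllable subspace
feedback is invisible. -/
theorem stabPair_of_stabilizable {A : Matrix ι ι ℝ} {B : Matrix ι κ ℝ} (h : Stabilizable A B) :
    StabPair A B := by
  obtain ⟨F, hF⟩ := h
  refine ⟨(A + B * F).charpoly, ⟨(A + B * F).charpoly_monic.ne_zero, fun z hz => hF z ?_⟩, ?_⟩
  · rw [Matrix.mem_spectrum_iff_isRoot_charpoly, Matrix.charpoly_map, IsRoot.def,
      eval_map_algebraMap]
    exact hz
  · intro x
    rw [← aeval_feedback_mem A B F, aeval_charpoly_mulVec]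
    exact Submodule.zero_mem _

/-- Hautus test: an uncontrollable eigenvalue lies in the open left half plane. -/
theorem StabPair.hautus {A : Matrix ι ι ℝ} {B : Matrix ι κ ℝ} (h : StabPair A B) {z : ℂ}
    {x y : ι → ℝ} (h1 : Aᵀ *ᵥ x = z.re • x - z.im • y) (h2 : Aᵀ *ᵥ y = z.im • x + z.re • y)
    (hx : Bᵀ *ᵥ x = 0) (hy : Bᵀ *ᵥ y = 0) (hxy : ¬ (x = 0 ∧ y = 0)) : z.re < 0 := by
  obtain ⟨q, hq, hqA⟩ := h
  -- The annihilator of x and y contains Im B and is A-invariant, hence contains the controllable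
  -- subspace and the image of q(A). Testing with the vector q(Aᵀ)x gives |q(Aᵀ)x|² = 0, and
  -- likewise for y.
  let V : Submodule ℝ (ι → ℝ) :=
    { carrier := {v | x ⬝ᵥ v = 0 ∧ y ⬝ᵥ v = 0}
      add_mem' := fun ha hb => by
        simp only [Set.mem_ofPred_eq, dotProduct_add] at *
        simp [ha.1, ha.2, hb.1, hb.2]
      zero_mem' := by simp
      smul_mem' := fun c v hv => by
        simp only [Set.mem_ofPred_eq, dotProduct_smul] at *
        simp [hv.1, hv.2] }
  have hle : controllableSubspace A B ≤ V := by
    refine controllable_le (fun u => ⟨?_, ?_⟩) fun v hv => ⟨?_, ?_⟩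
    · rw [dot_mulVec, hx, zero_dotProduct]
    · rw [dot_mulVec, hy, zero_dotProduct]
    · rw [dot_mulVec, h1, sub_dotProduct, smul_dotProduct, smul_dotProduct, hv.1, hv.2]; simp
    · rw [dot_mulVec, h2, add_dotProduct, smul_dotProduct, smul_dotProduct, hv.1, hv.2]; simp
  refine hq.2 z (root_of_eigenpair h1 h2 (p := q) ?_ ?_ hxy)
  · rw [← dot_self_eq_zero, ← transpose_aeval, ← dot_mulVec]
    exact (hle (hqA _)).1
  · rw [← dot_self_eq_zero, ← transpose_aeval, ← dot_mulVec]
    exact (hle (hqA _)).2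

/-- A subspace is the range of a matrix with a left inverse. -/
theorem exists_basis_matrix (V : Submodule ℝ (ι → ℝ)) :
    ∃ (k : ℕ) (σ : Matrix ι (Fin k) ℝ) (π : Matrix (Fin k) ι ℝ), π * σ = 1 ∧
      ∀ x, x ∈ V ↔ ∃ c, σ *ᵥ c = x := by
  let e : V ≃ₗ[ℝ] (Fin (Module.finrank ℝ V) → ℝ) := (Module.finBasis ℝ V).equivFun
  let f : (Fin (Module.finrank ℝ V) → ℝ) →ₗ[ℝ] (ι → ℝ) := V.subtype ∘ₗ e.symm.toLinearMap
  have hf : LinearMap.ker f = ⊥ := by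
    rw [LinearMap.ker_eq_bot]
    exact V.injective_subtype.comp e.symm.injective
  obtain ⟨g, hg⟩ := LinearMap.exists_leftInverse_of_injective f hf
  refine ⟨_, LinearMap.toMatrix' f, LinearMap.toMatrix' g, ?_, fun x => ?_⟩
  · rw [← LinearMap.toMatrix'_comp, hg, LinearMap.toMatrix'_id]
  · simp only [LinearMap.toMatrix'_mulVec]
    constructor
    · intro hx
      exact ⟨e ⟨x, hx⟩, by simp [f]⟩
    · rintro ⟨c, rfl⟩
      exact (e.symm c).2

/-- The matrix of the restriction to an invariant subspace. -/
theorem basis_intertwine {V : Submodule ℝ (ι → ℝ)} {σ : Matrix ι κ ℝ} {π : Matrix κ ι ℝ}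
    (hπσ : π * σ = 1) (hr : ∀ x, x ∈ V ↔ ∃ c, σ *ᵥ c = x) {M : Matrix ι ι ℝ}
    (hV : ∀ x ∈ V, M *ᵥ x ∈ V) : M * σ = σ * (π * M * σ) := by
  refine mulVec_ext fun c => ?_
  obtain ⟨d, hd⟩ := (hr _).1 (hV _ ((hr _).2 ⟨c, rfl⟩))
  simp only [← Matrix.mulVec_mulVec]
  rw [← hd, Matrix.mulVec_mulVec d π σ, hπσ, Matrix.one_mulVec]

/-- The real part of w*DMw = z w*Dw for w = x + iy; the cross terms cancel by symmetry. The
eigenvalue relation is needed only after applying D, that is, modulo Ker D. -/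
theorem eigen_form {D M : Matrix ι ι ℝ} (hD : D.IsSymm) {z : ℂ} {x y : ι → ℝ}
    (h1 : D *ᵥ (M *ᵥ x) = z.re • D *ᵥ x - z.im • D *ᵥ y)
    (h2 : D *ᵥ (M *ᵥ y) = z.im • D *ᵥ x + z.re • D *ᵥ y) :
    x ⬝ᵥ D *ᵥ (M *ᵥ x) + y ⬝ᵥ D *ᵥ (M *ᵥ y) = z.re * (x ⬝ᵥ D *ᵥ x + y ⬝ᵥ D *ᵥ y) := by
  rw [h1, h2, dotProduct_sub, dotProduct_add]
  simp only [dotProduct_smul, smul_eq_mul]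
  rw [symm_dot hD y x]
  ring

theorem lyapunov_form {X M : Matrix ι ι ℝ} (hX : X.IsSymm) (x : ι → ℝ) :
    x ⬝ᵥ (Mᵀ * X + X * M) *ᵥ x = 2 * (x ⬝ᵥ X *ᵥ (M *ᵥ x)) := by
  rw [Matrix.add_mulVec, dotProduct_add, ← Matrix.mulVec_mulVec, ← Matrix.mulVec_mulVec,
    dot_mulVec, Matrix.transpose_transpose, symm_dot hX (M *ᵥ x) x]
  ring

/-- A controllable pair can be stabilized by feedback. -/
theorem exists_stabilizing_of_top {A : Matrix ι ι ℝ} {B : Matrix ι κ ℝ}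
    (h : controllableSubspace A B = ⊤) : ∃ F : Matrix κ ι ℝ, Hurwitz (A + B * F) := by
  -- Bass's construction: W is the controllability Gramian of the shifted system, and the feedback
  -- -BᵀW⁻¹ moves the spectrum to the line Re z = -β.
  obtain ⟨β, hβ, hH⟩ := exists_neg_shift A
  obtain ⟨W, hW, hE⟩ := exists_lyapunov hH.transpose (R := (2 : ℝ) • (B * Bᵀ)) (by
    have h1 := transpose_mul_self_nonneg Bᵀ
    rw [Matrix.transpose_transpose] at h1
    exact smul_nonneg (by norm_num) h1)
  obtain ⟨hWs, hWp⟩ := nonneg_iff.1 hW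
  rw [Matrix.transpose_transpose] at hE
  have hE' : A * W + W * Aᵀ + (2 * β) • W = (2 : ℝ) • (B * Bᵀ) := by
    have := congrArg Neg.neg hE
    rw [neg_neg] at this
    rw [← this]
    simp only [Matrix.transpose_neg, Matrix.transpose_add, Matrix.transpose_smul,
      Matrix.transpose_one, Matrix.neg_mul, Matrix.mul_neg, Matrix.add_mul, Matrix.mul_add,
      Matrix.smul_mul, Matrix.mul_smul, Matrix.one_mul, Matrix.mul_one]
    module
  -- Ker W is Aᵀ-invariant and contained in Ker Bᵀ, hence orthogonal to the controllable subspace,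
  -- which is the whole space.
  have hinj : ∀ y, W *ᵥ y = 0 → y = 0 := by
    have hBy : ∀ y, W *ᵥ y = 0 → Bᵀ *ᵥ y = 0 := by
      intro y hy
      have h1 := congrArg (fun M => y ⬝ᵥ M *ᵥ y) hE'
      simp only [Matrix.add_mulVec, Matrix.smul_mulVec, ← Matrix.mulVec_mulVec, hy,
        Matrix.mulVec_zero, smul_zero, dotProduct_add, dotProduct_zero, dotProduct_smul] at h1
      rw [symm_dot hWs] at h1
      simp only [hy, dotProduct_zero, smul_eq_mul] at h1
      rw [dot_mulVec] at h1
      refine dot_self_eq_zero.1 ?_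
      linarith
    have hAy : ∀ y, W *ᵥ y = 0 → W *ᵥ (Aᵀ *ᵥ y) = 0 := by
      intro y hy
      have h1 := congrArg (fun M => M *ᵥ y) hE'
      simpa only [Matrix.add_mulVec, Matrix.smul_mulVec, ← Matrix.mulVec_mulVec, hy, hBy y hy,
        Matrix.mulVec_zero, smul_zero, zero_add, add_zero] using h1
    intro y hy
    let V : Submodule ℝ (ι → ℝ) :=
      { carrier := {v | ∀ w, W *ᵥ w = 0 → w ⬝ᵥ v = 0}
        add_mem' := fun ha hb w hw => by rw [dotProduct_add, ha w hw, hb w hw, add_zero]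
        zero_mem' := by simp
        smul_mem' := fun c v hv w hw => by rw [dotProduct_smul, hv w hw, smul_zero] }
    have hle : controllableSubspace A B ≤ V :=
      controllable_le (fun u w hw => by rw [dot_mulVec, hBy w hw, zero_dotProduct])
        fun v hv w hw => by rw [dot_mulVec]; exact hv _ (hAy w hw)
    rw [h] at hle
    exact dot_self_eq_zero.1 ((hle (Submodule.mem_top (x := y))) y hy)
  have hU : IsUnit W := Matrix.mulVec_injective_iff_isUnit.1 (by
    intro a b hab
    rw [← sub_eq_zero]
    apply hinj
    rw [Matrix.mulVec_sub, sub_eq_zero]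
    exact hab)
  have hdet : IsUnit W.det := (Matrix.isUnit_iff_isUnit_det W).1 hU
  refine ⟨-(Bᵀ * W⁻¹), ?_⟩
  set M := A + B * -(Bᵀ * W⁻¹) with hM
  have hMW : M * W = A * W - B * Bᵀ := by
    rw [hM, Matrix.add_mul, Matrix.mul_neg, Matrix.neg_mul, Matrix.mul_assoc, Matrix.mul_assoc,
      Matrix.nonsing_inv_mul _ hdet, Matrix.mul_one, sub_eq_add_neg]
  have hWM : W * Mᵀ = W * Aᵀ - B * Bᵀ := by
    have := congrArg Matrix.transpose hMW
    simpa [Matrix.transpose_mul, hWs.eq] using this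
  have hsum : M * W + W * Mᵀ = (-(2 * β)) • W := by
    rw [hMW, hWM]
    have : A * W + W * Aᵀ = (2 : ℝ) • (B * Bᵀ) - (2 * β) • W := by rw [← hE']; abel
    calc A * W - B * Bᵀ + (W * Aᵀ - B * Bᵀ) = (A * W + W * Aᵀ) - (2 : ℝ) • (B * Bᵀ) := by module
      _ = _ := by rw [this]; module
  suffices hT : Hurwitz Mᵀ by simpa using hT.transpose
  obtain ⟨p, hp, hpM⟩ := exists_rootsIn_of_eigenpairs (S := {z | z.re < 0}) (M := Mᵀ) (V := ⊤)
    (Y := ⊥) (by simp) (by simp) (by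
      intro z hz x _ y _ h1 h2
      simp only [Submodule.mem_bot, Set.mem_ofPred_eq, not_lt] at h1 h2 hz ⊢
      have e1 : Mᵀ *ᵥ x = z.re • x - z.im • y := by
        rw [← sub_eq_zero, ← h1]; abel
      have e2 : Mᵀ *ᵥ y = z.im • x + z.re • y := by
        rw [← sub_eq_zero, ← h2]; abel
      have hf := eigen_form hWs (M := Mᵀ) (z := z) (x := x) (y := y)
        (by rw [e1, Matrix.mulVec_sub, Matrix.mulVec_smul, Matrix.mulVec_smul])
        (by rw [e2, Matrix.mulVec_add, Matrix.mulVec_smul, Matrix.mulVec_smul])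
      have hq : ∀ v : ι → ℝ, v ⬝ᵥ W *ᵥ (Mᵀ *ᵥ v) = -β * (v ⬝ᵥ W *ᵥ v) := by
        intro v
        have := lyapunov_form hWs (M := Mᵀ) v
        rw [Matrix.transpose_transpose, hsum, Matrix.smul_mulVec, dotProduct_smul,
          smul_eq_mul] at this
        linarith
      rw [hq, hq] at hf
      have hx0 := hWp x
      have hy0 := hWp y
      -- Since Re z ≥ 0 and β > 0, the W-form of the eigenvector vanishes, and W is definite.
      have h0 : (z.re + β) * (x ⬝ᵥ W *ᵥ x + y ⬝ᵥ W *ᵥ y) = 0 := by linarith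
      have h00 : x ⬝ᵥ W *ᵥ x + y ⬝ᵥ W *ᵥ y = 0 := by
        rcases mul_eq_zero.1 h0 with h | h
        · linarith
        · exact h
      exact ⟨hinj _ (mulVec_eq_zero_of_form hW (by linarith)),
        hinj _ (mulVec_eq_zero_of_form hW (by linarith))⟩)
  refine ⟨p, hp, mulVec_ext fun x => ?_⟩
  simpa using hpM x trivial

/-- The feedback is designed on the controllable subspace and extended by a left inverse of its
embedding; the quotient dynamics is stable already and not affected by feedback. -/
theorem StabPair.exists_stabilizing {A : Matrix ι ι ℝ} {B : Matrix ι κ ℝ} (h : StabPair A B) :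
    ∃ F : Matrix κ ι ℝ, Hurwitz (A + B * F) := by
  obtain ⟨q, hq, hqA⟩ := h
  obtain ⟨k, σ, π, hπσ, hr⟩ := exists_basis_matrix (controllableSubspace A B)
  have hA := basis_intertwine hπσ hr (M := A) fun x hx => controllable_invariant hx
  have hB : B = σ * (π * B) := by
    refine mulVec_ext fun u => ?_
    obtain ⟨d, hd⟩ := (hr _).1 (mulVec_mem_controllable A B u)
    simp only [← Matrix.mulVec_mulVec]
    rw [← hd, Matrix.mulVec_mulVec _ π σ, hπσ, Matrix.one_mulVec]
  set A' := π * A * σ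
  set B' := π * B
  have htop : controllableSubspace A' B' = ⊤ := by
    rw [eq_top_iff]
    intro c _
    have hle : controllableSubspace A B ≤ (controllableSubspace A' B').map σ.mulVecLin := by
      refine controllable_le (fun u => ?_) ?_
      · refine ⟨B' *ᵥ u, mulVec_mem_controllable A' B' u, ?_⟩
        rw [Matrix.mulVecLin_apply, Matrix.mulVec_mulVec, ← hB]
      · rintro _ ⟨c, hc, rfl⟩
        refine ⟨A' *ᵥ c, controllable_invariant hc, ?_⟩
        simp only [Matrix.mulVecLin_apply, Matrix.mulVec_mulVec]
        rw [← hA]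
    obtain ⟨d, hd, hdc⟩ := hle ((hr (σ *ᵥ c)).2 ⟨c, rfl⟩)
    rw [Matrix.mulVecLin_apply] at hdc
    have := congrArg (fun v => π *ᵥ v) hdc
    simp only [Matrix.mulVec_mulVec, hπσ, Matrix.one_mulVec] at this
    rwa [this] at hd
  obtain ⟨F, p, hp, hpF⟩ := exists_stabilizing_of_top htop
  -- The factor q sends the state space into the controllable subspace, where p annihilates the
  -- closed loop.
  refine ⟨F * π, p * q, hp.mul hq, mulVec_ext fun x => ?_⟩
  have hF : (A + B * (F * π)) * σ = σ * (A' + B' * F) := by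
    rw [Matrix.add_mul, Matrix.mul_add, ← hA, Matrix.mul_assoc, Matrix.mul_assoc, hπσ,
      Matrix.mul_one, ← Matrix.mul_assoc σ, ← hB]
  obtain ⟨c, hc⟩ := (hr _).1 ((aeval_feedback_mem A B (F * π) q x).2 (hqA x))
  rw [aeval_mul_mulVec, ← hc, Matrix.mulVec_mulVec, ← mul_aeval_of_intertwine hF.symm, hpF]
  simp

end Controllability

/-! ### The kernel of a semidefinite solution of a Lyapunov-type equation -/

section Kernel

variable {ι κ : Type*} [Fintype ι] [DecidableEq ι] [Fintype κ] [DecidableEq κ]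

/-- If `Mᵀ D + D M = c D B Bᵀ D` on an `M`-invariant subspace `V` with `c = ±1` and `D ≥ 0`, and the
spectrum of `M` on `V` (modulo `Ker D`) lies in `c Re z ≤ 0`, then `D` vanishes on `V`. -/
theorem mulVec_eq_zero_of_lyapunov {A : Matrix ι ι ℝ} {B : Matrix ι κ ℝ} (hst : StabPair A B)
    {F : Matrix κ ι ℝ} {D : Matrix ι ι ℝ} (hD : 0 ≤ D) {c : ℝ} (hc : c ^ 2 = 1)
    {V : Submodule ℝ (ι → ℝ)} (hV : ∀ x ∈ V, (A + B * F) *ᵥ x ∈ V)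
    (hE : ∀ x ∈ V, ((A + B * F)ᵀ * D + D * (A + B * F)) *ᵥ x = c • (D * B * Bᵀ * D) *ᵥ x)
    {p : ℝ[X]} (hp : RootsIn {z | c * z.re ≤ 0} p)
    (hpV : ∀ x ∈ V, D *ᵥ (aeval (A + B * F) p *ᵥ x) = 0) {x : ι → ℝ} (hx : x ∈ V) :
    D *ᵥ x = 0 := by
  obtain ⟨hDs, hDp⟩ := nonneg_iff.1 hD
  by_contra hne
  set M := A + B * F with hM
  -- If D does not vanish on V, there is an eigenvector of M modulo Ker D, whose D-form is then
  -- positive.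
  obtain ⟨z, hz, x, hxV, y, hyV, hxy, h1, h2⟩ := exists_eigenpair (Y := kerM D) hV hp.1 hx
    (by simpa using hne) (by simpa using hpV x hx)
  have hz' : c * z.re ≤ 0 := hp.2 z hz
  simp only [LinearMap.mem_ker, Matrix.mulVecLin_apply, Matrix.mulVec_sub, Matrix.mulVec_add,
    Matrix.mulVec_smul] at h1 h2 hxy
  have e1 : D *ᵥ (M *ᵥ x) = z.re • D *ᵥ x - z.im • D *ᵥ y := by
    rw [← sub_eq_zero, ← h1]; abel
  have e2 : D *ᵥ (M *ᵥ y) = z.im • D *ᵥ x + z.re • D *ᵥ y := by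
    rw [← sub_eq_zero, ← h2]; abel
  have hform := eigen_form hDs e1 e2
  have hq : ∀ v ∈ V, 2 * (v ⬝ᵥ D *ᵥ (M *ᵥ v)) = c * ((Bᵀ *ᵥ (D *ᵥ v)) ⬝ᵥ (Bᵀ *ᵥ (D *ᵥ v))) := by
    intro v hv
    rw [← lyapunov_form hDs, hE v hv, dotProduct_smul, smul_eq_mul]
    congr 1
    simp only [← Matrix.mulVec_mulVec]
    rw [dot_mulVec, hDs.eq, dot_mulVec]
  have hqx := hq x hxV
  have hqy := hq y hyV
  have hpos : 0 < x ⬝ᵥ D *ᵥ x + y ⬝ᵥ D *ᵥ y := by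
    have hx0 := hDp x
    have hy0 := hDp y
    refine lt_of_le_of_ne (by linarith) fun h => hxy ⟨?_, ?_⟩
    · exact mulVec_eq_zero_of_form hD (by linarith)
    · exact mulVec_eq_zero_of_form hD (by linarith)
  set P := x ⬝ᵥ D *ᵥ x + y ⬝ᵥ D *ᵥ y
  have hbx := dot_self_nonneg (Bᵀ *ᵥ (D *ᵥ x))
  have hby := dot_self_nonneg (Bᵀ *ᵥ (D *ᵥ y))
  set bx := (Bᵀ *ᵥ (D *ᵥ x)) ⬝ᵥ (Bᵀ *ᵥ (D *ᵥ x)) with hbxd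
  set by' := (Bᵀ *ᵥ (D *ᵥ y)) ⬝ᵥ (Bᵀ *ᵥ (D *ᵥ y)) with hbyd
  -- The left side is nonpositive by the assumption on the spectrum and the right side is
  -- nonnegative. Both vanish, so z is imaginary and BᵀD kills the eigenvector.
  have hkey : 2 * (c * z.re) * P = bx + by' := by
    have h3 : 2 * (z.re * P) = c * (bx + by') := by rw [← hform]; linarith
    linear_combination c * h3 + (bx + by') * hc
  have hsum : bx + by' = 0 := by nlinarith
  have hbx0 : Bᵀ *ᵥ (D *ᵥ x) = 0 := dot_self_eq_zero.1 (by linarith)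
  have hby0 : Bᵀ *ᵥ (D *ᵥ y) = 0 := dot_self_eq_zero.1 (by linarith)
  have hre : z.re = 0 := by
    rw [hsum] at hkey
    have h4 : c ≠ 0 := by rintro rfl; norm_num at hc
    have : c * z.re = 0 := by
      rcases mul_eq_zero.1 hkey with h | h
      · linarith
      · exact absurd h hpos.ne'
    exact (mul_eq_zero.1 this).resolve_left h4
  -- With BᵀDv = 0 the equation reduces to AᵀDv = -DMv. Thus D maps the eigenvector to an
  -- uncontrollable eigenvector of Aᵀ for -z, against the Hautus test.
  have hAt : ∀ v ∈ V, Bᵀ *ᵥ (D *ᵥ v) = 0 → Aᵀ *ᵥ (D *ᵥ v) = -(D *ᵥ (M *ᵥ v)) := by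
    intro v hv hbv
    have h5 := hE v hv
    simp only [Matrix.add_mulVec, ← Matrix.mulVec_mulVec, hbv, Matrix.mulVec_zero,
      smul_zero] at h5
    have h6 : Mᵀ *ᵥ (D *ᵥ v) = Aᵀ *ᵥ (D *ᵥ v) := by
      rw [hM, Matrix.transpose_add, Matrix.transpose_mul, Matrix.add_mulVec,
        ← Matrix.mulVec_mulVec _ Fᵀ, hbv, Matrix.mulVec_zero, add_zero]
    rw [← h6]
    exact eq_neg_of_add_eq_zero_left h5
  have hlt := hst.hautus (z := -z) (x := D *ᵥ x) (y := D *ᵥ y)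
    (by rw [hAt x hxV hbx0, e1, Complex.neg_re, Complex.neg_im]; module)
    (by rw [hAt y hyV hby0, e2, Complex.neg_re, Complex.neg_im]; module) hbx0 hby0 hxy
  rw [Complex.neg_re, hre] at hlt
  simp at hlt

end Kernel

end IndefLQ

namespace IndefLQ

/-! ### Characteristic polynomials and limits of Hurwitz matrices -/

section CharpolyBound

variable {ι κ : Type*} [Fintype ι] [DecidableEq ι] [Fintype κ] [DecidableEq κ]

/-- The pair consists of the real and imaginary parts of a complex eigenvector. -/
theorem exists_eigenpair_of_charpoly {M : Matrix ι ι ℝ} {z : ℂ} (hz : aeval z M.charpoly = 0) :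
    ∃ x y : ι → ℝ, ¬ (x = 0 ∧ y = 0) ∧ M *ᵥ x = z.re • x - z.im • y ∧
      M *ᵥ y = z.im • x + z.re • y := by
  have hdet : (Matrix.scalar ι z - M.map (algebraMap ℝ ℂ)).det = 0 := by
    rw [← Matrix.eval_charpoly, Matrix.charpoly_map, eval_map_algebraMap, hz]
  obtain ⟨v, hv, hMv⟩ := Matrix.exists_mulVec_eq_zero_iff.2 hdet
  have hMv' : M.map (algebraMap ℝ ℂ) *ᵥ v = z • v := by
    rw [Matrix.sub_mulVec, sub_eq_zero] at hMv
    rw [← hMv]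
    ext i
    simp [Matrix.scalar_apply, Matrix.mulVec_diagonal]
  refine ⟨fun i => (v i).re, fun i => (v i).im, ?_, ?_, ?_⟩
  · rintro ⟨h1, h2⟩
    apply hv
    ext i
    exact Complex.ext (congrFun h1 i) (congrFun h2 i)
  · ext i
    have := congrArg Complex.re (congrFun hMv' i)
    simpa [Matrix.mulVec, dotProduct] using this
  · ext i
    have := congrArg Complex.im (congrFun hMv' i)
    simp [Matrix.mulVec, dotProduct] at this ⊢
    linarith

/-- The charpoly of an annihilated matrix has its roots in the same set. -/
theorem rootsIn_charpoly {S : Set ℂ} {M : Matrix ι ι ℝ} {p : ℝ[X]} (hp : RootsIn S p)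
    (hM : aeval M p = 0) : RootsIn S M.charpoly := by
  refine ⟨M.charpoly_monic.ne_zero, fun z hz => hp.2 z ?_⟩
  obtain ⟨x, y, hxy, h1, h2⟩ := exists_eigenpair_of_charpoly hz
  exact root_of_eigenpair h1 h2 (by rw [hM, Matrix.zero_mulVec]) (by rw [hM, Matrix.zero_mulVec])
    hxy

/-- The determinant is the product of the z - λ over the eigenvalues λ, and |z - λ| ≥ Re z when Re λ
< 0. The bound does not depend on M, so it survives limits and keeps a limit matrix from having
eigenvalues with positive real part. -/
theorem Hurwitz.charpoly_bound {M : Matrix ι ι ℝ} (h : Hurwitz M) {z : ℂ} (hz : 0 < z.re) :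
    z.re ^ Fintype.card ι ≤ ‖(Matrix.scalar ι z - M.map (algebraMap ℝ ℂ)).det‖ := by
  obtain ⟨p, hp, hM⟩ := h
  have hr := rootsIn_charpoly hp hM
  rw [← Matrix.eval_charpoly]
  set q := (M.map (algebraMap ℝ ℂ)).charpoly with hq
  have hroots : ∀ w ∈ q.roots, w.re < 0 := by
    intro w hw
    refine hr.2 w ?_
    rw [mem_roots (Matrix.charpoly_monic _).ne_zero, Matrix.charpoly_map, IsRoot.def,
      eval_map_algebraMap] at hw
    exact hw
  have hsplit := IsAlgClosed.splits q
  have hcard : q.roots.card = Fintype.card ι := by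
    rw [← hsplit.natDegree_eq_card_roots, hq, Matrix.charpoly_natDegree_eq_dim]
  have hprod : ∀ s : Multiset ℂ, (∀ w ∈ s, w.re < 0) →
      z.re ^ s.card ≤ ‖eval z (s.map fun a => X - C a).prod‖ := by
    intro s
    induction s using Multiset.induction_on with
    | empty => intro _; simp
    | cons a s ih =>
      intro hs
      rw [Multiset.map_cons, Multiset.prod_cons, eval_mul, norm_mul, Multiset.card_cons, pow_succ']
      refine mul_le_mul ?_ (ih fun w hw => hs w (Multiset.mem_cons_of_mem hw)) (by positivity)
        (norm_nonneg _)
      have h1 := Complex.re_le_norm (z - a)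
      have h2 := hs a (Multiset.mem_cons_self a s)
      simp only [eval_sub, eval_X, eval_C]
      rw [Complex.sub_re] at h1
      linarith
  rw [hsplit.eq_prod_roots_of_monic (Matrix.charpoly_monic _), ← hcard]
  exact hprod _ hroots

/-- A limit of Hurwitz matrices has its spectrum in the closed left half plane. -/
theorem rootsIn_charpoly_of_tendsto {M : ℕ → Matrix ι ι ℝ} {M' : Matrix ι ι ℝ}
    (h : ∀ k, Hurwitz (M k)) (hlim : Tendsto M atTop (𝓝 M')) :
    RootsIn {z | z.re ≤ 0} M'.charpoly := by
  refine ⟨M'.charpoly_monic.ne_zero, fun z hz => ?_⟩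
  by_contra hlt
  simp only [Set.mem_ofPred_eq, not_le] at hlt
  have hdet : (Matrix.scalar ι z - M'.map (algebraMap ℝ ℂ)).det = 0 := by
    rw [← Matrix.eval_charpoly, Matrix.charpoly_map, eval_map_algebraMap, hz]
  have hc : Continuous fun M : Matrix ι ι ℝ =>
      ‖(Matrix.scalar ι z - M.map (algebraMap ℝ ℂ)).det‖ := by
    refine continuous_norm.comp (Continuous.matrix_det ?_)
    refine continuous_const.sub (Continuous.matrix_map continuous_id ?_)
    exact Complex.continuous_ofReal
  have h1 := (hc.tendsto M').comp hlim
  have h2 := ge_of_tendsto' h1 fun k => (h k).charpoly_bound hlt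
  rw [hdet, norm_zero] at h2
  exact absurd h2 (not_le.2 (pow_pos hlt _))

end CharpolyBound

section Kleinman

variable {ι κ : Type*} [Fintype ι] [DecidableEq ι] [Fintype κ] [DecidableEq κ]

/-! ### The Newton-Kleinman iteration -/

theorem riccati_form {A Q K : Matrix ι ι ℝ} {B : Matrix ι κ ℝ} (hK : K.IsSymm) (x : ι → ℝ) :
    x ⬝ᵥ riccati A B Q K *ᵥ x =
      2 * (x ⬝ᵥ K *ᵥ (A *ᵥ x)) + x ⬝ᵥ Q *ᵥ x - (Bᵀ *ᵥ (K *ᵥ x)) ⬝ᵥ (Bᵀ *ᵥ (K *ᵥ x)) := by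
  unfold riccati
  rw [Matrix.sub_mulVec, Matrix.add_mulVec (Aᵀ * K + K * A) Q, dotProduct_sub, dotProduct_add,
    lyapunov_form hK]
  congr 1
  simp only [← Matrix.mulVec_mulVec]
  rw [dot_mulVec, hK.eq, dot_mulVec]

theorem riccati_isSymm {A Q K : Matrix ι ι ℝ} {B : Matrix ι κ ℝ} (hQ : Q.IsSymm)
    (hK : K.IsSymm) : (riccati A B Q K).IsSymm := by
  unfold riccati Matrix.IsSymm
  simp only [Matrix.transpose_sub, Matrix.transpose_add, Matrix.transpose_mul,
    Matrix.transpose_transpose, hQ.eq, hK.eq, Matrix.mul_assoc]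
  abel

/-- The Lyapunov equation says that xᵀXx is the cost of the feedback F. Isolating A makes the
identities for different feedbacks comparable. -/
theorem kleinman_form {A Q X : Matrix ι ι ℝ} {B : Matrix ι κ ℝ} {F : Matrix κ ι ℝ}
    (hX : X.IsSymm) (hE : (A + B * F)ᵀ * X + X * (A + B * F) = -(Q + Fᵀ * F)) (x : ι → ℝ) :
    2 * (x ⬝ᵥ X *ᵥ (A *ᵥ x)) + 2 * ((F *ᵥ x) ⬝ᵥ (Bᵀ *ᵥ (X *ᵥ x))) =
      -(x ⬝ᵥ Q *ᵥ x) - (F *ᵥ x) ⬝ᵥ (F *ᵥ x) := by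
  have h1 := lyapunov_form hX (M := A + B * F) x
  rw [hE, Matrix.neg_mulVec, Matrix.add_mulVec, dotProduct_neg, dotProduct_add,
    ← Matrix.mulVec_mulVec, dot_mulVec Fᵀ x, Matrix.transpose_transpose, Matrix.add_mulVec,
    Matrix.mulVec_add, dotProduct_add, ← Matrix.mulVec_mulVec, symm_dot hX x (B *ᵥ (F *ᵥ x)),
    dotProduct_comm (B *ᵥ _), dot_mulVec B (X *ᵥ x)] at h1
  rw [dotProduct_comm (F *ᵥ x) (Bᵀ *ᵥ _)]
  linarith

theorem form_add_feedback {A X : Matrix ι ι ℝ} {B : Matrix ι κ ℝ} {F : Matrix κ ι ℝ}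
    (hX : X.IsSymm) (x : ι → ℝ) :
    x ⬝ᵥ X *ᵥ ((A + B * F) *ᵥ x) = x ⬝ᵥ X *ᵥ (A *ᵥ x) + (F *ᵥ x) ⬝ᵥ (Bᵀ *ᵥ (X *ᵥ x)) := by
  rw [Matrix.add_mulVec, Matrix.mulVec_add, dotProduct_add, ← Matrix.mulVec_mulVec,
    symm_dot hX x (B *ᵥ (F *ᵥ x)), dotProduct_comm (B *ᵥ _), dot_mulVec B (X *ᵥ x),
    dotProduct_comm (F *ᵥ x) (Bᵀ *ᵥ _)]

/-- The feedback `-Bᵀ X` attached to `X`. -/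
def gain (B : Matrix ι κ ℝ) (X : Matrix ι ι ℝ) : Matrix κ ι ℝ := -(Bᵀ * X)

theorem gain_mulVec (B : Matrix ι κ ℝ) (X : Matrix ι ι ℝ) (x : ι → ℝ) :
    gain B X *ᵥ x = -(Bᵀ *ᵥ (X *ᵥ x)) := by
  rw [gain, Matrix.neg_mulVec, Matrix.mulVec_mulVec]

theorem closedLoop_eq (A : Matrix ι ι ℝ) (B : Matrix ι κ ℝ) (K : Matrix ι ι ℝ) :
    closedLoop A B K = A + B * gain B K := by
  rw [closedLoop, gain, Matrix.mul_neg, sub_eq_add_neg, Matrix.mul_assoc]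

/-- Along the closed loop of F the form of X - K has derivative -xᵀφ(K)x - |Fx + BᵀKx|², which is
nonpositive, so `lyapunov_nonneg` applies. -/
theorem kleinman_ge {A Q X K : Matrix ι ι ℝ} {B : Matrix ι κ ℝ} {F : Matrix κ ι ℝ}
    (hF : Hurwitz (A + B * F)) (hX : X.IsSymm)
    (hE : (A + B * F)ᵀ * X + X * (A + B * F) = -(Q + Fᵀ * F))
    (hK : K.IsSymm) (hφ : 0 ≤ riccati A B Q K) : K ≤ X := by
  rw [← sub_nonneg]
  refine lyapunov_nonneg hF (hX.sub hK) fun x => ?_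
  have h1 := kleinman_form hX hE x
  have h2 := (nonneg_iff.1 hφ).2 x
  rw [riccati_form hK] at h2
  rw [form_add_feedback (hX.sub hK)]
  simp only [Matrix.sub_mulVec, dotProduct_sub, Matrix.mulVec_sub]
  have h3 := dot_self_nonneg (F *ᵥ x + Bᵀ *ᵥ (K *ᵥ x))
  simp only [dotProduct_add, add_dotProduct] at h3
  rw [dotProduct_comm (Bᵀ *ᵥ (K *ᵥ x)) (F *ᵥ x)] at h3
  linarith

/-- With G = -BᵀX, the form of X - K has derivative at most -|Fx - Gx|² along the closed loop of G.
An eigenvector of A + BG in the closed right half plane would force Fx = Gx, hence be an eigenvector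
of the Hurwitz matrix A + BF. -/
theorem kleinman_hurwitz {A Q X K : Matrix ι ι ℝ} {B : Matrix ι κ ℝ} {F : Matrix κ ι ℝ}
    (hF : Hurwitz (A + B * F)) (hX : X.IsSymm)
    (hE : (A + B * F)ᵀ * X + X * (A + B * F) = -(Q + Fᵀ * F))
    (hK : K.IsSymm) (hφ : 0 ≤ riccati A B Q K) : Hurwitz (A + B * gain B X) := by
  have hD : 0 ≤ X - K := sub_nonneg.2 (kleinman_ge hF hX hE hK hφ)
  have hDs := hX.sub hK
  obtain ⟨p, hp, hpM⟩ := exists_rootsIn_of_eigenpairs (S := {z | z.re < 0})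
    (M := A + B * gain B X) (V := ⊤) (Y := ⊥) (by simp) (by simp) (by
      intro z hz x _ y _ h1 h2
      simp only [Submodule.mem_bot, Set.mem_ofPred_eq, not_lt] at h1 h2 hz ⊢
      have e1 : (A + B * gain B X) *ᵥ x = z.re • x - z.im • y := by
        rw [← sub_eq_zero, ← h1]; abel
      have e2 : (A + B * gain B X) *ᵥ y = z.im • x + z.re • y := by
        rw [← sub_eq_zero, ← h2]; abel
      have hf := eigen_form hDs (M := A + B * gain B X) (z := z) (x := x) (y := y)
        (by rw [e1, Matrix.mulVec_sub, Matrix.mulVec_smul, Matrix.mulVec_smul])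
        (by rw [e2, Matrix.mulVec_add, Matrix.mulVec_smul, Matrix.mulVec_smul])
      have hq : ∀ v : ι → ℝ, 2 * (v ⬝ᵥ (X - K) *ᵥ ((A + B * gain B X) *ᵥ v)) ≤
          -((F *ᵥ v - gain B X *ᵥ v) ⬝ᵥ (F *ᵥ v - gain B X *ᵥ v)) := by
        intro v
        have h1 := kleinman_form hX hE v
        have h2 := (nonneg_iff.1 hφ).2 v
        rw [riccati_form hK] at h2
        rw [form_add_feedback hDs]
        simp only [Matrix.sub_mulVec, dotProduct_sub, Matrix.mulVec_sub, sub_dotProduct,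
          gain_mulVec, neg_dotProduct, dotProduct_neg]
        have h3 := dot_self_nonneg (-(Bᵀ *ᵥ (X *ᵥ v)) + Bᵀ *ᵥ (K *ᵥ v))
        simp only [dotProduct_add, add_dotProduct, neg_dotProduct, dotProduct_neg] at h3
        rw [dotProduct_comm (Bᵀ *ᵥ (K *ᵥ v)) (Bᵀ *ᵥ (X *ᵥ v))] at h3
        rw [dotProduct_comm (Bᵀ *ᵥ (X *ᵥ v)) (F *ᵥ v)]
        linarith
      have hqx := hq x
      have hqy := hq y
      have hx0 := (nonneg_iff.1 hD).2 x
      have hy0 := (nonneg_iff.1 hD).2 y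
      have hfx := dot_self_nonneg (F *ᵥ x - gain B X *ᵥ x)
      have hfy := dot_self_nonneg (F *ᵥ y - gain B X *ᵥ y)
      have hnn : 0 ≤ z.re * (x ⬝ᵥ (X - K) *ᵥ x + y ⬝ᵥ (X - K) *ᵥ y) :=
        mul_nonneg hz (by linarith)
      have hFx : F *ᵥ x = gain B X *ᵥ x :=
        sub_eq_zero.1 (dot_self_eq_zero.1 (by linarith))
      have hFy : F *ᵥ y = gain B X *ᵥ y :=
        sub_eq_zero.1 (dot_self_eq_zero.1 (by linarith))
      obtain ⟨q, hq, hqF⟩ := hF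
      by_contra hxy
      have hroot := root_of_eigenpair (M := A + B * F) (z := z) (x := x) (y := y) (p := q)
        (by rw [← e1, Matrix.add_mulVec, Matrix.add_mulVec, ← Matrix.mulVec_mulVec, hFx,
          Matrix.mulVec_mulVec])
        (by rw [← e2, Matrix.add_mulVec, Matrix.add_mulVec, ← Matrix.mulVec_mulVec, hFy,
          Matrix.mulVec_mulVec])
        (by rw [hqF, Matrix.zero_mulVec]) (by rw [hqF, Matrix.zero_mulVec]) hxy
      exact absurd (hq.2 z hroot) (not_lt.2 hz))
  refine ⟨p, hp, mulVec_ext fun x => ?_⟩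
  simpa using hpM x trivial

/-- Along the improved closed loop, with gain G = -BᵀX, the form of X - X' has derivative exactly
-|Fx - Gx|². -/
theorem kleinman_antitone {A Q X X' : Matrix ι ι ℝ} {B : Matrix ι κ ℝ} {F : Matrix κ ι ℝ}
    (hX : X.IsSymm) (hE : (A + B * F)ᵀ * X + X * (A + B * F) = -(Q + Fᵀ * F))
    (hF' : Hurwitz (A + B * gain B X)) (hX' : X'.IsSymm)
    (hE' : (A + B * gain B X)ᵀ * X' + X' * (A + B * gain B X) =
      -(Q + (gain B X)ᵀ * gain B X)) : X' ≤ X := by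
  rw [← sub_nonneg]
  refine lyapunov_nonneg hF' (hX.sub hX') fun x => ?_
  have h1 := kleinman_form hX hE x
  have h2 := kleinman_form hX' hE' x
  rw [form_add_feedback (hX.sub hX')]
  simp only [Matrix.sub_mulVec, dotProduct_sub, Matrix.mulVec_sub, gain_mulVec, neg_dotProduct,
    dotProduct_neg] at h2 ⊢
  have h3 := dot_self_nonneg (F *ᵥ x + Bᵀ *ᵥ (X *ᵥ x))
  simp only [dotProduct_add, add_dotProduct] at h3
  rw [dotProduct_comm (Bᵀ *ᵥ (X *ᵥ x)) (F *ᵥ x)] at h3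
  linarith

/-- A monotone bounded sequence of symmetric matrices converges. -/
theorem exists_tendsto_of_antitone {X : ℕ → Matrix ι ι ℝ} (hs : ∀ k, (X k).IsSymm)
    (ha : ∀ k, X (k + 1) ≤ X k) {K : Matrix ι ι ℝ} (hK : K.IsSymm) (hle : ∀ k, K ≤ X k) :
    ∃ Y, Tendsto X atTop (𝓝 Y) := by
  have hq : ∀ x : ι → ℝ, ∃ l, Tendsto (fun k => x ⬝ᵥ X k *ᵥ x) atTop (𝓝 l) := by
    intro x
    refine ⟨_, tendsto_atTop_ciInf (antitone_nat_of_succ_le fun k => ?_) ⟨x ⬝ᵥ K *ᵥ x, ?_⟩⟩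
    · exact (loewner_le_iff (hs _) (hs _)).1 (ha k) x
    · rintro _ ⟨k, rfl⟩
      exact (loewner_le_iff hK (hs _)).1 (hle k) x
  choose l hl using hq
  -- The entries of the limit are recovered from the limits of the quadratic forms by polarization.
  refine ⟨Matrix.of fun i j => (l (Pi.single i 1 + Pi.single j 1) - l (Pi.single i 1) -
    l (Pi.single j 1)) / 2, ?_⟩
  refine tendsto_pi_nhds.2 fun i => tendsto_pi_nhds.2 fun j => ?_
  have := (((hl (Pi.single i 1 + Pi.single j 1)).sub (hl (Pi.single i 1))).sub
    (hl (Pi.single j 1))).div_const 2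
  refine this.congr fun k => ?_
  have hsym : (X k) j i = (X k) i j := by
    have := congrFun (congrFun (hs k).eq i) j
    simpa using this
  simp only [Matrix.mulVec_add, dotProduct_add, add_dotProduct, Matrix.mulVec_single_one,
    single_one_dotProduct, Matrix.col_apply]
  rw [hsym]
  ring

/-- For a stabilizable pair, if the Riccati inequality has a solution then the Riccati equation has
a solution that dominates all solutions of the inequality; it is a limit of costs of stabilizing
feedbacks. -/
theorem exists_maximal_solution {A Q : Matrix ι ι ℝ} {B : Matrix ι κ ℝ} (hQ : Q.IsSymm)
    (hst : StabPair A B) {K₀ : Matrix ι ι ℝ} (hK₀ : K₀.IsSymm) (hφ₀ : 0 ≤ riccati A B Q K₀) :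
    ∃ Kp : Matrix ι ι ℝ, Kp.IsSymm ∧ riccati A B Q Kp = 0 ∧
      (∀ K, K.IsSymm → 0 ≤ riccati A B Q K → K ≤ Kp) ∧
      RootsIn {z | z.re ≤ 0} (closedLoop A B Kp).charpoly ∧
      ∃ (X : ℕ → Matrix ι ι ℝ) (F : ℕ → Matrix κ ι ℝ),
        (∀ k, (X k).IsSymm ∧ Hurwitz (A + B * F k) ∧
          (A + B * F k)ᵀ * X k + X k * (A + B * F k) = -(Q + (F k)ᵀ * F k)) ∧
        Tendsto X atTop (𝓝 Kp) := by
  have hsol : ∀ F : {F : Matrix κ ι ℝ // Hurwitz (A + B * F)}, ∃ X : Matrix ι ι ℝ, X.IsSymm ∧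
      (A + B * F.1)ᵀ * X + X * (A + B * F.1) = -(Q + F.1ᵀ * F.1) := by
    intro F
    obtain ⟨X, hX, -⟩ := lyapunov_existsUnique F.2 (-(Q + F.1ᵀ * F.1))
    refine ⟨X, lyapunov_symm F.2 ?_ hX, hX⟩
    exact (hQ.add (nonneg_iff.1 (transpose_mul_self_nonneg F.1)).1).neg
  choose sol hsols hsolE using hsol
  obtain ⟨F₀, hF₀⟩ := hst.exists_stabilizing
  -- The iteration runs on stabilizing feedbacks: each gain is computed from the cost matrix of the
  -- previous one, and the given solution of the inequality guarantees that stability is preserved.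
  let F : ℕ → {F : Matrix κ ι ℝ // Hurwitz (A + B * F)} := fun k =>
    Nat.rec ⟨F₀, hF₀⟩ (fun _ F => ⟨gain B (sol F),
      kleinman_hurwitz F.2 (hsols F) (hsolE F) hK₀ hφ₀⟩) k
  have hFs : ∀ k, (F (k + 1)).1 = gain B (sol (F k)) := fun k => rfl
  have hge : ∀ K, K.IsSymm → 0 ≤ riccati A B Q K → ∀ k, K ≤ sol (F k) := fun K hK hφ k =>
    kleinman_ge (F k).2 (hsols _) (hsolE _) hK hφ
  have hanti : ∀ k, sol (F (k + 1)) ≤ sol (F k) := fun k =>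
    kleinman_antitone (hsols (F k)) (hsolE (F k)) (F (k + 1)).2 (hsols (F (k + 1)))
      (hsolE (F (k + 1)))
  obtain ⟨Kp, hKp⟩ := exists_tendsto_of_antitone (fun k => hsols (F k)) hanti hK₀
    (hge K₀ hK₀ hφ₀)
  have hKps : Kp.IsSymm := by
    have h1 : Tendsto (fun k => (sol (F k))ᵀ) atTop (𝓝 Kpᵀ) :=
      ((continuous_id.matrix_transpose).tendsto Kp).comp hKp
    refine tendsto_nhds_unique h1 ?_
    exact hKp.congr fun k => (hsols (F k)).eq.symm
  have hgain : Continuous fun X : Matrix ι ι ℝ => gain B X := by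
    unfold gain
    exact (continuous_const.matrix_mul continuous_id).neg
  have hFlim : Tendsto (fun k => (F (k + 1)).1) atTop (𝓝 (gain B Kp)) :=
    (hgain.tendsto Kp).comp hKp
  have hcl : Tendsto (fun k => A + B * (F (k + 1)).1) atTop (𝓝 (closedLoop A B Kp)) := by
    rw [closedLoop_eq]
    have hc : Continuous fun G : Matrix κ ι ℝ => A + B * G :=
      continuous_const.add (continuous_const.matrix_mul continuous_id)
    exact (hc.tendsto _).comp hFlim
  have hKp1 := hKp.comp (tendsto_add_atTop_nat 1)
  -- In the limit, cost matrix and gain refer to the same matrix, and the Lyapunov equation of the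
  -- iteration becomes the Riccati equation.
  have hric : riccati A B Q Kp = 0 := by
    have hc : Continuous fun p : Matrix ι ι ℝ × Matrix κ ι ℝ =>
        (A + B * p.2)ᵀ * p.1 + p.1 * (A + B * p.2) + (Q + p.2ᵀ * p.2) := by
      have h2 : Continuous fun p : Matrix ι ι ℝ × Matrix κ ι ℝ => A + B * p.2 :=
        continuous_const.add (continuous_const.matrix_mul continuous_snd)
      exact ((h2.matrix_transpose.matrix_mul continuous_fst).add
        (continuous_fst.matrix_mul h2)).add (continuous_const.add
          (continuous_snd.matrix_transpose.matrix_mul continuous_snd))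
    have h1 := (hc.tendsto (Kp, gain B Kp)).comp (hKp1.prodMk_nhds hFlim)
    have h0 : (A + B * gain B Kp)ᵀ * Kp + Kp * (A + B * gain B Kp) +
        (Q + (gain B Kp)ᵀ * gain B Kp) = 0 := by
      refine tendsto_nhds_unique h1 (tendsto_const_nhds.congr fun k => ?_)
      simp only [Function.comp_apply]
      rw [hsolE (F (k + 1))]
      abel
    rw [← h0]
    unfold riccati gain
    simp only [Matrix.transpose_neg, Matrix.transpose_add, Matrix.transpose_mul,
      Matrix.transpose_transpose, Matrix.mul_neg, Matrix.neg_mul, Matrix.mul_add, Matrix.add_mul,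
      hKps.eq, Matrix.mul_assoc]
    abel
  refine ⟨Kp, hKps, hric, fun K hK hφ => ?_, rootsIn_charpoly_of_tendsto (fun k => (F (k + 1)).2) hcl,
    fun k => sol (F k), fun k => (F k).1, fun k => ⟨hsols _, (F k).2, hsolE _⟩, hKp⟩
  rw [loewner_le_iff hK hKps]
  intro x
  have hc : Continuous fun X : Matrix ι ι ℝ => x ⬝ᵥ X *ᵥ x :=
    continuous_const.dotProduct (continuous_id.matrix_mulVec continuous_const)
  exact ge_of_tendsto' ((hc.tendsto Kp).comp hKp) fun k =>
    (loewner_le_iff hK (hsols _)).1 (hge K hK hφ k) x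

end Kleinman

end IndefLQ

namespace IndefLQ

section Riccati

variable {ι κ : Type*} [Fintype ι] [DecidableEq ι] [Fintype κ] [DecidableEq κ]

/-! ### Extremal solutions and the gap -/

/-- Time reversal: it exchanges least and greatest solutions, and the two half planes. -/
theorem riccati_neg (A Q K : Matrix ι ι ℝ) (B : Matrix ι κ ℝ) :
    riccati (-A) B Q (-K) = riccati A B Q K := by
  unfold riccati
  simp

theorem closedLoop_neg (A K : Matrix ι ι ℝ) (B : Matrix ι κ ℝ) :
    closedLoop (-A) B (-K) = -closedLoop A B K := by
  unfold closedLoop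
  rw [Matrix.mul_neg]
  abel

theorem riccati_mulVec (A Q K : Matrix ι ι ℝ) (B : Matrix ι κ ℝ) (x : ι → ℝ) :
    riccati A B Q K *ᵥ x = Aᵀ *ᵥ (K *ᵥ x) + K *ᵥ (closedLoop A B K *ᵥ x) + Q *ᵥ x := by
  simp only [riccati, closedLoop, Matrix.mulVec_mulVec, ← Matrix.add_mulVec, Matrix.mul_sub,
    Matrix.mul_assoc]
  congr 1
  abel

/-- The exact second order expansion of φ around K. All comparisons between two solutions go through
it. -/
theorem riccati_add {A Q K D : Matrix ι ι ℝ} {B : Matrix ι κ ℝ} (hK : K.IsSymm) :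
    riccati A B Q (K + D) = riccati A B Q K +
      ((closedLoop A B K)ᵀ * D + D * closedLoop A B K) - D * B * Bᵀ * D := by
  simp only [riccati, closedLoop, Matrix.transpose_sub, Matrix.transpose_mul,
    Matrix.transpose_transpose, hK.eq, Matrix.mul_add, Matrix.add_mul, Matrix.mul_sub,
    Matrix.sub_mul, Matrix.mul_assoc]
  abel

theorem lyapunov_of_riccati_add {A Q K D : Matrix ι ι ℝ} {B : Matrix ι κ ℝ} (hK : K.IsSymm) :
    (closedLoop A B K)ᵀ * D + D * closedLoop A B K =
      D * B * Bᵀ * D + (riccati A B Q (K + D) - riccati A B Q K) := by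
  rw [riccati_add hK]; abel

theorem isSymm_of_dot {K : Matrix ι ι ℝ} (h : ∀ x y : ι → ℝ, x ⬝ᵥ K *ᵥ y = y ⬝ᵥ K *ᵥ x) :
    K.IsSymm := by
  ext i j
  have := h (Pi.single j 1) (Pi.single i 1)
  simpa using this

theorem controllable_neg {A : Matrix ι ι ℝ} {B : Matrix ι κ ℝ}
    (h : controllableSubspace A B = ⊤) : controllableSubspace (-A) B = ⊤ := by
  rw [eq_top_iff, ← h]
  refine controllable_le (mulVec_mem_controllable (-A) B) fun x hx => ?_
  have := controllable_invariant hx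
  rw [Matrix.neg_mulVec] at this
  simpa using Submodule.neg_mem _ this

/-- The extremal solutions of the Riccati equation of a controllable pair. -/
theorem exists_extremal_solutions {A Q : Matrix ι ι ℝ} {B : Matrix ι κ ℝ} (hQ : Q.IsSymm)
    (hc : controllableSubspace A B = ⊤) {K₀ : Matrix ι ι ℝ} (hK₀ : K₀.IsSymm)
    (hφ₀ : 0 ≤ riccati A B Q K₀) :
    ∃ Km Kp : Matrix ι ι ℝ, IsLeast (areSolutions A B Q) Km ∧
      IsGreatest (areSolutions A B Q) Kp ∧
      (∀ K, K.IsSymm → 0 ≤ riccati A B Q K → Km ≤ K) ∧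
      RootsIn {z | 0 ≤ z.re} (closedLoop A B Km).charpoly ∧
      RootsIn {z | z.re ≤ 0} (closedLoop A B Kp).charpoly := by
  obtain ⟨Kp, hps, hpr, hpm, hpc, -⟩ := exists_maximal_solution hQ (StabPair.of_top hc) hK₀ hφ₀
  -- The greatest solution of the time-reversed equation is the negative of the least solution.
  obtain ⟨K', hms, hmr, hmm, hmc, -⟩ := exists_maximal_solution hQ
    (StabPair.of_top (controllable_neg hc)) hK₀.neg (by rwa [riccati_neg])
  have hle : ∀ K, K.IsSymm → 0 ≤ riccati A B Q K → -K' ≤ K := by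
    intro K hK hφ
    have := hmm (-K) hK.neg (by rwa [riccati_neg])
    exact neg_le.1 this
  have hmr' : riccati A B Q (-K') = 0 := by
    rw [← hmr, ← riccati_neg, neg_neg]
  have hcl : closedLoop (-A) B K' = -closedLoop A B (-K') := by
    rw [← closedLoop_neg, neg_neg]
  refine ⟨-K', Kp, ⟨⟨hms.neg, hmr'⟩, fun K hK => hle K hK.1 hK.2.ge⟩,
    ⟨⟨hps, hpr⟩, fun K hK => hpm K hK.1 hK.2.ge⟩, hle, ?_, hpc⟩
  rw [hcl] at hmc
  refine rootsIn_charpoly (p := (-closedLoop A B (-K')).charpoly.comp (C (-1) * X + C 0))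
    (rootsIn_comp hmc (by norm_num) fun w hw => ?_) ?_
  · simpa using hw
  · rw [aeval_comp_affine]
    simp [Matrix.aeval_self_charpoly]

theorem spectral_invariant {S : Set ℂ} {M : Matrix ι ι ℝ} {x : ι → ℝ}
    (hx : x ∈ spectralSubspace S M) : M *ᵥ x ∈ spectralSubspace S M := by
  unfold spectralSubspace kerM at *
  rw [LinearMap.mem_ker, Matrix.mulVecLin_apply] at *
  have := aeval_mulVec_comm M (rootFactor S M.charpoly) X x
  rw [aeval_X, hx, Matrix.mulVec_zero] at this
  exact this

theorem eq_zero_of_roots {S T : Set ℂ} (hST : Disjoint S T) {M : Matrix ι ι ℝ} {p q : ℝ[X]}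
    (hp : RootsIn S p) (hq : RootsIn T q) {x : ι → ℝ} (hpx : aeval M p *ᵥ x = 0)
    (hqx : aeval M q *ᵥ x = 0) : x = 0 :=
  eq_zero_of_isCoprime (hp.isCoprime hST hq) hpx hqx

/-! ### The gap of the extremal solutions and the solutions mixed from them -/

section Gap

variable {A Q Km Kp : Matrix ι ι ℝ} {B : Matrix ι κ ℝ}

theorem gap_nonneg (hm : IsLeast (areSolutions A B Q) Km)
    (hp : IsGreatest (areSolutions A B Q) Kp) : 0 ≤ Kp - Km :=
  sub_nonneg.2 (hm.2 hp.1)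

/-- The expansion of φ at K⁻; expanding at K⁺ instead changes the sign of the quadratic term. These
two signs are the values of c with which `mulVec_eq_zero_of_lyapunov` is applied. -/
theorem gap_lyapunov_neg (hm : Km ∈ areSolutions A B Q) (hp : Kp ∈ areSolutions A B Q) :
    (closedLoop A B Km)ᵀ * (Kp - Km) + (Kp - Km) * closedLoop A B Km =
      (Kp - Km) * B * Bᵀ * (Kp - Km) := by
  rw [lyapunov_of_riccati_add (Q := Q) hm.1, add_sub_cancel, hm.2, hp.2, sub_zero, add_zero]

theorem gap_lyapunov_pos (hm : Km ∈ areSolutions A B Q) (hp : Kp ∈ areSolutions A B Q) :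
    (closedLoop A B Kp)ᵀ * (Kp - Km) + (Kp - Km) * closedLoop A B Kp =
      -((Kp - Km) * B * Bᵀ * (Kp - Km)) := by
  have := lyapunov_of_riccati_add (Q := Q) (D := Km - Kp) (A := A) (B := B) hp.1
  rw [add_sub_cancel, hm.2, hp.2, sub_zero, add_zero] at this
  rw [← neg_sub Km Kp, Matrix.mul_neg, Matrix.neg_mul, ← neg_add, this]
  simp only [Matrix.neg_mul, Matrix.mul_neg, neg_neg]

theorem closedLoop_gap (x : ι → ℝ) : closedLoop A B Km *ᵥ x =
    closedLoop A B Kp *ᵥ x + B *ᵥ (Bᵀ *ᵥ ((Kp - Km) *ᵥ x)) := by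
  simp only [closedLoop, Matrix.mulVec_mulVec, ← Matrix.add_mulVec, Matrix.mul_sub,
    Matrix.mul_assoc]
  congr 1
  abel

theorem ker_gap_invariant (hm : Km ∈ areSolutions A B Q) (hp : Kp ∈ areSolutions A B Q)
    {x : ι → ℝ} (hx : x ∈ kerM (Kp - Km)) : closedLoop A B Km *ᵥ x ∈ kerM (Kp - Km) := by
  rw [LinearMap.mem_ker, Matrix.mulVecLin_apply] at *
  have := congrArg (fun M => M *ᵥ x) (gap_lyapunov_neg hm hp)
  simpa only [Matrix.add_mulVec, ← Matrix.mulVec_mulVec, hx, Matrix.mulVec_zero, zero_add] using this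

theorem closedLoop_eq_of_ker_gap {x : ι → ℝ} (hx : x ∈ kerM (Kp - Km)) :
    closedLoop A B Kp *ᵥ x = closedLoop A B Km *ᵥ x := by
  rw [LinearMap.mem_ker, Matrix.mulVecLin_apply] at hx
  rw [closedLoop_gap (Kp := Kp) (Km := Km), hx]
  simp

/-- On the kernel of the gap the closed loops agree and have imaginary spectrum. -/
theorem exists_rootsIn_ker_gap (hm : Km ∈ areSolutions A B Q) (hp : Kp ∈ areSolutions A B Q)
    (hmc : RootsIn {z | 0 ≤ z.re} (closedLoop A B Km).charpoly)
    (hpc : RootsIn {z | z.re ≤ 0} (closedLoop A B Kp).charpoly)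
    {x : ι → ℝ} (hx : x ∈ kerM (Kp - Km)) :
    ∃ g, RootsIn {z | z.re = 0} g ∧ aeval (closedLoop A B Km) g *ᵥ x = 0 := by
  -- The vector is annihilated by the characteristic polynomials of both closed loops, which have
  -- roots in opposite closed half planes, hence by their greatest common divisor.
  obtain ⟨g, hg, hgx⟩ := exists_rootsIn_inter (M := closedLoop A B Km) (x := x) hmc hpc
    (aeval_charpoly_mulVec _ x) (by
      rw [← aeval_mulVec_congr (fun x hx => ker_gap_invariant hm hp hx)
        (fun x hx => closedLoop_eq_of_ker_gap hx) _ hx]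
      exact aeval_charpoly_mulVec _ x)
  exact ⟨g, hg.mono fun z hz => le_antisymm (α := ℝ) (b := 0) hz.2 hz.1, hgx⟩

/-- On the imaginary spectral subspace the Lyapunov equation of the gap has a sign that controllable
directions cannot sustain, so the gap vanishes there. Conversely, on the kernel of the gap both
closed loops coincide. -/
theorem specZero_eq_ker_gap_pos (hst : StabPair A B) (hm : IsLeast (areSolutions A B Q) Km)
    (hp : IsGreatest (areSolutions A B Q) Kp)
    (hmc : RootsIn {z | 0 ≤ z.re} (closedLoop A B Km).charpoly)
    (hpc : RootsIn {z | z.re ≤ 0} (closedLoop A B Kp).charpoly) :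
    specZero (closedLoop A B Kp) = kerM (Kp - Km) := by
  apply le_antisymm
  · intro x hx
    rw [LinearMap.mem_ker, Matrix.mulVecLin_apply]
    refine mulVec_eq_zero_of_lyapunov hst (F := gain B Kp) (gap_nonneg hm hp) (c := -1)
      (by norm_num) (V := specZero (closedLoop A B Kp)) (fun x hx => ?_) (fun x hx => ?_)
      (p := rootFactor {z | z.re = 0} (closedLoop A B Kp).charpoly)
      ((rootsIn_rootFactor _ _).mono ?_) (fun x hx => ?_) hx
    · rw [← closedLoop_eq]; exact spectral_invariant hx
    · rw [← closedLoop_eq, gap_lyapunov_pos hm.1 hp.1]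
      simp [Matrix.neg_mulVec]
    · intro z hz
      have : z.re = 0 := hz
      simp [this]
    · have : aeval (closedLoop A B Kp) (rootFactor {z | z.re = 0} (closedLoop A B Kp).charpoly) *ᵥ x
          = 0 := hx
      rw [← closedLoop_eq, this, Matrix.mulVec_zero]
  · intro x hx
    obtain ⟨g, hg, hgx⟩ := exists_rootsIn_ker_gap hm.1 hp.1 hmc hpc hx
    refine mem_specZero.2 ⟨g, hg, ?_⟩
    rw [aeval_mulVec_congr (fun x hx => ker_gap_invariant hm.1 hp.1 hx)
        (fun x hx => closedLoop_eq_of_ker_gap hx) _ hx, hgx]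

theorem specZero_eq_ker_gap_neg (hst : StabPair A B) (hm : IsLeast (areSolutions A B Q) Km)
    (hp : IsGreatest (areSolutions A B Q) Kp)
    (hmc : RootsIn {z | 0 ≤ z.re} (closedLoop A B Km).charpoly)
    (hpc : RootsIn {z | z.re ≤ 0} (closedLoop A B Kp).charpoly) :
    specZero (closedLoop A B Km) = kerM (Kp - Km) := by
  apply le_antisymm
  · intro x hx
    rw [LinearMap.mem_ker, Matrix.mulVecLin_apply]
    refine mulVec_eq_zero_of_lyapunov hst (F := gain B Km) (gap_nonneg hm hp) (c := 1)
      (by norm_num) (V := specZero (closedLoop A B Km)) (fun x hx => ?_) (fun x hx => ?_)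
      (p := rootFactor {z | z.re = 0} (closedLoop A B Km).charpoly)
      ((rootsIn_rootFactor _ _).mono ?_) (fun x hx => ?_) hx
    · rw [← closedLoop_eq]; exact spectral_invariant hx
    · rw [← closedLoop_eq, gap_lyapunov_neg hm.1 hp.1, one_smul]
    · intro z hz
      have : z.re = 0 := hz
      simp [this]
    · have : aeval (closedLoop A B Km) (rootFactor {z | z.re = 0} (closedLoop A B Km).charpoly) *ᵥ x
          = 0 := hx
      rw [← closedLoop_eq, this, Matrix.mulVec_zero]
  · intro x hx
    exact mem_specZero.2 (exists_rootsIn_ker_gap hm.1 hp.1 hmc hpc hx)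

theorem disjoint_zero_pos : Disjoint {z : ℂ | z.re = 0} {z : ℂ | 0 < z.re} := by
  rw [Set.disjoint_left]
  intro z h1 h2
  exact absurd (h1 : z.re = 0) (ne_of_gt (h2 : 0 < z.re))

theorem disjoint_neg_zero : Disjoint {z : ℂ | z.re < 0} {z : ℂ | z.re = 0} := by
  rw [Set.disjoint_left]
  intro z h1 h2
  exact absurd (h2 : z.re = 0) (ne_of_lt (h1 : z.re < 0))

theorem disjoint_nonpos_pos : Disjoint {z : ℂ | z.re ≤ 0} {z : ℂ | 0 < z.re} := by
  rw [Set.disjoint_left]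
  intro z h1 h2
  have h3 : z.re ≤ 0 := h1
  have h4 : 0 < z.re := h2
  linarith

theorem disjoint_neg_nonneg : Disjoint {z : ℂ | z.re < 0} {z : ℂ | 0 ≤ z.re} := by
  rw [Set.disjoint_left]
  intro z h1 h2
  have h3 : z.re < 0 := h1
  have h4 : 0 ≤ z.re := h2
  linarith

/-- The gap is definite on subspaces of `𝒳⁺(A(K⁻))`, hence such a subspace has its orthogonal
complement for the gap as a complement. -/
theorem isCompl_gapComplement {D : Matrix ι ι ℝ} (hD : 0 ≤ D) {N : Submodule ℝ (ι → ℝ)}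
    (hN : ∀ x ∈ N, D *ᵥ x = 0 → x = 0) : IsCompl N (gapComplement D N) := by
  have hdis : ∀ x ∈ N, x ∈ gapComplement D N → x = 0 := fun x hx hx' =>
    hN x hx (mulVec_eq_zero_of_form hD (hx' x hx))
  constructor
  · rw [Submodule.disjoint_def]
    exact hdis
  · rw [codisjoint_iff, eq_top_iff]
    intro x _
    obtain ⟨k, σ, π, hπσ, hr⟩ := exists_basis_matrix N
    -- The Gram matrix of the form D on a basis of N is invertible because D is definite there.
    have hU : IsUnit (σᵀ * D * σ) := Matrix.mulVec_injective_iff_isUnit.1 (by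
      intro a b hab
      rw [← sub_eq_zero]
      have h0 : (σᵀ * D * σ) *ᵥ (a - b) = 0 := by
        rw [Matrix.mulVec_sub, sub_eq_zero]; exact hab
      have h1 : (σ *ᵥ (a - b)) ⬝ᵥ D *ᵥ (σ *ᵥ (a - b)) = 0 := by
        have := congrArg (fun v => (a - b) ⬝ᵥ v) h0
        simp only [← Matrix.mulVec_mulVec, dotProduct_zero] at this
        rwa [dot_mulVec, Matrix.transpose_transpose] at this
      have h2 := hN _ ((hr _).2 ⟨_, rfl⟩) (mulVec_eq_zero_of_form hD h1)
      have h3 := congrArg (fun v => π *ᵥ v) h2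
      simpa [Matrix.mulVec_mulVec, hπσ] using h3)
    -- The vector c holds the coordinates of the D-orthogonal projection of x to N.
    obtain ⟨c, hc⟩ := (Matrix.mulVec_surjective_iff_isUnit.2 hU) ((σᵀ * D) *ᵥ x)
    have hmem : x - σ *ᵥ c ∈ gapComplement D N := by
      intro y hy
      obtain ⟨d, rfl⟩ := (hr y).1 hy
      rw [← Matrix.transpose_transpose σ, ← dot_mulVec]
      have : σᵀ *ᵥ (D.mulVecLin (x - (σᵀ)ᵀ *ᵥ c)) = 0 := by
        simp only [← Matrix.mulVec_mulVec] at hc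
        simp only [Matrix.mulVecLin_apply, Matrix.mulVec_sub, Matrix.transpose_transpose]
        rw [hc, sub_self]
      rw [this, dotProduct_zero]
    have : x = σ *ᵥ c + (x - σ *ᵥ c) := by abel
    rw [this]
    exact Submodule.add_mem_sup ((hr _).2 ⟨c, rfl⟩) hmem

theorem exists_projection {V W : Submodule ℝ (ι → ℝ)} (h : IsCompl V W) :
    ∃ P : Matrix ι ι ℝ, IsProjectionAlong P V W := by
  refine ⟨LinearMap.toMatrix' (V.subtype ∘ₗ V.projectionOnto W h), h, fun x hx => ?_, fun x hx => ?_⟩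
  · rw [LinearMap.toMatrix'_mulVec]
    simp [Submodule.projectionOnto_apply_left h ⟨x, hx⟩]
  · rw [LinearMap.toMatrix'_mulVec]
    simp [(Submodule.projectionOnto_apply_eq_zero_iff h).2 hx]

theorem IsProjectionAlong.exists_add {P : Matrix ι ι ℝ} {V W : Submodule ℝ (ι → ℝ)}
    (h : IsProjectionAlong P V W) (x : ι → ℝ) :
    ∃ v ∈ V, ∃ w ∈ W, x = v + w ∧ P *ᵥ x = v := by
  have hx : x ∈ V ⊔ W := by rw [h.1.sup_eq_top]; trivial
  obtain ⟨v, hv, w, hw, rfl⟩ := Submodule.mem_sup.1 hx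
  exact ⟨v, hv, w, hw, rfl, by rw [Matrix.mulVec_add, h.2.1 v hv, h.2.2 w hw, add_zero]⟩

variable {N : Submodule ℝ (ι → ℝ)} {P : Matrix ι ι ℝ}

/-- The solution `K⁻ P + K⁺ (I - P)`. -/
def mixed (Km Kp P : Matrix ι ι ℝ) : Matrix ι ι ℝ := Km * P + Kp * (1 - P)

theorem mixed_left {W : Submodule ℝ (ι → ℝ)} (hP : IsProjectionAlong P N W) {x : ι → ℝ}
    (hx : x ∈ N) : mixed Km Kp P *ᵥ x = Km *ᵥ x := by
  rw [mixed, Matrix.add_mulVec, ← Matrix.mulVec_mulVec, ← Matrix.mulVec_mulVec, Matrix.sub_mulVec,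
    hP.2.1 x hx]
  simp

theorem mixed_right {W : Submodule ℝ (ι → ℝ)} (hP : IsProjectionAlong P N W) {x : ι → ℝ}
    (hx : x ∈ W) : mixed Km Kp P *ᵥ x = Kp *ᵥ x := by
  rw [mixed, Matrix.add_mulVec, ← Matrix.mulVec_mulVec, ← Matrix.mulVec_mulVec, Matrix.sub_mulVec,
    hP.2.2 x hx]
  simp

theorem closedLoop_congr {K K' : Matrix ι ι ℝ} {x : ι → ℝ} (h : K *ᵥ x = K' *ᵥ x) :
    closedLoop A B K *ᵥ x = closedLoop A B K' *ᵥ x := by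
  simp only [closedLoop, Matrix.sub_mulVec, ← Matrix.mulVec_mulVec, h]

/-- The Lyapunov equation of the gap can be read as Δ A(K⁺) = -A(K⁻)ᵀ Δ, so invariance of N under
A(K⁻) is dual to invariance of its Δ-orthogonal complement under A(K⁺). -/
theorem gapComplement_invariant (hm : Km ∈ areSolutions A B Q) (hp : Kp ∈ areSolutions A B Q)
    (hN : ∀ x ∈ N, closedLoop A B Km *ᵥ x ∈ N) {x : ι → ℝ}
    (hx : x ∈ gapComplement (Kp - Km) N) : closedLoop A B Kp *ᵥ x ∈ gapComplement (Kp - Km) N := by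
  intro y hy
  have h1 : (Kp - Km) *ᵥ (closedLoop A B Kp *ᵥ x) =
      -((closedLoop A B Km)ᵀ *ᵥ ((Kp - Km) *ᵥ x)) := by
    have h2 := congrArg (fun M => M *ᵥ x) (gap_lyapunov_neg hm hp)
    simp only [Matrix.add_mulVec, ← Matrix.mulVec_mulVec] at h2
    rw [closedLoop_gap (Kp := Kp) (Km := Km), Matrix.mulVec_add] at h2
    have h3 : (closedLoop A B Km)ᵀ *ᵥ (Kp - Km) *ᵥ x + (Kp - Km) *ᵥ closedLoop A B Kp *ᵥ x = 0 := by
      have := sub_eq_zero.2 h2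
      rw [← this]; abel
    exact eq_neg_of_add_eq_zero_right h3
  rw [Matrix.mulVecLin_apply, h1, dotProduct_neg, dot_mulVec, Matrix.transpose_transpose]
  have := hx _ (hN y hy)
  rw [Matrix.mulVecLin_apply] at this
  rw [this, neg_zero]

/-- Only the cross terms between N and the complement matter, and there the forms of K⁻ and K⁺ agree
because their difference is the form of Δ. -/
theorem mixed_isSymm (hm : Km.IsSymm) (hp : Kp.IsSymm)
    (hP : IsProjectionAlong P N (gapComplement (Kp - Km) N)) : (mixed Km Kp P).IsSymm := by
  refine isSymm_of_dot fun x y => ?_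
  obtain ⟨n, hn, w, hw, rfl, -⟩ := hP.exists_add x
  obtain ⟨n', hn', w', hw', rfl, -⟩ := hP.exists_add y
  rw [Matrix.mulVec_add, Matrix.mulVec_add, mixed_left hP hn, mixed_left hP hn',
    mixed_right hP hw, mixed_right hP hw']
  have h1 := hw' n hn
  have h2 := hw n' hn'
  simp only [Matrix.mulVecLin_apply, Matrix.sub_mulVec, dotProduct_sub] at h1 h2
  simp only [dotProduct_add, add_dotProduct]
  rw [symm_dot hm n n', symm_dot hp w w', symm_dot hm w n', symm_dot hm w' n]
  linarith

/-- Applied to a vector, φ(K) involves only K on that vector and on its image under the closed loop.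
Both summands are invariant, so on each of them the equation is that of K⁻ or of K⁺. -/
theorem mixed_riccati (hm : Km ∈ areSolutions A B Q) (hp : Kp ∈ areSolutions A B Q)
    (hN : ∀ x ∈ N, closedLoop A B Km *ᵥ x ∈ N)
    (hP : IsProjectionAlong P N (gapComplement (Kp - Km) N)) :
    riccati A B Q (mixed Km Kp P) = 0 := by
  refine mulVec_ext fun x => ?_
  obtain ⟨n, hn, w, hw, rfl, -⟩ := hP.exists_add x
  have h1 := riccati_mulVec A Q Km B n
  have h2 := riccati_mulVec A Q Kp B w
  rw [hm.2, Matrix.zero_mulVec] at h1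
  rw [hp.2, Matrix.zero_mulVec] at h2
  rw [Matrix.mulVec_add, Matrix.zero_mulVec, riccati_mulVec, riccati_mulVec,
    closedLoop_congr (mixed_left hP hn), closedLoop_congr (mixed_right hP hw),
    mixed_left hP hn, mixed_right hP hw, mixed_left hP (hN n hn),
    mixed_right hP (gapComplement_invariant hm hp hN hw), ← h1, ← h2, add_zero]

/-- Vectors killed by `p(A(K̄))` split along the two invariant subspaces. -/
theorem aeval_mixed (hm : Km ∈ areSolutions A B Q) (hp : Kp ∈ areSolutions A B Q)
    (hN : ∀ x ∈ N, closedLoop A B Km *ᵥ x ∈ N)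
    (hP : IsProjectionAlong P N (gapComplement (Kp - Km) N)) (p : ℝ[X]) {n w : ι → ℝ}
    (hn : n ∈ N) (hw : w ∈ gapComplement (Kp - Km) N) :
    aeval (closedLoop A B (mixed Km Kp P)) p *ᵥ (n + w) = 0 ↔
      aeval (closedLoop A B Km) p *ᵥ n = 0 ∧ aeval (closedLoop A B Kp) p *ᵥ w = 0 := by
  rw [Matrix.mulVec_add,
    aeval_mulVec_congr hN (fun x hx => closedLoop_congr (mixed_left hP hx)) p hn,
    aeval_mulVec_congr (fun x hx => gapComplement_invariant hm hp hN hx)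
      (fun x hx => closedLoop_congr (mixed_right hP hx)) p hw]
  constructor
  · intro h
    have h1 := aeval_mulVec_mem hN p hn
    have h2 := aeval_mulVec_mem (fun x hx => gapComplement_invariant hm hp hN hx) p hw
    have h3 : aeval (closedLoop A B Km) p *ᵥ n = 0 := by
      refine (Submodule.disjoint_def.1 hP.1.disjoint) _ h1 ?_
      rw [eq_neg_of_add_eq_zero_left h]
      exact Submodule.neg_mem _ h2
    rw [h3, zero_add] at h
    exact ⟨h3, h⟩
  · rintro ⟨h1, h2⟩
    rw [h1, h2, add_zero]

/-- On the complement the closed loop is that of K⁺, which has no spectrum in the open right half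
plane; N lies in the right spectral subspace by assumption. -/
theorem specPos_mixed (hm : Km ∈ areSolutions A B Q) (hp : Kp ∈ areSolutions A B Q)
    (hpc : RootsIn {z | z.re ≤ 0} (closedLoop A B Kp).charpoly)
    (hN : ∀ x ∈ N, closedLoop A B Km *ᵥ x ∈ N) (hNp : N ≤ specPos (closedLoop A B Km))
    (hP : IsProjectionAlong P N (gapComplement (Kp - Km) N)) :
    specPos (closedLoop A B (mixed Km Kp P)) = N := by
  ext x
  rw [mem_specPos]
  constructor
  · rintro ⟨p, hpr, hpx⟩
    obtain ⟨n, hn, w, hw, rfl, -⟩ := hP.exists_add x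
    have h := ((aeval_mixed hm hp hN hP p hn hw).1 hpx).2
    have hw0 := eq_zero_of_roots disjoint_nonpos_pos hpc hpr (aeval_charpoly_mulVec _ w) h
    rw [hw0, add_zero]
    exact hn
  · intro hx
    obtain ⟨p, hpr, hpx⟩ := mem_specPos.1 (hNp hx)
    refine ⟨p, hpr, ?_⟩
    have := (aeval_mixed hm hp hN hP p hx (Submodule.zero_mem _)).2 ⟨hpx, by simp⟩
    simpa using this

theorem specZero_mixed (hst : StabPair A B) (hm : IsLeast (areSolutions A B Q) Km)
    (hp : IsGreatest (areSolutions A B Q) Kp)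
    (hmc : RootsIn {z | 0 ≤ z.re} (closedLoop A B Km).charpoly)
    (hpc : RootsIn {z | z.re ≤ 0} (closedLoop A B Kp).charpoly)
    (hN : ∀ x ∈ N, closedLoop A B Km *ᵥ x ∈ N) (hNp : N ≤ specPos (closedLoop A B Km))
    (hP : IsProjectionAlong P N (gapComplement (Kp - Km) N)) :
    specZero (closedLoop A B (mixed Km Kp P)) = kerM (Kp - Km) := by
  have hz := specZero_eq_ker_gap_pos hst hm hp hmc hpc
  ext x
  constructor
  · intro hx
    obtain ⟨p, hpr, hpx⟩ := mem_specZero.1 hx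
    obtain ⟨n, hn, w, hw, rfl, -⟩ := hP.exists_add x
    obtain ⟨h1, h2⟩ := (aeval_mixed hm.1 hp.1 hN hP p hn hw).1 hpx
    obtain ⟨q, hqr, hqn⟩ := mem_specPos.1 (hNp hn)
    have hn0 := eq_zero_of_roots disjoint_zero_pos hpr hqr h1 hqn
    rw [hn0, zero_add, ← hz]
    exact mem_specZero.2 ⟨p, hpr, h2⟩
  · intro hx
    have hx' : x ∈ gapComplement (Kp - Km) N := by
      intro y _
      have : (Kp - Km).mulVecLin x = 0 := hx
      rw [this, dotProduct_zero]
    rw [← hz] at hx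
    obtain ⟨p, hpr, hpx⟩ := mem_specZero.1 hx
    refine mem_specZero.2 ⟨p, hpr, ?_⟩
    have := (aeval_mixed hm.1 hp.1 hN hP p (Submodule.zero_mem _) hx').2 ⟨by simp, hpx⟩
    simpa using this

theorem specNeg_mixed (hm : Km ∈ areSolutions A B Q) (hp : Kp ∈ areSolutions A B Q)
    (hN : ∀ x ∈ N, closedLoop A B Km *ᵥ x ∈ N) (hNp : N ≤ specPos (closedLoop A B Km))
    (hP : IsProjectionAlong P N (gapComplement (Kp - Km) N)) :
    specNeg (closedLoop A B (mixed Km Kp P)) =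
      specNeg (closedLoop A B Kp) ⊓ gapComplement (Kp - Km) N := by
  ext x
  rw [Submodule.mem_inf]
  constructor
  · intro hx
    obtain ⟨p, hpr, hpx⟩ := mem_specNeg.1 hx
    obtain ⟨n, hn, w, hw, rfl, -⟩ := hP.exists_add x
    obtain ⟨h1, h2⟩ := (aeval_mixed hm hp hN hP p hn hw).1 hpx
    obtain ⟨q, hqr, hqn⟩ := mem_specPos.1 (hNp hn)
    have hn0 := eq_zero_of_roots disjoint_neg_pos hpr hqr h1 hqn
    rw [hn0, zero_add]
    exact ⟨mem_specNeg.2 ⟨p, hpr, h2⟩, hw⟩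
  · rintro ⟨hx, hx'⟩
    obtain ⟨p, hpr, hpx⟩ := mem_specNeg.1 hx
    refine mem_specNeg.2 ⟨p, hpr, ?_⟩
    have := (aeval_mixed hm hp hN hP p (Submodule.zero_mem _) hx').2 ⟨by simp, hpx⟩
    simpa using this

end Gap

end Riccati

end IndefLQ

namespace IndefLQ

/-! ### Primitives of locally integrable functions on the half line -/

/-- On `[0, ∞)` the function `f` is a primitive of the locally integrable function `f'`. -/
def Prim (f f' : ℝ → ℝ) : Prop :=
  (∀ T, 0 ≤ T → IntervalIntegrable f' volume 0 T) ∧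
    ∀ t, 0 ≤ t → f t = f 0 + ∫ s in (0 : ℝ)..t, f' s

namespace Prim

variable {f f' g g' : ℝ → ℝ}

theorem continuousOn (hf : Prim f f') : ContinuousOn f (Set.Ici 0) := by
  intro t ht
  have ht' : (0 : ℝ) ≤ t := ht
  have h1 := intervalIntegral.continuousOn_primitive_interval' (hf.1 (t + 1) (by linarith))
    (Set.left_mem_uIcc)
  rw [Set.uIcc_of_le (by linarith)] at h1
  have h2 : ContinuousWithinAt f (Set.Icc 0 (t + 1)) t := by
    have h3 : ContinuousOn (fun t => f 0 + ∫ s in (0 : ℝ)..t, f' s) (Set.Icc 0 (t + 1)) :=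
      continuousOn_const.add h1
    exact (h3 t ⟨ht', by linarith⟩).congr (fun y hy => hf.2 y hy.1) (hf.2 t ht')
  refine h2.mono_of_mem_nhdsWithin ?_
  rw [← Set.Ici_inter_Iic]
  exact inter_mem self_mem_nhdsWithin
    (mem_nhdsWithin_of_mem_nhds (Iic_mem_nhds (lt_add_one t)))

theorem congr (hf : Prim f f') (h : ∀ t, 0 ≤ t → g t = f t) : Prim g f' :=
  ⟨hf.1, fun t ht => by rw [h t ht, h 0 le_rfl, hf.2 t ht]⟩

theorem congr_ae (hf : Prim f f') (h : g' =ᵐ[volume.restrict (Set.Ici 0)] f') : Prim f g' := by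
  have h' : ∀ T, 0 ≤ T → f' =ᵐ[volume.restrict (Set.uIoc 0 T)] g' := by
    intro T hT
    rw [Set.uIoc_of_le hT]
    have hs : Set.Ioc 0 T ⊆ Set.Ici (0 : ℝ) := fun x hx => hx.1.le
    exact EventuallyEq.symm (ae_restrict_of_ae_restrict_of_subset hs h)
  refine ⟨fun T hT => (hf.1 T hT).congr_ae (h' T hT), fun t ht => ?_⟩
  rw [hf.2 t ht, intervalIntegral.integral_congr_ae_restrict (h' t ht)]

theorem congr_deriv (hf : Prim f f') (h : ∀ t, 0 ≤ t → g' t = f' t) : Prim f g' :=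
  hf.congr_ae ((ae_restrict_iff' measurableSet_Ici).2 (Eventually.of_forall h))

theorem add (hf : Prim f f') (hg : Prim g g') :
    Prim (fun t => f t + g t) (fun t => f' t + g' t) := by
  refine ⟨fun T hT => (hf.1 T hT).add (hg.1 T hT), fun t ht => ?_⟩
  beta_reduce
  rw [intervalIntegral.integral_add (hf.1 t ht) (hg.1 t ht), hf.2 t ht, hg.2 t ht]
  ring

theorem const_mul (c : ℝ) (hf : Prim f f') : Prim (fun t => c * f t) (fun t => c * f' t) := by
  refine ⟨fun T hT => (hf.1 T hT).const_mul c, fun t ht => ?_⟩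
  beta_reduce
  rw [intervalIntegral.integral_const_mul, hf.2 t ht]
  ring

theorem neg (hf : Prim f f') : Prim (fun t => -f t) (fun t => -f' t) := by
  have h := hf.const_mul (-1)
  simpa only [neg_one_mul] using h

theorem sub (hf : Prim f f') (hg : Prim g g') :
    Prim (fun t => f t - g t) (fun t => f' t - g' t) := by
  have h := hf.add hg.neg
  simpa only [← sub_eq_add_neg] using h

theorem const (c : ℝ) : Prim (fun _ => c) (fun _ => 0) :=
  ⟨fun _ _ => intervalIntegrable_const, fun t _ => by simp⟩

theorem sum {α : Type*} (s : Finset α) {F F' : α → ℝ → ℝ} (h : ∀ i ∈ s, Prim (F i) (F' i)) :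
    Prim (fun t => ∑ i ∈ s, F i t) (fun t => ∑ i ∈ s, F' i t) := by
  classical
  induction s using Finset.induction_on with
  | empty => simpa using Prim.const 0
  | insert a s ha ih =>
    simp only [Finset.sum_insert ha]
    exact (h a (Finset.mem_insert_self _ _)).add
      (ih fun i hi => h i (Finset.mem_insert_of_mem hi))

theorem of_hasDerivAt (h : ∀ t, HasDerivAt f (f' t) t) (hc : Continuous f') : Prim f f' := by
  refine ⟨fun T _ => hc.intervalIntegrable _ _, fun t ht => ?_⟩
  rw [intervalIntegral.integral_eq_sub_of_hasDerivAt (fun s _ => h s) (hc.intervalIntegrable _ _)]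
  ring

/-- Integration by parts for absolutely continuous functions. Both functions are replaced by their
integral representations, because nothing is assumed about them at negative times. -/
theorem mul (hf : Prim f f') (hg : Prim g g') :
    Prim (fun t => f t * g t) (fun t => f' t * g t + f t * g' t) := by
  have key : ∀ {f f' : ℝ → ℝ}, Prim f f' → ∀ T, 0 ≤ T →
      AbsolutelyContinuousOnInterval (fun t => f 0 + ∫ s in (0 : ℝ)..t, f' s) 0 T ∧
      (∀ᵐ t, t ∈ Set.uIcc 0 T → deriv (fun t => f 0 + ∫ s in (0 : ℝ)..t, f' s) t = f' t) := by
    intro f f' hf T hT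
    constructor
    · exact (LipschitzWith.const (f 0)).lipschitzOnWith.absolutelyContinuousOnInterval.add
        ((hf.1 T hT).absolutelyContinuousOnInterval_intervalIntegral Set.left_mem_uIcc)
    · filter_upwards [(hf.1 T hT).ae_hasDerivAt_integral] with t ht hmem
      exact ((ht hmem 0 Set.left_mem_uIcc).const_add (f 0)).deriv
  have hint : ∀ T, 0 ≤ T → IntervalIntegrable (fun t => f' t * g t + f t * g' t) volume 0 T := by
    intro T hT
    have hs : Set.uIcc 0 T ⊆ Set.Ici (0 : ℝ) := by
      rw [Set.uIcc_of_le hT]; exact fun x hx => hx.1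
    exact ((hf.1 T hT).mul_continuousOn (hg.continuousOn.mono hs)).add
      ((hg.1 T hT).continuousOn_mul (hf.continuousOn.mono hs))
  refine ⟨hint, fun T hT => ?_⟩
  obtain ⟨af, df⟩ := key hf T hT
  obtain ⟨ag, dg⟩ := key hg T hT
  have h := af.integral_deriv_mul_eq_sub ag
  have h2 : ∫ x in (0 : ℝ)..T, (deriv (fun t => f 0 + ∫ s in (0 : ℝ)..t, f' s) x *
      (g 0 + ∫ s in (0 : ℝ)..x, g' s) + (f 0 + ∫ s in (0 : ℝ)..x, f' s) *
      deriv (fun t => g 0 + ∫ s in (0 : ℝ)..t, g' s) x) =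
      ∫ x in (0 : ℝ)..T, (f' x * g x + f x * g' x) := by
    refine intervalIntegral.integral_congr_ae ?_
    filter_upwards [df, dg] with x h1 h2 hx
    have hx' := Set.uIoc_subset_uIcc hx
    rw [h1 hx', h2 hx']
    rw [Set.uIcc_of_le hT] at hx'
    rw [← hf.2 x hx'.1, ← hg.2 x hx'.1]
  rw [h2] at h
  rw [h, ← hf.2 T hT, ← hg.2 T hT]
  simp

/-- The primitive is bounded by its initial value plus the integral of a bound of the
derivative. -/
theorem le_add_integral (hf : Prim f f') {T : ℝ} (hT : 0 ≤ T)
    (hg : IntervalIntegrable g volume 0 T) (h : ∀ t ∈ Set.Icc 0 T, f' t ≤ g t) :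
    f T ≤ f 0 + ∫ s in (0 : ℝ)..T, g s := by
  rw [hf.2 T hT]
  have := intervalIntegral.integral_mono_on hT (hf.1 T hT) hg h
  linarith

end Prim

/-! ### Vector-valued primitives and linear differential equations -/

section VectorPrimitives

variable {ι κ : Type*} [Fintype ι] [DecidableEq ι] [Fintype κ] [DecidableEq κ]

/-- On `[0, ∞)` the vector function `x` is a primitive of `x'`. -/
def VPrim (x x' : ℝ → ι → ℝ) : Prop := ∀ i, Prim (fun t => x t i) (fun t => x' t i)

namespace VPrim

variable {x x' y y' : ℝ → ι → ℝ}

theorem continuousOn (h : VPrim x x') : ContinuousOn x (Set.Ici 0) :=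
  continuousOn_pi.2 fun i => (h i).continuousOn

theorem sub (hx : VPrim x x') (hy : VPrim y y') :
    VPrim (fun t => x t - y t) (fun t => x' t - y' t) := fun i => (hx i).sub (hy i)

theorem congr (hx : VPrim x x') (h : ∀ t, 0 ≤ t → y t = x t) : VPrim y x' :=
  fun i => (hx i).congr fun t ht => by rw [h t ht]

theorem congr_deriv (hx : VPrim x x') (h : ∀ t, 0 ≤ t → y' t = x' t) : VPrim x y' :=
  fun i => (hx i).congr_deriv fun t ht => by rw [h t ht]

theorem congr_ae (hx : VPrim x x') (h : y' =ᵐ[volume.restrict (Set.Ici 0)] x') : VPrim x y' :=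
  fun i => (hx i).congr_ae (h.mono fun _ ht => congrFun ht i)

theorem mulVec (Y : Matrix κ ι ℝ) (hx : VPrim x x') :
    VPrim (fun t => Y *ᵥ x t) (fun t => Y *ᵥ x' t) := fun i => by
  simp only [Matrix.mulVec, dotProduct]
  exact Prim.sum _ fun j _ => (hx j).const_mul _

theorem dot (hx : VPrim x x') (hy : VPrim y y') :
    Prim (fun t => x t ⬝ᵥ y t) (fun t => x' t ⬝ᵥ y t + x t ⬝ᵥ y' t) := by
  simp only [dotProduct, ← Finset.sum_add_distrib]
  exact Prim.sum _ fun j _ => (hx j).mul (hy j)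

theorem form {K : Matrix ι ι ℝ} (hK : K.IsSymm) (hx : VPrim x x') :
    Prim (fun t => x t ⬝ᵥ K *ᵥ x t) (fun t => 2 * (x t ⬝ᵥ K *ᵥ x' t)) := by
  refine (hx.dot (hx.mulVec K)).congr_deriv fun t _ => ?_
  rw [symm_dot hK (x' t) (x t)]
  ring

theorem of_hasDerivAt (h : ∀ t, HasDerivAt x (x' t) t) (hc : Continuous x') : VPrim x x' :=
  fun i => Prim.of_hasDerivAt (fun t => hasDerivAt_pi.1 (h t) i)
    ((continuous_apply i).comp hc)

end VPrim

theorem continuous_flow_mulVec (M : Matrix ι ι ℝ) (v : ι → ℝ) :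
    Continuous fun t => flow M t *ᵥ v :=
  continuous_iff_continuousAt.2 fun t => (hasDerivAt_flow_mulVec M v t).continuousAt

theorem continuous_flow_apply (M : Matrix ι ι ℝ) (i j : ι) : Continuous fun t => flow M t i j :=
  continuous_iff_continuousAt.2 fun t => (hasDerivAt_flow_apply M t i j).continuousAt

theorem continuous_mulVec_of {X : Type*} [TopologicalSpace X] {f : X → ι → ℝ} (Y : Matrix κ ι ℝ) (hf : Continuous f) :
    Continuous fun t => Y *ᵥ f t := by
  refine continuous_pi fun i => ?_
  simp only [Matrix.mulVec, dotProduct]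
  fun_prop

theorem vprim_flow (M : Matrix ι ι ℝ) (v : ι → ℝ) :
    VPrim (fun t => flow M t *ᵥ v) (fun t => M *ᵥ (flow M t *ᵥ v)) :=
  VPrim.of_hasDerivAt (hasDerivAt_flow_mulVec M v)
    (continuous_mulVec_of M (continuous_flow_mulVec M v))

/-- Product rule for a matrix flow applied to a primitive. -/
theorem VPrim.flow_mulVec (M : Matrix ι ι ℝ) {c c' : ℝ → ι → ℝ} (hc : VPrim c c') :
    VPrim (fun t => flow M t *ᵥ c t) (fun t => M *ᵥ (flow M t *ᵥ c t) + flow M t *ᵥ c' t) := by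
  intro i
  have hf : ∀ j, Prim (fun t => flow M t i j) (fun t => (M * flow M t) i j) := fun j =>
    Prim.of_hasDerivAt (fun t => hasDerivAt_flow_apply M t i j) (by
      simp only [Matrix.mul_apply]
      exact continuous_finsetSum _ fun k _ => continuous_const.mul (continuous_flow_apply M k j))
  have h := Prim.sum Finset.univ fun j (_ : j ∈ Finset.univ) => (hf j).mul (hc j)
  simp only [Finset.sum_add_distrib] at h
  refine (h.congr fun t _ => rfl).congr_deriv fun t _ => ?_
  beta_reduce
  rw [Matrix.mulVec_mulVec]
  rfl

/-- Uniqueness for `ẋ = M x` in the class of absolutely continuous functions. -/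
theorem VPrim.eq_flow {M : Matrix ι ι ℝ} {x : ℝ → ι → ℝ} (hx : VPrim x fun t => M *ᵥ x t) {t : ℝ}
    (ht : 0 ≤ t) : x t = flow M t *ᵥ x 0 := by
  refine eq_flow_of_hasDerivAt hx.continuousOn (fun s hs => ?_) ht
  rw [hasDerivAt_pi]
  intro i
  -- The derivative M x is itself continuous, so the absolutely continuous solution is
  -- differentiable at every positive time.
  have hcont : ContinuousOn (fun s => (M *ᵥ x s) i) (Set.Ici 0) := by
    simp only [Matrix.mulVec, dotProduct]
    exact continuousOn_finsetSum _ fun j _ =>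
      continuousOn_const.mul (hx j).continuousOn
  have hnhds : Set.Ici (0 : ℝ) ∈ 𝓝 s := Ici_mem_nhds hs
  have h1 : HasDerivAt (fun u => ∫ r in (0 : ℝ)..u, (M *ᵥ x r) i) ((M *ᵥ x s) i) s := by
    refine intervalIntegral.integral_hasDerivAt_right ((hx i).1 s hs.le) ?_
      (hcont.continuousAt hnhds)
    exact hcont.stronglyMeasurableAtFilter_nhdsWithin measurableSet_Ici s |> fun h => by
      rwa [nhdsWithin_eq_nhds.2 hnhds] at h
  refine (h1.const_add (x 0 i)).congr_of_eventuallyEq ?_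
  filter_upwards [hnhds] with u hu
  exact (hx i).2 u hu

end VectorPrimitives

end IndefLQ

namespace IndefLQ

/-! ### Locally square integrable functions -/

namespace L2loc

variable {k l : ℕ}

theorem intervalIntegrable {u : ℝ → Fin k → ℝ} (hu : L2loc u) {T : ℝ} (hT : 0 ≤ T) :
    IntervalIntegrable (fun t => u t ⬝ᵥ u t) volume 0 T := by
  rw [intervalIntegrable_iff_integrableOn_Ioc_of_le hT]
  exact (hu.2 T hT).mono_set Set.Ioc_subset_Icc_self

theorem of_continuousOn {x : ℝ → Fin k → ℝ} (hx : ContinuousOn x (Set.Ici 0)) : L2loc x := by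
  refine ⟨hx.aestronglyMeasurable measurableSet_Ici, fun T _ => ?_⟩
  refine ContinuousOn.integrableOn_Icc ?_
  have h : ContinuousOn x (Set.Icc 0 T) := hx.mono fun t ht => ht.1
  simp only [dotProduct]
  exact continuousOn_finsetSum _ fun i _ =>
    ((continuousOn_pi.1 h) i).mul ((continuousOn_pi.1 h) i)

theorem of_le {u : ℝ → Fin k → ℝ} {g : ℝ → ℝ}
    (hm : AEStronglyMeasurable u (volume.restrict (Set.Ici 0)))
    (hg : ∀ T, 0 ≤ T → IntegrableOn g (Set.Icc 0 T)) (h : ∀ t, u t ⬝ᵥ u t ≤ g t) : L2loc u := by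
  refine ⟨hm, fun T hT => ?_⟩
  refine Integrable.mono' (hg T hT) ?_ (Eventually.of_forall fun t => ?_)
  · have h1 : AEStronglyMeasurable (fun t => u t ⬝ᵥ u t) (volume.restrict (Set.Ici 0)) := by
      have hc : Continuous fun v : Fin k → ℝ => v ⬝ᵥ v := by
        simp only [dotProduct]; fun_prop
      exact hc.comp_aestronglyMeasurable hm
    exact h1.mono_set fun t ht => ht.1
  · rw [Real.norm_of_nonneg (dot_self_nonneg _)]
    exact h t

theorem add {u v : ℝ → Fin k → ℝ} (hu : L2loc u) (hv : L2loc v) :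
    L2loc fun t => u t + v t := by
  refine of_le (g := fun t => 2 * (u t ⬝ᵥ u t) + 2 * (v t ⬝ᵥ v t)) (hu.1.add hv.1)
    (fun T hT => ((hu.2 T hT).const_mul 2).add ((hv.2 T hT).const_mul 2)) fun t => ?_
  have h := dot_self_nonneg (u t - v t)
  simp only [dotProduct_add, add_dotProduct, dotProduct_sub, sub_dotProduct] at h ⊢
  rw [dotProduct_comm (v t) (u t)] at h ⊢
  linarith

/-- Inner products of locally square integrable functions are locally integrable. -/
theorem intervalIntegrable_dot {u v : ℝ → Fin k → ℝ} (hu : L2loc u) (hv : L2loc v) {T : ℝ}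
    (hT : 0 ≤ T) : IntervalIntegrable (fun t => u t ⬝ᵥ v t) volume 0 T := by
  have h := ((((hu.add hv).intervalIntegrable hT).sub (hu.intervalIntegrable hT)).sub
    (hv.intervalIntegrable hT)).const_mul (1 / 2)
  refine h.congr fun t _ => ?_
  simp only [dotProduct_add, add_dotProduct]
  rw [dotProduct_comm (v t) (u t)]
  ring

theorem intervalIntegrable_apply {u : ℝ → Fin k → ℝ} (hu : L2loc u) (i : Fin k) {T : ℝ}
    (hT : 0 ≤ T) : IntervalIntegrable (fun t => u t i) volume 0 T := by
  have h := hu.intervalIntegrable_dot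
    (of_continuousOn (x := fun _ => Pi.single i (1 : ℝ)) continuousOn_const) hT
  refine h.congr fun t _ => ?_
  simp

end L2loc

/-! ### Trajectories -/

section Trajectories

variable {n m : ℕ}

theorem intervalIntegrable_mulVec_apply {k : ℕ} {f : ℝ → Matrix (Fin k) (Fin m) ℝ}
    (hf : ∀ i j, Continuous fun t => f t i j) {u : ℝ → Fin m → ℝ} (hu : L2loc u) (i : Fin k)
    {T : ℝ} (hT : 0 ≤ T) : IntervalIntegrable (fun t => (f t *ᵥ u t) i) volume 0 T := by
  simp only [Matrix.mulVec, dotProduct]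
  have h := IntervalIntegrable.sum (s := Finset.univ) (μ := volume) (a := 0) (b := T)
    (f := fun j t => f t i j * u t j) fun j _ =>
      (hu.intervalIntegrable_apply j hT).continuousOn_mul (hf i j).continuousOn
  refine h.congr fun t _ => ?_
  simp

theorem continuous_flow_neg_mul (A : Matrix (Fin n) (Fin n) ℝ) (B : Matrix (Fin n) (Fin m) ℝ)
    (i : Fin n) (j : Fin m) : Continuous fun t => (flow A (-t) * B) i j := by
  simp only [Matrix.mul_apply]
  exact continuous_finsetSum _ fun k _ =>
    ((continuous_flow_apply A i k).comp continuous_neg).mul continuous_const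

theorem traj_zero (A : Matrix (Fin n) (Fin n) ℝ) (B : Matrix (Fin n) (Fin m) ℝ)
    (x₀ : Fin n → ℝ) (u : ℝ → Fin m → ℝ) : traj A B x₀ u 0 = x₀ := by
  simp [traj]

/-- The trajectory satisfies the differential equation. -/
theorem vprim_traj (A : Matrix (Fin n) (Fin n) ℝ) (B : Matrix (Fin n) (Fin m) ℝ)
    (x₀ : Fin n → ℝ) {u : ℝ → Fin m → ℝ} (hu : L2loc u) :
    VPrim (traj A B x₀ u) fun t => A *ᵥ traj A B x₀ u t + B *ᵥ u t := by
  have hint : ∀ i, ∀ T, 0 ≤ T →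
      IntervalIntegrable (fun t => ((flow A (-t) * B) *ᵥ u t) i) volume 0 T := fun i T hT =>
    intervalIntegrable_mulVec_apply (continuous_flow_neg_mul A B) hu i hT
  have hvec : ∀ T, 0 ≤ T →
      IntervalIntegrable (fun t => (flow A (-t) * B) *ᵥ u t) volume 0 T := by
    intro T hT
    rw [intervalIntegrable_iff_integrableOn_Ioc_of_le hT]
    exact Integrable.of_eval fun i =>
      (intervalIntegrable_iff_integrableOn_Ioc_of_le hT).1 (hint i T hT)
  -- Variation of constants: the trajectory is exp(tA) applied to c(t), with the flow taken out of
  -- the integral.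
  set c : ℝ → Fin n → ℝ := fun t => x₀ + ∫ s in (0 : ℝ)..t, (flow A (-s) * B) *ᵥ u s with hc
  have hcP : VPrim c fun t => (flow A (-t) * B) *ᵥ u t := by
    intro i
    refine ⟨hint i, fun t ht => ?_⟩
    have h := (ContinuousLinearMap.proj (R := ℝ) (φ := fun _ : Fin n => ℝ)
      i).intervalIntegral_comp_comm (hvec t ht)
    simp only [ContinuousLinearMap.proj_apply] at h
    simp [hc, h]
  have heq : ∀ t, 0 ≤ t → traj A B x₀ u t = flow A t *ᵥ c t := by
    intro t ht
    have h := (LinearMap.toContinuousLinearMap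
      (flow A t).mulVecLin).intervalIntegral_comp_comm (hvec t ht)
    simp only [LinearMap.coe_toContinuousLinearMap', Matrix.mulVecLin_apply] at h
    rw [hc]
    beta_reduce
    rw [Matrix.mulVec_add, ← h]
    unfold traj
    congr 1
    refine intervalIntegral.integral_congr fun s _ => ?_
    change flow A (t - s) *ᵥ (B *ᵥ u s) = flow A t *ᵥ ((flow A (-s) * B) *ᵥ u s)
    rw [sub_eq_add_neg, flow_add]
    simp only [Matrix.mulVec_mulVec, Matrix.mul_assoc]
  refine ((hcP.flow_mulVec A).congr heq).congr_deriv fun t ht => ?_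
  rw [heq t ht]
  congr 1
  rw [Matrix.mulVec_mulVec, ← Matrix.mul_assoc, flow_mul_neg, Matrix.one_mul]

/-- The trajectory generated by a feedback. -/
theorem traj_eq_flow {A : Matrix (Fin n) (Fin n) ℝ} {B : Matrix (Fin n) (Fin m) ℝ}
    {x₀ : Fin n → ℝ} {u : ℝ → Fin m → ℝ} (hu : L2loc u) {G : Matrix (Fin m) (Fin n) ℝ}
    (h : u =ᵐ[volume.restrict (Set.Ici 0)] fun t => G *ᵥ traj A B x₀ u t) {t : ℝ} (ht : 0 ≤ t) :
    traj A B x₀ u t = flow (A + B * G) t *ᵥ x₀ := by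
  have h1 : VPrim (traj A B x₀ u) fun t => (A + B * G) *ᵥ traj A B x₀ u t := by
    refine (vprim_traj A B x₀ hu).congr_ae (h.mono fun t ht => ?_)
    beta_reduce at ht ⊢
    rw [ht, Matrix.add_mulVec, Matrix.mulVec_mulVec]
  have h2 := h1.eq_flow ht
  rwa [traj_zero] at h2

/-- The input realizing a feedback. -/
theorem traj_feedback (A : Matrix (Fin n) (Fin n) ℝ) (B : Matrix (Fin n) (Fin m) ℝ)
    (G : Matrix (Fin m) (Fin n) ℝ) (x₀ : Fin n → ℝ) :
    L2loc (fun t => G *ᵥ (flow (A + B * G) t *ᵥ x₀)) ∧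
    ∀ t, 0 ≤ t → traj A B x₀ (fun t => G *ᵥ (flow (A + B * G) t *ᵥ x₀)) t =
      flow (A + B * G) t *ᵥ x₀ := by
  have hu : L2loc (fun t => G *ᵥ (flow (A + B * G) t *ᵥ x₀)) :=
    L2loc.of_continuousOn
      (continuous_mulVec_of G (continuous_flow_mulVec _ _)).continuousOn
  refine ⟨hu, fun t ht => ?_⟩
  -- The difference between the trajectory and the closed loop flow solves ẋ = A x with initial
  -- value zero.
  have h := (vprim_traj A B x₀ hu).sub (vprim_flow (A + B * G) x₀)
  have h1 := VPrim.eq_flow (M := A) (h.congr_deriv fun t _ => by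
    rw [Matrix.add_mulVec, Matrix.mulVec_sub, Matrix.mulVec_mulVec _ B G]; abel) ht
  rw [traj_zero, flow_zero, Matrix.one_mulVec, sub_self, Matrix.mulVec_zero] at h1
  exact sub_eq_zero.1 h1

theorem continuousOn_form {x : ℝ → Fin n → ℝ} (hx : ContinuousOn x (Set.Ici 0))
    (K : Matrix (Fin n) (Fin n) ℝ) : ContinuousOn (fun t => x t ⬝ᵥ K *ᵥ x t) (Set.Ici 0) := by
  have hc : Continuous fun v : Fin n → ℝ => v ⬝ᵥ K *ᵥ v := by
    simp only [Matrix.mulVec, dotProduct]; fun_prop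
  exact hc.comp_continuousOn hx

theorem intervalIntegrable_of_continuousOn {f : ℝ → ℝ} (hf : ContinuousOn f (Set.Ici 0)) {T : ℝ}
    (hT : 0 ≤ T) : IntervalIntegrable f volume 0 T := by
  refine ContinuousOn.intervalIntegrable (hf.mono ?_)
  rw [Set.uIcc_of_le hT]
  exact fun t ht => ht.1

theorem continuousOn_traj (A : Matrix (Fin n) (Fin n) ℝ) (B : Matrix (Fin n) (Fin m) ℝ)
    (x₀ : Fin n → ℝ) {u : ℝ → Fin m → ℝ} (hu : L2loc u) :
    ContinuousOn (traj A B x₀ u) (Set.Ici 0) := (vprim_traj A B x₀ hu).continuousOn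

theorem L2loc.add_mulVec_traj {A : Matrix (Fin n) (Fin n) ℝ} {B : Matrix (Fin n) (Fin m) ℝ}
    {x₀ : Fin n → ℝ} {u : ℝ → Fin m → ℝ} (hu : L2loc u) (G : Matrix (Fin m) (Fin n) ℝ) :
    L2loc fun t => u t + G *ᵥ traj A B x₀ u t := by
  refine hu.add (L2loc.of_continuousOn ?_)
  have hc : Continuous fun v : Fin n → ℝ => G *ᵥ v := continuous_mulVec_of G continuous_id
  exact hc.comp_continuousOn (continuousOn_traj A B x₀ hu)

/-- Completion of squares: the cost integrand plus the derivative of xᵀKx equals xᵀφ(K)x + |u +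
BᵀKx|². It is used with K⋆, where φ vanishes, and with Γ, where both integrands are nonnegative. -/
theorem costT_eq {A : Matrix (Fin n) (Fin n) ℝ} {B : Matrix (Fin n) (Fin m) ℝ}
    {Q K : Matrix (Fin n) (Fin n) ℝ} (hK : K.IsSymm) {x₀ : Fin n → ℝ} {u : ℝ → Fin m → ℝ}
    (hu : L2loc u) {T : ℝ} (hT : 0 ≤ T) :
    costT A B Q x₀ u T = x₀ ⬝ᵥ K *ᵥ x₀ - traj A B x₀ u T ⬝ᵥ K *ᵥ traj A B x₀ u T +
      (∫ t in (0 : ℝ)..T, traj A B x₀ u t ⬝ᵥ riccati A B Q K *ᵥ traj A B x₀ u t) +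
      ∫ t in (0 : ℝ)..T, (u t + (Bᵀ * K) *ᵥ traj A B x₀ u t) ⬝ᵥ
        (u t + (Bᵀ * K) *ᵥ traj A B x₀ u t) := by
  set x := traj A B x₀ u with hx
  have hcx := continuousOn_traj A B x₀ hu
  have hform := (vprim_traj A B x₀ hu).form hK
  have h1 := hform.2 T hT
  have i1 := intervalIntegrable_of_continuousOn (continuousOn_form hcx Q) hT
  have i2 := intervalIntegrable_of_continuousOn (continuousOn_form hcx (riccati A B Q K)) hT
  have i3 := (hu.add_mulVec_traj (A := A) (B := B) (x₀ := x₀) (Bᵀ * K)).intervalIntegrable hT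
  have i4 := hu.intervalIntegrable hT
  unfold costT
  have h2 : ∫ t in (0 : ℝ)..T, (x t ⬝ᵥ Q *ᵥ x t + u t ⬝ᵥ u t) =
      ∫ t in (0 : ℝ)..T, (x t ⬝ᵥ riccati A B Q K *ᵥ x t +
        (u t + (Bᵀ * K) *ᵥ x t) ⬝ᵥ (u t + (Bᵀ * K) *ᵥ x t) -
        2 * (x t ⬝ᵥ K *ᵥ (A *ᵥ x t + B *ᵥ u t))) := by
    refine intervalIntegral.integral_congr fun t _ => ?_
    rw [riccati_form hK, ← Matrix.mulVec_mulVec]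
    have h3 : x t ⬝ᵥ K *ᵥ (B *ᵥ u t) = u t ⬝ᵥ Bᵀ *ᵥ (K *ᵥ x t) := by
      rw [symm_dot hK, dotProduct_comm, dot_mulVec B, dotProduct_comm]
    simp only [Matrix.mulVec_add, dotProduct_add, add_dotProduct]
    rw [h3, dotProduct_comm (Bᵀ *ᵥ (K *ᵥ x t)) (u t)]
    ring
  rw [h2, intervalIntegral.integral_sub (i2.add i3) (hform.1 T hT),
    intervalIntegral.integral_add i2 i3]
  beta_reduce at h1
  rw [traj_zero] at h1
  linarith

end Trajectories

end IndefLQ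

namespace IndefLQ

/-! ### Exponentially weighted integrals -/

section Weighted

/-- The integral of `g` over `[0, T]` with the weight `exp (-a (T - t))`. -/
noncomputable def weighted (a : ℝ) (g : ℝ → ℝ) (T : ℝ) : ℝ :=
  Real.exp (-(a * T)) * ∫ t in (0 : ℝ)..T, Real.exp (a * t) * g t

theorem intervalIntegrable_exp_mul (a : ℝ) {g : ℝ → ℝ} {S T : ℝ}
    (hg : IntervalIntegrable g volume S T) :
    IntervalIntegrable (fun t => Real.exp (a * t) * g t) volume S T :=
  hg.continuousOn_mul (by fun_prop : Continuous fun t => Real.exp (a * t)).continuousOn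

theorem weighted_add (a : ℝ) {g h : ℝ → ℝ} {T : ℝ} (hg : IntervalIntegrable g volume 0 T)
    (hh : IntervalIntegrable h volume 0 T) :
    weighted a (fun t => g t + h t) T = weighted a g T + weighted a h T := by
  unfold weighted
  rw [← mul_add, ← intervalIntegral.integral_add (intervalIntegrable_exp_mul a hg)
    (intervalIntegrable_exp_mul a hh)]
  simp only [mul_add]

theorem weighted_nonneg (a : ℝ) {g : ℝ → ℝ} (hg : ∀ t, 0 ≤ g t) {T : ℝ} (hT : 0 ≤ T) :
    0 ≤ weighted a g T :=
  mul_nonneg (Real.exp_nonneg _)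
    (intervalIntegral.integral_nonneg hT fun t _ => mul_nonneg (Real.exp_nonneg _) (hg t))

theorem exp_mul_integral_le {a : ℝ} (ha : 0 < a) {g : ℝ → ℝ} (h0 : ∀ t, 0 ≤ g t) {S T : ℝ}
    (hST : S ≤ T) (hg : IntervalIntegrable g volume S T) :
    Real.exp (-(a * T)) * ∫ t in S..T, Real.exp (a * t) * g t ≤ ∫ t in S..T, g t := by
  rw [← intervalIntegral.integral_const_mul]
  refine intervalIntegral.integral_mono_on hST
    ((intervalIntegrable_exp_mul a hg).const_mul _) hg fun t ht => ?_
  rw [← mul_assoc, ← Real.exp_add]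
  have h1 : Real.exp (-(a * T) + a * t) ≤ 1 := by
    rw [Real.exp_le_one_iff]
    nlinarith [ht.2]
  exact mul_le_of_le_one_left (h0 t) h1

/-- The weight never exceeds one. This handles supplies with bounded integral; `weighted_le_of_le`
handles bounded supplies. -/
theorem weighted_le_of_integral_le {a : ℝ} (ha : 0 < a) {g : ℝ → ℝ} (h0 : ∀ t, 0 ≤ g t)
    {C T : ℝ} (hT : 0 ≤ T) (hg : IntervalIntegrable g volume 0 T)
    (hC : ∫ t in (0 : ℝ)..T, g t ≤ C) : weighted a g T ≤ C :=
  (exp_mul_integral_le ha h0 hT hg).trans hC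

/-- The total mass of the weight is at most 1/a. -/
theorem weighted_le_of_le {a : ℝ} (ha : 0 < a) {g : ℝ → ℝ} {b T : ℝ} (hb : 0 ≤ b) (hT : 0 ≤ T)
    (hg : IntervalIntegrable g volume 0 T) (h : ∀ t ∈ Set.Icc 0 T, g t ≤ b) :
    weighted a g T ≤ b / a := by
  have h1 : ∫ t in (0 : ℝ)..T, Real.exp (a * t) * g t ≤
      ∫ t in (0 : ℝ)..T, Real.exp (a * t) * b := by
    refine intervalIntegral.integral_mono_on hT (intervalIntegrable_exp_mul a hg)
      (intervalIntegrable_exp_mul a intervalIntegrable_const) fun t ht => ?_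
    exact mul_le_mul_of_nonneg_left (h t ht) (Real.exp_nonneg _)
  have h2 : ∫ t in (0 : ℝ)..T, Real.exp (a * t) * b = (b / a) * Real.exp (a * T) - b / a := by
    rw [intervalIntegral.integral_eq_sub_of_hasDerivAt
      (f := fun t => (b / a) * Real.exp (a * t))]
    · simp
    · intro t _
      have h3 := (((hasDerivAt_id t).const_mul a).exp).const_mul (b / a)
      refine h3.congr_deriv ?_
      simp only [id]
      field_simp
    · exact intervalIntegrable_exp_mul a intervalIntegrable_const
  unfold weighted
  have h3 : 0 ≤ b / a := div_nonneg hb ha.le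
  calc Real.exp (-(a * T)) * ∫ t in (0 : ℝ)..T, Real.exp (a * t) * g t
      ≤ Real.exp (-(a * T)) * ((b / a) * Real.exp (a * T)) :=
        mul_le_mul_of_nonneg_left (by linarith) (Real.exp_nonneg _)
    _ = b / a := by
        rw [mul_comm, mul_assoc, ← Real.exp_add, add_neg_cancel, Real.exp_zero, mul_one]

theorem tendsto_exp_neg_mul {a : ℝ} (ha : 0 < a) (c : ℝ) :
    Tendsto (fun T => Real.exp (-(a * T)) * c) atTop (𝓝 0) := by
  have h1 : Tendsto (fun T : ℝ => -(a * T)) atTop atBot :=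
    tendsto_neg_atTop_atBot.comp (tendsto_id.const_mul_atTop ha)
  simpa using (Real.tendsto_exp_atBot.comp h1).mul_const c

/-- The weighted integrals of an integrable nonnegative function tend to zero. -/
theorem tendsto_weighted {a : ℝ} (ha : 0 < a) {g : ℝ → ℝ} (h0 : ∀ t, 0 ≤ g t) {C : ℝ}
    (hg : ∀ T, 0 ≤ T → IntervalIntegrable g volume 0 T)
    (hC : ∀ T, 0 ≤ T → ∫ t in (0 : ℝ)..T, g t ≤ C) : Tendsto (weighted a g) atTop (𝓝 0) := by
  have hST : ∀ S T, 0 ≤ S → S ≤ T → IntervalIntegrable g volume S T := fun S T hS h =>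
    (hg T (hS.trans h)).mono_set (by
      rw [Set.uIcc_of_le h, Set.uIcc_of_le (hS.trans h)]
      exact Set.Icc_subset_Icc_left hS)
  rw [Metric.tendsto_atTop]
  intro ε hε
  have hbdd : BddAbove (Set.range fun T : Set.Ici (0 : ℝ) => ∫ t in (0 : ℝ)..T, g t) :=
    ⟨C, by rintro _ ⟨T, rfl⟩; exact hC T T.2⟩
  -- Beyond S the integral of g contributes less than ε/2; the fixed part on [0, S] is damped by the
  -- weight.
  obtain ⟨⟨S, hS⟩, hSs⟩ := exists_lt_of_lt_ciSup
    (show (⨆ T : Set.Ici (0 : ℝ), ∫ t in (0 : ℝ)..T, g t) - ε / 2 <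
      ⨆ T : Set.Ici (0 : ℝ), ∫ t in (0 : ℝ)..T, g t by linarith)
  have hS' : (0 : ℝ) ≤ S := hS
  obtain ⟨T₁, hT₁⟩ := Metric.tendsto_atTop.1
    (tendsto_exp_neg_mul ha (∫ t in (0 : ℝ)..S, Real.exp (a * t) * g t)) (ε / 2) (by linarith)
  refine ⟨max T₁ S, fun T hT => ?_⟩
  have hTS : S ≤ T := (le_max_right _ _).trans hT
  have h1 := hT₁ T ((le_max_left _ _).trans hT)
  rw [Real.dist_eq, sub_zero] at h1 ⊢
  rw [abs_of_nonneg (weighted_nonneg a h0 (hS'.trans hTS))]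
  have h2 := exp_mul_integral_le ha h0 hTS (hST S T hS' hTS)
  have h3 := le_ciSup hbdd ⟨T, hS'.trans hTS⟩
  have h4 := intervalIntegral.integral_add_adjacent_intervals (hg S hS') (hST S T hS' hTS)
  have h5 := intervalIntegral.integral_add_adjacent_intervals
    (intervalIntegrable_exp_mul a (hg S hS')) (intervalIntegrable_exp_mul a (hST S T hS' hTS))
  unfold weighted
  rw [← h5, mul_add]
  have h6 := le_abs_self (Real.exp (-(a * T)) * ∫ t in (0 : ℝ)..S, Real.exp (a * t) * g t)
  have hSs' : (⨆ T : Set.Ici (0 : ℝ), ∫ t in (0 : ℝ)..T, g t) - ε / 2 <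
    ∫ t in (0 : ℝ)..S, g t := hSs
  have h3' : ∫ t in (0 : ℝ)..T, g t ≤ ⨆ T : Set.Ici (0 : ℝ), ∫ t in (0 : ℝ)..T, g t := h3
  linarith

end Weighted

/-! ### Lyapunov estimates along trajectories -/

section Estimates

variable {n m : ℕ}

theorem exists_form_le {ι : Type*} [Fintype ι] [DecidableEq ι] (D : Matrix ι ι ℝ) :
    ∃ c : ℝ, 0 ≤ c ∧ ∀ v : ι → ℝ, v ⬝ᵥ D *ᵥ v ≤ c * (v ⬝ᵥ v) := by
  refine ⟨∑ i, ∑ j, |D i j|, Finset.sum_nonneg fun i _ => Finset.sum_nonneg fun j _ =>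
    abs_nonneg _, fun v => ?_⟩
  have hv : ∀ i, v i ^ 2 ≤ v ⬝ᵥ v := fun i => by
    rw [sq]
    exact Finset.single_le_sum (f := fun i => v i * v i) (fun i _ => mul_self_nonneg _)
      (Finset.mem_univ i)
  rw [dotProduct, Finset.sum_mul]
  refine Finset.sum_le_sum fun i _ => ?_
  rw [Matrix.mulVec, dotProduct, Finset.mul_sum, Finset.sum_mul]
  refine Finset.sum_le_sum fun j _ => ?_
  have h1 : |v i * v j| ≤ v ⬝ᵥ v := by
    rw [abs_le]
    have := hv i
    have := hv j
    constructor <;> nlinarith [sq_nonneg (v i - v j), sq_nonneg (v i + v j)]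
  calc v i * (D i j * v j) = D i j * (v i * v j) := by ring
    _ ≤ |D i j * (v i * v j)| := le_abs_self _
    _ = |D i j| * |v i * v j| := abs_mul _ _
    _ ≤ _ := mul_le_mul_of_nonneg_left h1 (abs_nonneg _)

/-- A Lyapunov function along `ẋ = M x + B w` is dominated by its exponentially weighted
supply. -/
theorem exists_form_le_weighted {M W S : Matrix (Fin n) (Fin n) ℝ}
    (B : Matrix (Fin n) (Fin m) ℝ) (hW : 0 ≤ W) {a : ℝ} (ha : 0 < a)
    (h : ∀ x, 2 * (x ⬝ᵥ W *ᵥ (M *ᵥ x)) ≤ x ⬝ᵥ S *ᵥ x - 2 * a * (x ⬝ᵥ W *ᵥ x)) :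
    ∃ c : ℝ, 0 ≤ c ∧ ∀ {x : ℝ → Fin n → ℝ} {w : ℝ → Fin m → ℝ}, L2loc w →
      VPrim x (fun t => M *ᵥ x t + B *ᵥ w t) → ∀ T, 0 ≤ T →
      x T ⬝ᵥ W *ᵥ x T ≤ Real.exp (-(a * T)) * (x 0 ⬝ᵥ W *ᵥ x 0) +
        weighted a (fun t => x t ⬝ᵥ S *ᵥ x t + c * (w t ⬝ᵥ w t)) T := by
  obtain ⟨hWs, hW0⟩ := nonneg_iff.1 hW
  obtain ⟨c, hc, hcv⟩ := exists_form_le (Bᵀ * W * B)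
  refine ⟨1 / a * c, by positivity, fun {x w} hw hx T hT => ?_⟩
  -- The factor exp(at) absorbs one of the two a-terms in the hypothesis; the other pays for the
  -- input in the estimate below.
  have hexp : Prim (fun t => Real.exp (a * t)) (fun t => a * Real.exp (a * t)) :=
    Prim.of_hasDerivAt (fun t => by
      have := ((hasDerivAt_id t).const_mul a).exp
      refine this.congr_deriv ?_
      simp only [id]; ring) (by fun_prop)
  have hP := hexp.mul (hx.form hWs)
  have hS := intervalIntegrable_of_continuousOn (continuousOn_form hx.continuousOn S) hT
  have hg := intervalIntegrable_exp_mul a (hS.add ((hw.intervalIntegrable hT).const_mul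
    (1 / a * c)))
  have h1 := hP.le_add_integral hT hg fun t _ => by
    have h2 := h (x t)
    -- Young's inequality for the W-form, from its nonnegativity at a x - B w.
    have h3 : 2 * (x t ⬝ᵥ W *ᵥ (B *ᵥ w t)) ≤
        a * (x t ⬝ᵥ W *ᵥ x t) + 1 / a * (c * (w t ⬝ᵥ w t)) := by
      have h4 := hW0 (a • x t - B *ᵥ w t)
      have h5 := hcv (w t)
      have h6 : w t ⬝ᵥ (Bᵀ * W * B) *ᵥ w t = (B *ᵥ w t) ⬝ᵥ W *ᵥ (B *ᵥ w t) := by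
        rw [Matrix.mul_assoc, ← Matrix.mulVec_mulVec, dot_mulVec Bᵀ, Matrix.transpose_transpose,
          ← Matrix.mulVec_mulVec]
      rw [h6] at h5
      simp only [Matrix.mulVec_sub, Matrix.mulVec_smul, sub_dotProduct, dotProduct_sub,
        smul_dotProduct, dotProduct_smul, smul_eq_mul] at h4
      rw [symm_dot hWs (B *ᵥ w t) (x t)] at h4
      have h7 : a * (2 * (x t ⬝ᵥ W *ᵥ (B *ᵥ w t))) ≤
          a * (a * (x t ⬝ᵥ W *ᵥ x t) + 1 / a * (c * (w t ⬝ᵥ w t))) := by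
        have : a * (1 / a * (c * (w t ⬝ᵥ w t))) = c * (w t ⬝ᵥ w t) := by field_simp
        rw [mul_add, this]
        linarith
      exact le_of_mul_le_mul_left h7 ha
    have h8 : 2 * (x t ⬝ᵥ W *ᵥ (M *ᵥ x t + B *ᵥ w t)) + a * (x t ⬝ᵥ W *ᵥ x t) ≤
        x t ⬝ᵥ S *ᵥ x t + 1 / a * c * (w t ⬝ᵥ w t) := by
      rw [Matrix.mulVec_add, dotProduct_add]
      linarith
    have h9 := mul_le_mul_of_nonneg_left h8 (Real.exp_nonneg (a * t))
    linarith
  have h2 := mul_le_mul_of_nonneg_left h1 (Real.exp_nonneg (-(a * T)))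
  rw [← mul_assoc, ← Real.exp_add, neg_add_cancel, Real.exp_zero, one_mul, mul_add] at h2
  simpa [weighted] using h2

theorem tendsto_mulVec {ι κ : Type*} [Fintype ι] {x : ℝ → ι → ℝ} {v : ι → ℝ} (Y : Matrix κ ι ℝ)
    (h : Tendsto x atTop (𝓝 v)) : Tendsto (fun t => Y *ᵥ x t) atTop (𝓝 (Y *ᵥ v)) := by
  have hc : Continuous fun v : ι → ℝ => Y *ᵥ v := by
    refine continuous_pi fun i => ?_
    simp only [Matrix.mulVec, dotProduct]
    fun_prop
  exact (hc.tendsto v).comp h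

theorem tendsto_zero_of_dot_self {ι : Type*} [Fintype ι] {x : ℝ → ι → ℝ}
    (h : Tendsto (fun t => x t ⬝ᵥ x t) atTop (𝓝 0)) : Tendsto x atTop (𝓝 0) := by
  refine tendsto_pi_nhds.2 fun i => ?_
  have h1 : Tendsto (fun t => (x t i) ^ 2) atTop (𝓝 0) :=
    squeeze_zero (fun t => sq_nonneg _) (fun t => by
      rw [sq]
      exact Finset.single_le_sum (f := fun i => x t i * x t i) (fun i _ => mul_self_nonneg _)
        (Finset.mem_univ i)) h
  have h2 := h1.sqrt
  simp only [Real.sqrt_sq_eq_abs, Real.sqrt_zero] at h2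
  exact (tendsto_zero_iff_abs_tendsto_zero _).2 h2

theorem tendsto_mulVec_of_form {ι : Type*} [Fintype ι] [DecidableEq ι] {D : Matrix ι ι ℝ}
    (hD : 0 ≤ D) {x : ℝ → ι → ℝ} (h : Tendsto (fun t => x t ⬝ᵥ D *ᵥ x t) atTop (𝓝 0)) :
    Tendsto (fun t => D *ᵥ x t) atTop (𝓝 0) := by
  obtain ⟨c, hc, hle⟩ := exists_mulVec_sq_le hD
  refine tendsto_zero_of_dot_self (squeeze_zero (fun t => dot_self_nonneg _)
    (fun t => hle (x t)) ?_)
  simpa using h.const_mul c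

/-- The part of the state seen through the stable dynamics tends to zero under square integrable
inputs. -/
theorem tendsto_stable_part {M : Matrix (Fin n) (Fin n) ℝ} (B : Matrix (Fin n) (Fin m) ℝ)
    {q : ℝ[X]} (hq : RootsIn {z | z.re < 0} q) {k : ℕ} {Y : Matrix (Fin k) (Fin n) ℝ}
    (hY : Y * aeval M q = 0) {x : ℝ → Fin n → ℝ} {w : ℝ → Fin m → ℝ} (hw : L2loc w)
    (hx : VPrim x (fun t => M *ᵥ x t + B *ᵥ w t)) {C : ℝ}
    (hC : ∀ T, 0 ≤ T → ∫ t in (0 : ℝ)..T, w t ⬝ᵥ w t ≤ C) :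
    Tendsto (fun t => Y *ᵥ x t) atTop (𝓝 0) := by
  -- Modulo the largest invariant subspace of Ker Y the polynomial q annihilates the whole dynamics,
  -- not only its image under Y. The quotient matrix is therefore Hurwitz.
  set U := unobservableSubspace (LinearMap.ker Y.mulVecLin) M with hU
  have hUY : ∀ x ∈ U, Y *ᵥ x = 0 := fun x hx => by
    have := unobservable_le hx
    simpa using this
  have hinv : ∀ x ∈ U, M *ᵥ x ∈ U := fun x hx => unobservable_invariant hx
  obtain ⟨d, π, σ, hπσ, hker⟩ := exists_quotient_matrix U
  have hint := quotient_intertwine hπσ hker hinv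
  set N := π * M * σ with hN
  have hq0 : aeval N q = 0 := by
    have h1 := mul_aeval_of_intertwine hint q
    have h2 : π * aeval M q = 0 := mulVec_ext fun x => by
      rw [← Matrix.mulVec_mulVec, Matrix.zero_mulVec, hker, hU, mem_unobservable]
      intro p
      rw [LinearMap.mem_ker, Matrix.mulVecLin_apply, aeval_mulVec_comm, Matrix.mulVec_mulVec, hY,
        Matrix.zero_mulVec]
    rw [h2] at h1
    calc aeval N q = aeval N q * π * σ := by rw [Matrix.mul_assoc, hπσ, Matrix.mul_one]
      _ = 0 := by rw [← h1, Matrix.zero_mul]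
  -- Shifting before solving the Lyapunov equation builds the decay rate 2a into the Lyapunov
  -- function.
  obtain ⟨a, ha, hH⟩ := Hurwitz.exists_shift ⟨q, hq, hq0⟩
  obtain ⟨X, hX0, hX⟩ := exists_lyapunov hH (R := 1) Matrix.PosSemidef.one.nonneg
  obtain ⟨hXs, hXn⟩ := nonneg_iff.1 hX0
  have hlyap : ∀ v, 2 * (v ⬝ᵥ X *ᵥ (N *ᵥ v)) = -(v ⬝ᵥ v) - 2 * a * (v ⬝ᵥ X *ᵥ v) := fun v => by
    have h1 := lyapunov_form hXs (M := N + a • 1) v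
    rw [hX, Matrix.neg_mulVec, Matrix.one_mulVec, dotProduct_neg, Matrix.add_mulVec,
      Matrix.smul_mulVec, Matrix.one_mulVec, Matrix.mulVec_add, Matrix.mulVec_smul,
      dotProduct_add, dotProduct_smul, smul_eq_mul] at h1
    linarith
  obtain ⟨c, hc, hb⟩ := exists_form_le_weighted (S := 0) (π * B) hX0 ha fun v => by
    rw [hlyap v, Matrix.zero_mulVec, dotProduct_zero]
    have := dot_self_nonneg v
    linarith
  have hy : VPrim (fun t => π *ᵥ x t) fun t => N *ᵥ (π *ᵥ x t) + (π * B) *ᵥ w t :=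
    (hx.mulVec π).congr_deriv fun t _ => by
      rw [Matrix.mulVec_add, Matrix.mulVec_mulVec, Matrix.mulVec_mulVec, Matrix.mulVec_mulVec,
        hint]
  have hlim : Tendsto (fun T => (π *ᵥ x T) ⬝ᵥ X *ᵥ (π *ᵥ x T)) atTop (𝓝 0) := by
    have h1 := (tendsto_exp_neg_mul ha ((π *ᵥ x 0) ⬝ᵥ X *ᵥ (π *ᵥ x 0))).add
      (tendsto_weighted ha (g := fun t => c * (w t ⬝ᵥ w t))
        (fun t => mul_nonneg hc (dot_self_nonneg _))
        (fun T hT => (hw.intervalIntegrable hT).const_mul c) (C := c * C) fun T hT => by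
          rw [intervalIntegral.integral_const_mul]
          exact mul_le_mul_of_nonneg_left (hC T hT) hc)
    rw [add_zero] at h1
    refine tendsto_of_tendsto_of_tendsto_of_le_of_le' tendsto_const_nhds h1
      (Eventually.of_forall fun t => hXn _) ?_
    filter_upwards [eventually_ge_atTop 0] with T hT
    have h2 := hb hw hy T hT
    simpa only [Matrix.zero_mulVec, dotProduct_zero, zero_add] using h2
  have hXy := tendsto_mulVec_of_form hX0 hlim
  -- X is injective by its Lyapunov inequality, so its argument can be recovered from X times it.
  obtain ⟨Z, hZ⟩ := exists_factor (π := X) (Y := (1 : Matrix (Fin d) (Fin d) ℝ)) fun v hv => by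
    have h1 := hlyap v
    rw [symm_dot hXs, hv, dotProduct_zero, dotProduct_zero] at h1
    rw [Matrix.one_mulVec]
    exact dot_self_eq_zero.1 (by linarith)
  obtain ⟨Z', hZ'⟩ := exists_factor (π := π) (Y := Y) fun v hv => hUY v ((hker v).1 hv)
  have h1 := tendsto_mulVec (Z' * Z) hXy
  rw [Matrix.mulVec_zero] at h1
  refine h1.congr fun t => ?_
  rw [Matrix.mulVec_mulVec, Matrix.mulVec_mulVec, Matrix.mul_assoc Z' Z, ← hZ,
    Matrix.mul_one, ← hZ']

/-! ### Distance to a subspace -/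

/-- Y is a quotient map with kernel L. Its operator norm bounds Y x by the distance to L, and a
right inverse gives the reverse estimate. The constraint becomes a linear observation that tends to
zero. -/
theorem exists_subspace_distance (L : Submodule ℝ (Fin n → ℝ)) :
    ∃ (k : ℕ) (Y : Matrix (Fin k) (Fin n) ℝ), (∀ x, Y *ᵥ x = 0 ↔ x ∈ L) ∧
      ∀ x : ℝ → Fin n → ℝ, Tendsto (fun t => eucDist L (x t)) atTop (𝓝 0) ↔
        Tendsto (fun t => Y *ᵥ x t) atTop (𝓝 0) := by
  obtain ⟨k, Y, σ, hσ, hker⟩ := exists_quotient_matrix L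
  refine ⟨k, Y, hker, fun x => ⟨fun h => ?_, fun h => ?_⟩⟩
  · let Λ : EuclideanSpace ℝ (Fin n) →L[ℝ] (Fin k → ℝ) :=
      LinearMap.toContinuousLinearMap
        (Y.mulVecLin ∘ₗ (WithLp.linearEquiv 2 ℝ (Fin n → ℝ)).toLinearMap)
    have hΛ : ∀ v, Λ (WithLp.toLp 2 v) = Y *ᵥ v := fun v => rfl
    have hle : ∀ v, ‖Y *ᵥ v‖ ≤ (‖Λ‖ + 1) * eucDist L v := fun v => by
      have hpos : 0 < ‖Λ‖ + 1 := by positivity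
      rw [← div_le_iff₀' hpos]
      refine (Metric.le_infDist (Set.Nonempty.image _ ⟨0, L.zero_mem⟩)).2 ?_
      rintro _ ⟨y, hy, rfl⟩
      rw [div_le_iff₀' hpos, dist_eq_norm, ← WithLp.toLp_sub]
      have h1 : Y *ᵥ v = Λ (WithLp.toLp 2 (v - y)) := by
        rw [hΛ, Matrix.mulVec_sub, (hker y).2 hy, sub_zero]
      rw [h1]
      exact (Λ.le_opNorm _).trans (mul_le_mul_of_nonneg_right (by linarith) (norm_nonneg _))
    refine squeeze_zero_norm (fun t => hle (x t)) ?_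
    simpa using h.const_mul (‖Λ‖ + 1)
  · have h1 : Continuous fun v : Fin k → ℝ => ‖(WithLp.toLp 2 (σ *ᵥ v) : EuclideanSpace ℝ (Fin n))‖ :=
      (PiLp.continuous_toLp 2 _ |>.comp (continuous_mulVec_of σ continuous_id)).norm
    have h2 := (h1.tendsto 0).comp h
    rw [Matrix.mulVec_zero, WithLp.toLp_zero, norm_zero] at h2
    refine squeeze_zero (fun t => Metric.infDist_nonneg) (fun t => ?_) h2
    have hmem : x t - σ *ᵥ (Y *ᵥ x t) ∈ L := by
      rw [← hker, Matrix.mulVec_sub, Matrix.mulVec_mulVec, hσ, Matrix.one_mulVec, sub_self]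
    refine (Metric.infDist_le_dist_of_mem (Set.mem_image_of_mem _ hmem)).trans (le_of_eq ?_)
    rw [dist_eq_norm, ← WithLp.toLp_sub, sub_sub_cancel]
    rfl

end Estimates

end IndefLQ

namespace IndefLQ

section SpectralDecomposition

variable {ι κ : Type*} [Fintype ι] [DecidableEq ι] [Fintype κ] [DecidableEq κ]

/-! ### Spectral decomposition and the off-diagonal block -/

/-- A real polynomial splits into factors with roots in the left half plane, on the imaginary axis
and in the right half plane. -/
theorem exists_spectral_split (M : Matrix ι ι ℝ) :
    ∃ p q r : ℝ[X], RootsIn {z | z.re < 0} p ∧ RootsIn {z | z.re = 0} q ∧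
      RootsIn {z | 0 < z.re} r ∧ aeval M (p * q * r) = 0 := by
  obtain ⟨p, s, hp, hs, hps⟩ := exists_split (S := {z | z.re < 0}) (fun z hz => by
    have : z.re < 0 := hz
    simpa using this) M.charpoly_monic.ne_zero
  obtain ⟨q, r, hq, hr, hqr⟩ := exists_split (S := {z | z.re = 0}) (fun z hz => by
    have : z.re = 0 := hz
    simpa using this) hs.1
  refine ⟨p, q, r, hp, hq, ⟨hr.1, fun z hz => ?_⟩, ?_⟩
  · have h1 : ¬ z.re = 0 := hr.2 z hz
    have h2 : ¬ z.re < 0 := hs.2 z (by rw [hqr, map_mul, hz, mul_zero])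
    exact lt_of_le_of_ne (not_lt.1 h2) (Ne.symm h1)
  · rw [mul_assoc, ← hqr, ← hps, Matrix.aeval_self_charpoly]

theorem re_nonpos_conj : ∀ z ∈ {z : ℂ | z.re ≤ 0}, (starRingEnd ℂ) z ∈ {z : ℂ | z.re ≤ 0} :=
  fun z hz => by
    have : z.re ≤ 0 := hz
    simpa using this

/-- The spectral subspace of the closed left half plane. -/
theorem mem_spectral_nonpos {M : Matrix ι ι ℝ} {x : ι → ℝ} :
    x ∈ spectralSubspace {z | z.re ≤ 0} M ↔
      ∃ p, RootsIn {z | z.re ≤ 0} p ∧ aeval M p *ᵥ x = 0 :=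
  mem_spectralSubspace re_nonpos_conj

theorem spectral_nonpos_eq (M : Matrix ι ι ℝ) :
    spectralSubspace {z | z.re ≤ 0} M = specZero M ⊔ specNeg M := by
  refine le_antisymm (fun x hx => ?_) (sup_le (fun x hx => ?_) fun x hx => ?_)
  · obtain ⟨s, hs, hsx⟩ := mem_spectral_nonpos.1 hx
    obtain ⟨p, q, r, hp, hq, hr, hM⟩ := exists_spectral_split M
    have h1 : aeval M (p * q) *ᵥ x = 0 := by
      refine eq_zero_of_roots (M := M) disjoint_nonpos_pos hs hr ?_ ?_
      · rw [aeval_mulVec_comm, hsx, Matrix.mulVec_zero]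
      · rw [← aeval_mul_mulVec, mul_comm r, hM, Matrix.zero_mulVec]
    obtain ⟨a, b, hab⟩ := hp.isCoprime disjoint_neg_zero hq
    have h2 : x = aeval M (a * p) *ᵥ x + aeval M (b * q) *ᵥ x := by
      rw [← Matrix.add_mulVec, ← map_add, hab, map_one, Matrix.one_mulVec]
    rw [h2]
    refine Submodule.add_mem_sup (mem_specZero.2 ⟨q, hq, ?_⟩) (mem_specNeg.2 ⟨p, hp, ?_⟩)
    · rw [← aeval_mul_mulVec, show q * (a * p) = a * (p * q) by ring, aeval_mul_mulVec, h1,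
        Matrix.mulVec_zero]
    · rw [← aeval_mul_mulVec, show p * (b * q) = b * (p * q) by ring, aeval_mul_mulVec, h1,
        Matrix.mulVec_zero]
  · obtain ⟨p, hp, hpx⟩ := mem_specZero.1 hx
    exact mem_spectral_nonpos.2 ⟨p, hp.mono fun z hz => le_of_eq hz, hpx⟩
  · obtain ⟨p, hp, hpx⟩ := mem_specNeg.1 hx
    exact mem_spectral_nonpos.2 ⟨p, hp.mono fun z hz => show z.re ≤ 0 from le_of_lt hz, hpx⟩

theorem isCompl_specPos (M : Matrix ι ι ℝ) :
    IsCompl (specPos M) (spectralSubspace {z | z.re ≤ 0} M) := by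
  constructor
  · rw [Submodule.disjoint_def]
    intro x hx hx'
    obtain ⟨p, hp, hpx⟩ := mem_specPos.1 hx
    obtain ⟨q, hq, hqx⟩ := mem_spectral_nonpos.1 hx'
    exact eq_zero_of_roots disjoint_nonpos_pos hq hp hqx hpx
  · rw [codisjoint_iff, eq_top_iff]
    intro x _
    obtain ⟨p, q, r, hp, hq, hr, hM⟩ := exists_spectral_split M
    have hpq : RootsIn {z : ℂ | z.re ≤ 0} (p * q) :=
      (hp.mono fun z hz => le_of_lt hz).mul (hq.mono fun z hz => le_of_eq hz)
    obtain ⟨a, b, hab⟩ := hpq.isCoprime disjoint_nonpos_pos hr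
    have h2 : x = aeval M (a * (p * q)) *ᵥ x + aeval M (b * r) *ᵥ x := by
      rw [← Matrix.add_mulVec, ← map_add, hab, map_one, Matrix.one_mulVec]
    rw [h2]
    refine Submodule.add_mem_sup (mem_specPos.2 ⟨r, hr, ?_⟩) (mem_spectral_nonpos.2 ⟨p * q, hpq, ?_⟩)
    · rw [← aeval_mul_mulVec, show r * (a * (p * q)) = a * (p * q * r) by ring, aeval_mul_mulVec,
        hM, Matrix.zero_mulVec, Matrix.mulVec_zero]
    · rw [← aeval_mul_mulVec, show p * q * (b * r) = b * (p * q * r) by ring, aeval_mul_mulVec,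
        hM, Matrix.zero_mulVec, Matrix.mulVec_zero]

theorem vecMul_sylvester (M : Matrix ι ι ℝ) (A₂ : Matrix κ κ ℝ) (X : Matrix ι κ ℝ) (x : ι → ℝ) :
    x ᵥ* (Mᵀ * X + X * A₂) = (M *ᵥ x) ᵥ* X + (x ᵥ* X) ᵥ* A₂ := by
  rw [Matrix.vecMul_add, ← Matrix.vecMul_vecMul, Matrix.vecMul_transpose, Matrix.vecMul_vecMul]

theorem eq_of_vecMul {X Y : Matrix ι κ ℝ} (h : ∀ x, x ᵥ* X = x ᵥ* Y) : X = Y := by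
  ext i j
  have := congrFun (h (Pi.single i 1)) j
  simpa using this

/-- A Sylvester equation prescribed on the rows of the closed left half plane part has exactly one
solution that vanishes on the right half plane part. -/
theorem exists_partial_sylvester (M : Matrix ι ι ℝ) {A₂ : Matrix κ κ ℝ} (hA₂ : Hurwitz A₂)
    (R : Matrix ι κ ℝ) : ∃ X₀ : Matrix ι κ ℝ, ∀ X : Matrix ι κ ℝ,
      ((∀ x ∈ specPos M, x ᵥ* X = 0) ∧
        (∀ x ∈ specZero M, x ᵥ* (Mᵀ * X + X * A₂) = x ᵥ* R) ∧
        (∀ x ∈ specNeg M, x ᵥ* (Mᵀ * X + X * A₂) = x ᵥ* R)) ↔ X = X₀ := by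
  obtain ⟨P, hP⟩ := exists_projection (isCompl_specPos M)
  -- All conditions are packed into one endomorphism: the rows on 𝒳⁺ return X itself, the other rows
  -- return the Sylvester operator. Unique solvability is then a matter of injectivity.
  let Λ : Matrix ι κ ℝ →ₗ[ℝ] Matrix ι κ ℝ :=
    { toFun := fun X => Pᵀ * X + (1 - P)ᵀ * (Mᵀ * X + X * A₂)
      map_add' := fun X Y => by simp only [Matrix.mul_add, Matrix.add_mul]; abel
      map_smul' := fun c X => by
        simp only [Matrix.mul_smul, Matrix.smul_mul, ← smul_add, RingHom.id_apply] }
  have hΛ : ∀ X x, x ᵥ* Λ X = (P *ᵥ x) ᵥ* X + ((1 - P) *ᵥ x) ᵥ* (Mᵀ * X + X * A₂) := by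
    intro X x
    change x ᵥ* (Pᵀ * X + (1 - P)ᵀ * (Mᵀ * X + X * A₂)) = _
    rw [Matrix.vecMul_add, ← Matrix.vecMul_vecMul, Matrix.vecMul_transpose,
      ← Matrix.vecMul_vecMul x (1 - P)ᵀ, Matrix.vecMul_transpose]
  have hpos : ∀ X, ∀ x ∈ specPos M, x ᵥ* Λ X = x ᵥ* X := fun X x hx => by
    rw [hΛ, Matrix.sub_mulVec, Matrix.one_mulVec, hP.2.1 x hx, sub_self, Matrix.zero_vecMul,
      add_zero]
  have hneg : ∀ X, ∀ x ∈ spectralSubspace {z | z.re ≤ 0} M,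
      x ᵥ* Λ X = x ᵥ* (Mᵀ * X + X * A₂) := fun X x hx => by
    rw [hΛ, Matrix.sub_mulVec, Matrix.one_mulVec, hP.2.2 x hx, sub_zero, Matrix.zero_vecMul,
      zero_add]
  have hinj : Function.Injective Λ := by
    rw [injective_iff_map_eq_zero]
    intro X hX
    have h1 : ∀ x ∈ specPos M, x ᵥ* X = 0 := fun x hx => by
      rw [← hpos X x hx, hX, Matrix.vecMul_zero]
    -- On 𝒳⁺ the homogeneous equation holds for free, since X vanishes on this invariant subspace;
    -- so it holds on the whole space.
    have h2 : Mᵀ * X + X * A₂ = 0 := eq_of_vecMul fun x => by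
      obtain ⟨v, hv, w, hw, rfl, -⟩ := hP.exists_add x
      rw [Matrix.add_vecMul, ← hneg X w hw, hX, vecMul_sylvester, h1 v hv,
        h1 _ (spectral_invariant hv)]
      simp
    obtain ⟨r, hr, hr0⟩ := hA₂
    have hint : X * A₂ = (-Mᵀ) * X := by
      rw [Matrix.neg_mul]
      exact eq_neg_of_add_eq_zero_right h2
    have h3 := mul_aeval_of_intertwine hint r
    rw [hr0, Matrix.mul_zero] at h3
    -- Here s(w) = r(-w), which reflects the roots of r into the right half plane.
    obtain ⟨s, hs, hs0⟩ : ∃ s, RootsIn {z | 0 < z.re} s ∧ aeval (-Mᵀ) r = (aeval M s)ᵀ := by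
      refine ⟨r.comp (C (-1) * Polynomial.X + C 0), rootsIn_comp hr (by norm_num) fun w hw => ?_, ?_⟩
      · simpa using hw
      · rw [transpose_aeval, aeval_comp_affine]
        simp
    refine eq_of_vecMul fun x => ?_
    obtain ⟨v, hv, w, hw, rfl, -⟩ := hP.exists_add x
    rw [Matrix.add_vecMul, h1 v hv, zero_add, Matrix.vecMul_zero]
    obtain ⟨p, hp, hpw⟩ := mem_spectral_nonpos.1 hw
    obtain ⟨a, b, hab⟩ := hp.isCoprime disjoint_nonpos_pos hs
    -- The matrix s(M) is invertible on the closed left half plane part, so w lies in its image, and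
    -- X vanishes on that image.
    have h4 : w = aeval M s *ᵥ (aeval M b *ᵥ w) := by
      calc w = aeval M (a * p + b * s) *ᵥ w := by rw [hab, map_one, Matrix.one_mulVec]
        _ = _ := by
          rw [map_add, Matrix.add_mulVec, aeval_mul_mulVec, hpw, Matrix.mulVec_zero, zero_add,
            mul_comm, aeval_mul_mulVec]
    rw [h4, ← Matrix.vecMul_transpose, Matrix.vecMul_vecMul, ← hs0, ← h3, Matrix.vecMul_zero]
  obtain ⟨X₀, hX₀⟩ := (LinearMap.injective_iff_surjective.1 hinj) ((1 - P)ᵀ * R)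
  have hR : ∀ x, x ᵥ* ((1 - P)ᵀ * R) = ((1 - P) *ᵥ x) ᵥ* R := fun x => by
    rw [← Matrix.vecMul_vecMul, Matrix.vecMul_transpose]
  have key : ∀ X, Λ X = (1 - P)ᵀ * R ↔ (∀ x ∈ specPos M, x ᵥ* X = 0) ∧
      ∀ x ∈ spectralSubspace {z | z.re ≤ 0} M, x ᵥ* (Mᵀ * X + X * A₂) = x ᵥ* R := by
    intro X
    have hRp : ∀ x ∈ specPos M, x ᵥ* ((1 - P)ᵀ * R) = 0 := fun x hx => by
      rw [hR, Matrix.sub_mulVec, Matrix.one_mulVec, hP.2.1 x hx, sub_self, Matrix.zero_vecMul]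
    have hRn : ∀ x ∈ spectralSubspace {z | z.re ≤ 0} M, x ᵥ* ((1 - P)ᵀ * R) = x ᵥ* R :=
      fun x hx => by rw [hR, Matrix.sub_mulVec, Matrix.one_mulVec, hP.2.2 x hx, sub_zero]
    constructor
    · intro h
      exact ⟨fun x hx => by rw [← hpos X x hx, h, hRp x hx],
        fun x hx => by rw [← hneg X x hx, h, hRn x hx]⟩
    · rintro ⟨h1, h2⟩
      refine eq_of_vecMul fun x => ?_
      obtain ⟨v, hv, w, hw, rfl, -⟩ := hP.exists_add x
      rw [Matrix.add_vecMul, Matrix.add_vecMul, hpos X v hv, hneg X w hw, h1 v hv, h2 w hw,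
        hRp v hv, hRn w hw]
  refine ⟨X₀, fun X => ?_⟩
  rw [← hinj.eq_iff, hX₀, key]
  refine and_congr_right fun _ => ⟨fun h x hx => ?_, fun h => ⟨fun x hx => ?_, fun x hx => ?_⟩⟩
  · rw [spectral_nonpos_eq] at hx
    obtain ⟨v, hv, w, hw, rfl⟩ := Submodule.mem_sup.1 hx
    rw [Matrix.add_vecMul, Matrix.add_vecMul, h.1 v hv, h.2 w hw]
  · exact h x (by rw [spectral_nonpos_eq]; exact Submodule.mem_sup_left hx)
  · exact h x (by rw [spectral_nonpos_eq]; exact Submodule.mem_sup_right hx)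

end SpectralDecomposition

/-! ### The Kalman decomposition -/

section Kalman

variable {n m n₁ n₂ : ℕ}

/-- The controllability decomposition: `E₁`, `E₂` embed the two coordinate blocks, `S₁`, `S₂` are
the coordinate maps. -/
structure KalmanForm (A : Matrix (Fin n) (Fin n) ℝ) (B : Matrix (Fin n) (Fin m) ℝ)
    (E₁ : Matrix (Fin n) (Fin n₁) ℝ) (E₂ : Matrix (Fin n) (Fin n₂) ℝ)
    (S₁ : Matrix (Fin n₁) (Fin n) ℝ) (S₂ : Matrix (Fin n₂) (Fin n) ℝ)
    (A₁ : Matrix (Fin n₁) (Fin n₁) ℝ) (A₁₂ : Matrix (Fin n₁) (Fin n₂) ℝ)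
    (A₂ : Matrix (Fin n₂) (Fin n₂) ℝ) (B₁ : Matrix (Fin n₁) (Fin m) ℝ) : Prop where
  sum : E₁ * S₁ + E₂ * S₂ = 1
  s11 : S₁ * E₁ = 1
  s12 : S₁ * E₂ = 0
  s21 : S₂ * E₁ = 0
  s22 : S₂ * E₂ = 1
  a1 : A * E₁ = E₁ * A₁
  a2 : A * E₂ = E₁ * A₁₂ + E₂ * A₂
  b1 : B = E₁ * B₁
  ctr : ∀ x, x ∈ controllableSubspace A B ↔ ∃ z, E₁ *ᵥ z = x

/-- The lower blocks of A and B vanish because the controllable subspace is A-invariant and contains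
Im B. The matrix identities let the rest of the proof proceed without coordinates. -/
theorem kalmanForm_of_basis {A : Matrix (Fin n) (Fin n) ℝ} {B : Matrix (Fin n) (Fin m) ℝ}
    {b : Module.Basis (Fin n₁ ⊕ Fin n₂) ℝ (Fin n → ℝ)}
    (hb : Submodule.span ℝ (Set.range fun i : Fin n₁ => b (Sum.inl i)) =
      controllableSubspace A B) :
    ∃ S : Matrix (Fin n₁ ⊕ Fin n₂) (Fin n) ℝ, S * colMatrix b = 1 ∧ colMatrix b * S = 1 ∧
      KalmanForm A B ((colMatrix b).submatrix id Sum.inl) ((colMatrix b).submatrix id Sum.inr)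
        (S.submatrix Sum.inl id) (S.submatrix Sum.inr id) (coordA A b).toBlocks₁₁
        (coordA A b).toBlocks₁₂ (coordA A b).toBlocks₂₂ (coordB₁ B b) := by
  set T := colMatrix b with hT
  obtain ⟨S, hST, hTS⟩ : ∃ S : Matrix (Fin n₁ ⊕ Fin n₂) (Fin n) ℝ, S * T = 1 ∧ T * S = 1 := by
    have h : T = (Pi.basisFun ℝ (Fin n)).toMatrix b := by
      ext i j; simp [hT, colMatrix, Module.Basis.toMatrix_apply]
    refine ⟨b.toMatrix (Pi.basisFun ℝ (Fin n)), ?_, ?_⟩ <;> rw [h]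
    · exact Module.Basis.toMatrix_mul_toMatrix_flip _ _
    · exact Module.Basis.toMatrix_mul_toMatrix_flip _ _
  have hTrepr : ∀ x, T *ᵥ (b.repr x) = x := fun x => by
    conv_rhs => rw [← b.sum_repr x]
    rw [Matrix.mulVec_eq_sum]
    refine Finset.sum_congr rfl fun j _ => ?_
    rw [op_smul_eq_smul]
    rfl
  have hrepr : ∀ x, (b.repr x : Fin n₁ ⊕ Fin n₂ → ℝ) = S *ᵥ x := fun x => by
    conv_rhs => rw [← hTrepr x]
    rw [Matrix.mulVec_mulVec, hST, Matrix.one_mulVec]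
  have hA : A * T = T * coordA A b := by
    have h : coordA A b * S = S * A := mulVec_ext fun x => by
      rw [← Matrix.mulVec_mulVec, ← Matrix.mulVec_mulVec, ← hrepr, ← hrepr]
      exact LinearMap.toMatrix_mulVec_repr b b A.mulVecLin x
    calc A * T = T * S * A * T := by rw [hTS, Matrix.one_mul]
      _ = T * (S * A) * T := by simp only [Matrix.mul_assoc]
      _ = T * coordA A b * (S * T) := by rw [← h]; simp only [Matrix.mul_assoc]
      _ = _ := by rw [hST, Matrix.mul_one]
  have hB : coordB B b = S * B := mulVec_ext fun u => by
    rw [← Matrix.mulVec_mulVec, ← hrepr]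
    exact LinearMap.toMatrix_mulVec_repr (Pi.basisFun ℝ (Fin m)) b B.mulVecLin u
  have hinl : ∀ {k : ℕ} (Y : Matrix (Fin n₁ ⊕ Fin n₂) (Fin k) ℝ), T * Y =
      T.submatrix id Sum.inl * Y.submatrix Sum.inl id +
        T.submatrix id Sum.inr * Y.submatrix Sum.inr id := fun Y => by
    ext i j
    simp [Matrix.mul_apply, Fintype.sum_sum_type]
  have hctr : ∀ x, x ∈ controllableSubspace A B ↔ ∃ z, T.submatrix id Sum.inl *ᵥ z = x := by
    intro x
    rw [← hb]
    have h := Matrix.range_mulVecLin (T.submatrix id (Sum.inl : Fin n₁ → Fin n₁ ⊕ Fin n₂))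
    have h' : (T.submatrix id (Sum.inl : Fin n₁ → Fin n₁ ⊕ Fin n₂)).col =
        fun i : Fin n₁ => b (Sum.inl i) := rfl
    rw [← h', ← h]
    simp [LinearMap.mem_range]
  have s11 : S.submatrix Sum.inl id * T.submatrix id Sum.inl = (1 : Matrix (Fin n₁) (Fin n₁) ℝ) := by
    ext i j
    have := congrFun (congrFun hST (Sum.inl i)) (Sum.inl j)
    simpa [Matrix.mul_apply, Matrix.one_apply] using this
  have s12 : S.submatrix Sum.inl id * T.submatrix id Sum.inr = (0 : Matrix (Fin n₁) (Fin n₂) ℝ) := by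
    ext i j
    have := congrFun (congrFun hST (Sum.inl i)) (Sum.inr j)
    simpa [Matrix.mul_apply, Matrix.one_apply] using this
  have s21 : S.submatrix Sum.inr id * T.submatrix id Sum.inl = (0 : Matrix (Fin n₂) (Fin n₁) ℝ) := by
    ext i j
    have := congrFun (congrFun hST (Sum.inr i)) (Sum.inl j)
    simpa [Matrix.mul_apply, Matrix.one_apply] using this
  have s22 : S.submatrix Sum.inr id * T.submatrix id Sum.inr = (1 : Matrix (Fin n₂) (Fin n₂) ℝ) := by
    ext i j
    have := congrFun (congrFun hST (Sum.inr i)) (Sum.inr j)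
    simpa [Matrix.mul_apply, Matrix.one_apply] using this
  have sum : T.submatrix id Sum.inl * S.submatrix Sum.inl id +
      T.submatrix id Sum.inr * S.submatrix Sum.inr id = 1 := by rw [← hinl, hTS]
  have hS2 : ∀ x ∈ controllableSubspace A B, S.submatrix Sum.inr id *ᵥ x = 0 := fun x hx => by
    obtain ⟨z, rfl⟩ := (hctr x).1 hx
    rw [Matrix.mulVec_mulVec, s21, Matrix.zero_mulVec]
  have a1' : A * T.submatrix id Sum.inl = T.submatrix id Sum.inl * (coordA A b).toBlocks₁₁ +
      T.submatrix id Sum.inr * (coordA A b).toBlocks₂₁ := by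
    ext i j
    have := congrFun (congrFun hA i) (Sum.inl j)
    simpa [Matrix.mul_apply, Fintype.sum_sum_type, Matrix.toBlocks₁₁, Matrix.toBlocks₂₁] using this
  have a2 : A * T.submatrix id Sum.inr = T.submatrix id Sum.inl * (coordA A b).toBlocks₁₂ +
      T.submatrix id Sum.inr * (coordA A b).toBlocks₂₂ := by
    ext i j
    have := congrFun (congrFun hA i) (Sum.inr j)
    simpa [Matrix.mul_apply, Fintype.sum_sum_type, Matrix.toBlocks₁₂, Matrix.toBlocks₂₂] using this
  have a21 : (coordA A b).toBlocks₂₁ = 0 := by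
    have h1 : S.submatrix Sum.inr id * (A * T.submatrix id Sum.inl) =
        (0 : Matrix (Fin n₂) (Fin n₁) ℝ) := mulVec_ext fun z => by
      rw [← Matrix.mulVec_mulVec, ← Matrix.mulVec_mulVec, Matrix.zero_mulVec]
      exact hS2 _ (controllable_invariant ((hctr _).2 ⟨z, rfl⟩))
    rw [a1', Matrix.mul_add, ← Matrix.mul_assoc, ← Matrix.mul_assoc, s21, s22, Matrix.zero_mul,
      Matrix.one_mul, zero_add] at h1
    exact h1
  have b1 : B = T.submatrix id Sum.inl * coordB₁ B b := by
    have h1 : (S * B).submatrix Sum.inr id = (0 : Matrix (Fin n₂) (Fin m) ℝ) :=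
      mulVec_ext fun u => by
        have := hS2 _ (mulVec_mem_controllable A B u)
        rw [Matrix.mulVec_mulVec] at this
        rw [Matrix.zero_mulVec, ← this]
        rfl
    calc B = T * (S * B) := by rw [← Matrix.mul_assoc, hTS, Matrix.one_mul]
      _ = _ := by rw [hinl, h1, Matrix.mul_zero, add_zero, coordB₁, hB]
  exact ⟨S, hST, hTS, sum, s11, s12, s21, s22, by rw [a1', a21, Matrix.mul_zero, add_zero], a2, b1, hctr⟩

end Kalman

end IndefLQ

namespace IndefLQ

section Quotient

variable {ι κ μ : Type*} [Fintype ι] [DecidableEq ι] [Fintype κ] [DecidableEq κ] [Fintype μ]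
  [DecidableEq μ]

/-! ### Passage to a quotient of the state space -/

/-- When A descends to the quotient and Q factors through it, φ commutes with pulling back forms;
this turns a solution vanishing on N into a solution of a smaller problem. -/
theorem riccati_quotient {A Q : Matrix ι ι ℝ} {B : Matrix ι κ ℝ} {π : Matrix μ ι ℝ}
    {A' Q' : Matrix μ μ ℝ} (hA : π * A = A' * π) (hQ : Q = πᵀ * Q' * π) (X : Matrix μ μ ℝ) :
    riccati A B Q (πᵀ * X * π) = πᵀ * riccati A' (π * B) Q' X * π := by
  have hA' : Aᵀ * πᵀ = πᵀ * A'ᵀ := by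
    rw [← Matrix.transpose_mul, hA, Matrix.transpose_mul]
  have h1 : Aᵀ * (πᵀ * X * π) = πᵀ * (A'ᵀ * X) * π := by
    rw [← Matrix.mul_assoc, ← Matrix.mul_assoc, hA']
    simp only [Matrix.mul_assoc]
  have h2 : πᵀ * X * π * A = πᵀ * (X * A') * π := by
    rw [Matrix.mul_assoc, hA]
    simp only [Matrix.mul_assoc]
  unfold riccati
  rw [h1, h2, hQ, Matrix.transpose_mul]
  simp only [Matrix.mul_add, Matrix.add_mul, Matrix.mul_sub, Matrix.sub_mul, Matrix.mul_assoc]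

theorem StabPair.quotient {A : Matrix ι ι ℝ} {B : Matrix ι κ ℝ} (h : StabPair A B)
    {π : Matrix μ ι ℝ} {σ : Matrix ι μ ℝ} (hπσ : π * σ = 1) {A' : Matrix μ μ ℝ}
    (hA : π * A = A' * π) : StabPair A' (π * B) := by
  obtain ⟨q, hq, hqx⟩ := h
  refine ⟨q, hq, fun y => ?_⟩
  have hle : controllableSubspace A B ≤
      (controllableSubspace A' (π * B)).comap π.mulVecLin := by
    refine controllable_le (fun u => ?_) fun x hx => ?_
    · rw [Submodule.mem_comap, Matrix.mulVecLin_apply, Matrix.mulVec_mulVec]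
      exact mulVec_mem_controllable _ _ _
    · rw [Submodule.mem_comap, Matrix.mulVecLin_apply] at hx ⊢
      rw [Matrix.mulVec_mulVec, hA, ← Matrix.mulVec_mulVec]
      exact controllable_invariant hx
  have h1 := hle (hqx (σ *ᵥ y))
  rw [Submodule.mem_comap, Matrix.mulVecLin_apply, Matrix.mulVec_mulVec,
    mul_aeval_of_intertwine hA, ← Matrix.mulVec_mulVec, Matrix.mulVec_mulVec y π σ, hπσ,
    Matrix.one_mulVec] at h1
  exact h1

theorem nonneg_of_conj {π : Matrix μ ι ℝ} {σ : Matrix ι μ ℝ} (hπσ : π * σ = 1)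
    {Y : Matrix μ μ ℝ} (h : 0 ≤ πᵀ * Y * π) : 0 ≤ Y := by
  have h1 := conj_nonneg h σ
  have h2 : σᵀ * (πᵀ * Y * π) * σ = (π * σ)ᵀ * Y * (π * σ) := by
    rw [Matrix.transpose_mul]
    simp only [Matrix.mul_assoc]
  rwa [h2, hπσ, Matrix.transpose_one, Matrix.one_mul, Matrix.mul_one] at h1

/-- A symmetric matrix that vanishes on `N` descends to the quotient by `N`. -/
theorem eq_conj_of_vanish {π : Matrix μ ι ℝ} {σ : Matrix ι μ ℝ} (hπσ : π * σ = 1)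
    {N : Submodule ℝ (ι → ℝ)} (hker : ∀ x, π *ᵥ x = 0 ↔ x ∈ N) {Y : Matrix ι ι ℝ}
    (hY : Y.IsSymm) (hN : ∀ x ∈ N, Y *ᵥ x = 0) : Y = πᵀ * (σᵀ * Y * σ) * π := by
  have h1 := factor_through_quotient hπσ hker hN
  have h2 : Y = πᵀ * (σᵀ * Y) := by
    conv_lhs => rw [← hY.eq, h1]
    rw [Matrix.transpose_mul, Matrix.transpose_mul, hY.eq]
  calc Y = Y * σ * π := h1
    _ = πᵀ * (σᵀ * Y) * σ * π := by rw [← h2]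
    _ = _ := by simp only [Matrix.mul_assoc]

theorem eq_zero_mulVec {Y : Matrix κ ι ℝ} (h : ∀ x, Y *ᵥ x = 0) : Y = 0 :=
  mulVec_ext fun x => by rw [h, Matrix.zero_mulVec]

/-- A solution `K` of the Riccati equation that vanishes on an invariant subspace `N` modulo which
the closed loop has its spectrum in the closed left half plane is, modulo `N`, the greatest
solution; it is approached by stabilizing feedbacks. -/
theorem maximal_modulo {A Q K : Matrix ι ι ℝ} {B : Matrix ι κ ℝ} (hQ : Q.IsSymm)
    (hst : StabPair A B) (hK : K.IsSymm) (hφ : riccati A B Q K = 0)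
    {N : Submodule ℝ (ι → ℝ)} (hNK : ∀ x ∈ N, K *ᵥ x = 0)
    (hN : ∀ x ∈ N, closedLoop A B K *ᵥ x ∈ N) {p : ℝ[X]} (hp : RootsIn {z | z.re ≤ 0} p)
    (hpN : ∀ x, aeval (closedLoop A B K) p *ᵥ x ∈ N) :
    (∀ Γ : Matrix ι ι ℝ, Γ.IsSymm → (∀ x ∈ N, Γ *ᵥ x = 0) → 0 ≤ riccati A B Q Γ →
      0 ≤ K - Γ) ∧
    ∃ (X : ℕ → Matrix ι ι ℝ) (F : ℕ → Matrix κ ι ℝ),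
      (∀ k, (X k).IsSymm ∧
        (A + B * F k)ᵀ * X k + X k * (A + B * F k) = -(Q + (F k)ᵀ * F k) ∧
        (∀ x ∈ N, X k *ᵥ x = 0) ∧
        ∀ {d : ℕ} (Y : Matrix (Fin d) ι ℝ), (∀ x ∈ N, Y *ᵥ x = 0) → ∀ v,
          Tendsto (fun t => Y *ᵥ (flow (A + B * F k) t *ᵥ v)) atTop (𝓝 0)) ∧
      Tendsto X atTop (𝓝 K) := by
  -- Since K vanishes on N, the closed loop there is A itself, and the Riccati equation makes Q
  -- vanish too. The whole problem descends to the quotient by N.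
  have hAK : ∀ x ∈ N, A *ᵥ x = closedLoop A B K *ᵥ x := fun x hx => by
    unfold closedLoop
    rw [Matrix.sub_mulVec, ← Matrix.mulVec_mulVec, hNK x hx, Matrix.mulVec_zero, sub_zero]
  have hAN : ∀ x ∈ N, A *ᵥ x ∈ N := fun x hx => by rw [hAK x hx]; exact hN x hx
  have hQN : ∀ x ∈ N, Q *ᵥ x = 0 := fun x hx => by
    have h := riccati_mulVec A Q K B x
    rw [hφ, Matrix.zero_mulVec, hNK x hx, hNK _ (hN x hx), Matrix.mulVec_zero] at h
    simpa using h.symm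
  obtain ⟨k, π, σ, hπσ, hker⟩ := exists_quotient_matrix N
  have hA := quotient_intertwine hπσ hker hAN
  have hM := quotient_intertwine hπσ hker hN
  set A' := π * A * σ with hA'
  set Q' := σᵀ * Q * σ with hQ'
  set K' := σᵀ * K * σ with hK'
  have hQeq : Q = πᵀ * Q' * π := eq_conj_of_vanish hπσ hker hQ hQN
  have hKeq : K = πᵀ * K' * π := eq_conj_of_vanish hπσ hker hK hNK
  have hsymm : ∀ Y : Matrix ι ι ℝ, Y.IsSymm → (σᵀ * Y * σ).IsSymm := fun Y hY => by
    rw [Matrix.IsSymm, Matrix.transpose_mul, Matrix.transpose_mul, Matrix.transpose_transpose,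
      hY.eq, Matrix.mul_assoc]
  have hst' := hst.quotient hπσ hA
  have hcancel : ∀ Y : Matrix (Fin k) (Fin k) ℝ, πᵀ * Y * π = 0 → Y = 0 := fun Y h => by
    have h1 : (π * σ)ᵀ * Y * (π * σ) = σᵀ * (πᵀ * Y * π) * σ := by
      rw [Matrix.transpose_mul]
      simp only [Matrix.mul_assoc]
    rw [hπσ, h, Matrix.transpose_one, Matrix.one_mul, Matrix.mul_one, Matrix.mul_zero,
      Matrix.zero_mul] at h1
    exact h1
  have hφ' : riccati A' (π * B) Q' K' = 0 := by
    refine hcancel _ ?_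
    rw [← riccati_quotient hA hQeq, ← hKeq, hφ]
  obtain ⟨Kp, hKps, hKp0, hmax, -, X, F, hXF, hlim⟩ :=
    exists_maximal_solution (hsymm Q hQ) hst' (hsymm K hK) hφ'.ge
  have hclosed : π * closedLoop A B K = closedLoop A' (π * B) K' * π := by
    unfold closedLoop
    rw [Matrix.mul_sub, Matrix.sub_mul, hA]
    congr 1
    conv_lhs => rw [hKeq]
    rw [Matrix.transpose_mul]
    simp only [Matrix.mul_assoc]
  have hp' : aeval (closedLoop A' (π * B) K') p = 0 := by
    have h1 := mul_aeval_of_intertwine hclosed p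
    have h2 : π * aeval (closedLoop A B K) p = 0 := eq_zero_mulVec fun x => by
      rw [← Matrix.mulVec_mulVec]
      exact (hker _).2 (hpN x)
    calc aeval (closedLoop A' (π * B) K') p
        = aeval (closedLoop A' (π * B) K') p * π * σ := by
          rw [Matrix.mul_assoc, hπσ, Matrix.mul_one]
      _ = 0 := by rw [← h1, h2, Matrix.zero_mul]
  have hD0 : 0 ≤ Kp - K' := sub_nonneg.2 (hmax K' (hsymm K hK) hφ'.ge)
  -- The gap between the greatest solution and K' is nonnegative and satisfies the Lyapunov equation
  -- with c = 1, while the closed loop of K' has spectrum in the closed left half plane. So the gap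
  -- is zero.
  have hKpK : Kp = K' := by
    rw [← sub_eq_zero]
    have hl := lyapunov_of_riccati_add (A := A') (Q := Q') (B := π * B) (D := Kp - K')
      (hsymm K hK)
    rw [← hK', add_sub_cancel, hKp0, hφ', sub_zero, add_zero, closedLoop_eq] at hl
    refine eq_zero_mulVec fun x => mulVec_eq_zero_of_lyapunov hst' (F := gain (π * B) K') hD0
      (c := 1) (by norm_num) (V := ⊤) (fun _ _ => trivial) (fun x _ => ?_) (p := p) ?_
      (fun x _ => ?_) (x := x) trivial
    · rw [hl, one_smul]
    · simpa using hp
    · rw [← closedLoop_eq, hp', Matrix.zero_mulVec, Matrix.mulVec_zero]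
  -- The stabilizing feedbacks of the quotient are pulled back. They leave the motion in N alone, so
  -- decay is available only for observations that vanish on N.
  refine ⟨fun Γ hΓ hΓN hΓφ => ?_, fun j => πᵀ * X j * π, fun j => F j * π, fun j => ?_, ?_⟩
  · have hΓeq := eq_conj_of_vanish hπσ hker hΓ hΓN
    have h1 : 0 ≤ riccati A' (π * B) Q' (σᵀ * Γ * σ) := by
      refine nonneg_of_conj hπσ ?_
      rw [← riccati_quotient hA hQeq, ← hΓeq]
      exact hΓφ
    have h2 := conj_nonneg (sub_nonneg.2 (hmax _ (hsymm Γ hΓ) h1)) π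
    rw [hKpK, Matrix.mul_sub, Matrix.sub_mul, ← hKeq, ← hΓeq] at h2
    exact h2
  · obtain ⟨hs, hH, hE⟩ := hXF j
    have hint : π * (A + B * (F j * π)) = (A' + π * B * F j) * π := by
      rw [Matrix.mul_add, Matrix.add_mul, hA]
      simp only [Matrix.mul_assoc]
    refine ⟨?_, ?_, fun x hx => ?_, fun {d} Y hY v => ?_⟩
    · change (πᵀ * X j * π)ᵀ = πᵀ * X j * π
      rw [Matrix.transpose_mul, Matrix.transpose_mul, Matrix.transpose_transpose, hs.eq,
        Matrix.mul_assoc]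
    · have hint' : (A + B * (F j * π))ᵀ * πᵀ = πᵀ * (A' + π * B * F j)ᵀ := by
        rw [← Matrix.transpose_mul, hint, Matrix.transpose_mul]
      calc (A + B * (F j * π))ᵀ * (πᵀ * X j * π) + πᵀ * X j * π * (A + B * (F j * π))
          = (A + B * (F j * π))ᵀ * πᵀ * X j * π + πᵀ * X j * (π * (A + B * (F j * π))) := by
            simp only [Matrix.mul_assoc]
        _ = πᵀ * ((A' + π * B * F j)ᵀ * X j + X j * (A' + π * B * F j)) * π := by
            rw [hint, hint']
            generalize A' + π * B * F j = M
            simp only [Matrix.mul_add, Matrix.add_mul, Matrix.mul_assoc]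
        _ = _ := by
            rw [hE, Matrix.mul_neg, Matrix.neg_mul, Matrix.mul_add, Matrix.add_mul, ← hQeq,
              Matrix.transpose_mul]
            simp only [Matrix.mul_assoc]
    · rw [← Matrix.mulVec_mulVec, (hker x).2 hx, Matrix.mulVec_zero]
    · obtain ⟨q, hq, hq0⟩ := hH
      refine tendsto_flow_zero hq ?_ v
      obtain ⟨Z, rfl⟩ := exists_factor (π := π) (Y := Y) fun x hx => hY x ((hker x).1 hx)
      rw [Matrix.mul_assoc, mul_aeval_of_intertwine hint, hq0, Matrix.zero_mul, Matrix.mul_zero]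
  · have hc : Continuous fun Y : Matrix (Fin k) (Fin k) ℝ => πᵀ * Y * π := by fun_prop
    have h1 := (hc.tendsto Kp).comp hlim
    rw [hKpK, ← hKeq] at h1
    exact h1

end Quotient

/-! ### Riccati equation and unobservable motions in the controllability decomposition -/

section Kalman

variable {n m n₁ n₂ : ℕ} {A Q : Matrix (Fin n) (Fin n) ℝ} {B : Matrix (Fin n) (Fin m) ℝ}
  {E₁ : Matrix (Fin n) (Fin n₁) ℝ} {E₂ : Matrix (Fin n) (Fin n₂) ℝ}
  {S₁ : Matrix (Fin n₁) (Fin n) ℝ} {S₂ : Matrix (Fin n₂) (Fin n) ℝ}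
  {A₁ : Matrix (Fin n₁) (Fin n₁) ℝ} {A₁₂ : Matrix (Fin n₁) (Fin n₂) ℝ}
  {A₂ : Matrix (Fin n₂) (Fin n₂) ℝ} {B₁ : Matrix (Fin n₁) (Fin m) ℝ}

namespace KalmanForm

theorem s2a (hk : KalmanForm A B E₁ E₂ S₁ S₂ A₁ A₁₂ A₂ B₁) : S₂ * A = A₂ * S₂ := by
  calc S₂ * A = S₂ * A * (E₁ * S₁ + E₂ * S₂) := by rw [hk.sum, Matrix.mul_one]
    _ = S₂ * (A * E₁) * S₁ + S₂ * (A * E₂) * S₂ := by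
      rw [Matrix.mul_add]; simp only [Matrix.mul_assoc]
    _ = (S₂ * E₁) * A₁ * S₁ + (S₂ * E₁ * A₁₂ + S₂ * E₂ * A₂) * S₂ := by
      rw [hk.a1, hk.a2, Matrix.mul_add]; simp only [Matrix.mul_assoc]
    _ = _ := by simp [hk.s21, hk.s22]

theorem injective (hk : KalmanForm A B E₁ E₂ S₁ S₂ A₁ A₁₂ A₂ B₁) {z w : Fin n₁ → ℝ}
    (h : E₁ *ᵥ z = E₁ *ᵥ w) : z = w := by
  have h1 := congrArg (S₁ *ᵥ ·) h
  simpa only [Matrix.mulVec_mulVec, hk.s11, Matrix.one_mulVec] using h1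

theorem eq_embed (hk : KalmanForm A B E₁ E₂ S₁ S₂ A₁ A₁₂ A₂ B₁) {x : Fin n → ℝ}
    (h : S₂ *ᵥ x = 0) : x = E₁ *ᵥ (S₁ *ᵥ x) := by
  conv_lhs => rw [← Matrix.one_mulVec x, ← hk.sum]
  rw [Matrix.add_mulVec, ← Matrix.mulVec_mulVec, ← Matrix.mulVec_mulVec, h, Matrix.mulVec_zero,
    add_zero]

theorem s2_of_controllable (hk : KalmanForm A B E₁ E₂ S₁ S₂ A₁ A₁₂ A₂ B₁) {x : Fin n → ℝ}
    (hx : x ∈ controllableSubspace A B) : S₂ *ᵥ x = 0 := by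
  obtain ⟨z, rfl⟩ := (hk.ctr x).1 hx
  rw [Matrix.mulVec_mulVec, hk.s21, Matrix.zero_mulVec]

/-- A₂ is the matrix induced on the quotient by the controllable subspace, and there q(A) vanishes.
-/
theorem hurwitz (hk : KalmanForm A B E₁ E₂ S₁ S₂ A₁ A₁₂ A₂ B₁) (h : StabPair A B) :
    Hurwitz A₂ := by
  obtain ⟨q, hq, hqx⟩ := h
  refine ⟨q, hq, eq_zero_mulVec fun y => ?_⟩
  have h1 := hk.s2_of_controllable (hqx (E₂ *ᵥ y))
  rwa [Matrix.mulVec_mulVec, mul_aeval_of_intertwine hk.s2a, ← Matrix.mulVec_mulVec,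
    Matrix.mulVec_mulVec y, hk.s22, Matrix.one_mulVec] at h1

theorem controllable_eq_top (hk : KalmanForm A B E₁ E₂ S₁ S₂ A₁ A₁₂ A₂ B₁) :
    controllableSubspace A₁ B₁ = ⊤ := by
  rw [eq_top_iff]
  intro z _
  have hle : controllableSubspace A B ≤ (controllableSubspace A₁ B₁).map E₁.mulVecLin := by
    refine controllable_le (fun u => ⟨B₁ *ᵥ u, mulVec_mem_controllable _ _ _, ?_⟩) ?_
    · rw [Matrix.mulVecLin_apply, Matrix.mulVec_mulVec, ← hk.b1]
    · rintro _ ⟨w, hw, rfl⟩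
      refine ⟨A₁ *ᵥ w, controllable_invariant hw, ?_⟩
      rw [Matrix.mulVecLin_apply, Matrix.mulVecLin_apply, Matrix.mulVec_mulVec,
        Matrix.mulVec_mulVec, hk.a1]
  obtain ⟨w, hw, hwz⟩ := hle ((hk.ctr _).2 ⟨z, rfl⟩)
  rwa [← hk.injective hwz]

theorem dot_embed (E : Matrix (Fin n) (Fin n₁) ℝ) (K : Matrix (Fin n) (Fin n) ℝ)
    (z w : Fin n₁ → ℝ) : z ⬝ᵥ (Eᵀ * K * E) *ᵥ w = (E *ᵥ z) ⬝ᵥ K *ᵥ (E *ᵥ w) := by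
  rw [Matrix.mul_assoc, ← Matrix.mulVec_mulVec, dot_mulVec Eᵀ, Matrix.transpose_transpose,
    ← Matrix.mulVec_mulVec]

theorem embed_mulVec (E : Matrix (Fin n) (Fin n₁) ℝ) (K : Matrix (Fin n) (Fin n) ℝ)
    (z : Fin n₁ → ℝ) : (Eᵀ * K * E) *ᵥ z = Eᵀ *ᵥ (K *ᵥ (E *ᵥ z)) := by
  simp only [Matrix.mulVec_mulVec, Matrix.mul_assoc]

/-- Because the controllable subspace is invariant and contains Im B, restricting the form φ(K) to
it involves only the upper left block of K. -/
theorem riccati_compress (hk : KalmanForm A B E₁ E₂ S₁ S₂ A₁ A₁₂ A₂ B₁)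
    (K : Matrix (Fin n) (Fin n) ℝ) :
    E₁ᵀ * riccati A B Q K * E₁ = riccati A₁ B₁ (E₁ᵀ * Q * E₁) (E₁ᵀ * K * E₁) := by
  have ha : E₁ᵀ * Aᵀ = A₁ᵀ * E₁ᵀ := by
    rw [← Matrix.transpose_mul, hk.a1, Matrix.transpose_mul]
  calc E₁ᵀ * riccati A B Q K * E₁
      = E₁ᵀ * Aᵀ * K * E₁ + E₁ᵀ * K * (A * E₁) + E₁ᵀ * Q * E₁ - E₁ᵀ * K * B * Bᵀ * K * E₁ := by
        unfold riccati
        simp only [Matrix.mul_add, Matrix.add_mul, Matrix.mul_sub, Matrix.sub_mul,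
          Matrix.mul_assoc]
    _ = _ := by
        rw [ha, hk.a1]
        conv_lhs => rw [hk.b1]
        unfold riccati
        rw [Matrix.transpose_mul]
        simp only [Matrix.mul_assoc]

theorem isSymm_compress {K : Matrix (Fin n) (Fin n) ℝ} (hK : K.IsSymm)
    (E : Matrix (Fin n) (Fin n₁) ℝ) : (Eᵀ * K * E).IsSymm := by
  rw [Matrix.IsSymm, Matrix.transpose_mul, Matrix.transpose_mul, Matrix.transpose_transpose,
    hK.eq, Matrix.mul_assoc]

theorem closedLoop_embed (hk : KalmanForm A B E₁ E₂ S₁ S₂ A₁ A₁₂ A₂ B₁)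
    (K : Matrix (Fin n) (Fin n) ℝ) :
    closedLoop A B K * E₁ = E₁ * closedLoop A₁ B₁ (E₁ᵀ * K * E₁) := by
  unfold closedLoop
  rw [Matrix.sub_mul, Matrix.mul_sub, hk.a1]
  congr 1
  conv_lhs => rw [hk.b1]
  rw [Matrix.transpose_mul]
  simp only [Matrix.mul_assoc]

theorem s2_closedLoop (hk : KalmanForm A B E₁ E₂ S₁ S₂ A₁ A₁₂ A₂ B₁)
    (K : Matrix (Fin n) (Fin n) ℝ) : S₂ * closedLoop A B K = A₂ * S₂ := by
  have h : S₂ * B = 0 := by rw [hk.b1, ← Matrix.mul_assoc, hk.s21, Matrix.zero_mul]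
  unfold closedLoop
  rw [Matrix.mul_sub, hk.s2a, ← Matrix.mul_assoc, ← Matrix.mul_assoc, h]
  simp

end KalmanForm

theorem closedLoop_mulVec_of_ker {ι κ : Type*} [Fintype ι] [DecidableEq ι] [Fintype κ]
    {A K : Matrix ι ι ℝ} {B : Matrix ι κ ℝ} {x : ι → ℝ} (h : K *ᵥ x = 0) :
    closedLoop A B K *ᵥ x = A *ᵥ x := by
  unfold closedLoop
  rw [Matrix.sub_mulVec, ← Matrix.mulVec_mulVec, h, Matrix.mulVec_zero, sub_zero]

/-- On an invariant subspace of `Ker K₁⁻` every `Γ ≤ 0` with `φ(Γ) ≥ 0` vanishes, and so do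
`φ(Γ)` and `Q`. -/
theorem KalmanForm.vanish (hk : KalmanForm A B E₁ E₂ S₁ S₂ A₁ A₁₂ A₂ B₁)
    {Γ : Matrix (Fin n) (Fin n) ℝ} (hΓ : Γ ∈ negAriSolutions A B Q)
    {Km : Matrix (Fin n₁) (Fin n₁) ℝ} (hKm : Km ∈ areSolutions A₁ B₁ (E₁ᵀ * Q * E₁))
    (hle : 0 ≤ E₁ᵀ * Γ * E₁ - Km) {V : Submodule ℝ (Fin n₁ → ℝ)}
    (hV : ∀ z ∈ V, A₁ *ᵥ z ∈ V) (hVK : ∀ z ∈ V, Km *ᵥ z = 0) {z : Fin n₁ → ℝ} (hz : z ∈ V) :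
    Γ *ᵥ (E₁ *ᵥ z) = 0 ∧ riccati A B Q Γ *ᵥ (E₁ *ᵥ z) = 0 ∧ Q *ᵥ (E₁ *ᵥ z) = 0 := by
  obtain ⟨hs, hφ, hn⟩ := hΓ
  have hnΓ : 0 ≤ -Γ := by simpa using sub_nonneg.2 hn
  -- On V the form of Γ is squeezed between that of K₁⁻, which is zero, and zero.
  have hG : ∀ z ∈ V, Γ *ᵥ (E₁ *ᵥ z) = 0 := fun z hz => by
    have h1 := (nonneg_iff.1 hle).2 z
    have h2 := (nonneg_iff.1 hnΓ).2 (E₁ *ᵥ z)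
    rw [Matrix.sub_mulVec, hVK z hz, sub_zero, dot_embed] at h1
    rw [Matrix.neg_mulVec, dotProduct_neg] at h2
    have h3 := mulVec_eq_zero_of_form hnΓ (x := E₁ *ᵥ z) (by
      rw [Matrix.neg_mulVec, dotProduct_neg]; linarith)
    rwa [Matrix.neg_mulVec, neg_eq_zero] at h3
  -- With Γ and K₁⁻ vanishing at the vector, the forms of φ(Γ) and of φ₁(K₁⁻) = 0 both reduce to the
  -- form of Q.
  have hR : riccati A B Q Γ *ᵥ (E₁ *ᵥ z) = 0 := by
    refine mulVec_eq_zero_of_form hφ ?_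
    have h1 := riccati_form (A := A₁) (B := B₁) (Q := E₁ᵀ * Q * E₁) hKm.1 z
    rw [hKm.2, symm_dot hKm.1, hVK z hz, Matrix.zero_mulVec, dot_embed] at h1
    rw [riccati_form hs, symm_dot hs, hG z hz]
    simpa using h1.symm
  refine ⟨hG z hz, hR, ?_⟩
  have h1 := riccati_mulVec A Q Γ B (E₁ *ᵥ z)
  rw [hR, hG z hz, closedLoop_mulVec_of_ker (hG z hz), Matrix.mulVec_mulVec z A, hk.a1,
    ← Matrix.mulVec_mulVec z E₁, hG _ (hV z hz)] at h1
  simpa using h1.symm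

/-- The antistable and oscillating motions that no running term detects are invisible to `K`. -/
theorem KalmanForm.unobservable_vanish (hk : KalmanForm A B E₁ E₂ S₁ S₂ A₁ A₁₂ A₂ B₁)
    (hst : StabPair A B) {K Γ : Matrix (Fin n) (Fin n) ℝ} (hφK : riccati A B Q K = 0)
    (hΓs : Γ.IsSymm) (hD : 0 ≤ K - Γ)
    {Km : Matrix (Fin n₁) (Fin n₁) ℝ} (hKm : Km ∈ areSolutions A₁ B₁ (E₁ᵀ * Q * E₁))
    (hle : 0 ≤ E₁ᵀ * Γ * E₁ - Km) {L : Submodule ℝ (Fin n → ℝ)}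
    (hN : ∀ z ∈ nSubspace A₁ B₁ (L.comap E₁.mulVecLin) Km, K *ᵥ (E₁ *ᵥ z) = 0)
    {V : Submodule ℝ (Fin n → ℝ)} (hV : ∀ x ∈ V, A *ᵥ x ∈ V) (hVL : V ≤ L)
    (hVΓ : ∀ x ∈ V, Γ *ᵥ x = 0) (hVφ : ∀ x ∈ V, riccati A B Q Γ *ᵥ x = 0) {p : ℝ[X]}
    (hp : RootsIn {z | 0 ≤ z.re} p) (hpV : ∀ x ∈ V, aeval A p *ᵥ x = 0) {x : Fin n → ℝ}
    (hx : x ∈ V) : K *ᵥ x = 0 := by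
  -- The uncontrollable dynamics is Hurwitz while V carries only spectrum with nonnegative real
  -- part, so V lies in the controllable subspace.
  have hrange : ∀ x ∈ V, x = E₁ *ᵥ (S₁ *ᵥ x) := fun x hx => by
    refine hk.eq_embed ?_
    obtain ⟨r, hr, hr0⟩ := hk.hurwitz hst
    refine eq_zero_of_roots (M := A₂) disjoint_neg_nonneg hr hp ?_ ?_
    · rw [hr0, Matrix.zero_mulVec]
    · rw [Matrix.mulVec_mulVec, ← mul_aeval_of_intertwine hk.s2a, ← Matrix.mulVec_mulVec,
        hpV x hx, Matrix.mulVec_zero]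
  set V₁ := V.comap E₁.mulVecLin with hV₁
  have mem₁ : ∀ z, z ∈ V₁ ↔ E₁ *ᵥ z ∈ V := fun z => Iff.rfl
  have inv₁ : ∀ z ∈ V₁, A₁ *ᵥ z ∈ V₁ := fun z hz => by
    rw [mem₁, Matrix.mulVec_mulVec, ← hk.a1, ← Matrix.mulVec_mulVec]
    exact hV _ hz
  have aeval₁ : ∀ (q : ℝ[X]) z, E₁ *ᵥ (aeval A₁ q *ᵥ z) = aeval A q *ᵥ (E₁ *ᵥ z) := fun q z => by
    rw [Matrix.mulVec_mulVec, mul_aeval_of_intertwine hk.a1.symm, ← Matrix.mulVec_mulVec]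
  have ker₁ : ∀ z ∈ V₁, (E₁ᵀ * Γ * E₁) *ᵥ z = 0 := fun z hz => by
    rw [embed_mulVec, hVΓ _ ((mem₁ z).1 hz), Matrix.mulVec_zero]
  have hpz : ∀ z ∈ V₁, aeval A₁ p *ᵥ z = 0 := fun z hz =>
    hk.injective (by rw [aeval₁, hpV _ ((mem₁ z).1 hz)]; simp)
  have hcl₁ : ∀ z ∈ V₁, closedLoop A₁ B₁ (E₁ᵀ * Γ * E₁) *ᵥ z = A₁ *ᵥ z := fun z hz =>
    closedLoop_mulVec_of_ker (ker₁ z hz)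
  -- The difference Γ₁ - K₁⁻ is nonnegative and satisfies the Lyapunov equation with c = -1 on V₁,
  -- where the spectrum lies in Re z ≥ 0. It therefore vanishes, and Γ₁ vanishes there by
  -- assumption.
  have hKmV : ∀ z ∈ V₁, Km *ᵥ z = 0 := fun z hz => by
    have hl := lyapunov_of_riccati_add (A := A₁) (B := B₁) (Q := E₁ᵀ * Q * E₁)
      (D := -(E₁ᵀ * Γ * E₁ - Km)) (isSymm_compress hΓs E₁)
    rw [neg_sub, add_sub_cancel, hKm.2, ← hk.riccati_compress] at hl
    have h1 := mulVec_eq_zero_of_lyapunov (StabPair.of_top hk.controllable_eq_top)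
      (F := gain B₁ (E₁ᵀ * Γ * E₁)) hle (c := -1) (by norm_num) (V := V₁)
      (fun w hw => by rw [← closedLoop_eq, hcl₁ w hw]; exact inv₁ w hw)
      (fun w hw => by
        have h2 := congrArg (· *ᵥ w) hl
        simp only [Matrix.add_mulVec, zero_sub, Matrix.neg_mulVec, embed_mulVec] at h2
        rw [hVφ _ ((mem₁ w).1 hw), Matrix.mulVec_zero, neg_zero, add_zero] at h2
        rw [← closedLoop_eq, ← neg_sub Km]
        simp only [Matrix.mul_neg, Matrix.neg_mul, Matrix.add_mulVec, Matrix.neg_mulVec, neg_neg,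
          neg_smul, one_smul]
        rw [← h2]
        abel)
      (p := p) (hp.mono fun z hz => by
        have : 0 ≤ z.re := hz
        change -1 * z.re ≤ 0
        linarith)
      (fun w hw => by
        rw [← closedLoop_eq, aeval_mulVec_congr inv₁ hcl₁ p hw, hpz w hw, Matrix.mulVec_zero]) hz
    rw [Matrix.sub_mulVec, ker₁ z hz, zero_sub, neg_eq_zero] at h1
    exact h1
  obtain ⟨p₀, p₁, hp₀, hp₁, hpp⟩ := exists_split (S := {z | z.re = 0}) (fun z hz => by
    have : z.re = 0 := hz
    simpa using this) hp.1
  have hp₁' : RootsIn {z | 0 < z.re} p₁ := ⟨hp₁.1, fun z hz => by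
    have h1 : ¬ z.re = 0 := hp₁.2 z hz
    have h2 : 0 ≤ z.re := hp.2 z (by rw [hpp, map_mul, hz, mul_zero])
    exact lt_of_le_of_ne h2 (Ne.symm h1)⟩
  obtain ⟨a, b, hab⟩ := hp₀.isCoprime disjoint_zero_pos hp₁'
  -- On the oscillating part the same principle is applied to K - Γ, now with c = 1; imaginary
  -- spectrum is allowed for either sign.
  have hcov : ∀ w ∈ V ⊓ kerM (aeval A p₀), K *ᵥ w = 0 := fun w hw => by
    have hl := lyapunov_of_riccati_add (A := A) (B := B) (Q := Q) (D := K - Γ) hΓs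
    rw [add_sub_cancel, hφK] at hl
    have hcl : ∀ w ∈ V ⊓ kerM (aeval A p₀), closedLoop A B Γ *ᵥ w = A *ᵥ w := fun w hw =>
      closedLoop_mulVec_of_ker (hVΓ w hw.1)
    have hinv : ∀ w ∈ V ⊓ kerM (aeval A p₀), A *ᵥ w ∈ V ⊓ kerM (aeval A p₀) := fun w hw => by
      refine ⟨hV w hw.1, ?_⟩
      have h2 : aeval A p₀ *ᵥ w = 0 := hw.2
      have h3 := aeval_mulVec_comm A p₀ Polynomial.X w
      rw [aeval_X] at h3
      change aeval A p₀ *ᵥ (A *ᵥ w) = 0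
      rw [h3, h2, Matrix.mulVec_zero]
    have h1 := mulVec_eq_zero_of_lyapunov hst (F := gain B Γ) hD (c := 1) (by norm_num)
      (V := V ⊓ kerM (aeval A p₀))
      (fun w hw => by rw [← closedLoop_eq, hcl w hw]; exact hinv w hw)
      (fun w hw => by
        rw [← closedLoop_eq, hl, Matrix.add_mulVec, zero_sub, Matrix.neg_mulVec, hVφ w hw.1]
        simp)
      (p := p₀) (hp₀.mono fun z hz => by
        have : z.re = 0 := hz
        change 1 * z.re ≤ 0
        linarith)
      (fun w hw => by
        have h2 : aeval A p₀ *ᵥ w = 0 := hw.2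
        rw [← closedLoop_eq, aeval_mulVec_congr hinv hcl p₀ hw, h2, Matrix.mulVec_zero]) hw
    rw [Matrix.sub_mulVec, hVΓ w hw.1, sub_zero] at h1
    exact h1
  have hsplit : x = aeval A (a * p₀) *ᵥ x + aeval A (b * p₁) *ᵥ x := by
    rw [← Matrix.add_mulVec, ← map_add, hab, map_one, Matrix.one_mulVec]
  have h₀ : K *ᵥ (aeval A (b * p₁) *ᵥ x) = 0 := by
    refine hcov _ ⟨aeval_mulVec_mem hV _ hx, ?_⟩
    change aeval A p₀ *ᵥ (aeval A (b * p₁) *ᵥ x) = 0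
    rw [← aeval_mul_mulVec,
      show p₀ * (b * p₁) = b * p by rw [hpp]; ring, aeval_mul_mulVec, hpV x hx, Matrix.mulVec_zero]
  -- The antistable part lies in the image of 𝒩₁, since it is an invariant subspace inside both ℒ
  -- and Ker K₁⁻; there K vanishes by hypothesis.
  have h₁ : K *ᵥ (aeval A (a * p₀) *ᵥ x) = 0 := by
    have hmem : aeval A (a * p₀) *ᵥ x ∈ V := aeval_mulVec_mem hV _ hx
    have he := hrange _ hmem
    set z := S₁ *ᵥ (aeval A (a * p₀) *ᵥ x) with hz
    rw [he] at hmem ⊢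
    have hclm : ∀ z ∈ V₁, closedLoop A₁ B₁ Km *ᵥ z = A₁ *ᵥ z := fun z hz =>
      closedLoop_mulVec_of_ker (hKmV z hz)
    refine hN z ⟨?_, mem_specPos.2 ⟨p₁, hp₁', ?_⟩⟩
    · have hle' : V₁ ≤ L.comap E₁.mulVecLin ⊓ kerM Km := fun w hw =>
        ⟨hVL ((mem₁ w).1 hw), show Km *ᵥ w = 0 from hKmV w hw⟩
      exact le_unobservable hle' (fun w hw => by rw [hclm w hw]; exact inv₁ w hw) hmem
    · rw [aeval_mulVec_congr inv₁ hclm p₁ hmem]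
      refine hk.injective ?_
      rw [aeval₁, ← he, ← aeval_mul_mulVec,
        show p₁ * (a * p₀) = a * p by rw [hpp]; ring, aeval_mul_mulVec, hpV x hx,
        Matrix.mulVec_zero, Matrix.mulVec_zero]
  rw [hsplit, Matrix.mulVec_add, h₀, h₁, add_zero]

end Kalman

end IndefLQ

namespace IndefLQ

/-! ### Bounded vector functions -/

section Bounded

variable {ι κ : Type*} [Fintype ι] [DecidableEq ι] [Fintype κ] [DecidableEq κ]

/-- `x` is bounded on `[0, ∞)`. -/
def BddHalfLine (x : ℝ → ι → ℝ) : Prop := ∃ C : ℝ, ∀ t, 0 ≤ t → x t ⬝ᵥ x t ≤ C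

theorem BddHalfLine.mulVec {x : ℝ → ι → ℝ} (h : BddHalfLine x) (Y : Matrix κ ι ℝ) :
    BddHalfLine fun t => Y *ᵥ x t := by
  obtain ⟨C, hC⟩ := h
  obtain ⟨c, hc, hle⟩ := exists_form_le (Yᵀ * Y)
  refine ⟨c * C, fun t ht => ?_⟩
  have h1 := hle (x t)
  rw [← Matrix.mulVec_mulVec, dot_mulVec Yᵀ, Matrix.transpose_transpose] at h1
  exact h1.trans (mul_le_mul_of_nonneg_left (hC t ht) hc)

theorem BddHalfLine.add {x y : ℝ → ι → ℝ} (hx : BddHalfLine x) (hy : BddHalfLine y) :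
    BddHalfLine fun t => x t + y t := by
  obtain ⟨C, hC⟩ := hx
  obtain ⟨D, hD⟩ := hy
  refine ⟨2 * C + 2 * D, fun t ht => ?_⟩
  have h := dot_self_nonneg (x t - y t)
  have h1 := hC t ht
  have h2 := hD t ht
  simp only [dotProduct_add, add_dotProduct, dotProduct_sub, sub_dotProduct] at h ⊢
  rw [dotProduct_comm (y t) (x t)] at h ⊢
  linarith

theorem bddAbove_of_eventually {f : ℝ → ℝ} (hf : ContinuousOn f (Set.Ici 0)) {C : ℝ}
    (h : ∀ᶠ t in atTop, f t ≤ C) : ∃ D, ∀ t, 0 ≤ t → f t ≤ D := by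
  obtain ⟨T, hT⟩ := eventually_atTop.1 h
  obtain ⟨D, hD⟩ := (isCompact_Icc (a := (0 : ℝ)) (b := T)).bddAbove_image
    (hf.mono fun t ht => ht.1)
  refine ⟨max C D, fun t ht => ?_⟩
  rcases le_total T t with h1 | h1
  · exact (hT t h1).trans (le_max_left _ _)
  · exact (hD (Set.mem_image_of_mem f ⟨ht, h1⟩)).trans (le_max_right _ _)

theorem continuousOn_dot {x y : ℝ → ι → ℝ} (hx : ContinuousOn x (Set.Ici 0))
    (hy : ContinuousOn y (Set.Ici 0)) : ContinuousOn (fun t => x t ⬝ᵥ y t) (Set.Ici 0) := by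
  simp only [dotProduct]
  exact continuousOn_finsetSum _ fun i _ =>
    ((continuousOn_pi.1 hx) i).mul ((continuousOn_pi.1 hy) i)

theorem tendsto_dot {x y : ℝ → ι → ℝ} {v w : ι → ℝ} (hx : Tendsto x atTop (𝓝 v))
    (hy : Tendsto y atTop (𝓝 w)) : Tendsto (fun t => x t ⬝ᵥ y t) atTop (𝓝 (v ⬝ᵥ w)) := by
  simp only [dotProduct]
  exact tendsto_finsetSum _ fun i _ => (tendsto_pi_nhds.1 hx i).mul (tendsto_pi_nhds.1 hy i)

theorem BddHalfLine.of_tendsto {x : ℝ → ι → ℝ} (hx : ContinuousOn x (Set.Ici 0)) {v : ι → ℝ}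
    (h : Tendsto x atTop (𝓝 v)) : BddHalfLine x :=
  bddAbove_of_eventually (continuousOn_dot hx hx)
    ((tendsto_dot h h).eventually_le_const (lt_add_one _))

theorem BddHalfLine.tendsto_dot {x y : ℝ → ι → ℝ} (hy : BddHalfLine y)
    (hx : Tendsto x atTop (𝓝 0)) : Tendsto (fun t => x t ⬝ᵥ y t) atTop (𝓝 0) := by
  obtain ⟨C, hC⟩ := hy
  have h1 : Tendsto (fun t => √((x t ⬝ᵥ x t) * C)) atTop (𝓝 0) := by
    have h2 := ((IndefLQ.tendsto_dot hx hx).mul_const C).sqrt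
    simpa using h2
  rw [tendsto_zero_iff_abs_tendsto_zero]
  refine squeeze_zero' (Eventually.of_forall fun t => abs_nonneg _) ?_ h1
  filter_upwards [eventually_ge_atTop 0] with t ht
  refine Real.le_sqrt_of_sq_le ?_
  simp only [Function.comp_apply, sq_abs]
  have h3 := dot_sq_le (D := (1 : Matrix ι ι ℝ)) Matrix.PosSemidef.one.nonneg (x t) (y t)
  simp only [Matrix.one_mulVec] at h3
  exact h3.trans (mul_le_mul_of_nonneg_left (hC t ht) (dot_self_nonneg _))

/-- The quadratic form of a symmetric `K` is a quadratic form in `K x`. -/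
theorem exists_form_of_image {K : Matrix ι ι ℝ} (hK : K.IsSymm) :
    ∃ Y : Matrix ι ι ℝ, ∀ x, x ⬝ᵥ K *ᵥ x = (K *ᵥ x) ⬝ᵥ Y *ᵥ (K *ᵥ x) := by
  obtain ⟨k, π, σ, hπσ, hker⟩ := exists_quotient_matrix (kerM K)
  have h1 := factor_through_quotient hπσ hker (Y := K) fun x hx => hx
  obtain ⟨Z, hZ⟩ := exists_factor (π := K) (Y := π) fun x hx => (hker x).2 hx
  refine ⟨σ * Z, fun x => ?_⟩
  have h2 : K *ᵥ x = K *ᵥ (σ *ᵥ (Z *ᵥ (K *ᵥ x))) := by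
    conv_lhs => rw [h1, hZ]
    simp only [Matrix.mulVec_mulVec, Matrix.mul_assoc]
  conv_lhs => rw [h2, dot_mulVec K, hK.eq]
  simp only [Matrix.mulVec_mulVec, Matrix.mul_assoc]

end Bounded

/-! ### The lower bound -/

section LowerBound

variable {n m : ℕ} {A Q K : Matrix (Fin n) (Fin n) ℝ} {B : Matrix (Fin n) (Fin m) ℝ}
  {L N Z : Submodule ℝ (Fin n → ℝ)}

/-- The properties of the solution `K` of the Riccati equation that determine the optimal cost: the
state space modulo `N ⊔ Z` is stable under the closed loop, `Z` carries the oscillations, and `N`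
is the part that is free of cost and compatible with the constraint. -/
structure OptimalForm (A : Matrix (Fin n) (Fin n) ℝ) (B : Matrix (Fin n) (Fin m) ℝ)
    (Q : Matrix (Fin n) (Fin n) ℝ) (L : Submodule ℝ (Fin n → ℝ)) (K : Matrix (Fin n) (Fin n) ℝ)
    (N Z : Submodule ℝ (Fin n → ℝ)) : Prop where
  symm : K.IsSymm
  are : riccati A B Q K = 0
  n_le : N ≤ L
  n_ker : ∀ x ∈ N, K *ᵥ x = 0
  n_inv : ∀ x ∈ N, closedLoop A B K *ᵥ x ∈ N
  z_inv : ∀ x ∈ Z, closedLoop A B K *ᵥ x ∈ Z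
  z_osc : ∃ p, RootsIn {z | z.re = 0} p ∧ ∀ x ∈ Z, aeval (closedLoop A B K) p *ᵥ x = 0
  stable : ∃ q, RootsIn {z | z.re < 0} q ∧ ∀ x, aeval (closedLoop A B K) q *ᵥ x ∈ N ⊔ Z
  z_nonpos : ∀ x ∈ Z, x ⬝ᵥ K *ᵥ x ≤ 0
  z_vanish : Z ≤ L → (∀ x ∈ Z, x ⬝ᵥ K *ᵥ x = 0) → ∀ x ∈ Z, K *ᵥ x = 0
  invisible : ∃ Γ ∈ negAriSolutions A B Q, ∀ V : Submodule ℝ (Fin n → ℝ),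
    (∀ x ∈ V, A *ᵥ x ∈ V) → V ≤ L → (∀ x ∈ V, Γ *ᵥ x = 0) →
    (∀ x ∈ V, riccati A B Q Γ *ᵥ x = 0) → ∀ p : ℝ[X], RootsIn {z | 0 ≤ z.re} p →
    (∀ x ∈ V, aeval A p *ᵥ x = 0) → ∀ x ∈ V, K *ᵥ x = 0

theorem vprim_closedLoop (A : Matrix (Fin n) (Fin n) ℝ) (B : Matrix (Fin n) (Fin m) ℝ)
    (K : Matrix (Fin n) (Fin n) ℝ) (x₀ : Fin n → ℝ) {u : ℝ → Fin m → ℝ} (hu : L2loc u) :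
    VPrim (traj A B x₀ u) fun t => closedLoop A B K *ᵥ traj A B x₀ u t +
      B *ᵥ (u t + (Bᵀ * K) *ᵥ traj A B x₀ u t) :=
  (vprim_traj A B x₀ hu).congr_deriv fun t _ => by
    unfold closedLoop
    rw [Matrix.mulVec_add, Matrix.sub_mulVec, Matrix.mulVec_mulVec, Matrix.mul_assoc]
    abel

/-- The state itself may be unbounded, but every unbounded motion is undetected by the constraint,
by Γ and by φ(Γ), and belongs to the closed right half plane. On such motions K vanishes, so K x is
a linear function of bounded observations. -/
theorem OptimalForm.bddHalfLine_mulVec (h : OptimalForm A B Q L K N Z) {x₀ : Fin n → ℝ}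
    {u : ℝ → Fin m → ℝ} (hu : L2loc u)
    (hL : Tendsto (fun t => eucDist L (traj A B x₀ u t)) atTop (𝓝 0)) {C : ℝ}
    (hC : ∀ T, 0 ≤ T → costT A B Q x₀ u T ≤ C) : BddHalfLine fun t => K *ᵥ traj A B x₀ u t := by
  obtain ⟨Γ, ⟨hΓs, hR, hΓ0⟩, hinv⟩ := h.invisible
  set x := traj A B x₀ u with hx
  set R := riccati A B Q Γ with hRdef
  have hcx : ContinuousOn x (Set.Ici 0) := continuousOn_traj A B x₀ hu
  obtain ⟨kl, Y, hY, hYL⟩ := exists_subspace_distance L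
  have hYx := (hYL x).1 hL
  have hnΓ : 0 ≤ -Γ := by simpa using sub_nonneg.2 hΓ0
  have hw := hu.add_mulVec_traj (A := A) (B := B) (x₀ := x₀) (Bᵀ * Γ)
  set w : ℝ → Fin m → ℝ := fun t => u t + (Bᵀ * Γ) *ᵥ x t with hwdef
  have hΓx : ∀ t, 0 ≤ -(x t ⬝ᵥ Γ *ᵥ x t) := fun t => by
    have := (nonneg_iff.1 hnΓ).2 (x t)
    rwa [Matrix.neg_mulVec, dotProduct_neg] at this
  have hRx : ∀ t, 0 ≤ x t ⬝ᵥ R *ᵥ x t := fun t => (nonneg_iff.1 hR).2 (x t)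
  -- In the square completion with Γ all three terms other than the initial one are nonnegative, so
  -- each is bounded separately.
  have hcost : ∀ T, 0 ≤ T → -(x T ⬝ᵥ Γ *ᵥ x T) ≤ C - x₀ ⬝ᵥ Γ *ᵥ x₀ ∧
      ∫ t in (0 : ℝ)..T, x t ⬝ᵥ R *ᵥ x t ≤ C - x₀ ⬝ᵥ Γ *ᵥ x₀ ∧
      ∫ t in (0 : ℝ)..T, w t ⬝ᵥ w t ≤ C - x₀ ⬝ᵥ Γ *ᵥ x₀ := fun T hT => by
    have h1 := hC T hT
    rw [costT_eq hΓs hu hT] at h1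
    have h2 : 0 ≤ ∫ t in (0 : ℝ)..T, x t ⬝ᵥ R *ᵥ x t :=
      intervalIntegral.integral_nonneg hT fun t _ => hRx t
    have h3 : 0 ≤ ∫ t in (0 : ℝ)..T, w t ⬝ᵥ w t :=
      intervalIntegral.integral_nonneg hT fun t _ => dot_self_nonneg _
    have h4 := hΓx T
    refine ⟨?_, ?_, ?_⟩ <;> linarith
  set C' := C - x₀ ⬝ᵥ Γ *ᵥ x₀ with hC'
  set M := closedLoop A B Γ with hM
  have hxM : VPrim x fun t => M *ᵥ x t + B *ᵥ w t := vprim_closedLoop A B Γ x₀ hu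
  -- S collects the available observations: distance to L, Γ x, and the running term φ(Γ).
  set S := Yᵀ * Y + Γᵀ * Γ + R with hS
  have hYY : 0 ≤ Yᵀ * Y := transpose_mul_self_nonneg Y
  have hGG : 0 ≤ Γᵀ * Γ := transpose_mul_self_nonneg Γ
  have hSform : ∀ v, v ⬝ᵥ S *ᵥ v = (Y *ᵥ v) ⬝ᵥ (Y *ᵥ v) + (Γ *ᵥ v) ⬝ᵥ (Γ *ᵥ v) + v ⬝ᵥ R *ᵥ v :=
    fun v => by
      rw [hS, Matrix.add_mulVec, Matrix.add_mulVec, dotProduct_add, dotProduct_add,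
        ← Matrix.mulVec_mulVec, ← Matrix.mulVec_mulVec, dot_mulVec Yᵀ, dot_mulVec Γᵀ,
        Matrix.transpose_transpose, Matrix.transpose_transpose]
  have hS0 : 0 ≤ S := add_nonneg (add_nonneg hYY hGG) hR
  clear_value S
  -- The Gramian W of the shifted reversed dynamics has as its kernel only motions that S does not
  -- see, and along trajectories its form is dominated by exponentially weighted observations.
  obtain ⟨β, hβ, hH⟩ := exists_neg_shift M
  obtain ⟨W, hW0, hWE⟩ := exists_lyapunov hH hS0
  obtain ⟨hWs, hWn⟩ := nonneg_iff.1 hW0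
  have hlyap : ∀ v, 2 * (v ⬝ᵥ W *ᵥ (M *ᵥ v)) = v ⬝ᵥ S *ᵥ v - 2 * β * (v ⬝ᵥ W *ᵥ v) := fun v => by
    have h1 := lyapunov_form hWs (M := -(M + β • 1)) v
    rw [hWE, Matrix.neg_mulVec, dotProduct_neg, Matrix.neg_mulVec, Matrix.mulVec_neg,
      dotProduct_neg, Matrix.add_mulVec, Matrix.smul_mulVec, Matrix.one_mulVec, Matrix.mulVec_add,
      Matrix.mulVec_smul, dotProduct_add, dotProduct_smul, smul_eq_mul] at h1
    linarith
  obtain ⟨c, hc, hb⟩ := exists_form_le_weighted B hW0 hβ (S := S) fun v => (hlyap v).le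
  have bY : BddHalfLine fun t => Y *ᵥ x t :=
    BddHalfLine.of_tendsto ((continuous_mulVec_of Y continuous_id).comp_continuousOn hcx) hYx
  have bΓ : BddHalfLine fun t => Γ *ᵥ x t := by
    obtain ⟨d, hd, hle⟩ := exists_mulVec_sq_le hnΓ
    refine ⟨d * C', fun t ht => ?_⟩
    have h1 := hle (x t)
    simp only [Matrix.neg_mulVec, dotProduct_neg, neg_dotProduct, neg_neg] at h1
    exact h1.trans (mul_le_mul_of_nonneg_left (hcost t ht).1 hd)
  have bW : BddHalfLine fun t => W *ᵥ x t := by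
    obtain ⟨C₁, hC₁⟩ := bY
    obtain ⟨C₂, hC₂⟩ := bΓ
    obtain ⟨d, hd, hle⟩ := exists_mulVec_sq_le hW0
    have hC₁0 : 0 ≤ C₁ := (dot_self_nonneg _).trans (hC₁ 0 le_rfl)
    have hC₂0 : 0 ≤ C₂ := (dot_self_nonneg _).trans (hC₂ 0 le_rfl)
    refine ⟨d * (x 0 ⬝ᵥ W *ᵥ x 0 + ((C₁ + C₂) / β + (C' + c * C'))), fun T hT => ?_⟩
    refine (hle (x T)).trans (mul_le_mul_of_nonneg_left ?_ hd)
    refine (hb hw hxM T hT).trans (add_le_add ?_ ?_)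
    · refine mul_le_of_le_one_left (hWn _) ?_
      rw [Real.exp_le_one_iff]
      nlinarith
    · have i1 : IntervalIntegrable (fun t => (Y *ᵥ x t) ⬝ᵥ (Y *ᵥ x t) + (Γ *ᵥ x t) ⬝ᵥ (Γ *ᵥ x t))
          volume 0 T := by
        refine intervalIntegrable_of_continuousOn ?_ hT
        have e1 := (continuous_mulVec_of Y continuous_id).comp_continuousOn hcx
        have e2 := (continuous_mulVec_of Γ continuous_id).comp_continuousOn hcx
        exact (continuousOn_dot e1 e1).add (continuousOn_dot e2 e2)
      have i2 := intervalIntegrable_of_continuousOn (continuousOn_form hcx R) hT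
      have i3 := (hw.intervalIntegrable hT).const_mul c
      have e : (fun t => x t ⬝ᵥ S *ᵥ x t + c * (w t ⬝ᵥ w t)) = fun t =>
          ((Y *ᵥ x t) ⬝ᵥ (Y *ᵥ x t) + (Γ *ᵥ x t) ⬝ᵥ (Γ *ᵥ x t)) +
          (x t ⬝ᵥ R *ᵥ x t + c * (w t ⬝ᵥ w t)) := by
        funext t
        rw [hSform]
        ring
      rw [e, weighted_add β i1 (i2.add i3)]
      refine add_le_add (weighted_le_of_le hβ (add_nonneg hC₁0 hC₂0) hT i1 fun t ht =>
        add_le_add (hC₁ t ht.1) (hC₂ t ht.1)) ?_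
      refine weighted_le_of_integral_le hβ
        (fun t => add_nonneg (hRx t) (mul_nonneg hc (dot_self_nonneg _))) hT (i2.add i3) ?_
      rw [intervalIntegral.integral_add i2 i3, intervalIntegral.integral_const_mul]
      exact add_le_add (hcost T hT).2.1 (mul_le_mul_of_nonneg_left (hcost T hT).2.2 hc)
  obtain ⟨q, r, hq, hr, hqr⟩ := exists_split (S := {z | z.re < 0}) (fun z hz => by
    have : z.re < 0 := hz
    simpa using this) M.charpoly_monic.ne_zero
  have hr' : RootsIn {z | 0 ≤ z.re} r := ⟨hr.1, fun z hz => not_lt.1 (show ¬ z.re < 0 from hr.2 z hz)⟩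
  -- The left half plane factor q annihilates r(M), so r(M) x sees only stable dynamics driven by a
  -- square integrable input.
  have br : BddHalfLine fun t => aeval M r *ᵥ x t := by
    refine BddHalfLine.of_tendsto
      ((continuous_mulVec_of (aeval M r) continuous_id).comp_continuousOn hcx)
      (tendsto_stable_part B hq (Y := aeval M r) ?_ hw hxM (C := C') fun T hT => (hcost T hT).2.2)
    rw [← map_mul, mul_comm, ← hqr, Matrix.aeval_self_charpoly]
  have hker : ∀ v, W *ᵥ v = 0 → (Y *ᵥ v = 0 ∧ Γ *ᵥ v = 0 ∧ R *ᵥ v = 0) ∧ W *ᵥ (M *ᵥ v) = 0 := by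
    intro v hv
    have h1 := hlyap v
    have h2 : v ⬝ᵥ S *ᵥ v = 0 := by
      rw [symm_dot hWs, hv, dotProduct_zero, dotProduct_zero] at h1
      linarith
    have h3 := mulVec_eq_zero_of_form hS0 h2
    rw [hSform] at h2
    have e1 := dot_self_nonneg (Y *ᵥ v)
    have e2 := dot_self_nonneg (Γ *ᵥ v)
    have e3 := (nonneg_iff.1 hR).2 v
    refine ⟨⟨dot_self_eq_zero.1 (by linarith), dot_self_eq_zero.1 (by linarith),
      mulVec_eq_zero_of_form hR (by linarith)⟩, ?_⟩
    have h4 := congrArg (· *ᵥ v) hWE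
    simp only [Matrix.add_mulVec, ← Matrix.mulVec_mulVec, hv, Matrix.mulVec_zero, zero_add,
      Matrix.neg_mulVec, h3, Matrix.mulVec_neg, Matrix.mulVec_add, Matrix.smul_mulVec,
      Matrix.one_mulVec, Matrix.mulVec_smul, smul_zero, add_zero, neg_zero, neg_eq_zero] at h4
    exact h4
  have hMA : ∀ v, W *ᵥ v = 0 → M *ᵥ v = A *ᵥ v := fun v hv =>
    closedLoop_mulVec_of_ker (hker v hv).1.2.1
  set V : Submodule ℝ (Fin n → ℝ) := kerM W ⊓ kerM (aeval M r) with hV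
  have memV : ∀ v, v ∈ V ↔ W *ᵥ v = 0 ∧ aeval M r *ᵥ v = 0 := fun v => Iff.rfl
  have hVM : ∀ v ∈ V, M *ᵥ v ∈ V := fun v hv => by
    rw [memV] at hv ⊢
    refine ⟨(hker v hv.1).2, ?_⟩
    have h3 := aeval_mulVec_comm M r Polynomial.X v
    rw [aeval_X] at h3
    rw [h3, hv.2, Matrix.mulVec_zero]
  have hKV := hinv V (fun v hv => by rw [← hMA v ((memV v).1 hv).1]; exact hVM v hv)
    (fun v hv => (hY v).1 (hker v ((memV v).1 hv).1).1.1)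
    (fun v hv => (hker v ((memV v).1 hv).1).1.2.1)
    (fun v hv => (hker v ((memV v).1 hv).1).1.2.2) r hr' (fun v hv => by
      rw [aeval_mulVec_congr hVM (fun v hv => (hMA v ((memV v).1 hv).1).symm) r hv]
      exact ((memV v).1 hv).2)
  -- K vanishes on the common kernel of W and r(M), which is the kernel of this sum of squares, and
  -- therefore factors through it.
  obtain ⟨F, hF⟩ := exists_factor (π := Wᵀ * W + (aeval M r)ᵀ * aeval M r) (Y := K) fun v hv => by
    have h1 : v ⬝ᵥ (Wᵀ * W + (aeval M r)ᵀ * aeval M r) *ᵥ v = 0 := by rw [hv, dotProduct_zero]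
    rw [Matrix.add_mulVec, dotProduct_add, ← Matrix.mulVec_mulVec, ← Matrix.mulVec_mulVec,
      dot_mulVec Wᵀ, dot_mulVec (aeval M r)ᵀ, Matrix.transpose_transpose,
      Matrix.transpose_transpose] at h1
    have e1 := dot_self_nonneg (W *ᵥ v)
    have e2 := dot_self_nonneg (aeval M r *ᵥ v)
    exact hKV v ((memV v).2 ⟨dot_self_eq_zero.1 (by linarith), dot_self_eq_zero.1 (by linarith)⟩)
  obtain ⟨D, hD⟩ := ((bW.mulVec Wᵀ).add (br.mulVec (aeval M r)ᵀ)).mulVec F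
  refine ⟨D, fun t ht => ?_⟩
  have h1 := hD t ht
  have h2 : K *ᵥ x t = F *ᵥ (Wᵀ *ᵥ (W *ᵥ x t) + (aeval M r)ᵀ *ᵥ (aeval M r *ᵥ x t)) := by
    conv_lhs => rw [hF]
    rw [← Matrix.mulVec_mulVec, Matrix.add_mulVec, Matrix.mulVec_mulVec, Matrix.mulVec_mulVec]
  beta_reduce
  rw [h2]
  exact h1

/-- Along an admissible trajectory of cost bounded above, the deviation from the feedback is square
integrable and the quadratic form of `K` is asymptotically nonpositive. -/
theorem OptimalForm.asymptotics (h : OptimalForm A B Q L K N Z) {x₀ : Fin n → ℝ}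
    {u : ℝ → Fin m → ℝ} (hu : L2loc u)
    (hL : Tendsto (fun t => eucDist L (traj A B x₀ u t)) atTop (𝓝 0)) {C : ℝ}
    (hC : ∀ T, 0 ≤ T → costT A B Q x₀ u T ≤ C) :
    ∃ e : ℝ → ℝ, Tendsto e atTop (𝓝 0) ∧
      ∀ t, traj A B x₀ u t ⬝ᵥ K *ᵥ traj A B x₀ u t ≤ e t := by
  have hb := h.bddHalfLine_mulVec hu hL hC
  set x := traj A B x₀ u with hx
  obtain ⟨Y, hY⟩ := exists_form_of_image h.symm
  obtain ⟨c, hc, hcY⟩ := exists_form_le Y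
  obtain ⟨D, hD⟩ := hb
  have hv := hu.add_mulVec_traj (A := A) (B := B) (x₀ := x₀) (Bᵀ * K)
  -- The form of K is a form in K x, hence bounded along the trajectory. This bounds the integral of
  -- the squared deviation from the feedback.
  have hint : ∀ T, 0 ≤ T → ∫ t in (0 : ℝ)..T, (u t + (Bᵀ * K) *ᵥ x t) ⬝ᵥ
      (u t + (Bᵀ * K) *ᵥ x t) ≤ C - x₀ ⬝ᵥ K *ᵥ x₀ + c * D := fun T hT => by
    have h1 := hC T hT
    rw [costT_eq h.symm hu hT, h.are] at h1
    simp only [Matrix.zero_mulVec, dotProduct_zero, intervalIntegral.integral_zero] at h1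
    have h2 := hcY (K *ᵥ x T)
    rw [← hY] at h2
    have h3 := mul_le_mul_of_nonneg_left (hD T hT) hc
    rw [← hx] at h1
    linarith
  obtain ⟨q, hq, hqx⟩ := h.stable
  obtain ⟨k, π, σ, hπσ, hker⟩ := exists_quotient_matrix (N ⊔ Z)
  have hπq : π * aeval (closedLoop A B K) q = 0 := eq_zero_mulVec fun v => by
    rw [← Matrix.mulVec_mulVec]
    exact (hker _).2 (hqx v)
  have hπ := tendsto_stable_part B hq hπq hv (vprim_closedLoop A B K x₀ hu) hint
  have hs := tendsto_mulVec σ hπ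
  rw [Matrix.mulVec_zero] at hs
  -- With s a decaying component such that x - s lies in N ⊔ Z, expanding (x - s)ᵀK(x - s) ≤ 0
  -- bounds xᵀKx by 2 sᵀKx - sᵀKs. This tends to zero because s does and K x is bounded.
  refine ⟨fun t => 2 * ((σ *ᵥ (π *ᵥ x t)) ⬝ᵥ (K *ᵥ x t)) -
    (σ *ᵥ (π *ᵥ x t)) ⬝ᵥ K *ᵥ (σ *ᵥ (π *ᵥ x t)), ?_, fun t => ?_⟩
  · have h1 := (BddHalfLine.tendsto_dot ⟨D, hD⟩ hs).const_mul 2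
    have h2 := tendsto_dot hs (tendsto_mulVec K hs)
    have h3 := h1.sub h2
    simpa using h3
  · set s := σ *ᵥ (π *ᵥ x t) with hsdef
    have hy : x t - s ∈ N ⊔ Z := by
      rw [← hker, Matrix.mulVec_sub, hsdef, Matrix.mulVec_mulVec (π *ᵥ x t), hπσ, Matrix.one_mulVec,
        sub_self]
    have hneg : (x t - s) ⬝ᵥ K *ᵥ (x t - s) ≤ 0 := by
      obtain ⟨a, ha, z, hz, haz⟩ := Submodule.mem_sup.1 hy
      rw [← haz, Matrix.mulVec_add, h.n_ker a ha, zero_add, add_dotProduct, symm_dot h.symm a z,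
        h.n_ker a ha, dotProduct_zero, zero_add]
      exact h.z_nonpos z hz
    rw [Matrix.mulVec_sub, dotProduct_sub, sub_dotProduct, sub_dotProduct,
      symm_dot h.symm (x t) s] at hneg
    linarith

end LowerBound

end IndefLQ

namespace IndefLQ

section Value

variable {n m : ℕ} {A Q K : Matrix (Fin n) (Fin n) ℝ} {B : Matrix (Fin n) (Fin m) ℝ}
  {L N Z : Submodule ℝ (Fin n → ℝ)}

/-! ### The value of the problem -/

theorem prim_costT (A Q : Matrix (Fin n) (Fin n) ℝ) (B : Matrix (Fin n) (Fin m) ℝ)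
    (x₀ : Fin n → ℝ) {u : ℝ → Fin m → ℝ} (hu : L2loc u) :
    Prim (costT A B Q x₀ u)
      fun t => traj A B x₀ u t ⬝ᵥ Q *ᵥ traj A B x₀ u t + u t ⬝ᵥ u t := by
  refine ⟨fun T hT => (intervalIntegrable_of_continuousOn
    (continuousOn_form (continuousOn_traj A B x₀ hu) Q) hT).add (hu.intervalIntegrable hT),
    fun t _ => ?_⟩
  simp [costT]

theorem cost_eq_of_tendsto {x₀ : Fin n → ℝ} {u : ℝ → Fin m → ℝ} {J : EReal}
    (h : Tendsto (fun T : ℝ => (costT A B Q x₀ u T : EReal)) atTop (𝓝 J)) :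
    cost A B Q x₀ u = J := h.limUnder_eq

/-- The limit is an eventual bound, and continuity covers the initial interval. The limit -∞ is not
yet excluded at this stage. -/
theorem exists_costT_le {x₀ : Fin n → ℝ} {u : ℝ → Fin m → ℝ} (hu : L2loc u) {J : EReal}
    (h : Tendsto (fun T : ℝ => (costT A B Q x₀ u T : EReal)) atTop (𝓝 J)) (hJ : J < ⊤) :
    ∃ C, ∀ T, 0 ≤ T → costT A B Q x₀ u T ≤ C := by
  obtain ⟨C, hJC, -⟩ := EReal.lt_iff_exists_real_btwn.1 hJ
  refine bddAbove_of_eventually (prim_costT A Q B x₀ hu).continuousOn (C := C) ?_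
  filter_upwards [h.eventually_lt_const hJC] with T hT
  exact (EReal.coe_lt_coe_iff.1 hT).le

theorem tendsto_coe {f : ℝ → ℝ} {a : ℝ} (h : Tendsto f atTop (𝓝 a)) :
    Tendsto (fun t => (f t : EReal)) atTop (𝓝 (a : EReal)) :=
  (continuous_coe_real_ereal.tendsto a).comp h

theorem OptimalForm.costT_eq (h : OptimalForm A B Q L K N Z) {x₀ : Fin n → ℝ}
    {u : ℝ → Fin m → ℝ} (hu : L2loc u) {T : ℝ} (hT : 0 ≤ T) :
    costT A B Q x₀ u T = x₀ ⬝ᵥ K *ᵥ x₀ - traj A B x₀ u T ⬝ᵥ K *ᵥ traj A B x₀ u T +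
      ∫ t in (0 : ℝ)..T, (u t + (Bᵀ * K) *ᵥ traj A B x₀ u t) ⬝ᵥ
        (u t + (Bᵀ * K) *ᵥ traj A B x₀ u t) := by
  rw [IndefLQ.costT_eq h.symm hu hT, h.are]
  simp

theorem OptimalForm.le_cost (h : OptimalForm A B Q L K N Z) {x₀ : Fin n → ℝ}
    {u : ℝ → Fin m → ℝ} (hu : u ∈ admissible A B Q L x₀) :
    ((x₀ ⬝ᵥ K *ᵥ x₀ : ℝ) : EReal) ≤ cost A B Q x₀ u := by
  obtain ⟨hu2, ⟨J, hJ⟩, hL⟩ := hu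
  rw [cost_eq_of_tendsto hJ]
  rcases eq_or_ne J ⊤ with rfl | hJt
  · exact le_top
  obtain ⟨C, hC⟩ := exists_costT_le hu2 hJ (lt_top_iff_ne_top.2 hJt)
  obtain ⟨e, he, hxe⟩ := h.asymptotics hu2 hL hC
  have h1 := tendsto_coe ((tendsto_const_nhds (x := x₀ ⬝ᵥ K *ᵥ x₀)).sub he)
  rw [sub_zero] at h1
  refine le_of_tendsto_of_tendsto h1 hJ ?_
  filter_upwards [eventually_ge_atTop 0] with T hT
  rw [EReal.coe_le_coe_iff, h.costT_eq hu2 hT]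
  have h2 : 0 ≤ ∫ t in (0 : ℝ)..T, (u t + (Bᵀ * K) *ᵥ traj A B x₀ u t) ⬝ᵥ
      (u t + (Bᵀ * K) *ᵥ traj A B x₀ u t) :=
    intervalIntegral.integral_nonneg hT fun t _ => dot_self_nonneg _
  have h3 := hxe T
  linarith

theorem tendsto_form_of_image {X : Matrix (Fin n) (Fin n) ℝ} (hX : X.IsSymm)
    {x : ℝ → Fin n → ℝ} (h : Tendsto (fun t => X *ᵥ x t) atTop (𝓝 0)) :
    Tendsto (fun t => x t ⬝ᵥ X *ᵥ x t) atTop (𝓝 0) := by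
  obtain ⟨Y, hY⟩ := exists_form_of_image hX
  simp only [hY]
  have h1 := tendsto_dot h (tendsto_mulVec Y h)
  simpa using h1

/-- Merges the oscillating and the stable part, as required by `maximal_modulo`, which allows
imaginary spectrum modulo N. -/
theorem OptimalForm.exists_nonpos_poly (h : OptimalForm A B Q L K N Z) :
    ∃ p, RootsIn {z | z.re ≤ 0} p ∧ ∀ x, aeval (closedLoop A B K) p *ᵥ x ∈ N := by
  obtain ⟨q, hq, hqx⟩ := h.stable
  obtain ⟨p, hp, hpx⟩ := h.z_osc
  refine ⟨p * q, (hp.mono fun z hz => show z.re ≤ 0 from le_of_eq hz).mul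
    (hq.mono fun z hz => show z.re ≤ 0 from le_of_lt hz), fun x => ?_⟩
  obtain ⟨a, ha, z, hz, haz⟩ := Submodule.mem_sup.1 (hqx x)
  rw [aeval_mul_mulVec, ← haz, Matrix.mulVec_add, hpx z hz, add_zero]
  exact aeval_mulVec_mem h.n_inv p ha

/-- An admissible feedback with prescribed cost. -/
theorem feedback_admissible {X : Matrix (Fin n) (Fin n) ℝ} {F : Matrix (Fin m) (Fin n) ℝ}
    (hX : X.IsSymm) (hE : (A + B * F)ᵀ * X + X * (A + B * F) = -(Q + Fᵀ * F)) {x₀ : Fin n → ℝ}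
    (hlim : Tendsto (fun t => X *ᵥ (flow (A + B * F) t *ᵥ x₀)) atTop (𝓝 0))
    (hL : Tendsto (fun t => eucDist L (flow (A + B * F) t *ᵥ x₀)) atTop (𝓝 0)) :
    (fun t => F *ᵥ (flow (A + B * F) t *ᵥ x₀)) ∈ admissible A B Q L x₀ ∧
      cost A B Q x₀ (fun t => F *ᵥ (flow (A + B * F) t *ᵥ x₀)) = ((x₀ ⬝ᵥ X *ᵥ x₀ : ℝ) : EReal) := by
  obtain ⟨hu, htraj⟩ := traj_feedback A B F x₀
  set u : ℝ → Fin m → ℝ := fun t => F *ᵥ (flow (A + B * F) t *ᵥ x₀) with hudef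
  have hcost : ∀ T, 0 ≤ T → costT A B Q x₀ u T = x₀ ⬝ᵥ X *ᵥ x₀ -
      (flow (A + B * F) T *ᵥ x₀) ⬝ᵥ X *ᵥ (flow (A + B * F) T *ᵥ x₀) := fun T hT => by
    have h1 := ((vprim_flow (A + B * F) x₀).form hX).2 T hT
    beta_reduce at h1
    rw [flow_zero, Matrix.one_mulVec] at h1
    rw [h1]
    have h2 : costT A B Q x₀ u T = ∫ t in (0 : ℝ)..T,
        -(2 * ((flow (A + B * F) t *ᵥ x₀) ⬝ᵥ X *ᵥ ((A + B * F) *ᵥ (flow (A + B * F) t *ᵥ x₀)))) := by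
      refine intervalIntegral.integral_congr fun t ht => ?_
      rw [Set.uIcc_of_le hT] at ht
      rw [htraj t ht.1, ← lyapunov_form hX, hE, Matrix.neg_mulVec, dotProduct_neg, neg_neg,
        Matrix.add_mulVec, dotProduct_add, ← Matrix.mulVec_mulVec, dot_mulVec Fᵀ,
        Matrix.transpose_transpose]
    rw [h2, intervalIntegral.integral_neg]
    ring
  have hform := tendsto_form_of_image hX hlim
  have hJ : Tendsto (fun T : ℝ => (costT A B Q x₀ u T : EReal)) atTop
      (𝓝 ((x₀ ⬝ᵥ X *ᵥ x₀ : ℝ) : EReal)) := by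
    have h1 := tendsto_coe ((tendsto_const_nhds (x := x₀ ⬝ᵥ X *ᵥ x₀)).sub hform)
    rw [sub_zero] at h1
    refine h1.congr' ?_
    filter_upwards [eventually_ge_atTop 0] with T hT
    rw [hcost T hT]
  refine ⟨⟨hu, ⟨_, hJ⟩, hL.congr' ?_⟩, cost_eq_of_tendsto hJ⟩
  filter_upwards [eventually_ge_atTop 0] with T hT
  rw [htraj T hT]

/-- The lower bound is `OptimalForm.le_cost`. For the upper bound, the approximating feedbacks of
`maximal_modulo` are admissible because N lies in L, and their costs x₀ᵀX_k x₀ converge to x₀ᵀKx₀.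
-/
theorem OptimalForm.value_eq (h : OptimalForm A B Q L K N Z) (hQ : Q.IsSymm)
    (hst : StabPair A B) (x₀ : Fin n → ℝ) :
    value A B Q L x₀ = ((x₀ ⬝ᵥ K *ᵥ x₀ : ℝ) : EReal) := by
  refine le_antisymm ?_ (le_sInf ?_)
  · obtain ⟨p, hp, hpN⟩ := h.exists_nonpos_poly
    obtain ⟨-, X, F, hXF, hlim⟩ := maximal_modulo hQ hst h.symm h.are h.n_ker h.n_inv hp hpN
    have hc : Continuous fun Y : Matrix (Fin n) (Fin n) ℝ => x₀ ⬝ᵥ Y *ᵥ x₀ := by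
      simp only [Matrix.mulVec, dotProduct]; fun_prop
    have h1 : Tendsto (fun k => ((x₀ ⬝ᵥ X k *ᵥ x₀ : ℝ) : EReal)) atTop
        (𝓝 ((x₀ ⬝ᵥ K *ᵥ x₀ : ℝ) : EReal)) :=
      (continuous_coe_real_ereal.tendsto _).comp ((hc.tendsto K).comp hlim)
    refine ge_of_tendsto' h1 fun k => ?_
    obtain ⟨hs, hE, hXN, hdecay⟩ := hXF k
    obtain ⟨d, Y, hY, hYL⟩ := exists_subspace_distance L
    obtain ⟨hadm, hcost⟩ := feedback_admissible (L := L) hs hE (hdecay (X k) hXN x₀)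
      ((hYL _).2 (hdecay Y (fun x hx => (hY x).2 (h.n_le hx)) x₀))
    rw [← hcost]
    exact sInf_le ⟨_, hadm, rfl⟩
  · rintro _ ⟨u, hu, rfl⟩
    exact h.le_cost hu

/-! ### Optimal inputs -/

theorem ae_zero_of_integral {f : ℝ → ℝ} (h0 : ∀ t, 0 ≤ f t)
    (hf : ∀ T, 0 ≤ T → IntervalIntegrable f volume 0 T)
    (h : ∀ T, 0 ≤ T → ∫ t in (0 : ℝ)..T, f t = 0) : f =ᵐ[volume.restrict (Set.Ici 0)] 0 := by
  rw [← restrict_Ioi_eq_restrict_Ici]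
  have hU : Set.Ioi (0 : ℝ) = ⋃ k : ℕ, Set.Ioc 0 (k : ℝ) := by
    ext t
    simp only [Set.mem_Ioi, Set.mem_iUnion, Set.mem_Ioc]
    constructor
    · intro ht
      obtain ⟨k, hk⟩ := exists_nat_ge t
      exact ⟨k, ht, hk⟩
    · rintro ⟨k, hk⟩
      exact hk.1
  rw [hU]
  refine (ae_restrict_iUnion_iff _ _).2 fun k => ?_
  exact (intervalIntegral.integral_eq_zero_iff_of_le_of_nonneg_ae (Nat.cast_nonneg k)
    (Eventually.of_forall h0) (hf k (Nat.cast_nonneg k))).1 (h k (Nat.cast_nonneg k))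

/-- An optimal input is given by the feedback, and the terminal form tends to zero. -/
theorem OptimalForm.of_isOptimal (h : OptimalForm A B Q L K N Z) (hQ : Q.IsSymm)
    (hst : StabPair A B) {x₀ : Fin n → ℝ} {u : ℝ → Fin m → ℝ} (hu : IsOptimal A B Q L x₀ u) :
    u =ᵐ[volume.restrict (Set.Ici 0)]
        (fun t => gain B K *ᵥ (flow (closedLoop A B K) t *ᵥ x₀)) ∧
      (∀ t, 0 ≤ t → traj A B x₀ u t = flow (closedLoop A B K) t *ᵥ x₀) ∧
      Tendsto (fun t => (flow (closedLoop A B K) t *ᵥ x₀) ⬝ᵥ K *ᵥ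
        (flow (closedLoop A B K) t *ᵥ x₀)) atTop (𝓝 0) := by
  obtain ⟨⟨hu2, ⟨J, hJ⟩, hL⟩, hval⟩ := hu
  rw [h.value_eq hQ hst, cost_eq_of_tendsto hJ] at hval
  subst hval
  obtain ⟨C, hC⟩ := exists_costT_le hu2 hJ (EReal.coe_lt_top _)
  obtain ⟨e, he, hxe⟩ := h.asymptotics hu2 hL hC
  have hJ' : Tendsto (fun T => costT A B Q x₀ u T) atTop (𝓝 (x₀ ⬝ᵥ K *ᵥ x₀)) :=
    EReal.tendsto_coe.1 hJ
  set x := traj A B x₀ u with hx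
  set f : ℝ → ℝ := fun t => (u t + (Bᵀ * K) *ᵥ x t) ⬝ᵥ (u t + (Bᵀ * K) *ᵥ x t) with hf
  have hf0 : ∀ t, 0 ≤ f t := fun t => dot_self_nonneg _
  have hfi : ∀ T, 0 ≤ T → IntervalIntegrable f volume 0 T := fun T hT =>
    (hu2.add_mulVec_traj (A := A) (B := B) (x₀ := x₀) (Bᵀ * K)).intervalIntegrable hT
  have hid : ∀ T, 0 ≤ T → costT A B Q x₀ u T = x₀ ⬝ᵥ K *ᵥ x₀ - x T ⬝ᵥ K *ᵥ x T +
      ∫ t in (0 : ℝ)..T, f t := fun T hT => h.costT_eq hu2 hT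
  -- The integral up to T is at most cost minus value plus an error, at every later time; both tend
  -- to zero for an optimal input.
  have hzero : ∀ T, 0 ≤ T → ∫ t in (0 : ℝ)..T, f t = 0 := fun T hT => by
    refine le_antisymm ?_ (intervalIntegral.integral_nonneg hT fun t _ => hf0 t)
    have h1 := (hJ'.sub_const (x₀ ⬝ᵥ K *ᵥ x₀)).add he
    rw [sub_self, add_zero] at h1
    refine ge_of_tendsto h1 ?_
    filter_upwards [eventually_ge_atTop T] with S hS
    have h2 := hid S (hT.trans hS)
    have h3 := hxe S
    have h4 := intervalIntegral.integral_mono_interval le_rfl hT hS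
      (Eventually.of_forall hf0) (hfi S (hT.trans hS))
    linarith
  have hae := ae_zero_of_integral hf0 hfi hzero
  have hu' : u =ᵐ[volume.restrict (Set.Ici 0)] fun t => gain B K *ᵥ x t := by
    filter_upwards [hae] with t ht
    have h1 : u t + (Bᵀ * K) *ᵥ x t = 0 := dot_self_eq_zero.1 ht
    rw [gain_mulVec, eq_neg_iff_add_eq_zero, Matrix.mulVec_mulVec]
    exact h1
  have htraj : ∀ t, 0 ≤ t → x t = flow (closedLoop A B K) t *ᵥ x₀ := fun t ht => by
    rw [closedLoop_eq]
    exact traj_eq_flow hu2 hu' ht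
  refine ⟨?_, htraj, ?_⟩
  · filter_upwards [hu', ae_restrict_mem measurableSet_Ici] with t h1 h2
    rw [h1, htraj t h2]
  · have h1 := (tendsto_const_nhds (x := x₀ ⬝ᵥ K *ᵥ x₀)).sub hJ'
    rw [sub_self] at h1
    refine h1.congr' ?_
    filter_upwards [eventually_ge_atTop 0] with T hT
    rw [hid T hT, hzero T hT, ← htraj T hT]
    ring

/-- A nonzero observed oscillation does not decay. -/
theorem vanish_of_oscillation {M : Matrix (Fin n) (Fin n) ℝ} {d : ℕ}
    {Y : Matrix (Fin d) (Fin n) ℝ} (hZ : ∀ x ∈ Z, M *ᵥ x ∈ Z) {p : ℝ[X]}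
    (hp : RootsIn {z | z.re = 0} p) (hpZ : ∀ x ∈ Z, aeval M p *ᵥ x = 0)
    (hlim : ∀ x ∈ Z, Tendsto (fun t => Y *ᵥ (flow M t *ᵥ x)) atTop (𝓝 0)) {x : Fin n → ℝ}
    (hx : x ∈ Z) : Y *ᵥ x = 0 := by
  set U := unobservableSubspace (LinearMap.ker Y.mulVecLin) M with hU
  by_contra hne
  have hxU : x ∉ U := fun h => hne (by simpa using unobservable_le h)
  obtain ⟨z, hz, a, ha, b, hb, hab, h1, h2⟩ := exists_eigenpair hZ hp.1 hx hxU
    (by rw [hpZ x hx]; exact U.zero_mem)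
  have hre : z.re = 0 := hp.2 z hz
  rw [hre, zero_smul, sub_zero] at h1
  rw [hre, zero_smul, sub_zero] at h2
  have hmem : ∀ q : ℝ[X], ∀ v ∈ U, ∀ t, 0 ≤ t → (Y * aeval M q) *ᵥ (flow M t *ᵥ v) = 0 := by
    intro q v hv t ht
    have h3 := flow_mulVec_mem (V := U) (fun w hw => unobservable_invariant hw) ht hv
    have h4 := mem_unobservable.1 h3 q
    rw [← Matrix.mulVec_mulVec]
    simpa using h4
  -- Modulo U, which C does not see, the flow rotates the pair (a, b), so the sum of the squared
  -- observations is constant. Since it also tends to zero, it vanishes, and all q together put a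
  -- and b into U.
  have hkey : ∀ q : ℝ[X], Y *ᵥ (aeval M q *ᵥ a) = 0 ∧ Y *ᵥ (aeval M q *ᵥ b) = 0 := fun q => by
    set C := Y * aeval M q with hC
    have hpa := (vprim_flow M a).mulVec C
    have hpb := (vprim_flow M b).mulVec C
    have hcomm : ∀ v t, M *ᵥ (flow M t *ᵥ v) = flow M t *ᵥ (M *ᵥ v) := fun v t => by
      rw [Matrix.mulVec_mulVec, Matrix.mulVec_mulVec, commute_flow]
    have da : ∀ t, 0 ≤ t → C *ᵥ (M *ᵥ (flow M t *ᵥ a)) = -(z.im • (C *ᵥ (flow M t *ᵥ b))) := by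
      intro t ht
      have h3 := hmem q _ h1 t ht
      rw [Matrix.mulVec_add, Matrix.mulVec_add, Matrix.mulVec_smul, Matrix.mulVec_smul] at h3
      rw [hcomm, eq_neg_iff_add_eq_zero]
      exact h3
    have db : ∀ t, 0 ≤ t → C *ᵥ (M *ᵥ (flow M t *ᵥ b)) = z.im • (C *ᵥ (flow M t *ᵥ a)) := by
      intro t ht
      have h3 := hmem q _ h2 t ht
      rw [Matrix.mulVec_sub, Matrix.mulVec_sub, Matrix.mulVec_smul, Matrix.mulVec_smul] at h3
      rw [hcomm, ← sub_eq_zero]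
      exact h3
    have hP := ((hpa.dot hpa).add (hpb.dot hpb)).congr_deriv (g' := fun _ => 0) fun t ht => by
      rw [da t ht, db t ht]
      simp only [neg_dotProduct, dotProduct_neg, smul_dotProduct, dotProduct_smul, smul_eq_mul]
      rw [dotProduct_comm (C *ᵥ (flow M t *ᵥ b)) (C *ᵥ (flow M t *ᵥ a))]
      ring
    have hconst : ∀ t, 0 ≤ t → (C *ᵥ (flow M t *ᵥ a)) ⬝ᵥ (C *ᵥ (flow M t *ᵥ a)) +
        (C *ᵥ (flow M t *ᵥ b)) ⬝ᵥ (C *ᵥ (flow M t *ᵥ b)) =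
        (C *ᵥ a) ⬝ᵥ (C *ᵥ a) + (C *ᵥ b) ⬝ᵥ (C *ᵥ b) := fun t ht => by
      have h3 := hP.2 t ht
      simpa [flow_zero] using h3
    have hl : ∀ v ∈ Z, Tendsto (fun t => C *ᵥ (flow M t *ᵥ v)) atTop (𝓝 0) := fun v hv => by
      refine (hlim _ (aeval_mulVec_mem hZ q hv)).congr' ?_
      filter_upwards [eventually_ge_atTop 0] with t ht
      rw [hC, ← Matrix.mulVec_mulVec]
      congr 1
      exact (flow_intertwine (Y := aeval M q) (M := M) (M' := M) (by
        have h5 := mul_aeval_of_intertwine (Y := M) (M := M) (M' := M) rfl q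
        exact h5.symm) ht v).symm
    have hsum := (tendsto_dot (hl a ha) (hl a ha)).add (tendsto_dot (hl b hb) (hl b hb))
    rw [dotProduct_zero, add_zero] at hsum
    have h4 : (C *ᵥ a) ⬝ᵥ (C *ᵥ a) + (C *ᵥ b) ⬝ᵥ (C *ᵥ b) = 0 := by
      refine tendsto_nhds_unique (tendsto_const_nhds.congr' ?_) hsum
      filter_upwards [eventually_ge_atTop 0] with t ht
      exact (hconst t ht).symm
    have e1 := dot_self_nonneg (C *ᵥ a)
    have e2 := dot_self_nonneg (C *ᵥ b)
    rw [Matrix.mulVec_mulVec, Matrix.mulVec_mulVec]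
    exact ⟨dot_self_eq_zero.1 (by linarith), dot_self_eq_zero.1 (by linarith)⟩
  exact hab ⟨mem_unobservable.2 fun q => (hkey q).1, mem_unobservable.2 fun q => (hkey q).2⟩

/-- An optimal trajectory from a point of Z is the closed loop flow, an oscillation inside Z. Its
distance to L and its terminal form tend to zero, which an oscillation allows only if both vanish
from the start. -/
theorem OptimalForm.of_attainable (h : OptimalForm A B Q L K N Z) (hQ : Q.IsSymm)
    (hst : StabPair A B) (hatt : Attainable A B Q L) :
    Z ≤ L ∧ ∀ x ∈ Z, x ⬝ᵥ K *ᵥ x = 0 := by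
  obtain ⟨p, hp, hpZ⟩ := h.z_osc
  constructor
  · intro x hx
    obtain ⟨d, Y, hY, hYL⟩ := exists_subspace_distance L
    refine (hY x).1 (vanish_of_oscillation h.z_inv hp hpZ (fun v hv => ?_) hx)
    obtain ⟨u, hu⟩ := hatt v
    obtain ⟨-, htraj, -⟩ := h.of_isOptimal hQ hst hu
    refine ((hYL _).1 hu.1.2.2).congr' ?_
    filter_upwards [eventually_ge_atTop 0] with t ht
    rw [htraj t ht]
  · intro x hx
    -- In coordinates on Z the form -K is nonnegative, so its decay along the flow gives decay of a
    -- linear observation, to which `vanish_of_oscillation` applies.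
    obtain ⟨k, σ, π, hπσ, hr⟩ := exists_basis_matrix Z
    have hσπ : ∀ v ∈ Z, σ *ᵥ (π *ᵥ v) = v := fun v hv => by
      obtain ⟨c, rfl⟩ := (hr v).1 hv
      rw [Matrix.mulVec_mulVec c π, hπσ, Matrix.one_mulVec]
    have hform : ∀ c, c ⬝ᵥ (σᵀ * (-K) * σ) *ᵥ c = -((σ *ᵥ c) ⬝ᵥ K *ᵥ (σ *ᵥ c)) := fun c => by
      rw [Matrix.mul_assoc, ← Matrix.mulVec_mulVec, dot_mulVec σᵀ, Matrix.transpose_transpose,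
        ← Matrix.mulVec_mulVec, Matrix.neg_mulVec, dotProduct_neg]
    have hD : 0 ≤ σᵀ * (-K) * σ := nonneg_iff.2 ⟨by
      rw [Matrix.IsSymm, Matrix.transpose_mul, Matrix.transpose_mul, Matrix.transpose_transpose,
        Matrix.transpose_neg, h.symm.eq, Matrix.mul_assoc], fun c => by
      rw [hform]
      have := h.z_nonpos _ ((hr _).2 ⟨c, rfl⟩)
      linarith⟩
    have h1 := vanish_of_oscillation (Y := σᵀ * (-K) * σ * π) h.z_inv hp hpZ (fun v hv => by
      obtain ⟨u, hu⟩ := hatt v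
      obtain ⟨-, -, hlim⟩ := h.of_isOptimal hQ hst hu
      have h2 := tendsto_mulVec_of_form hD
        (x := fun t => π *ᵥ (flow (closedLoop A B K) t *ᵥ v)) (by
          have h3 := hlim.neg
          rw [neg_zero] at h3
          refine h3.congr' ?_
          filter_upwards [eventually_ge_atTop 0] with t ht
          rw [hform, hσπ _ (flow_mulVec_mem h.z_inv ht hv)])
      refine h2.congr fun t => ?_
      rw [Matrix.mulVec_mulVec _ (σᵀ * (-K) * σ) π]) hx
    have h2 := hform (π *ᵥ x)
    rw [Matrix.mulVec_mulVec, h1, dotProduct_zero, hσπ x hx] at h2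
    linarith

/-- If the oscillations are free of cost and compatible with the constraint, the feedback is
optimal. -/
theorem OptimalForm.exists_optimal (h : OptimalForm A B Q L K N Z) (hQ : Q.IsSymm)
    (hst : StabPair A B) (hZL : Z ≤ L) (hZK : ∀ x ∈ Z, x ⬝ᵥ K *ᵥ x = 0) (x₀ : Fin n → ℝ) :
    ∃ u : ℝ → Fin m → ℝ, IsOptimal A B Q L x₀ u ∧
      (∀ t : ℝ, 0 ≤ t → u t = -(Bᵀ *ᵥ (K *ᵥ traj A B x₀ u t))) ∧
      ∀ v : ℝ → Fin m → ℝ, IsOptimal A B Q L x₀ v → v =ᵐ[volume.restrict (Set.Ici 0)] u := by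
  -- Now K and the distance to L both ignore N ⊔ Z, modulo which the closed loop is stable; this
  -- gives admissibility and the value.
  have hKZ := h.z_vanish hZL hZK
  obtain ⟨q, hq, hqx⟩ := h.stable
  have hdecay : ∀ {d : ℕ} (Y : Matrix (Fin d) (Fin n) ℝ), (∀ x ∈ N ⊔ Z, Y *ᵥ x = 0) →
      Tendsto (fun t => Y *ᵥ (flow (A + B * gain B K) t *ᵥ x₀)) atTop (𝓝 0) := fun Y hY => by
    rw [← closedLoop_eq]
    refine tendsto_flow_zero hq (eq_zero_mulVec fun x => ?_) x₀
    rw [← Matrix.mulVec_mulVec]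
    exact hY _ (hqx x)
  have hsup : ∀ {d : ℕ} (Y : Matrix (Fin d) (Fin n) ℝ), (∀ x ∈ N, Y *ᵥ x = 0) →
      (∀ x ∈ Z, Y *ᵥ x = 0) → ∀ x ∈ N ⊔ Z, Y *ᵥ x = 0 := fun Y h1 h2 x hx => by
    obtain ⟨a, ha, z, hz, rfl⟩ := Submodule.mem_sup.1 hx
    rw [Matrix.mulVec_add, h1 a ha, h2 z hz, add_zero]
  obtain ⟨d, Y, hY, hYL⟩ := exists_subspace_distance L
  have hE : (A + B * gain B K)ᵀ * K + K * (A + B * gain B K) =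
      -(Q + (gain B K)ᵀ * gain B K) := by
    have h1 := h.are
    unfold riccati at h1
    unfold gain
    rw [Matrix.transpose_add, Matrix.transpose_mul, Matrix.transpose_neg, Matrix.transpose_mul,
      Matrix.transpose_transpose, h.symm.eq, eq_neg_iff_add_eq_zero, ← h1]
    simp only [Matrix.mul_add, Matrix.add_mul, Matrix.mul_neg, Matrix.neg_mul, Matrix.mul_assoc,
      neg_neg]
    abel
  obtain ⟨hadm, hcost⟩ := feedback_admissible (L := L) h.symm hE
    (hdecay K (hsup K h.n_ker hKZ))
    ((hYL _).2 (hdecay Y (hsup Y (fun x hx => (hY x).2 (h.n_le hx))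
      fun x hx => (hY x).2 (hZL hx))))
  refine ⟨_, ⟨hadm, by rw [hcost, h.value_eq hQ hst]⟩, fun t ht => ?_, fun v hv => ?_⟩
  · rw [(traj_feedback A B (gain B K) x₀).2 t ht, gain_mulVec]
  · have h1 := (h.of_isOptimal hQ hst hv).1
    rw [closedLoop_eq] at h1
    exact h1

theorem OptimalForm.attainable_iff (h : OptimalForm A B Q L K N Z) (hQ : Q.IsSymm)
    (hst : StabPair A B) : Attainable A B Q L ↔ Z ≤ L ∧ ∀ x ∈ Z, x ⬝ᵥ K *ᵥ x = 0 := by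
  refine ⟨h.of_attainable hQ hst, fun hZ x₀ => ?_⟩
  obtain ⟨u, hu, -⟩ := h.exists_optimal hQ hst hZ.1 hZ.2 x₀
  exact ⟨u, hu⟩

end Value

end IndefLQ

namespace IndefLQ

/-! ### The optimal form in the Kalman decomposition -/

section Subspace

variable {ι κ : Type*} [Fintype ι] [DecidableEq ι] [Fintype κ]
variable {A Km : Matrix ι ι ℝ} {B : Matrix ι κ ℝ} {L : Submodule ℝ (ι → ℝ)} {x : ι → ℝ}

theorem mem_of_nSubspace (hx : x ∈ nSubspace A B L Km) : x ∈ L := (unobservable_le hx.1).1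

theorem mulVec_of_nSubspace (hx : x ∈ nSubspace A B L Km) : Km *ᵥ x = 0 := (unobservable_le hx.1).2

theorem nSubspace_invariant (hx : x ∈ nSubspace A B L Km) :
    closedLoop A B Km *ᵥ x ∈ nSubspace A B L Km :=
  ⟨unobservable_invariant hx.1, spectral_invariant hx.2⟩

theorem nSubspace_le_specPos : nSubspace A B L Km ≤ specPos (closedLoop A B Km) := inf_le_right

theorem ker_le_gapComplement (D : Matrix ι ι ℝ) (N : Submodule ℝ (ι → ℝ)) :
    kerM D ≤ gapComplement D N := fun x hx y _ => by
  rw [show D.mulVecLin x = 0 from hx, dotProduct_zero]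

theorem exists_spectral_decomp (M : Matrix ι ι ℝ) (x : ι → ℝ) :
    ∃ a ∈ specPos M, ∃ b ∈ specZero M, ∃ c ∈ specNeg M, x = a + (b + c) := by
  have h : x ∈ specPos M ⊔ spectralSubspace {z | z.re ≤ 0} M := by
    rw [(isCompl_specPos M).sup_eq_top]; trivial
  rw [spectral_nonpos_eq] at h
  obtain ⟨a, ha, y, hy, rfl⟩ := Submodule.mem_sup.1 h
  obtain ⟨b, hb, c, hc, rfl⟩ := Submodule.mem_sup.1 hy
  exact ⟨a, ha, b, hb, c, hc, rfl⟩

/-- Applying the left half plane factor leaves a vector killed by the two remaining factors, and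
these are coprime. -/
theorem exists_aeval_mem_specZero_sup_specPos (M : Matrix ι ι ℝ) :
    ∃ p, RootsIn {z | z.re < 0} p ∧ ∀ x, aeval M p *ᵥ x ∈ specPos M ⊔ specZero M := by
  obtain ⟨p, q, r, hp, hq, hr, hM⟩ := exists_spectral_split M
  refine ⟨p, hp, fun x => ?_⟩
  obtain ⟨a, b, hab⟩ := hq.isCoprime disjoint_zero_pos hr
  have h : aeval M p *ᵥ x = aeval M (a * q) *ᵥ (aeval M p *ᵥ x) +
      aeval M (b * r) *ᵥ (aeval M p *ᵥ x) := by
    rw [← Matrix.add_mulVec, ← map_add, hab, map_one, Matrix.one_mulVec]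
  rw [h]
  refine Submodule.add_mem_sup (mem_specPos.2 ⟨r, hr, ?_⟩) (mem_specZero.2 ⟨q, hq, ?_⟩)
  · rw [← aeval_mul_mulVec, ← aeval_mul_mulVec,
      show r * (a * q) * p = a * (p * q * r) by ring, map_mul, hM, Matrix.mul_zero,
      Matrix.zero_mulVec]
  · rw [← aeval_mul_mulVec, ← aeval_mul_mulVec,
      show q * (b * r) * p = b * (p * q * r) by ring, map_mul, hM, Matrix.mul_zero,
      Matrix.zero_mulVec]

end Subspace

namespace KalmanForm

variable {n m n₁ n₂ : ℕ} {A Q : Matrix (Fin n) (Fin n) ℝ} {B : Matrix (Fin n) (Fin m) ℝ}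
  {E₁ : Matrix (Fin n) (Fin n₁) ℝ} {E₂ : Matrix (Fin n) (Fin n₂) ℝ}
  {S₁ : Matrix (Fin n₁) (Fin n) ℝ} {S₂ : Matrix (Fin n₂) (Fin n) ℝ}
  {A₁ : Matrix (Fin n₁) (Fin n₁) ℝ} {A₁₂ : Matrix (Fin n₁) (Fin n₂) ℝ}
  {A₂ : Matrix (Fin n₂) (Fin n₂) ℝ} {B₁ : Matrix (Fin n₁) (Fin m) ℝ}
  {L : Submodule ℝ (Fin n → ℝ)} {K Γ : Matrix (Fin n) (Fin n) ℝ}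
  {Km Kp P : Matrix (Fin n₁) (Fin n₁) ℝ}

/-- Once the upper left block is fixed, the off-diagonal block of the Riccati equation is a linear
Sylvester equation. -/
theorem riccati_offDiag (hk : KalmanForm A B E₁ E₂ S₁ S₂ A₁ A₁₂ A₂ B₁) (hK : K.IsSymm) :
    E₁ᵀ * riccati A B Q K * E₂ =
      (closedLoop A₁ B₁ (E₁ᵀ * K * E₁))ᵀ * (E₁ᵀ * K * E₂) + E₁ᵀ * K * E₂ * A₂ +
        (E₁ᵀ * Q * E₂ + E₁ᵀ * K * E₁ * A₁₂) := by
  have ha : E₁ᵀ * Aᵀ = A₁ᵀ * E₁ᵀ := by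
    rw [← Matrix.transpose_mul, hk.a1, Matrix.transpose_mul]
  have hB : E₁ᵀ * K * B * Bᵀ * K * E₂ =
      E₁ᵀ * K * E₁ * (B₁ * B₁ᵀ) * (E₁ᵀ * K * E₂) := by
    conv_lhs => rw [hk.b1]
    rw [Matrix.transpose_mul]
    simp only [Matrix.mul_assoc]
  have hcl : (closedLoop A₁ B₁ (E₁ᵀ * K * E₁))ᵀ = A₁ᵀ - E₁ᵀ * K * E₁ * (B₁ * B₁ᵀ) := by
    unfold closedLoop
    rw [Matrix.transpose_sub, Matrix.transpose_mul, Matrix.transpose_mul B₁,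
      Matrix.transpose_transpose, (isSymm_compress hK E₁).eq]
  calc E₁ᵀ * riccati A B Q K * E₂
      = E₁ᵀ * Aᵀ * K * E₂ + E₁ᵀ * K * (A * E₂) + E₁ᵀ * Q * E₂ - E₁ᵀ * K * B * Bᵀ * K * E₂ := by
        unfold riccati
        simp only [Matrix.mul_add, Matrix.add_mul, Matrix.mul_sub, Matrix.sub_mul,
          Matrix.mul_assoc]
    _ = _ := by
        rw [ha, hk.a2, hB, hcl]
        simp only [Matrix.mul_add, Matrix.sub_mul, Matrix.mul_assoc]
        abel

/-- The quadratic term sees the state only through B₁, hence involves no lower right block; what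
remains is a Lyapunov equation for that block. -/
theorem riccati_lower (hk : KalmanForm A B E₁ E₂ S₁ S₂ A₁ A₁₂ A₂ B₁) (hK : K.IsSymm) :
    E₂ᵀ * riccati A B Q K * E₂ =
      A₂ᵀ * (E₂ᵀ * K * E₂) + E₂ᵀ * K * E₂ * A₂ -
        ((E₁ᵀ * K * E₂)ᵀ * B₁ * B₁ᵀ * (E₁ᵀ * K * E₂) - (E₁ᵀ * K * E₂)ᵀ * A₁₂ -
          A₁₂ᵀ * (E₁ᵀ * K * E₂) - E₂ᵀ * Q * E₂) := by
  have ha : E₂ᵀ * Aᵀ = A₁₂ᵀ * E₁ᵀ + A₂ᵀ * E₂ᵀ := by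
    rw [← Matrix.transpose_mul, hk.a2, Matrix.transpose_add, Matrix.transpose_mul,
      Matrix.transpose_mul]
  have hB : E₂ᵀ * K * B * Bᵀ * K * E₂ =
      E₂ᵀ * K * E₁ * B₁ * B₁ᵀ * (E₁ᵀ * K * E₂) := by
    conv_lhs => rw [hk.b1]
    rw [Matrix.transpose_mul]
    simp only [Matrix.mul_assoc]
  have ht : (E₁ᵀ * K * E₂)ᵀ = E₂ᵀ * K * E₁ := by
    rw [Matrix.transpose_mul, Matrix.transpose_mul, Matrix.transpose_transpose, hK.eq,
      Matrix.mul_assoc]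
  calc E₂ᵀ * riccati A B Q K * E₂
      = E₂ᵀ * Aᵀ * K * E₂ + E₂ᵀ * K * (A * E₂) + E₂ᵀ * Q * E₂ - E₂ᵀ * K * B * Bᵀ * K * E₂ := by
        unfold riccati
        simp only [Matrix.mul_add, Matrix.add_mul, Matrix.mul_sub, Matrix.sub_mul,
          Matrix.mul_assoc]
    _ = _ := by
        rw [ha, hk.a2, hB, ht]
        simp only [Matrix.mul_add, Matrix.add_mul, Matrix.mul_assoc]
        abel

/-- A symmetric matrix vanishes if its blocks do. -/
theorem eq_zero_of_blocks (hk : KalmanForm A B E₁ E₂ S₁ S₂ A₁ A₁₂ A₂ B₁)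
    {Y : Matrix (Fin n) (Fin n) ℝ} (hY : Y.IsSymm) (h11 : E₁ᵀ * Y * E₁ = 0)
    (h12 : E₁ᵀ * Y * E₂ = 0) (h22 : E₂ᵀ * Y * E₂ = 0) : Y = 0 := by
  have h21 : E₂ᵀ * Y * E₁ = 0 := by
    have h := congrArg Matrix.transpose h12
    rwa [Matrix.transpose_mul, Matrix.transpose_mul, Matrix.transpose_transpose, hY.eq,
      ← Matrix.mul_assoc, Matrix.transpose_zero] at h
  have key : ∀ {k l k' l' : ℕ} (E : Matrix (Fin n) (Fin k) ℝ) (F : Matrix (Fin n) (Fin l) ℝ)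
      (S : Matrix (Fin k) (Fin k') ℝ) (U : Matrix (Fin l) (Fin l') ℝ), Eᵀ * Y * F = 0 →
      Sᵀ * Eᵀ * Y * (F * U) = 0 := fun E F S U h => by
    rw [show Sᵀ * Eᵀ * Y * (F * U) = Sᵀ * (Eᵀ * Y * F) * U by simp only [Matrix.mul_assoc], h,
      Matrix.mul_zero, Matrix.zero_mul]
  calc Y = (E₁ * S₁ + E₂ * S₂)ᵀ * Y * (E₁ * S₁ + E₂ * S₂) := by
        rw [hk.sum, Matrix.transpose_one, Matrix.one_mul, Matrix.mul_one]
    _ = 0 := by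
        rw [Matrix.transpose_add, Matrix.transpose_mul, Matrix.transpose_mul, Matrix.add_mul,
          Matrix.mul_add, Matrix.add_mul, Matrix.add_mul, key _ _ _ _ h11, key _ _ _ _ h12,
          key _ _ _ _ h21, key _ _ _ _ h22]
        simp

theorem nSubspace_state_invariant {z : Fin n₁ → ℝ}
    (hz : z ∈ nSubspace A₁ B₁ (L.comap E₁.mulVecLin) Km) :
    A₁ *ᵥ z ∈ nSubspace A₁ B₁ (L.comap E₁.mulVecLin) Km := by
  have h := nSubspace_invariant hz
  rwa [closedLoop_mulVec_of_ker (mulVec_of_nSubspace hz)] at h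

/-- The matrix assembled from the three blocks solves the Riccati equation. -/
theorem riccati_eq_zero (hk : KalmanForm A B E₁ E₂ S₁ S₂ A₁ A₁₂ A₂ B₁) (hQ : Q.IsSymm)
    (hΓ : Γ ∈ negAriSolutions A B Q) (hm : Km ∈ areSolutions A₁ B₁ (E₁ᵀ * Q * E₁))
    (hp : Kp ∈ areSolutions A₁ B₁ (E₁ᵀ * Q * E₁)) (hle : 0 ≤ E₁ᵀ * Γ * E₁ - Km)
    (hpc : RootsIn {z | z.re ≤ 0} (closedLoop A₁ B₁ Kp).charpoly)
    (hP : IsProjectionAlong P (nSubspace A₁ B₁ (L.comap E₁.mulVecLin) Km)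
      (gapComplement (Kp - Km) (nSubspace A₁ B₁ (L.comap E₁.mulVecLin) Km)))
    (hK : K.IsSymm) (h11 : E₁ᵀ * K * E₁ = mixed Km Kp P)
    (hoff : OffDiagonalBlock A₁ A₁₂ A₂ B₁ (E₁ᵀ * Q * E₂) (mixed Km Kp P) (E₁ᵀ * K * E₂))
    (hlow : LowerBlock A₁₂ A₂ B₁ (E₂ᵀ * Q * E₂) (E₁ᵀ * K * E₂) (E₂ᵀ * K * E₂)) :
    riccati A B Q K = 0 := by
  obtain ⟨o1, o2, o3⟩ := hoff
  refine hk.eq_zero_of_blocks (riccati_isSymm hQ hK) ?_ ?_ ?_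
  · rw [hk.riccati_compress, h11]
    exact mixed_riccati hm hp (fun x hx => nSubspace_invariant hx) hP
  · rw [hk.riccati_offDiag hK, h11]
    set X := E₁ᵀ * K * E₂ with hX
    set M := closedLoop A₁ B₁ (mixed Km Kp P) with hM
    refine eq_of_vecMul fun x => ?_
    rw [Matrix.vecMul_zero]
    obtain ⟨a, ha, b, hb, c, hc, rfl⟩ := exists_spectral_decomp M x
    -- On 𝒳⁺ = 𝒩₁ the Sylvester equation is not imposed. It holds because every term vanishes: the
    -- off-diagonal block by its normalization, Q by `KalmanForm.vanish`, and the upper left block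
    -- because K₁⁻ vanishes there.
    have hpos : a ᵥ* (Mᵀ * X + X * A₂ + (E₁ᵀ * Q * E₂ + mixed Km Kp P * A₁₂)) = 0 := by
      have haN : a ∈ nSubspace A₁ B₁ (L.comap E₁.mulVecLin) Km := by
        rwa [← specPos_mixed hm hp hpc (fun x hx => nSubspace_invariant hx)
          nSubspace_le_specPos hP]
      have hq := (hk.vanish hΓ hm hle (fun z hz => nSubspace_state_invariant hz)
        (fun z hz => mulVec_of_nSubspace hz) haN).2.2
      have h1 : a ᵥ* (E₁ᵀ * Q * E₂) = 0 := by
        rw [← Matrix.vecMul_vecMul, ← Matrix.vecMul_vecMul, Matrix.vecMul_transpose,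
          ← Matrix.mulVec_transpose Q, hQ.eq, hq, Matrix.zero_vecMul]
      have h2 : a ᵥ* (mixed Km Kp P * A₁₂) = 0 := by
        rw [← Matrix.vecMul_vecMul, ← Matrix.mulVec_transpose (mixed Km Kp P), (mixed_isSymm hm.1 hp.1 hP).eq,
          mixed_left hP haN, mulVec_of_nSubspace haN, Matrix.zero_vecMul]
      rw [Matrix.vecMul_add, Matrix.vecMul_add (E₁ᵀ * Q * E₂), h1, h2, vecMul_sylvester, o1 a ha,
        o1 _ (spectral_invariant ha), Matrix.zero_vecMul]
      simp
    rw [Matrix.add_vecMul, Matrix.add_vecMul, hpos, Matrix.vecMul_add (Mᵀ * X + X * A₂),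
      Matrix.vecMul_add (Mᵀ * X + X * A₂), o2 b hb,
      o3 c hc, Matrix.vecMul_neg, Matrix.vecMul_neg]
    simp
  · rw [hk.riccati_lower hK, sub_eq_zero]
    exact hlow

/-- The assembled matrix is the optimal form of the problem. -/
theorem optimalForm (hk : KalmanForm A B E₁ E₂ S₁ S₂ A₁ A₁₂ A₂ B₁) (hQ : Q.IsSymm)
    (hst : StabPair A B) (hΓ : Γ ∈ negAriSolutions A B Q)
    (hm : IsLeast (areSolutions A₁ B₁ (E₁ᵀ * Q * E₁)) Km)
    (hp : IsGreatest (areSolutions A₁ B₁ (E₁ᵀ * Q * E₁)) Kp) (hle : 0 ≤ E₁ᵀ * Γ * E₁ - Km)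
    (hmc : RootsIn {z | 0 ≤ z.re} (closedLoop A₁ B₁ Km).charpoly)
    (hpc : RootsIn {z | z.re ≤ 0} (closedLoop A₁ B₁ Kp).charpoly)
    (hP : IsProjectionAlong P (nSubspace A₁ B₁ (L.comap E₁.mulVecLin) Km)
      (gapComplement (Kp - Km) (nSubspace A₁ B₁ (L.comap E₁.mulVecLin) Km)))
    (hK : K.IsSymm) (h11 : E₁ᵀ * K * E₁ = mixed Km Kp P)
    (hoff : OffDiagonalBlock A₁ A₁₂ A₂ B₁ (E₁ᵀ * Q * E₂) (mixed Km Kp P) (E₁ᵀ * K * E₂))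
    (hlow : LowerBlock A₁₂ A₂ B₁ (E₂ᵀ * Q * E₂) (E₁ᵀ * K * E₂) (E₂ᵀ * K * E₂)) :
    OptimalForm A B Q L K ((nSubspace A₁ B₁ (L.comap E₁.mulVecLin) Km).map E₁.mulVecLin)
      ((kerM (Kp - Km)).map E₁.mulVecLin) := by
  have hφ := hk.riccati_eq_zero hQ hΓ hm.1 hp.1 hle hpc hP hK h11 hoff hlow
  have hst₁ := StabPair.of_top hk.controllable_eq_top
  set N₁ := nSubspace A₁ B₁ (L.comap E₁.mulVecLin) Km with hN₁
  have hNinv : ∀ x ∈ N₁, closedLoop A₁ B₁ Km *ᵥ x ∈ N₁ := fun x hx => nSubspace_invariant hx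
  have hpos := specPos_mixed hm.1 hp.1 hpc hNinv nSubspace_le_specPos hP
  have hzero := specZero_mixed hst₁ hm hp hmc hpc hNinv nSubspace_le_specPos hP
  have hcl : ∀ z, closedLoop A B K *ᵥ (E₁ *ᵥ z) =
      E₁ *ᵥ (closedLoop A₁ B₁ (mixed Km Kp P) *ᵥ z) := fun z => by
    rw [Matrix.mulVec_mulVec, hk.closedLoop_embed, h11, ← Matrix.mulVec_mulVec]
  have hclp : ∀ (p : ℝ[X]) z, aeval (closedLoop A B K) p *ᵥ (E₁ *ᵥ z) =
      E₁ *ᵥ (aeval (closedLoop A₁ B₁ (mixed Km Kp P)) p *ᵥ z) := fun p z => by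
    have h := mul_aeval_of_intertwine (Y := E₁) (M := closedLoop A₁ B₁ (mixed Km Kp P))
      (M' := closedLoop A B K) (by rw [hk.closedLoop_embed, h11]) p
    rw [Matrix.mulVec_mulVec, ← h, ← Matrix.mulVec_mulVec]
  -- The upper component is K₁⁻ on 𝒩₁, which is zero, and the lower one is the normalization of the
  -- off-diagonal block.
  have hKN : ∀ z ∈ N₁, K *ᵥ (E₁ *ᵥ z) = 0 := fun z hz => by
    have h1 : E₁ᵀ *ᵥ (K *ᵥ (E₁ *ᵥ z)) = 0 := by
      rw [← embed_mulVec, h11, mixed_left hP hz, mulVec_of_nSubspace hz]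
    have h2 : E₂ᵀ *ᵥ (K *ᵥ (E₁ *ᵥ z)) = 0 := by
      have h3 := hoff.1 z (by rwa [hpos])
      rw [← Matrix.mulVec_transpose, Matrix.transpose_mul, Matrix.transpose_mul,
        Matrix.transpose_transpose, hK.eq] at h3
      simpa only [Matrix.mulVec_mulVec] using h3
    have h4 : (E₁ * S₁ + E₂ * S₂)ᵀ *ᵥ (K *ᵥ (E₁ *ᵥ z)) = 0 := by
      rw [Matrix.transpose_add, Matrix.transpose_mul, Matrix.transpose_mul, Matrix.add_mulVec,
        ← Matrix.mulVec_mulVec, ← Matrix.mulVec_mulVec, h1, h2]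
      simp
    rwa [hk.sum, Matrix.transpose_one, Matrix.one_mulVec] at h4
  have hKZ : ∀ d ∈ kerM (Kp - Km), mixed Km Kp P *ᵥ d = Km *ᵥ d := fun d hd => by
    rw [mixed_right hP (ker_le_gapComplement _ _ hd)]
    have h : (Kp - Km) *ᵥ d = 0 := hd
    rwa [Matrix.sub_mulVec, sub_eq_zero] at h
  have hform : ∀ d ∈ kerM (Kp - Km), (E₁ *ᵥ d) ⬝ᵥ K *ᵥ (E₁ *ᵥ d) = d ⬝ᵥ Km *ᵥ d :=
    fun d hd => by rw [← dot_embed, h11, hKZ d hd]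
  -- K₁⁻ ≤ Γ₁ ≤ 0, so -K₁⁻ is nonnegative.
  have hneg : 0 ≤ -Km := by
    have h1 : 0 ≤ -Γ := by simpa using sub_nonneg.2 hΓ.2.2
    have h2 := add_nonneg hle (conj_nonneg h1 E₁)
    rwa [show E₁ᵀ * Γ * E₁ - Km + E₁ᵀ * -Γ * E₁ = -Km by
      rw [Matrix.mul_neg, Matrix.neg_mul]; abel] at h2
  have hosc : ∃ p, RootsIn {z | z.re = 0} p ∧ ∀ x ∈ (kerM (Kp - Km)).map E₁.mulVecLin,
      aeval (closedLoop A B K) p *ᵥ x = 0 := by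
    refine ⟨rootFactor {z | z.re = 0} (closedLoop A₁ B₁ (mixed Km Kp P)).charpoly,
      rootsIn_rootFactor _ _, ?_⟩
    rintro _ ⟨d, hd, rfl⟩
    rw [SetLike.mem_coe, ← hzero] at hd
    have h : aeval (closedLoop A₁ B₁ (mixed Km Kp P)) (rootFactor {z | z.re = 0}
      (closedLoop A₁ B₁ (mixed Km Kp P)).charpoly) *ᵥ d = 0 := hd
    rw [Matrix.mulVecLin_apply, hclp, h, Matrix.mulVec_zero]
  have hstable : ∃ q, RootsIn {z | z.re < 0} q ∧ ∀ x, aeval (closedLoop A B K) q *ᵥ x ∈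
      N₁.map E₁.mulVecLin ⊔ (kerM (Kp - Km)).map E₁.mulVecLin := by
    obtain ⟨r, hr, hr0⟩ := hk.hurwitz hst
    obtain ⟨p, hp', hpM⟩ :=
      exists_aeval_mem_specZero_sup_specPos (closedLoop A₁ B₁ (mixed Km Kp P))
    -- The factor r removes the uncontrollable dynamics, and p then removes the stable part of the
    -- controllable closed loop.
    refine ⟨p * r, hp'.mul hr, fun x => ?_⟩
    have h1 : S₂ *ᵥ (aeval (closedLoop A B K) r *ᵥ x) = 0 := by
      rw [Matrix.mulVec_mulVec, mul_aeval_of_intertwine (hk.s2_closedLoop K), hr0,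
        Matrix.zero_mul, Matrix.zero_mulVec]
    rw [aeval_mul_mulVec, hk.eq_embed h1, hclp, ← Submodule.map_sup, ← hpos, ← hzero]
    exact ⟨_, hpM _, rfl⟩
  have hNinv' : ∀ x ∈ N₁.map E₁.mulVecLin, closedLoop A B K *ᵥ x ∈ N₁.map E₁.mulVecLin := by
    rintro _ ⟨z, hz, rfl⟩
    rw [Matrix.mulVecLin_apply, hcl, closedLoop_congr (mixed_left hP hz)]
    exact ⟨_, hNinv z hz, rfl⟩
  have hKN' : ∀ x ∈ N₁.map E₁.mulVecLin, K *ᵥ x = 0 := by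
    rintro _ ⟨z, hz, rfl⟩
    exact hKN z hz
  -- Γ also vanishes on 𝒩₁, so the maximality of K modulo 𝒩₁ applies to it.
  have hD : 0 ≤ K - Γ := by
    obtain ⟨p, hp', hpZ⟩ := hosc
    obtain ⟨q, hq, hqx⟩ := hstable
    refine (maximal_modulo hQ hst hK hφ hKN' hNinv' (p := p * q)
      ((hp'.mono fun z (hz : z.re = 0) => hz.le).mul (hq.mono fun z (hz : z.re < 0) => hz.le))
      fun x => ?_).1 Γ hΓ.1 ?_ hΓ.2.1
    · obtain ⟨a, ha, d, hd, h⟩ := Submodule.mem_sup.1 (hqx x)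
      rw [aeval_mul_mulVec, ← h, Matrix.mulVec_add, hpZ d hd, add_zero]
      exact aeval_mulVec_mem hNinv' p ha
    · rintro _ ⟨z, hz, rfl⟩
      exact (hk.vanish hΓ hm.1 hle (fun z hz => nSubspace_state_invariant hz)
        (fun z hz => mulVec_of_nSubspace hz) hz).1
  have hinvZ : ∀ x ∈ (kerM (Kp - Km)).map E₁.mulVecLin,
      closedLoop A B K *ᵥ x ∈ (kerM (Kp - Km)).map E₁.mulVecLin := by
    rintro _ ⟨d, hd, rfl⟩
    rw [Matrix.mulVecLin_apply, hcl, closedLoop_congr (hKZ d hd)]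
    exact ⟨_, ker_gap_invariant hm.1 hp.1 hd, rfl⟩
  have hinvisible : ∀ V : Submodule ℝ (Fin n → ℝ), (∀ x ∈ V, A *ᵥ x ∈ V) → V ≤ L →
      (∀ x ∈ V, Γ *ᵥ x = 0) → (∀ x ∈ V, riccati A B Q Γ *ᵥ x = 0) →
      ∀ p, RootsIn {z | 0 ≤ z.re} p → (∀ x ∈ V, aeval A p *ᵥ x = 0) → ∀ x ∈ V, K *ᵥ x = 0 :=
    fun V hV hVL hVΓ hVφ p hp' hpV x hx =>
      hk.unobservable_vanish hst hφ hΓ.1 hD hm.1 hle hKN hV hVL hVΓ hVφ hp' hpV hx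
  refine ⟨hK, hφ, ?_, hKN', hNinv', hinvZ, hosc, hstable, ?_, ?_, Γ, hΓ, hinvisible⟩
  · rintro _ ⟨z, hz, rfl⟩
    exact Submodule.mem_comap.1 (mem_of_nSubspace (L := L.comap E₁.mulVecLin) hz)
  · rintro _ ⟨d, hd, rfl⟩
    have h := (nonneg_iff.1 hneg).2 d
    rw [Matrix.neg_mulVec, dotProduct_neg] at h
    rw [Matrix.mulVecLin_apply, hform d hd]
    linarith
  -- A vanishing form of K on Ker Δ₁ makes K₁⁻ vanish there. Then Γ and φ(Γ) vanish too, the closed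
  -- loop is A, and Ker Δ₁ is one of the invisible subspaces.
  · intro hZL hZK
    have hKm0 : ∀ d ∈ kerM (Kp - Km), Km *ᵥ d = 0 := fun d hd => by
      have h1 := hZK _ ⟨d, hd, rfl⟩
      rw [Matrix.mulVecLin_apply, hform d hd] at h1
      have h2 := mulVec_eq_zero_of_form hneg (x := d) (by
        rw [Matrix.neg_mulVec, dotProduct_neg, h1, neg_zero])
      rwa [Matrix.neg_mulVec, neg_eq_zero] at h2
    have hAd : ∀ d ∈ kerM (Kp - Km), A₁ *ᵥ d ∈ kerM (Kp - Km) := fun d hd => by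
      have h := ker_gap_invariant hm.1 hp.1 hd
      rwa [closedLoop_mulVec_of_ker (hKm0 d hd)] at h
    have hv := fun d (hd : d ∈ kerM (Kp - Km)) => hk.vanish hΓ hm.1 hle hAd hKm0 hd
    have hAE : ∀ d, A *ᵥ (E₁ *ᵥ d) = E₁ *ᵥ (A₁ *ᵥ d) := fun d => by
      rw [Matrix.mulVec_mulVec, hk.a1, ← Matrix.mulVec_mulVec]
    obtain ⟨p, hp', hpZ⟩ := hosc
    have hclA : ∀ d ∈ kerM (Kp - Km), closedLoop A₁ B₁ (mixed Km Kp P) *ᵥ d = A₁ *ᵥ d :=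
      fun d hd => closedLoop_mulVec_of_ker (by rw [hKZ d hd, hKm0 d hd])
    refine hinvisible _ ?_ hZL ?_ ?_ p (hp'.mono fun z (hz : z.re = 0) => hz.ge) ?_
    · rintro _ ⟨d, hd, rfl⟩
      rw [Matrix.mulVecLin_apply, hAE]
      exact ⟨_, hAd d hd, rfl⟩
    · rintro _ ⟨d, hd, rfl⟩
      exact (hv d hd).1
    · rintro _ ⟨d, hd, rfl⟩
      exact (hv d hd).2.1
    · rintro _ ⟨d, hd, rfl⟩
      have h1 := hpZ _ ⟨d, hd, rfl⟩
      rw [Matrix.mulVecLin_apply, hclp, aeval_mulVec_congr hAd hclA p hd] at h1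
      rw [Matrix.mulVecLin_apply, Matrix.mulVec_mulVec,
        ← mul_aeval_of_intertwine hk.a1.symm, ← Matrix.mulVec_mulVec]
      exact h1

/-- The two forms of the attainability condition agree. -/
theorem attainability_condition_iff (hle : 0 ≤ E₁ᵀ * Γ * E₁ - Km) (hΓ : Γ ≤ 0)
    (hP : IsProjectionAlong P (nSubspace A₁ B₁ (L.comap E₁.mulVecLin) Km)
      (gapComplement (Kp - Km) (nSubspace A₁ B₁ (L.comap E₁.mulVecLin) Km)))
    (h11 : E₁ᵀ * K * E₁ = mixed Km Kp P) :
    ((kerM (Kp - Km)).map E₁.mulVecLin ≤ L ∧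
        ∀ x ∈ (kerM (Kp - Km)).map E₁.mulVecLin, x ⬝ᵥ K *ᵥ x = 0) ↔
      kerM (Kp - Km) ≤ L.comap E₁.mulVecLin ⊓ kerM Km := by
  have hneg : 0 ≤ -Km := by
    have h1 : 0 ≤ -Γ := by simpa using sub_nonneg.2 hΓ
    have h2 := add_nonneg hle (conj_nonneg h1 E₁)
    rwa [show E₁ᵀ * Γ * E₁ - Km + E₁ᵀ * -Γ * E₁ = -Km by
      rw [Matrix.mul_neg, Matrix.neg_mul]; abel] at h2
  have hform : ∀ d ∈ kerM (Kp - Km), (E₁ *ᵥ d) ⬝ᵥ K *ᵥ (E₁ *ᵥ d) = d ⬝ᵥ Km *ᵥ d :=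
    fun d hd => by
      rw [← dot_embed, h11, mixed_right hP (ker_le_gapComplement _ _ hd)]
      have h : (Kp - Km) *ᵥ d = 0 := hd
      rw [Matrix.sub_mulVec, sub_eq_zero] at h
      rw [h]
  rw [Submodule.map_le_iff_le_comap, le_inf_iff]
  refine and_congr_right fun _ => ⟨fun h d hd => ?_, ?_⟩
  · have h1 := h _ ⟨d, hd, rfl⟩
    rw [Matrix.mulVecLin_apply, hform d hd] at h1
    have h2 := mulVec_eq_zero_of_form hneg (x := d) (by
      rw [Matrix.neg_mulVec, dotProduct_neg, h1, neg_zero])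
    rw [Matrix.neg_mulVec, neg_eq_zero] at h2
    exact h2
  · rintro h _ ⟨d, hd, rfl⟩
    have h1 : Km *ᵥ d = 0 := h hd
    rw [Matrix.mulVecLin_apply, hform d hd, h1, dotProduct_zero]

end KalmanForm

end IndefLQ

namespace IndefLQ

/-! ### The blocks of the optimal solution and the conclusion -/

section Assembly

variable {n m n₁ n₂ : ℕ} {A Q : Matrix (Fin n) (Fin n) ℝ} {B : Matrix (Fin n) (Fin m) ℝ}

theorem coordForm_blocks (M : Matrix (Fin n) (Fin n) ℝ)
    (b : Module.Basis (Fin n₁ ⊕ Fin n₂) ℝ (Fin n → ℝ)) :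
    (coordForm M b).toBlocks₁₁ = ((colMatrix b).submatrix id Sum.inl)ᵀ * M *
        (colMatrix b).submatrix id Sum.inl ∧
      (coordForm M b).toBlocks₁₂ = ((colMatrix b).submatrix id Sum.inl)ᵀ * M *
        (colMatrix b).submatrix id Sum.inr ∧
      (coordForm M b).toBlocks₂₂ = ((colMatrix b).submatrix id Sum.inr)ᵀ * M *
        (colMatrix b).submatrix id Sum.inr :=
  ⟨rfl, rfl, rfl⟩

theorem lower_rhs_isSymm {K₁₂ A₁₂ : Matrix (Fin n₁) (Fin n₂) ℝ} (B₁ : Matrix (Fin n₁) (Fin m) ℝ)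
    {Q₂ : Matrix (Fin n₂) (Fin n₂) ℝ} (hQ₂ : Q₂.IsSymm) :
    (K₁₂ᵀ * B₁ * B₁ᵀ * K₁₂ - K₁₂ᵀ * A₁₂ - A₁₂ᵀ * K₁₂ - Q₂).IsSymm := by
  rw [Matrix.IsSymm]
  simp only [Matrix.transpose_sub, Matrix.transpose_mul, Matrix.transpose_transpose, hQ₂.eq,
    Matrix.mul_assoc]
  abel

end Assembly

end IndefLQ

theorem theorem4p6 {n m n₁ n₂ : ℕ}
    (A : Matrix (Fin n) (Fin n) ℝ) (B : Matrix (Fin n) (Fin m) ℝ)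
    (Q : Matrix (Fin n) (Fin n) ℝ) (hQ : Q.IsSymm)
    (L : Submodule ℝ (Fin n → ℝ))
    (hstab : IndefLQ.Stabilizable A B)
    (hΓ : (IndefLQ.negAriSolutions A B Q).Nonempty)
    (b : Module.Basis (Fin n₁ ⊕ Fin n₂) ℝ (Fin n → ℝ))
    (hb : Submodule.span ℝ (Set.range fun i : Fin n₁ => b (Sum.inl i)) =
      IndefLQ.controllableSubspace A B)
    (A₁ : Matrix (Fin n₁) (Fin n₁) ℝ) (hA₁ : A₁ = (IndefLQ.coordA A b).toBlocks₁₁)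
    (A₁₂ : Matrix (Fin n₁) (Fin n₂) ℝ) (hA₁₂ : A₁₂ = (IndefLQ.coordA A b).toBlocks₁₂)
    (A₂ : Matrix (Fin n₂) (Fin n₂) ℝ) (hA₂ : A₂ = (IndefLQ.coordA A b).toBlocks₂₂)
    (B₁ : Matrix (Fin n₁) (Fin m) ℝ) (hB₁ : B₁ = IndefLQ.coordB₁ B b)
    (Q₁ : Matrix (Fin n₁) (Fin n₁) ℝ) (hQ₁ : Q₁ = (IndefLQ.coordForm Q b).toBlocks₁₁)
    (Q₁₂ : Matrix (Fin n₁) (Fin n₂) ℝ) (hQ₁₂ : Q₁₂ = (IndefLQ.coordForm Q b).toBlocks₁₂)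
    (Q₂ : Matrix (Fin n₂) (Fin n₂) ℝ) (hQ₂ : Q₂ = (IndefLQ.coordForm Q b).toBlocks₂₂)
    (L₁ : Submodule ℝ (Fin n₁ → ℝ)) (hL₁ : L₁ = IndefLQ.coordL₁ L b) :
    -- the extremal solutions of the Riccati equation of the controllable subsystem exist
    ∃ K₁m K₁p : Matrix (Fin n₁) (Fin n₁) ℝ,
      IsLeast (IndefLQ.areSolutions A₁ B₁ Q₁) K₁m ∧
      IsGreatest (IndefLQ.areSolutions A₁ B₁ Q₁) K₁p ∧
    -- the projection defining the upper left block exists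
    ∃ P : Matrix (Fin n₁) (Fin n₁) ℝ,
      IndefLQ.IsProjectionAlong P (IndefLQ.nSubspace A₁ B₁ L₁ K₁m)
        (IndefLQ.gapComplement (K₁p - K₁m) (IndefLQ.nSubspace A₁ B₁ L₁ K₁m)) ∧
    ∃ K₁ : Matrix (Fin n₁) (Fin n₁) ℝ,
      K₁ = K₁m * P + K₁p * (1 - P) ∧
      IndefLQ.specPos (IndefLQ.closedLoop A₁ B₁ K₁) = IndefLQ.nSubspace A₁ B₁ L₁ K₁m ∧
      IndefLQ.specZero (IndefLQ.closedLoop A₁ B₁ K₁) = IndefLQ.kerM (K₁p - K₁m) ∧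
      IndefLQ.specNeg (IndefLQ.closedLoop A₁ B₁ K₁) =
        IndefLQ.specNeg (IndefLQ.closedLoop A₁ B₁ K₁p) ⊓
          IndefLQ.gapComplement (K₁p - K₁m) (IndefLQ.nSubspace A₁ B₁ L₁ K₁m) ∧
    -- the remaining blocks are the unique solutions of their equations
    ∃ K₁₂ : Matrix (Fin n₁) (Fin n₂) ℝ,
      (∀ X, IndefLQ.OffDiagonalBlock A₁ A₁₂ A₂ B₁ Q₁₂ K₁ X ↔ X = K₁₂) ∧
    ∃ K₂ : Matrix (Fin n₂) (Fin n₂) ℝ,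
      (∀ Y, IndefLQ.LowerBlock A₁₂ A₂ B₁ Q₂ K₁₂ Y ↔ Y = K₂) ∧
    ∃ K : Matrix (Fin n) (Fin n) ℝ,
      IndefLQ.coordForm K b = Matrix.fromBlocks K₁ K₁₂ K₁₂ᵀ K₂ ∧
      K ∈ IndefLQ.areSolutions A B Q ∧
      -- (i)
      IndefLQ.WellPosed A B Q L ∧
      -- (ii)
      (∀ x₀ : Fin n → ℝ, IndefLQ.value A B Q L x₀ = ((x₀ ⬝ᵥ K *ᵥ x₀ : ℝ) : EReal)) ∧
      -- (iii)
      (IndefLQ.Attainable A B Q L ↔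
        IndefLQ.kerM (K₁p - K₁m) ≤ L₁ ⊓ IndefLQ.kerM K₁m) ∧
      -- (iv)
      (IndefLQ.Attainable A B Q L → ∀ x₀ : Fin n → ℝ,
        ∃ u : ℝ → Fin m → ℝ, IndefLQ.IsOptimal A B Q L x₀ u ∧
          (∀ t : ℝ, 0 ≤ t → u t = -(Bᵀ *ᵥ (K *ᵥ IndefLQ.traj A B x₀ u t))) ∧
          ∀ v : ℝ → Fin m → ℝ, IndefLQ.IsOptimal A B Q L x₀ v →
            v =ᵐ[volume.restrict (Set.Ici 0)] u) := by
  subst hA₁ hA₁₂ hA₂ hB₁ hQ₁ hQ₁₂ hQ₂ hL₁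
  have hst := IndefLQ.stabPair_of_stabilizable hstab
  obtain ⟨Γ, hΓ⟩ := hΓ
  obtain ⟨S, hST, hTS, hk⟩ := IndefLQ.kalmanForm_of_basis hb
  obtain ⟨q11, q12, q22⟩ := IndefLQ.coordForm_blocks Q b
  -- The compression of Γ solves the Riccati inequality of the controllable subsystem and starts the
  -- construction of the extremal solutions.
  have hφ₁ := IndefLQ.conj_nonneg hΓ.2.1
    ((IndefLQ.colMatrix b).submatrix id (Sum.inl : Fin n₁ → Fin n₁ ⊕ Fin n₂))
  rw [hk.riccati_compress] at hφ₁
  obtain ⟨Km, Kp, hm, hp, hmin, hmc, hpc⟩ := IndefLQ.exists_extremal_solutions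
    (IndefLQ.KalmanForm.isSymm_compress hQ _) hk.controllable_eq_top
    (IndefLQ.KalmanForm.isSymm_compress hΓ.1 _) hφ₁
  -- The least solution also minorizes solutions of the inequality; this is needed because the
  -- compressed Γ need not solve the equation.
  have hle := sub_nonneg.2 (hmin _ (IndefLQ.KalmanForm.isSymm_compress hΓ.1 _) hφ₁)
  have hst₁ := IndefLQ.StabPair.of_top hk.controllable_eq_top
  rw [q11, q12, q22]
  set L₁ := IndefLQ.coordL₁ L b with hL₁
  -- The gap is definite on 𝒩₁, since its kernel is the imaginary spectral subspace of A₁(K₁⁻),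
  -- while 𝒩₁ lies in the right half plane one.
  obtain ⟨P, hP⟩ := IndefLQ.exists_projection (IndefLQ.isCompl_gapComplement
    (N := IndefLQ.nSubspace (IndefLQ.coordA A b).toBlocks₁₁ (IndefLQ.coordB₁ B b) L₁ Km)
    (IndefLQ.gap_nonneg hm hp) fun x hx hx0 => by
      have h0 : x ∈ IndefLQ.kerM (Kp - Km) := hx0
      rw [← IndefLQ.specZero_eq_ker_gap_neg hst₁ hm hp hmc hpc] at h0
      obtain ⟨p, hp', hpx⟩ := IndefLQ.mem_specZero.1 h0
      obtain ⟨q, hq', hqx⟩ := IndefLQ.mem_specPos.1 hx.2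
      exact IndefLQ.eq_zero_of_roots IndefLQ.disjoint_zero_pos hp' hq' hpx hqx)
  have hNinv := fun (x : Fin n₁ → ℝ) hx => IndefLQ.nSubspace_invariant (x := x)
    (A := (IndefLQ.coordA A b).toBlocks₁₁) (B := IndefLQ.coordB₁ B b) (L := L₁) (Km := Km) hx
  obtain ⟨K₁₂, hK₁₂⟩ := IndefLQ.exists_partial_sylvester
    (IndefLQ.closedLoop (IndefLQ.coordA A b).toBlocks₁₁ (IndefLQ.coordB₁ B b)
      (IndefLQ.mixed Km Kp P)) (hk.hurwitz hst)
    (-(((IndefLQ.colMatrix b).submatrix id Sum.inl)ᵀ * Q *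
      (IndefLQ.colMatrix b).submatrix id Sum.inr +
        IndefLQ.mixed Km Kp P * (IndefLQ.coordA A b).toBlocks₁₂))
  obtain ⟨K₂, hK₂, hK₂u⟩ := IndefLQ.lyapunov_existsUnique (hk.hurwitz hst)
    (K₁₂ᵀ * IndefLQ.coordB₁ B b * (IndefLQ.coordB₁ B b)ᵀ * K₁₂ -
      K₁₂ᵀ * (IndefLQ.coordA A b).toBlocks₁₂ - (IndefLQ.coordA A b).toBlocks₁₂ᵀ * K₁₂ -
      ((IndefLQ.colMatrix b).submatrix id Sum.inr)ᵀ * Q *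
        (IndefLQ.colMatrix b).submatrix id Sum.inr)
  have hK₂s : K₂.IsSymm := IndefLQ.lyapunov_symm (hk.hurwitz hst)
    (IndefLQ.lower_rhs_isSymm _ (IndefLQ.KalmanForm.isSymm_compress hQ _)) hK₂
  -- F is the coordinate form of K⋆; the inverse S of the basis matrix carries it back to the
  -- original coordinates as SᵀFS.
  set F := Matrix.fromBlocks (IndefLQ.mixed Km Kp P) K₁₂ K₁₂ᵀ K₂ with hF
  have hFs : F.IsSymm := by
    rw [hF, Matrix.IsSymm, Matrix.fromBlocks_transpose, Matrix.transpose_transpose, hK₂s.eq,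
      (IndefLQ.mixed_isSymm hm.1.1 hp.1.1 hP).eq]
  have hKs : (Sᵀ * F * S).IsSymm := by
    rw [Matrix.IsSymm, Matrix.transpose_mul, Matrix.transpose_mul, Matrix.transpose_transpose,
      hFs.eq, Matrix.mul_assoc]
  have hcoord : IndefLQ.coordForm (Sᵀ * F * S) b = F := by
    rw [IndefLQ.coordForm, show (IndefLQ.colMatrix b)ᵀ * (Sᵀ * F * S) * IndefLQ.colMatrix b =
      (S * IndefLQ.colMatrix b)ᵀ * F * (S * IndefLQ.colMatrix b) by
        rw [Matrix.transpose_mul]; simp only [Matrix.mul_assoc], hST, Matrix.transpose_one,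
      Matrix.one_mul, Matrix.mul_one]
  obtain ⟨k11, k12, k22⟩ := IndefLQ.coordForm_blocks (Sᵀ * F * S) b
  rw [hcoord, hF, Matrix.toBlocks_fromBlocks₁₁] at k11
  rw [hcoord, hF, Matrix.toBlocks_fromBlocks₁₂] at k12
  rw [hcoord, hF, Matrix.toBlocks_fromBlocks₂₂] at k22
  have hopt := hk.optimalForm (L := L) hQ hst hΓ hm hp hle hmc hpc hP hKs k11.symm
    (by rw [← k12]; exact (hK₁₂ K₁₂).2 rfl) (by rw [← k12, ← k22]; exact hK₂)
  have hatt := IndefLQ.KalmanForm.attainability_condition_iff hle hΓ.2.2 hP k11.symm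
  refine ⟨Km, Kp, hm, hp, P, hP, IndefLQ.mixed Km Kp P, rfl,
    IndefLQ.specPos_mixed hm.1 hp.1 hpc hNinv IndefLQ.nSubspace_le_specPos hP,
    IndefLQ.specZero_mixed hst₁ hm hp hmc hpc hNinv IndefLQ.nSubspace_le_specPos hP,
    IndefLQ.specNeg_mixed hm.1 hp.1 hNinv IndefLQ.nSubspace_le_specPos hP, K₁₂, hK₁₂, K₂,
    fun Y => ⟨hK₂u Y, fun h => h ▸ hK₂⟩, Sᵀ * F * S, hcoord, ⟨hKs, hopt.are⟩,
    fun x₀ => ⟨_, hopt.value_eq hQ hst x₀⟩, hopt.value_eq hQ hst,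
    (hopt.attainable_iff hQ hst).trans hatt, fun h x₀ => ?_⟩
  obtain ⟨hZL, hZK⟩ := (hopt.attainable_iff hQ hst).1 h
  exact hopt.exists_optimal hQ hst hZL hZK x₀
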